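/- **Notation.** Let $\mathcal F$ be the set of finite subgroups of $\mathbb T=SO(2)$ and let $\mathcal O_{\mathcal F}=\prod_{H\in\mathcal F}\mathbb Q[c_H]$ be the product of graded rings, with $|c_H|=-2$. For a function $\nu:\mathcal F\to\mathbb N$ of finite support let $c^\nu$ be the Euler class with components $c_H^{\nu(H)}$. Let $\mathcal E$ be the multiplicative set of all $c^\nu$, and write $\mathcal E^{-1}$ for the localisation at $\mathcal E$. The ring $\mathcal E^{-1}\mathcal O_{\mathcal F}$ is graded: $p/c^\nu$ has degree $n$ if each component $p_H$ is homogeneous of degree $n-2\nu(H)$. An object of Greenlees' algebraic model $\mathcal A=\mathcal A(\mathbb T)$ for rational $SO(2)$-spectra is a degree-preserving map $\beta:N\to\mathcal E^{-1}\mathcal O_{\mathcal F}\otimes_{\mathbb Q}V$ of graded $\mathcal O_{\mathcal F}$-modules, where $V$ is a graded rational vector space and $\mathcal E^{-1}\beta$ is an isomorphism. One calls $N$ the nub and $V$ the vertex. A morphism is a pair of degree-$0$ maps $N\to N'$ and $V\to V'$ compatible with the maps $\beta$. The category $\partial\mathcal A$ of differential objects is defined in the same way, with $N$ a differential graded $\mathcal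 O_{\mathcal F}$-module, $V$ a complex of rational vector spaces (differentials have degree $-1$), and with $\beta$ and all morphisms commuting with the differentials. A map of $\partial\mathcal A$ is a *homology isomorphism* if it induces isomorphisms on the homology of the nubs and of the vertices. The category $\mathcal A$ is the full subcategory of objects with zero differential. Both categories are symmetric monoidal: nubs are tensored over $\mathcal O_{\mathcal F}$ and vertices over $\mathbb Q$, with the usual sign in the symmetry, and the unit is $S^0=(\mathcal O_{\mathcal F}\to\mathcal E^{-1}\mathcal O_{\mathcal F}\otimes\mathbb Q)$. An object $P$ of $\mathcal A$ is *dualisable* if the function object $F(P,-)$ in $\mathcal A$ (right adjoint to $P\otimes-$) exists and the canonical map $F(P,S^0)\otimes B\to F(P,B)$ is an isomorphism for every $B$ in $\mathcal A$. For a rational chain complex $K$ and $A$ in $\partial\mathcal A$, $K\otimes A$ means $(S^0\otimes K)\otimes A$, where $S^0\otimes K=(\mathcal O_{\mathcal F}\otimes K\to\mathcal E^{-1}\mathcal O_{\mathcal F}\otimes K)$. Let $S^{n-1}\to D^n$ be the inclusion of $\mathbb Q$ in degree $n-1$ into the acyclic complex $\mathbb Q\xrightarrow{\;=\;}\mathbb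 Q$ in degrees $n$ and $n-1$. **Theorem.** Let $\mathcal P$ be a collection of dualisable objects of $\mathcal A$ that contains exactly one representative of each isomorphism class of dualisable objects. Then $\mathcal P$ is a (small) set, the category $\partial\mathcal A$ has all small limits and colimits and is closed symmetric monoidal, and there is a model structure $\partial\mathcal A_{qd}$ on $\partial\mathcal A$ such that: 1. the weak equivalences are the homology isomorphisms; 2. it is cofibrantly generated, with generating cofibrations the maps $S^{n-1}\otimes P\to D^n\otimes P$ for $P\in\mathcal P$ and $n\in\mathbb Z$; 3. it is a monoidal model structure (the pushout product axiom and the unit axiom hold); 4. it is left and right proper; 5. it satisfies the monoid axiom: every transfinite composition of pushouts of maps $j\otimes Z$, with $j$ an acyclic cofibration and $Z$ any object, is a homology isomorphism. Moreover the injective model structure $\partial\mathcal A_i$ on $\partial\mathcal A$ exists (its weak equivalences are the homology isomorphisms and its cofibrations are the monomorphisms), and the identity functor $\partial\mathcal A_{qd}\to\partial\mathcal A_i$ is the left adjoint of a Quillen equivalence. -/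

import Mathlib

open CategoryTheory MonoidalCategory TensorProduct Polynomial Limits HomotopicalAlgebra

namespace AlgModel

section Grading
variable {X : Type} [AddCommGroup X]

theorem isInternal_of_proj' (gr : ℤ → AddSubgroup X) (ρ : ℤ → X →+ X)
    (h : ∀ m n x, x ∈ gr n → ρ m x = if n = m then x else 0) (hs : ⨆ n, gr n = ⊤) :
    DirectSum.IsInternal gr := by
  have key : ∀ (y : DirectSum ℤ fun n => gr n) (n : ℤ),
      ρ n (DirectSum.coeAddMonoidHom gr y) = (y n : X) := by
    intro y n
    induction y using DirectSum.induction_on with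
    | zero => simp
    | of i x =>
      rw [DirectSum.coeAddMonoidHom_of, h n i _ x.2, DirectSum.coe_of_apply]
      split_ifs <;> rfl
    | add a b ha hb => simp [ha, hb]
  constructor
  · rw [injective_iff_map_eq_zero]
    intro y hy
    ext n
    rw [← key y n, hy]; simp
  · intro x
    have hx : x ∈ ⨆ n, gr n := by rw [hs]; trivial
    induction hx using AddSubgroup.iSup_induction' with
    | hp n x hx => exact ⟨DirectSum.of (fun n => gr n) n ⟨x, hx⟩, by simp⟩
    | h1 => exact ⟨0, by simp⟩
    | hadd x y _ _ hx hy =>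
      obtain ⟨a, rfl⟩ := hx
      obtain ⟨b, rfl⟩ := hy
      exact ⟨a + b, by simp⟩

theorem isInternal_of_proj (gr : ℤ → AddSubgroup X) (ρ : X →+ (ℤ →₀ X))
    (h : ∀ n x, x ∈ gr n → ρ x = Finsupp.single n x) (hs : ⨆ n, gr n = ⊤) :
    DirectSum.IsInternal gr :=
  isInternal_of_proj' gr (fun n => (Finsupp.applyAddHom n).comp ρ)
    (fun m n x hx => by simp [h n x hx, Finsupp.single_apply]) hs

variable {gr : ℤ → AddSubgroup X}

theorem homogeneous_induction (h : DirectSum.IsInternal gr) {p : X → Prop} (zero : p 0)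
    (mem : ∀ n, ∀ x ∈ gr n, p x) (add : ∀ x y, p x → p y → p (x + y)) (x : X) : p x := by
  obtain ⟨y, rfl⟩ := h.2 x
  induction y using DirectSum.induction_on with
  | zero => simpa using zero
  | of i x => simpa using mem i _ x.2
  | add a b ha hb => simpa using add _ _ ha hb

theorem iSup_of_isInternal (h : DirectSum.IsInternal gr) : ⨆ n, gr n = ⊤ := by
  rw [eq_top_iff]
  rintro x -
  exact homogeneous_induction h (zero_mem _)
    (fun n x hx => (le_iSup gr n) hx) (fun _ _ => add_mem) x

/-- The decomposition of a graded group into its homogeneous parts. -/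
noncomputable def decompEquiv (h : DirectSum.IsInternal gr) : X ≃+ DirectSum ℤ fun n => gr n :=
  (AddEquiv.ofBijective (DirectSum.coeAddMonoidHom gr)
    (show Function.Bijective (DirectSum.coeAddMonoidHom gr) from h)).symm

/-- The homomorphism that agrees with `f n` on the elements of degree `n`. -/
noncomputable def byDegree (h : DirectSum.IsInternal gr) {Y : Type} [AddCommGroup Y]
    (f : ℤ → X →+ Y) : X →+ Y :=
  (DirectSum.toAddMonoid fun n => (f n).comp (gr n).subtype).comp
    (decompEquiv h).toAddMonoidHom

theorem byDegree_of_mem (h : DirectSum.IsInternal gr) {Y : Type} [AddCommGroup Y]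
    (f : ℤ → X →+ Y) {n : ℤ} {x : X} (hx : x ∈ gr n) : byDegree h f x = f n x := by
  have : decompEquiv h x = DirectSum.of (fun n => gr n) n ⟨x, hx⟩ := by
    rw [decompEquiv, AddEquiv.symm_apply_eq]
    simp
  simp [byDegree, this]

end Grading

section TensorGrading
variable (S : Type) [CommRing S] {M N : Type} [AddCommGroup M] [AddCommGroup N]
  [Module S M] [Module S N]

/-- The grading of `M ⊗ N`: the degree `n` part is spanned by the `x ⊗ y` with `|x| + |y| = n`. -/
def tensorGr (gM : ℤ → AddSubgroup M) (gN : ℤ → AddSubgroup N) (n : ℤ) :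
    AddSubgroup (M ⊗[S] N) :=
  AddSubgroup.closure {t | ∃ i j : ℤ, i + j = n ∧ ∃ x ∈ gM i, ∃ y ∈ gN j, t = x ⊗ₜ[S] y}

variable {S} {gM : ℤ → AddSubgroup M} {gN : ℤ → AddSubgroup N}

theorem tmul_mem_tensorGr {i j n : ℤ} (h : i + j = n) {x : M} {y : N} (hx : x ∈ gM i)
    (hy : y ∈ gN j) : x ⊗ₜ[S] y ∈ tensorGr S gM gN n :=
  AddSubgroup.subset_closure ⟨i, j, h, x, hx, y, hy, rfl⟩

theorem map_mem_of_tmul {Z : Type} [AddCommGroup Z] (f : M ⊗[S] N →+ Z) (K : AddSubgroup Z) {n : ℤ}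
    (h : ∀ i j : ℤ, i + j = n → ∀ x ∈ gM i, ∀ y ∈ gN j, f (x ⊗ₜ[S] y) ∈ K)
    {t : M ⊗[S] N} (ht : t ∈ tensorGr S gM gN n) : f t ∈ K := by
  have : tensorGr S gM gN n ≤ K.comap f := by
    rw [tensorGr, AddSubgroup.closure_le]
    rintro _ ⟨i, j, hij, x, hx, y, hy, rfl⟩
    exact h i j hij x hx y hy
  exact this ht

theorem tensor_hom_ext (hM : DirectSum.IsInternal gM) (hN : DirectSum.IsInternal gN)
    {Z : Type} [AddCommGroup Z] {f g : M ⊗[S] N →+ Z}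
    (h : ∀ i j : ℤ, ∀ x ∈ gM i, ∀ y ∈ gN j, f (x ⊗ₜ[S] y) = g (x ⊗ₜ[S] y)) : f = g := by
  ext t
  induction t using TensorProduct.induction_on with
  | zero => simp
  | add a b ha hb => simp [ha, hb]
  | tmul x y =>
    induction x using homogeneous_induction hM with
    | zero => simp
    | add a b ha hb => simp [TensorProduct.add_tmul, ha, hb]
    | mem i x hx =>
      induction y using homogeneous_induction hN with
      | zero => simp
      | add a b ha hb => simp [TensorProduct.tmul_add, ha, hb]
      | mem j y hy => exact h i j x hx y hy

theorem isInternal_tensorGr {gS : ℤ → AddSubgroup S} (hS : DirectSum.IsInternal gS)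
    (hM : DirectSum.IsInternal gM) (hN : DirectSum.IsInternal gN)
    (sM : ∀ i j : ℤ, ∀ a ∈ gS i, ∀ x ∈ gM j, a • x ∈ gM (i + j))
    (sN : ∀ i j : ℤ, ∀ a ∈ gS i, ∀ x ∈ gN j, a • x ∈ gN (i + j)) :
    DirectSum.IsInternal (tensorGr S gM gN) := by
  let G : ℤ → ℤ → M →+ N →+ (ℤ →₀ M ⊗[S] N) := fun i j =>
    AddMonoidHom.mk' (fun x => (Finsupp.singleAddHom (i + j)).comp
      (TensorProduct.mk S M N x).toAddMonoidHom) (by intro a b; ext; simp)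
  let F : ℤ → M →+ N →+ (ℤ →₀ M ⊗[S] N) := fun i =>
    AddMonoidHom.mk' (fun x => byDegree hN (fun j => G i j x)) (by
      intro a b
      ext y : 1
      induction y using homogeneous_induction hN with
      | zero => simp
      | add a b ha hb => rw [map_add, ha, hb, map_add]
      | mem j y hy =>
        simp only [AddMonoidHom.add_apply, byDegree_of_mem hN _ hy, map_add])
  have hF : ∀ i j x y, x ∈ gM i → y ∈ gN j →
      byDegree hM F x y = Finsupp.single (i + j) (x ⊗ₜ[S] y) := by
    intro i j x y hx hy
    rw [byDegree_of_mem hM _ hx]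
    exact byDegree_of_mem hN _ hy
  have bal : ∀ (r : S) (x : M) (y : N), byDegree hM F (r • x) y = byDegree hM F x (r • y) := by
    intro r x y
    induction x using homogeneous_induction hM with
    | zero => simp
    | add a b ha hb => simp only [smul_add, map_add, AddMonoidHom.add_apply, ha, hb]
    | mem i x hx =>
      induction y using homogeneous_induction hN with
      | zero => simp
      | add a b ha hb => simp only [smul_add, map_add, ha, hb]
      | mem j y hy =>
        induction r using homogeneous_induction hS with
        | zero => simp
        | add a b ha hb => simp only [add_smul, map_add, AddMonoidHom.add_apply, ha, hb]
        | mem k r hr =>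
          rw [hF _ _ _ _ (sM k i r hr x hx) hy, hF _ _ _ _ hx (sN k j r hr y hy),
            TensorProduct.smul_tmul, show k + i + j = i + (k + j) by ring]
  refine isInternal_of_proj _ (TensorProduct.liftAddHom (byDegree hM F) bal) ?_ ?_
  · intro n t ht
    have : (TensorProduct.liftAddHom (byDegree hM F) bal - Finsupp.singleAddHom n :
        M ⊗[S] N →+ (ℤ →₀ M ⊗[S] N)) t
        ∈ (⊥ : AddSubgroup (ℤ →₀ M ⊗[S] N)) := by
      refine map_mem_of_tmul _ _ ?_ ht
      intro i j hij x hx y hy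
      simp [hF _ _ _ _ hx hy, hij]
    simpa [sub_eq_zero] using this
  · rw [eq_top_iff]
    rintro t -
    induction t using TensorProduct.induction_on with
    | zero => exact zero_mem _
    | add a b ha hb => exact add_mem ha hb
    | tmul x y =>
      induction x using homogeneous_induction hM with
      | zero => simp
      | add a b ha hb => rw [TensorProduct.add_tmul]; exact add_mem ha hb
      | mem i x hx =>
        induction y using homogeneous_induction hN with
        | zero => simp
        | add a b ha hb => rw [TensorProduct.tmul_add]; exact add_mem ha hb
        | mem j y hy => exact le_iSup (tensorGr S gM gN) (i + j) (tmul_mem_tensorGr rfl hx hy)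

end TensorGrading

/-- A commutative ring with a `ℤ`-grading that is concentrated in even degrees. -/
class EvenGraded (R : Type) [CommRing R] where
  gr : ℤ → AddSubgroup R
  isInternal : DirectSum.IsInternal gr
  one_mem : (1 : R) ∈ gr 0
  mul_mem : ∀ i j : ℤ, ∀ a ∈ gr i, ∀ b ∈ gr j, a * b ∈ gr (i + j)
  odd_eq_bot : ∀ n : ℤ, Odd n → gr n = ⊥

/-- A differential graded module over an evenly graded ring `R` (with zero differential): the module
is the internal direct sum of its homogeneous parts `gr n`, and `d` is `R`-linear of degree `-1`. -/
structure DGMod (R : Type) [CommRing R] [EvenGraded R] where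
  carrier : Type
  [addCommGroup : AddCommGroup carrier]
  [module : Module R carrier]
  gr : ℤ → AddSubgroup carrier
  isInternal : DirectSum.IsInternal gr
  smul_mem : ∀ i j : ℤ, ∀ a ∈ EvenGraded.gr (R := R) i, ∀ x ∈ gr j, a • x ∈ gr (i + j)
  d : carrier →ₗ[R] carrier
  d_mem : ∀ n : ℤ, ∀ x ∈ gr n, d x ∈ gr (n - 1)
  d_d : ∀ x, d (d x) = 0

namespace DGMod

variable {R : Type} [CommRing R] [EvenGraded R]

instance : CoeSort (DGMod R) Type := ⟨carrier⟩

attribute [instance] addCommGroup module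

/-- Maps of differential graded modules: linear maps of degree `0` commuting with `d`. -/
@[ext]
structure Hom (M N : DGMod R) where
  toLin : M →ₗ[R] N
  map_mem : ∀ n : ℤ, ∀ x ∈ M.gr n, toLin x ∈ N.gr n
  map_d : ∀ x, toLin (M.d x) = N.d (toLin x)

instance : Category (DGMod R) where
  Hom := Hom
  id M := ⟨LinearMap.id, fun _ _ h => h, fun _ => rfl⟩
  comp f g := ⟨g.toLin ∘ₗ f.toLin, fun n x h => g.map_mem n _ (f.map_mem n x h),
    fun x => by simp [f.map_d, g.map_d]⟩

@[simp] theorem id_toLin (M : DGMod R) : Hom.toLin (𝟙 M) = LinearMap.id := rfl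

@[simp] theorem comp_toLin {M N P : DGMod R} (f : M ⟶ N) (g : N ⟶ P) :
    Hom.toLin (f ≫ g) = g.toLin ∘ₗ f.toLin := rfl

@[ext] theorem hom_ext {M N : DGMod R} {f g : M ⟶ N} (h : f.toLin = g.toLin) : f = g :=
  Hom.ext h

/-- The `R`-linear map that agrees with `f n` in degree `n`, if `f n` depends on the parity
of `n` only. -/
noncomputable def byParity (M : DGMod R) {Y : Type} [AddCommGroup Y] [Module R Y]
    (f : ℤ → M →ₗ[R] Y) (hf : ∀ i j : ℤ, Even i → f (i + j) = f j) : M →ₗ[R] Y where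
  toFun := byDegree M.isInternal fun n => (f n).toAddMonoidHom
  map_add' := map_add _
  map_smul' r x := by
    induction x using homogeneous_induction M.isInternal with
    | zero => simp
    | add a b ha hb => simp only [smul_add, map_add, ha, hb]
    | mem j x hx =>
      induction r using homogeneous_induction (EvenGraded.isInternal (R := R)) with
      | zero => simp
      | add a b ha hb => simp only [add_smul, map_add, ha, hb, RingHom.id_apply]
      | mem i r hr =>
        rw [byDegree_of_mem _ _ hx, byDegree_of_mem _ _ (M.smul_mem i j r hr x hx)]
        rcases Int.even_or_odd i with hi | hi
        · simp [hf i j hi]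
        · rw [EvenGraded.odd_eq_bot i hi, AddSubgroup.mem_bot] at hr
          simp [hr]

theorem byParity_of_mem (M : DGMod R) {Y : Type} [AddCommGroup Y] [Module R Y]
    (f : ℤ → M →ₗ[R] Y) (hf : ∀ i j : ℤ, Even i → f (i + j) = f j) {n : ℤ} {x : M}
    (hx : x ∈ M.gr n) : M.byParity f hf x = f n x :=
  byDegree_of_mem M.isInternal _ hx

/-- `x ↦ (-1)^|x| x`. -/
noncomputable def sign (M : DGMod R) : M →ₗ[R] M :=
  M.byParity (fun n => if Even n then LinearMap.id else -LinearMap.id) fun i j hi => by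
    simp [Int.even_add, hi]

theorem sign_of_mem (M : DGMod R) {n : ℤ} {x : M} (hx : x ∈ M.gr n) :
    M.sign x = if Even n then x else -x := by
  rw [sign, byParity_of_mem _ _ _ hx]
  split_ifs <;> rfl

theorem sign_mem (M : DGMod R) {n : ℤ} {x : M} (hx : x ∈ M.gr n) : M.sign x ∈ M.gr n := by
  rw [sign_of_mem _ hx]
  split_ifs
  exacts [hx, neg_mem hx]

@[simp] theorem sign_sign (M : DGMod R) (x : M) : M.sign (M.sign x) = x := by
  induction x using homogeneous_induction M.isInternal with
  | zero => simp
  | add a b ha hb => simp only [map_add, ha, hb]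
  | mem n x hx =>
    rw [sign_of_mem _ hx]
    split_ifs with h <;> simp [sign_of_mem _ hx, h]

@[simp] theorem sign_d (M : DGMod R) (x : M) : M.sign (M.d x) = -M.d (M.sign x) := by
  induction x using homogeneous_induction M.isInternal with
  | zero => simp
  | add a b ha hb => simp only [map_add, ha, hb, neg_add]
  | mem n x hx =>
    rw [sign_of_mem _ hx, sign_of_mem _ (M.d_mem n x hx)]
    by_cases h : Even n <;> simp [h, Int.even_sub_one]

@[simp] theorem sign_map {M N : DGMod R} (f : M ⟶ N) (x : M) :
    N.sign (f.toLin x) = f.toLin (M.sign x) := by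
  induction x using homogeneous_induction M.isInternal with
  | zero => simp
  | add a b ha hb => simp only [map_add, ha, hb]
  | mem n x hx =>
    rw [sign_of_mem _ hx, sign_of_mem _ (f.map_mem n x hx)]
    split_ifs <;> simp

/-- The differential of the tensor product, `d (x ⊗ y) = dx ⊗ y + (-1)^|x| x ⊗ dy`. -/
noncomputable def tensorD (M N : DGMod R) : M ⊗[R] N →ₗ[R] M ⊗[R] N :=
  TensorProduct.map M.d LinearMap.id + TensorProduct.map M.sign N.d

@[simp] theorem tensorD_tmul (M N : DGMod R) (x : M) (y : N) :
    tensorD M N (x ⊗ₜ[R] y) = M.d x ⊗ₜ[R] y + M.sign x ⊗ₜ[R] N.d y := rfl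

/-- The tensor product over `R`. -/
noncomputable def tensor (M N : DGMod R) : DGMod R where
  carrier := M ⊗[R] N
  gr := tensorGr R M.gr N.gr
  isInternal := isInternal_tensorGr EvenGraded.isInternal M.isInternal N.isInternal
    M.smul_mem N.smul_mem
  smul_mem i j a ha t ht := map_mem_of_tmul (DistribSMul.toAddMonoidHom (M ⊗[R] N) a) _
    (fun k l hkl x hx y hy => by
      simpa [TensorProduct.smul_tmul'] using
        tmul_mem_tensorGr (by rw [← hkl, add_assoc]) (M.smul_mem i k a ha x hx) hy) ht
  d := tensorD M N
  d_mem n t ht := map_mem_of_tmul (tensorD M N).toAddMonoidHom _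
    (fun i j hij x hx y hy => add_mem
      (tmul_mem_tensorGr (by lia) (M.d_mem i x hx) hy)
      (tmul_mem_tensorGr (by lia) (M.sign_mem hx) (N.d_mem j y hy))) ht
  d_d t := by
    induction t using TensorProduct.induction_on with
    | zero => simp
    | add a b ha hb => rw [map_add, map_add, ha, hb, add_zero]
    | tmul x y => simp [M.d_d, N.d_d, TensorProduct.neg_tmul]

theorem tensor_sign_tmul (M N : DGMod R) (x : M) (y : N) :
    (tensor M N).sign (x ⊗ₜ[R] y) = M.sign x ⊗ₜ[R] N.sign y := by
  have : (tensor M N).sign.toAddMonoidHom = (TensorProduct.map M.sign N.sign).toAddMonoidHom := by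
    refine tensor_hom_ext (S := R) M.isInternal N.isInternal fun i j x hx y hy => ?_
    change (tensor M N).sign (x ⊗ₜ[R] y) = M.sign x ⊗ₜ[R] N.sign y
    rw [sign_of_mem (tensor M N) (n := i + j) (tmul_mem_tensorGr rfl hx hy),
      sign_of_mem _ hx, sign_of_mem _ hy]
    by_cases hi : Even i <;> by_cases hj : Even j <;>
      simp [hi, hj, Int.even_add, TensorProduct.neg_tmul, TensorProduct.tmul_neg] <;> rfl
  exact DFunLike.congr_fun this (x ⊗ₜ[R] y)

/-- The tensor product of two maps. -/
noncomputable def tensorMap {M N M' N' : DGMod R} (f : M ⟶ M') (g : N ⟶ N') :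
    tensor M N ⟶ tensor M' N' where
  toLin := TensorProduct.map f.toLin g.toLin
  map_mem n t ht := map_mem_of_tmul (TensorProduct.map f.toLin g.toLin).toAddMonoidHom _
    (fun i j hij x hx y hy => tmul_mem_tensorGr hij (f.map_mem i x hx) (g.map_mem j y hy)) ht
  map_d t := by
    have : (TensorProduct.map f.toLin g.toLin).comp (tensorD M N)
        = (tensorD M' N').comp (TensorProduct.map f.toLin g.toLin) :=
      TensorProduct.ext' fun x y => by simp [f.map_d, g.map_d]
    exact DFunLike.congr_fun this t

/-- The ring itself, with zero differential. -/
def unit (R : Type) [CommRing R] [EvenGraded R] : DGMod R where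
  carrier := R
  gr := EvenGraded.gr
  isInternal := EvenGraded.isInternal
  smul_mem i j a ha x hx := EvenGraded.mul_mem i j a ha x hx
  d := 0
  d_mem _ _ _ := zero_mem _
  d_d _ := rfl

theorem unit_sign (r : unit R) : (unit R).sign r = r := by
  induction r using homogeneous_induction (unit R).isInternal with
  | zero => simp
  | add a b ha hb => simp only [map_add, ha, hb]
  | mem n x hx =>
    rw [sign_of_mem _ hx]
    split_ifs with h
    · rfl
    · have h0 : x ∈ EvenGraded.gr (R := R) n := hx
      rw [EvenGraded.odd_eq_bot n (Int.not_even_iff_odd.1 h)] at h0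
      have h1 : x = (0 : R) := h0
      rw [h1]; exact neg_zero

/-- An isomorphism from a linear equivalence that preserves degrees and differentials. -/
def mkIso {M N : DGMod R} (e : M ≃ₗ[R] N) (h : ∀ n : ℤ, ∀ x ∈ M.gr n, e x ∈ N.gr n)
    (h' : ∀ n : ℤ, ∀ x ∈ N.gr n, e.symm x ∈ M.gr n) (hd : ∀ x, e (M.d x) = N.d (e x)) : M ≅ N where
  hom := ⟨e.toLinearMap, h, hd⟩
  inv := ⟨e.symm.toLinearMap, h', fun x => by
    apply e.injective
    simp [hd]⟩
  hom_inv_id := by ext; simp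
  inv_hom_id := by ext; simp

/-- The associator. -/
noncomputable def assoc (M N P : DGMod R) : tensor (tensor M N) P ≅ tensor M (tensor N P) :=
  mkIso (TensorProduct.assoc R M N P)
    (fun n t ht => map_mem_of_tmul (TensorProduct.assoc R M N P).toLinearMap.toAddMonoidHom _
      (fun i j hij s hs z hz => map_mem_of_tmul
        ((TensorProduct.assoc R M N P).toLinearMap.toAddMonoidHom.comp
          ((TensorProduct.mk R (M ⊗[R] N) P).flip z).toAddMonoidHom) _
        (fun k l hkl x hx y hy => tmul_mem_tensorGr (by lia) hx (tmul_mem_tensorGr rfl hy hz))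
        hs) ht)
    (fun n t ht => map_mem_of_tmul (TensorProduct.assoc R M N P).symm.toLinearMap.toAddMonoidHom _
      (fun i j hij x hx s hs => map_mem_of_tmul
        ((TensorProduct.assoc R M N P).symm.toLinearMap.toAddMonoidHom.comp
          (TensorProduct.mk R M (N ⊗[R] P) x).toAddMonoidHom) _
        (fun k l hkl y hy z hz => tmul_mem_tensorGr (by lia) (tmul_mem_tensorGr rfl hx hy) hz)
        hs) ht)
    (fun t => by
      have : (TensorProduct.assoc R M N P).toLinearMap.comp (tensorD (tensor M N) P)
          = (tensorD M (tensor N P)).comp (TensorProduct.assoc R M N P).toLinearMap :=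
        TensorProduct.ext_threefold fun x y z => by
          change TensorProduct.assoc R M N P ((M.d x ⊗ₜ[R] y + M.sign x ⊗ₜ[R] N.d y) ⊗ₜ[R] z
              + (show M ⊗[R] N from (tensor M N).sign (x ⊗ₜ[R] y)) ⊗ₜ[R] P.d z)
            = M.d x ⊗ₜ[R] (y ⊗ₜ[R] z) + M.sign x ⊗ₜ[R] (N.d y ⊗ₜ[R] z + N.sign y ⊗ₜ[R] P.d z)
          rw [tensor_sign_tmul, TensorProduct.add_tmul, TensorProduct.tmul_add, map_add, map_add,
            add_assoc]
          rfl
      exact DFunLike.congr_fun this t)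

/-- The left unitor. -/
noncomputable def lid (M : DGMod R) : tensor (unit R) M ≅ M :=
  mkIso (TensorProduct.lid R M)
    (fun n t ht => map_mem_of_tmul (TensorProduct.lid R M).toLinearMap.toAddMonoidHom _
      (fun i j hij r hr x hx => by
        rw [← hij]
        exact M.smul_mem i j r hr x hx) ht)
    (fun n x hx => tmul_mem_tensorGr (zero_add n) (EvenGraded.one_mem (R := R)) hx)
    (fun t => by
      have : (TensorProduct.lid R M).toLinearMap.comp (tensorD (unit R) M)
          = M.d.comp (TensorProduct.lid R M).toLinearMap :=
        TensorProduct.ext' fun r x => by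
          change TensorProduct.lid R M
              ((0 : R) ⊗ₜ[R] x + (show R from (unit R).sign r) ⊗ₜ[R] M.d x)
            = M.d ((show R from r) • x)
          rw [unit_sign, TensorProduct.zero_tmul, zero_add, map_smul]
          rfl
      exact DFunLike.congr_fun this t)

/-- The right unitor. -/
noncomputable def rid (M : DGMod R) : tensor M (unit R) ≅ M :=
  mkIso (TensorProduct.rid R M)
    (fun n t ht => map_mem_of_tmul (TensorProduct.rid R M).toLinearMap.toAddMonoidHom _
      (fun i j hij x hx r hr => by
        rw [← hij, add_comm]
        exact M.smul_mem j i r hr x hx) ht)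
    (fun n x hx => tmul_mem_tensorGr (add_zero n) hx (EvenGraded.one_mem (R := R)))
    (fun t => by
      have : (TensorProduct.rid R M).toLinearMap.comp (tensorD M (unit R))
          = M.d.comp (TensorProduct.rid R M).toLinearMap :=
        TensorProduct.ext' fun x r => by
          change TensorProduct.rid R M 
              (M.d x ⊗ₜ[R] (show R from r) + M.sign x ⊗ₜ[R] (0 : R)) = M.d ((show R from r) • x)
          rw [TensorProduct.tmul_zero, add_zero, map_smul]
          rfl
      exact DFunLike.congr_fun this t)

noncomputable instance : MonoidalCategoryStruct (DGMod R) where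
  tensorObj := tensor
  tensorUnit := unit R
  tensorHom := tensorMap
  whiskerLeft M _ _ f := tensorMap (𝟙 M) f
  whiskerRight f N := tensorMap f (𝟙 N)
  associator := assoc
  leftUnitor := lid
  rightUnitor := rid

noncomputable instance : MonoidalCategory (DGMod R) := MonoidalCategory.ofTensorHom
  (id_tensorHom_id := fun M N => hom_ext TensorProduct.map_id)
  (id_tensorHom := fun _ _ _ _ => rfl)
  (tensorHom_id := fun _ _ => rfl)
  (tensorHom_comp_tensorHom := fun f g h k => hom_ext (TensorProduct.map_comp _ _ _ _).symm)
  (associator_naturality := fun f g h => hom_ext (TensorProduct.ext_threefold fun x y z => rfl))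
  (leftUnitor_naturality := fun f => hom_ext (TensorProduct.ext' fun r x =>
    (f.toLin.map_smul r x).symm))
  (rightUnitor_naturality := fun f => hom_ext (TensorProduct.ext' fun x r =>
    (f.toLin.map_smul r x).symm))
  (pentagon := fun W X Y Z => hom_ext (TensorProduct.ext_fourfold fun w x y z => rfl))
  (triangle := fun X Y => hom_ext (TensorProduct.ext_threefold
    fun x (r : R) y => (TensorProduct.smul_tmul r x y).symm))

/-- `x ⊗ y ↦ (-1)^{|x||y|} y ⊗ x`. -/
noncomputable def swap (M N : DGMod R) : M ⊗[R] N →ₗ[R] N ⊗[R] M :=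
  TensorProduct.lift (M.byParity
    (fun i => if Even i then (TensorProduct.mk R N M).flip
      else ((TensorProduct.mk R N M).comp N.sign).flip)
    fun i j hi => by simp [Int.even_add, hi])

theorem swap_tmul (M N : DGMod R) {i : ℤ} {x : M} (hx : x ∈ M.gr i) (y : N) :
    swap M N (x ⊗ₜ[R] y) = if Even i then y ⊗ₜ[R] x else N.sign y ⊗ₜ[R] x := by
  rw [swap, TensorProduct.lift.tmul, byParity_of_mem _ _ _ hx]
  split_ifs <;> rfl

theorem swap_tmul' (M N : DGMod R) {i j : ℤ} {x : M} (hx : x ∈ M.gr i) {y : N} (hy : y ∈ N.gr j) :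
    swap M N (x ⊗ₜ[R] y) = if Even i ∨ Even j then y ⊗ₜ[R] x else -(y ⊗ₜ[R] x) := by
  rw [swap_tmul M N hx, sign_of_mem N hy]
  by_cases hi : Even i <;> by_cases hj : Even j <;> simp [hi, hj, TensorProduct.neg_tmul]

theorem swap_swap (M N : DGMod R) (t : M ⊗[R] N) : swap N M (swap M N t) = t := by
  have : ((swap N M).comp (swap M N)).toAddMonoidHom = AddMonoidHom.id _ := by
    refine tensor_hom_ext (S := R) M.isInternal N.isInternal fun i j x hx y hy => ?_
    change swap N M (swap M N (x ⊗ₜ[R] y)) = x ⊗ₜ[R] y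
    rw [swap_tmul' M N hx hy]
    by_cases hi : Even i <;> by_cases hj : Even j <;> simp [hi, hj, swap_tmul' N M hy hx]
  exact DFunLike.congr_fun this t

theorem swap_mem (M N : DGMod R) (n : ℤ) (t : M ⊗[R] N) (ht : t ∈ tensorGr R M.gr N.gr n) :
    swap M N t ∈ tensorGr R N.gr M.gr n :=
  map_mem_of_tmul (swap M N).toAddMonoidHom _ (fun i j hij x hx y hy => by
    change swap M N (x ⊗ₜ[R] y) ∈ _
    have : y ⊗ₜ[R] x ∈ tensorGr R N.gr M.gr n := tmul_mem_tensorGr (by lia) hy hx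
    rw [swap_tmul' M N hx hy]
    split_ifs
    exacts [this, neg_mem this]) ht

/-- The symmetry, with the usual sign. -/
noncomputable def braid (M N : DGMod R) : tensor M N ≅ tensor N M :=
  mkIso (LinearEquiv.ofLinearMap (swap M N) (swap N M) (LinearMap.ext (swap_swap N M))
      (LinearMap.ext (swap_swap M N)))
    (swap_mem M N) (swap_mem N M)
    (fun t => by
      have : ((swap M N).comp (tensorD M N)).toAddMonoidHom
          = ((tensorD N M).comp (swap M N)).toAddMonoidHom := by
        refine tensor_hom_ext (S := R) M.isInternal N.isInternal fun i j x hx y hy => ?_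
        change swap M N (M.d x ⊗ₜ[R] y + M.sign x ⊗ₜ[R] N.d y)
          = tensorD N M (swap M N (x ⊗ₜ[R] y))
        rw [map_add, swap_tmul' M N (M.d_mem i x hx) hy,
          swap_tmul' M N (M.sign_mem hx) (N.d_mem j y hy), swap_tmul' M N hx hy,
          apply_ite (tensorD N M), map_neg, tensorD_tmul, sign_of_mem M hx, sign_of_mem N hy]
        by_cases hi : Even i <;> by_cases hj : Even j <;>
          simp [hi, hj, ← Int.not_even_iff_odd, Int.even_sub_one, TensorProduct.neg_tmul,
            TensorProduct.tmul_neg, add_comm]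
      exact DFunLike.congr_fun this t)

theorem hom_ext_tensor {M N P : DGMod R} {f g : M ⊗ N ⟶ P}
    (h : ∀ i j : ℤ, ∀ x ∈ M.gr i, ∀ y ∈ N.gr j, f.toLin (x ⊗ₜ[R] y) = g.toLin (x ⊗ₜ[R] y)) :
    f = g := by
  have : f.toLin.toAddMonoidHom = g.toLin.toAddMonoidHom :=
    tensor_hom_ext (S := R) M.isInternal N.isInternal h
  exact hom_ext (LinearMap.ext fun t => DFunLike.congr_fun this t)

theorem hom_ext_tensor_left {M N P Q : DGMod R} {f g : (M ⊗ N) ⊗ P ⟶ Q}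
    (h : ∀ i j k : ℤ, ∀ x ∈ M.gr i, ∀ y ∈ N.gr j, ∀ z ∈ P.gr k,
      f.toLin ((x ⊗ₜ[R] y) ⊗ₜ[R] z) = g.toLin ((x ⊗ₜ[R] y) ⊗ₜ[R] z)) : f = g := by
  refine hom_ext (LinearMap.ext fun t => ?_)
  have : f.toLin.toAddMonoidHom = g.toLin.toAddMonoidHom := by
    refine tensor_hom_ext (S := R) (tensor M N).isInternal P.isInternal
      fun n k s hs z hz => ?_
    have hs' : (f.toLin.comp ((TensorProduct.mk R (M ⊗[R] N) P).flip z)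
        - g.toLin.comp ((TensorProduct.mk R (M ⊗[R] N) P).flip z)).toAddMonoidHom s
          ∈ (⊥ : AddSubgroup Q) := by
      refine map_mem_of_tmul _ _ (fun i j _ x hx y hy => ?_) hs
      exact sub_eq_zero.2 (h i j k x hx y hy z hz)
    exact sub_eq_zero.1 hs'
  exact DFunLike.congr_fun this t

theorem braiding_naturality_right' (M : DGMod R) {N P : DGMod R} (f : N ⟶ P) :
    M ◁ f ≫ (braid M P).hom = (braid M N).hom ≫ f ▷ M :=
  hom_ext_tensor fun i j x hx y hy => by
    change swap M P (x ⊗ₜ[R] f.toLin y)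
      = TensorProduct.map f.toLin LinearMap.id (swap M N (x ⊗ₜ[R] y))
    rw [swap_tmul' M P hx (f.map_mem j y hy), swap_tmul' M N hx hy]
    split_ifs <;> simp

theorem hexagon_forward' (M N P : DGMod R) :
    (α_ M N P).hom ≫ (braid M (N ⊗ P)).hom ≫ (α_ N P M).hom
      = ((braid M N).hom ▷ P) ≫ (α_ N M P).hom ≫ (N ◁ (braid M P).hom) :=
  hom_ext_tensor_left fun i j k x hx y hy z hz => by
    change TensorProduct.assoc R N P M (swap M (tensor N P) (x ⊗ₜ[R] (y ⊗ₜ[R] z)))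
      = TensorProduct.map LinearMap.id (swap M P)
        (TensorProduct.assoc R N M P (swap M N (x ⊗ₜ[R] y) ⊗ₜ[R] z))
    have hyz : y ⊗ₜ[R] z ∈ (tensor N P).gr (j + k) := tmul_mem_tensorGr rfl hy hz
    have e1 : swap M (tensor N P) (x ⊗ₜ[R] (y ⊗ₜ[R] z))
        = if Even i ∨ Even (j + k) then (y ⊗ₜ[R] z) ⊗ₜ[R] x else -((y ⊗ₜ[R] z) ⊗ₜ[R] x) :=
      swap_tmul' M (tensor N P) hx hyz
    have e2 : TensorProduct.assoc R N M P (swap M N (x ⊗ₜ[R] y) ⊗ₜ[R] z)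
        = if Even i ∨ Even j then y ⊗ₜ[R] (x ⊗ₜ[R] z) else -(y ⊗ₜ[R] (x ⊗ₜ[R] z)) := by
      rw [swap_tmul' M N hx hy]
      split_ifs
      · rfl
      · rw [TensorProduct.neg_tmul, map_neg]; rfl
    have e3 : TensorProduct.map LinearMap.id (swap M P) (y ⊗ₜ[R] (x ⊗ₜ[R] z))
        = if Even i ∨ Even k then y ⊗ₜ[R] (z ⊗ₜ[R] x) else -(y ⊗ₜ[R] (z ⊗ₜ[R] x)) := by
      rw [TensorProduct.map_tmul, swap_tmul' M P hx hz]
      split_ifs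
      · rfl
      · rw [TensorProduct.tmul_neg]; rfl
    have e4 : TensorProduct.assoc R N P M ((y ⊗ₜ[R] z) ⊗ₜ[R] x) = y ⊗ₜ[R] (z ⊗ₜ[R] x) := rfl
    rw [e1, e2, apply_ite (TensorProduct.map LinearMap.id (swap M P)), map_neg, e3,
      apply_ite (TensorProduct.assoc R N P M)]
    refine Eq.trans (b := if Even i ∨ Even (j + k) then y ⊗ₜ[R] (z ⊗ₜ[R] x)
      else -(y ⊗ₜ[R] (z ⊗ₜ[R] x))) ?_ ?_
    · split_ifs
      · rfl
      · exact map_neg (TensorProduct.assoc R N P M) _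
    · by_cases hi : Even i <;> by_cases hj : Even j <;> by_cases hk : Even k <;>
        simp [hi, hj, hk, Int.even_add]

theorem symmetry' (M N : DGMod R) : (braid M N).hom ≫ (braid N M).hom = 𝟙 (M ⊗ N) :=
  hom_ext (LinearMap.ext (swap_swap M N))

theorem braid_inv (M N : DGMod R) : (braid M N).inv = (braid N M).hom := rfl

noncomputable instance : BraidedCategory (DGMod R) where
  braiding := braid
  braiding_naturality_right := braiding_naturality_right'
  braiding_naturality_left {M N} f P := by
    rw [← cancel_mono (braid N P).inv, Category.assoc, Iso.hom_inv_id, Category.comp_id,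
      Category.assoc, braid_inv N P, braiding_naturality_right', ← Category.assoc, symmetry',
      Category.id_comp]
  hexagon_forward := hexagon_forward'
  hexagon_reverse M N P := by
    have h : α_ P M N ≪≫ braid P (M ⊗ N) ≪≫ α_ M N P
        = whiskerRightIso (braid P M) N ≪≫ α_ M P N ≪≫ whiskerLeftIso M (braid P N) :=
      Iso.ext (hexagon_forward' P M N)
    simpa [braid_inv] using congrArg Iso.inv h

noncomputable instance : SymmetricCategory (DGMod R) where
  symmetry M N := hom_ext (LinearMap.ext (swap_swap M N))

end DGMod

/-- The field `ℚ` is concentrated in degree `0`. -/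
noncomputable instance : EvenGraded ℚ where
  gr n := if n = 0 then ⊤ else ⊥
  isInternal := isInternal_of_proj _ (Finsupp.singleAddHom 0)
    (fun n x hx => by
      by_cases hn : n = 0
      · simp [hn]
      · have : x = 0 := by simpa [hn] using hx
        simp [this])
    (by
      rw [eq_top_iff]
      intro x _
      exact (le_iSup (fun n : ℤ => if n = 0 then (⊤ : AddSubgroup ℚ) else ⊥) 0) (by simp))
  one_mem := by simp
  mul_mem i j a ha b hb := by
    by_cases hi : i = 0
    · by_cases hj : j = 0
      · simp [hi, hj]
      · have : b = 0 := by simpa [hj] using hb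
        simp [this]
    · have : a = 0 := by simpa [hi] using ha
      simp [this]
  odd_eq_bot n hn := by
    have : n ≠ 0 := by rintro rfl; simp at hn
    simp [this]

/-- The set of finite subgroups of the circle group `SO(2)`. -/
abbrev FinSub : Type := {H : Subgroup Circle // Finite H}

/-- The product of the graded rings `ℚ[c_H]`, as a subring of the product of the underlying rings:
an element is a finite sum of homogeneous families, i.e. a family of polynomials of bounded
degree. -/
def gradedProduct : Subalgebra ℚ (FinSub → ℚ[X]) where
  carrier := {p | ∃ n : ℕ, ∀ H, (p H).natDegree ≤ n}
  mul_mem' := by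
    rintro p q ⟨m, hm⟩ ⟨n, hn⟩
    exact ⟨m + n, fun H => natDegree_mul_le.trans (add_le_add (hm H) (hn H))⟩
  add_mem' := by
    rintro p q ⟨m, hm⟩ ⟨n, hn⟩
    exact ⟨max m n, fun H => (natDegree_add_le _ _).trans (max_le_max (hm H) (hn H))⟩
  algebraMap_mem' r := ⟨0, fun H => (natDegree_C r).le⟩

/-- The ring `O_F`. -/
def OF : Type := gradedProduct

noncomputable instance : CommRing OF := inferInstanceAs (CommRing gradedProduct)

noncomputable instance : Algebra ℚ OF := inferInstanceAs (Algebra ℚ gradedProduct)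

/-- The projection `p ↦ e_H p` to the factor `ℚ[c_H]`. -/
noncomputable def compAt (H : FinSub) : OF →+* ℚ[X] :=
  (Pi.evalRingHom (fun _ => ℚ[X]) H).comp gradedProduct.val.toRingHom

theorem OF_ext {p q : OF} (h : ∀ H, compAt H p = compAt H q) : p = q :=
  Subtype.ext (funext h)

theorem compAt_smul (H : FinSub) (r : ℚ) (p : OF) : compAt H (r • p) = r • compAt H p := rfl

/-- The elements of degree `n` of `O_F`, where `c_H` has degree `-2`. -/
def OFgr (n : ℤ) : AddSubgroup OF where
  carrier := {p | ∀ H (k : ℕ), (compAt H p).coeff k ≠ 0 → n = -2 * k}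
  zero_mem' := by simp
  add_mem' {p q} hp hq H k h := by
    by_contra hk
    have h1 : (compAt H p).coeff k = 0 := by_contra fun h => hk (hp H k h)
    have h2 : (compAt H q).coeff k = 0 := by_contra fun h => hk (hq H k h)
    simp [h1, h2] at h
  neg_mem' {p} hp H k h := hp H k (by simpa using h)

/-- The component of degree `-2k`. -/
noncomputable def OFpart (k : ℕ) : OF →+ OF :=
  AddMonoidHom.mk' (fun p => ⟨fun H => monomial k ((compAt H p).coeff k),
      ⟨k, fun _ => natDegree_monomial_le _⟩⟩) (fun p q => OF_ext fun H => by
    change monomial k ((compAt H (p + q)).coeff k)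
      = monomial k ((compAt H p).coeff k) + monomial k ((compAt H q).coeff k)
    rw [map_add, coeff_add, map_add])

theorem compAt_OFpart (k : ℕ) (p : OF) (H : FinSub) :
    compAt H (OFpart k p) = monomial k ((compAt H p).coeff k) := rfl

theorem OFpart_mem (k : ℕ) (p : OF) : OFpart k p ∈ OFgr (-2 * k) := by
  intro H l hl
  rw [compAt_OFpart, coeff_monomial] at hl
  split_ifs at hl with h
  · rw [h]
  · exact absurd rfl hl

theorem OFpart_of_mem {n : ℤ} {p : OF} (hp : p ∈ OFgr n) (k : ℕ) :
    OFpart k p = if n = -2 * k then p else 0 := by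
  refine OF_ext fun H => ?_
  rw [compAt_OFpart]
  ext l
  rw [coeff_monomial]
  split_ifs with h1 h2 h2
  · rw [h1]
  · rw [map_zero, coeff_zero]
    exact by_contra fun h => h2 (hp H k h)
  · exact (by_contra fun h => h1 (by have := hp H l (Ne.symm h); lia))
  · simp

noncomputable instance : EvenGraded OF where
  gr := OFgr
  isInternal := isInternal_of_proj' _
    (fun m => if -2 * ((m.natAbs / 2 : ℕ) : ℤ) = m then OFpart (m.natAbs / 2) else 0)
    (fun m n p hp => by
      by_cases hm : -2 * ((m.natAbs / 2 : ℕ) : ℤ) = m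
      · rw [if_pos hm, OFpart_of_mem hp, hm]
      · rw [if_neg hm, AddMonoidHom.zero_apply]
        split_ifs with h
        · refine OF_ext fun H => ?_
          rw [map_zero]
          ext k
          rw [coeff_zero]
          by_contra h0
          exact hm (by have := hp H k (Ne.symm h0); lia)
        · rfl)
    (by
      rw [eq_top_iff]
      intro p _
      obtain ⟨n, hn⟩ := p.2
      have : p = ∑ k ∈ Finset.range (n + 1), OFpart k p := by
        refine OF_ext fun H => ?_
        rw [map_sum]
        exact (compAt H p).as_sum_range' (n + 1) (Nat.lt_succ_of_le (hn H))
      rw [this]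
      exact sum_mem fun k _ => (le_iSup OFgr (-2 * (k : ℤ))) (OFpart_mem k p))
  one_mem := by
    intro H k hk
    rw [map_one, coeff_one] at hk
    split_ifs at hk with h
    · simp [h]
    · exact absurd rfl hk
  mul_mem i j a ha b hb H k hk := by
    rw [map_mul, coeff_mul] at hk
    obtain ⟨⟨l, m⟩, hlm, h⟩ := Finset.exists_ne_zero_of_sum_ne_zero hk
    replace hlm : l + m = k := Finset.HasAntidiagonal.mem_antidiagonal.1 hlm
    rw [ha H l (left_ne_zero_of_mul h), hb H m (right_ne_zero_of_mul h), ← hlm]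
    push_cast; ring
  odd_eq_bot n hn := by
    rw [eq_bot_iff]
    intro p hp
    rw [AddSubgroup.mem_bot]
    refine OF_ext fun H => ?_
    rw [map_zero]
    ext k
    by_contra h
    have := hp H k h
    rw [this] at hn
    obtain ⟨m, hm⟩ := hn
    lia

/-- The element `c^ν`, with `e_H c^ν = c_H^(ν H)`. -/
noncomputable def eulerClass (ν : FinSub →₀ ℕ) : OF :=
  ⟨fun H => X ^ ν H, ν.support.sup ν, fun H => by
    rw [natDegree_X_pow]
    by_cases h : H ∈ ν.support
    · exact Finset.le_sup h
    · rw [Finsupp.notMem_support_iff.1 h]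
      exact Nat.zero_le _⟩

@[simp] theorem compAt_eulerClass (ν : FinSub →₀ ℕ) (H : FinSub) :
    compAt H (eulerClass ν) = X ^ ν H := rfl

theorem eulerClass_zero : eulerClass 0 = 1 := OF_ext fun H => by simp

theorem eulerClass_add (ν μ : FinSub →₀ ℕ) :
    eulerClass (ν + μ) = eulerClass ν * eulerClass μ := OF_ext fun H => by simp [pow_add]

/-- The multiplicative set of Euler classes `c^ν`, for `ν` of finite support. -/
def euler : Submonoid OF where
  carrier := Set.range eulerClass
  one_mem' := ⟨0, eulerClass_zero⟩
  mul_mem' := by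
    rintro _ _ ⟨ν, rfl⟩ ⟨μ, rfl⟩
    exact ⟨ν + μ, eulerClass_add ν μ⟩

/-- The ring obtained from `O_F` by inverting the Euler classes. Since Euler classes are
elements of the underlying ungraded ring, the colimit of the regraded copies of `O_F` along
multiplication by Euler classes has this localisation as its underlying ring; its grading
is `Lgr`. -/
def L : Type := Localization euler

noncomputable instance : CommRing L := inferInstanceAs (CommRing (Localization euler))

noncomputable instance : Algebra OF L := inferInstanceAs (Algebra OF (Localization euler))

instance : IsLocalization euler L := inferInstanceAs (IsLocalization euler (Localization euler))

noncomputable instance : Algebra ℚ L := ((algebraMap OF L).comp (algebraMap ℚ OF)).toAlgebra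

instance : IsScalarTower ℚ OF L := IsScalarTower.of_algebraMap_eq fun _ => rfl

/-- The elements of degree `n` of `L`: the fractions `p / c^ν` such that, for every `H`, the
component `e_H p` is homogeneous of degree `n + |c_H^(ν H)| = n - 2 ν(H)`. -/
def Lgr (n : ℤ) : AddSubgroup L where
  carrier := {x | ∃ (ν : FinSub →₀ ℕ) (p : OF),
    algebraMap OF L (eulerClass ν) * x = algebraMap OF L p ∧
    ∀ H (k : ℕ), (compAt H p).coeff k ≠ 0 → n = 2 * ν H - 2 * k}
  zero_mem' := ⟨0, 0, by simp, by simp⟩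
  add_mem' := by
    rintro x y ⟨ν, p, hx, hp⟩ ⟨μ, q, hy, hq⟩
    refine ⟨ν + μ, eulerClass μ * p + eulerClass ν * q, ?_, ?_⟩
    · rw [eulerClass_add, map_add, map_mul, map_mul, map_mul, ← hx, ← hy]; ring
    · intro H k h
      rw [map_add, map_mul, map_mul, compAt_eulerClass, compAt_eulerClass, coeff_add,
        coeff_X_pow_mul', coeff_X_pow_mul'] at h
      have : (μ H ≤ k ∧ (compAt H p).coeff (k - μ H) ≠ 0) ∨
          (ν H ≤ k ∧ (compAt H q).coeff (k - ν H) ≠ 0) := by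
        by_contra hc
        push Not at hc
        apply h
        split_ifs with h1 h2 h2
        · rw [hc.1 h1, hc.2 h2, add_zero]
        · rw [hc.1 h1, add_zero]
        · rw [hc.2 h2, add_zero]
        · rw [add_zero]
      rcases this with ⟨h1, h2⟩ | ⟨h1, h2⟩
      · have := hp H _ h2
        rw [Finsupp.add_apply]; push_cast [h1] at this ⊢; lia
      · have := hq H _ h2
        rw [Finsupp.add_apply]; push_cast [h1] at this ⊢; lia
  neg_mem' := by
    rintro x ⟨ν, p, hx, hp⟩
    exact ⟨ν, -p, by rw [map_neg, ← hx]; ring, fun H k h => hp H k (by simpa using h)⟩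

theorem Lgr_mul {i j : ℤ} {x y : L} (hx : x ∈ Lgr i) (hy : y ∈ Lgr j) : x * y ∈ Lgr (i + j) := by
  obtain ⟨ν, p, hx, hp⟩ := hx
  obtain ⟨μ, q, hy, hq⟩ := hy
  refine ⟨ν + μ, p * q, ?_, ?_⟩
  · rw [eulerClass_add, map_mul, map_mul, ← hx, ← hy]; ring
  · intro H k h
    rw [map_mul, coeff_mul] at h
    obtain ⟨⟨l, m⟩, hlm, h⟩ := Finset.exists_ne_zero_of_sum_ne_zero h
    replace hlm : l + m = k := Finset.HasAntidiagonal.mem_antidiagonal.1 hlm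
    rw [hp H l (left_ne_zero_of_mul h), hq H m (right_ne_zero_of_mul h), ← hlm]
    simp only [Finsupp.add_apply]; push_cast; ring

theorem algebraMap_mem_Lgr {n : ℤ} {p : OF} (hp : p ∈ OFgr n) : algebraMap OF L p ∈ Lgr n :=
  ⟨0, p, by simp [eulerClass_zero], fun H k h => by rw [hp H k h]; simp⟩

theorem Lgr_odd {n : ℤ} (hn : ¬ Even n) {x : L} (hx : x ∈ Lgr n) : x = 0 := by
  obtain ⟨ν, p, hx, hp⟩ := hx
  have : p = 0 := OF_ext fun H => by
    rw [map_zero]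
    ext k
    by_contra h
    apply hn
    rw [hp H k (by simpa using h)]
    exact ⟨ν H - k, by ring⟩
  rw [this, map_zero] at hx
  exact (IsUnit.mul_right_eq_zero
    (IsLocalization.map_units L (⟨eulerClass ν, ν, rfl⟩ : euler))).1 hx

/-- `id ⊗ φ : L ⊗ V → L ⊗ W`. -/
noncomputable abbrev extendL {V W : Type} [AddCommGroup V] [AddCommGroup W] [Module ℚ V] [Module ℚ W]
    (φ : V →ₗ[ℚ] W) : L ⊗[ℚ] V →ₗ[OF] L ⊗[ℚ] W :=
  AlgebraTensorModule.lTensor OF L φ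

/-- The isomorphism `(L ⊗ V) ⊗ (L ⊗ W) ≅ L ⊗ (V ⊗ W)`. -/
noncomputable def combine (V W : Type) [AddCommGroup V] [AddCommGroup W] [Module ℚ V]
    [Module ℚ W] : (L ⊗[ℚ] V) ⊗[OF] (L ⊗[ℚ] W) ≃ₗ[OF] L ⊗[ℚ] (V ⊗[ℚ] W) :=
  (AlgebraTensorModule.tensorTensorTensorComm ℚ ℚ OF OF L V L W).trans
    (AlgebraTensorModule.congr ((IsLocalization.moduleLid euler L L).restrictScalars OF)
      (LinearEquiv.refl ℚ (V ⊗[ℚ] W)))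

@[simp] theorem combine_tmul {V W : Type} [AddCommGroup V] [AddCommGroup W] [Module ℚ V]
    [Module ℚ W] (a b : L) (v : V) (w : W) :
    combine V W ((a ⊗ₜ[ℚ] v) ⊗ₜ[OF] (b ⊗ₜ[ℚ] w)) = (a * b) ⊗ₜ[ℚ] (v ⊗ₜ[ℚ] w) := by
  rfl

/-- If the Euler classes act invertibly on the target of `β`, then inverting them makes `β` an
isomorphism if and only if `β` is a localisation. -/
theorem bijective_map_iff {N T : Type} [AddCommGroup N] [AddCommGroup T] [Module OF N]
    [Module OF T] [Module L T] [IsScalarTower OF L T] (β : N →ₗ[OF] T) :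
    Function.Bijective (LocalizedModule.map euler β) ↔ IsLocalizedModule euler β := by
  have : IsLocalizedModule euler (LinearMap.id : T →ₗ[OF] T) := isLocalizedModule_id euler T L
  let e : T ≃ₗ[OF] LocalizedModule euler T :=
    (IsLocalizedModule.iso euler (LinearMap.id : T →ₗ[OF] T)).symm
  have he : ∀ t, e t = LocalizedModule.mkLinearMap euler T t := fun t => by
    simp [e, LinearEquiv.symm_apply_eq]
  have comm : ((LocalizedModule.map euler β).restrictScalars OF).comp
      (LocalizedModule.mkLinearMap euler N) = e.toLinearMap.comp β := by
    ext x
    simp [he]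
  constructor
  · intro h
    let m : LocalizedModule euler N ≃ₗ[OF] LocalizedModule euler T :=
      LinearEquiv.ofBijective ((LocalizedModule.map euler β).restrictScalars OF) h
    have : β = (m.trans e.symm).toLinearMap.comp (LocalizedModule.mkLinearMap euler N) := by
      ext x
      have := DFunLike.congr_fun comm x
      simp only [LinearMap.comp_apply, LinearEquiv.coe_coe, LinearEquiv.trans_apply] at this ⊢
      rw [LinearEquiv.eq_symm_apply, ← this]
      rfl
    rw [this]
    exact IsLocalizedModule.of_linearEquiv _ _ _
  · intro h
    let i := IsLocalizedModule.iso euler β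
    have : (LocalizedModule.map euler β).restrictScalars OF = (i.trans e).toLinearMap := by
      refine IsLocalizedModule.ext euler (LocalizedModule.mkLinearMap euler N)
        (IsLocalizedModule.map_units (LocalizedModule.mkLinearMap euler T)) ?_
      rw [comm]
      ext x
      simp [i]
    have hb : Function.Bijective ((LocalizedModule.map euler β).restrictScalars OF) := by
      rw [this]; exact (i.trans e).bijective
    exact hb

/-- An object `β : N → L ⊗ V` of the category `∂A(T)` of differential objects: `N` (the nub) is a
differential graded `O_F`-module, `V` (the vertex) is a complex of rational vector spaces, `β` is a
map of differential graded `O_F`-modules, where the differential of `L ⊗ V` is `id ⊗ d` as `L`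
is even with zero differential, and `β` is an isomorphism after inverting the Euler classes. -/
structure DA where
  nub : DGMod OF
  vertex : DGMod ℚ
  β : nub →ₗ[OF] L ⊗[ℚ] vertex
  β_mem : ∀ n : ℤ, ∀ x ∈ nub.gr n, β x ∈ tensorGr ℚ Lgr vertex.gr n
  β_d : ∀ x, β (nub.d x) = extendL vertex.d (β x)
  bijective : Function.Bijective (LocalizedModule.map euler β)

namespace DA

/-- Maps of `∂A(T)`: commutative squares. -/
@[ext]
structure Hom (A B : DA) where
  nub : A.nub ⟶ B.nub
  vertex : A.vertex ⟶ B.vertex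
  comm : ∀ x, B.β (nub.toLin x) = extendL vertex.toLin (A.β x)

noncomputable instance : Category DA where
  Hom := Hom
  id A := ⟨𝟙 _, 𝟙 _, fun x => by simp⟩
  comp f g := ⟨f.nub ≫ g.nub, f.vertex ≫ g.vertex, fun x => by
    simp only [DGMod.comp_toLin, LinearMap.comp_apply, f.comm, g.comm]
    exact (LinearMap.lTensor_comp_apply _ _ _ _).symm⟩

@[simp] theorem id_nub (A : DA) : Hom.nub (𝟙 A) = 𝟙 A.nub := rfl
@[simp] theorem id_vertex (A : DA) : Hom.vertex (𝟙 A) = 𝟙 A.vertex := rfl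
@[simp] theorem comp_nub {A B C : DA} (f : A ⟶ B) (g : B ⟶ C) :
    Hom.nub (f ≫ g) = Hom.nub f ≫ Hom.nub g := rfl
@[simp] theorem comp_vertex {A B C : DA} (f : A ⟶ B) (g : B ⟶ C) :
    Hom.vertex (f ≫ g) = Hom.vertex f ≫ Hom.vertex g := rfl

@[ext] theorem hom_ext {A B : DA} {f g : A ⟶ B} (h : Hom.nub f = Hom.nub g)
    (h' : Hom.vertex f = Hom.vertex g) : f = g :=
  Hom.ext h h'

theorem extendL_sign {V : DGMod ℚ} {n : ℤ} {t : L ⊗[ℚ] V} (ht : t ∈ tensorGr ℚ Lgr V.gr n) :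
    extendL V.sign t = if Even n then t else -t := by
  have : (extendL V.sign).toAddMonoidHom t - (if Even n then t else -t) = 0 := by
    have key : ((extendL V.sign).toAddMonoidHom
        - (if Even n then AddMonoidHom.id _ else -AddMonoidHom.id _) :
          L ⊗[ℚ] V →+ L ⊗[ℚ] V) t
          ∈ (⊥ : AddSubgroup (L ⊗[ℚ] V)) := by
      refine map_mem_of_tmul _ _ (fun i j hij x hx y hy => ?_) ht
      rw [AddSubgroup.mem_bot, AddMonoidHom.sub_apply, sub_eq_zero]
      change x ⊗ₜ[ℚ] V.sign y = _
      by_cases hi : Even i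
      · rw [DGMod.sign_of_mem V hy, ← hij]
        by_cases hj : Even j <;> simp [hi, hj, Int.even_add, TensorProduct.tmul_neg]
      · rw [Lgr_odd hi hx]; simp
    rw [AddSubgroup.mem_bot, AddMonoidHom.sub_apply] at key
    split_ifs at key ⊢ <;> exact key
  exact sub_eq_zero.1 this

theorem β_sign (A : DA) (x : A.nub) : A.β (A.nub.sign x) = extendL A.vertex.sign (A.β x) := by
  induction x using homogeneous_induction A.nub.isInternal with
  | zero => simp
  | add a b ha hb => simp only [map_add, ha, hb]
  | mem n x hx =>
    rw [extendL_sign (A.β_mem n x hx), DGMod.sign_of_mem _ hx]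
    split_ifs <;> simp

theorem isLocalizedModule (A : DA) : IsLocalizedModule euler A.β :=
  (bijective_map_iff A.β).1 A.bijective

theorem combine_mem {V W : DGMod ℚ} {i j : ℤ} {s : L ⊗[ℚ] V} {t : L ⊗[ℚ] W}
    (hs : s ∈ tensorGr ℚ Lgr V.gr i) (ht : t ∈ tensorGr ℚ Lgr W.gr j) :
    combine V W (s ⊗ₜ[OF] t) ∈ tensorGr ℚ Lgr (V.tensor W).gr (i + j) :=
  map_mem_of_tmul ((combine V W).toLinearMap.toAddMonoidHom.comp
      ((TensorProduct.mk OF (L ⊗[ℚ] V) (L ⊗[ℚ] W)).flip t).toAddMonoidHom) _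
    (fun k l hkl a ha v hv => map_mem_of_tmul ((combine V W).toLinearMap.toAddMonoidHom.comp
        (TensorProduct.mk OF (L ⊗[ℚ] V) (L ⊗[ℚ] W) (a ⊗ₜ[ℚ] v)).toAddMonoidHom) _
      (fun k' l' hkl' b hb w hw => by
        change combine V W ((a ⊗ₜ[ℚ] v) ⊗ₜ[OF] (b ⊗ₜ[ℚ] w)) ∈ _
        rw [combine_tmul]
        exact tmul_mem_tensorGr (by lia) (Lgr_mul ha hb) (tmul_mem_tensorGr rfl hv hw)) ht) hs

theorem combine_map {V W V' W' : Type} [AddCommGroup V] [AddCommGroup W] [Module ℚ V]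
    [Module ℚ W] [AddCommGroup V'] [AddCommGroup W'] [Module ℚ V'] [Module ℚ W']
    (f : V →ₗ[ℚ] V') (g : W →ₗ[ℚ] W') (s : L ⊗[ℚ] V) (t : L ⊗[ℚ] W) :
    combine V' W' (extendL f s ⊗ₜ[OF] extendL g t)
      = extendL (TensorProduct.map f g) (combine V W (s ⊗ₜ[OF] t)) := by
  induction s using TensorProduct.induction_on with
  | zero => simp
  | add a b ha hb => simp only [map_add, TensorProduct.add_tmul, ha, hb]
  | tmul a v =>
    induction t using TensorProduct.induction_on with
    | zero => simp
    | add a b ha hb => simp only [map_add, TensorProduct.tmul_add, ha, hb]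
    | tmul b w => simp

theorem extendL_add {V W : Type} [AddCommGroup V] [AddCommGroup W] [Module ℚ V] [Module ℚ W]
    (f g : V →ₗ[ℚ] W) (t : L ⊗[ℚ] V) : extendL (f + g) t = extendL f t + extendL g t := by
  simp [extendL]

theorem extendL_id {V : Type} [AddCommGroup V] [Module ℚ V] (t : L ⊗[ℚ] V) :
    extendL LinearMap.id t = t := by
  simp [extendL]

/-- The structure map of a tensor product. -/
noncomputable def tensorβ (A B : DA) : A.nub ⊗[OF] B.nub →ₗ[OF] L ⊗[ℚ] (A.vertex ⊗[ℚ] B.vertex) :=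
  (combine A.vertex B.vertex).toLinearMap.comp (TensorProduct.map A.β B.β)

theorem tensorβ_tmul (A B : DA) (x : A.nub) (y : B.nub) :
    tensorβ A B (x ⊗ₜ[OF] y) = combine A.vertex B.vertex (A.β x ⊗ₜ[OF] B.β y) := rfl

/-- The tensor product of `∂A(T)`: nubs are tensored over `O_F`, vertices over `ℚ`. -/
noncomputable def tensor (A B : DA) : DA where
  nub := A.nub ⊗ B.nub
  vertex := A.vertex ⊗ B.vertex
  β := tensorβ A B
  β_mem n t ht := map_mem_of_tmul (tensorβ A B).toAddMonoidHom _
    (fun i j hij x hx y hy => by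
      rw [← hij]
      exact combine_mem (A.β_mem i x hx) (B.β_mem j y hy)) ht
  β_d t := by
    have : (tensorβ A B).comp (DGMod.tensorD A.nub B.nub)
        = (extendL (DGMod.tensorD A.vertex B.vertex)).comp (tensorβ A B) :=
      TensorProduct.ext' fun x y => by
        simp only [LinearMap.comp_apply, DGMod.tensorD_tmul, map_add, tensorβ_tmul, A.β_d, B.β_d,
          β_sign]
        rw [DGMod.tensorD, extendL_add, ← combine_map, ← combine_map, extendL_id]
    exact DFunLike.congr_fun this t
  bijective := (bijective_map_iff _).2 (by
    have := A.isLocalizedModule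
    have := B.isLocalizedModule
    exact IsLocalizedModule.of_linearEquiv euler (TensorProduct.map A.β B.β)
      (combine A.vertex B.vertex))

/-- The tensor product of two maps. -/
noncomputable def tensorMap {A B A' B' : DA} (f : A ⟶ A') (g : B ⟶ B') :
    tensor A B ⟶ tensor A' B' where
  nub := f.nub ⊗ₘ g.nub
  vertex := f.vertex ⊗ₘ g.vertex
  comm t := by
    have : (tensorβ A' B').comp (TensorProduct.map f.nub.toLin g.nub.toLin)
        = (extendL (TensorProduct.map f.vertex.toLin g.vertex.toLin)).comp (tensorβ A B) :=
      TensorProduct.ext' fun x y => by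
        simp only [LinearMap.comp_apply, TensorProduct.map_tmul, tensorβ_tmul, f.comm, g.comm,
          combine_map]
    exact DFunLike.congr_fun this t

/-- The map `O_F ⊗ V → L ⊗ V`. -/
noncomputable def freeβ (V : Type) [AddCommGroup V] [Module ℚ V] : OF ⊗[ℚ] V →ₗ[OF] L ⊗[ℚ] V :=
  AlgebraTensorModule.rTensor ℚ V (Algebra.linearMap OF L)

/-- The map `O_F → L ⊗ ℚ`. -/
noncomputable def unitβ : OF →ₗ[OF] L ⊗[ℚ] ℚ :=
  (AlgebraTensorModule.rid ℚ OF L).symm.toLinearMap.comp (Algebra.linearMap OF L)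

theorem unitβ_apply (p : OF) : unitβ p = algebraMap OF L p ⊗ₜ[ℚ] (1 : ℚ) := rfl

/-- The unit `S^0 = (O_F → L ⊗ ℚ)`. -/
noncomputable def unit : DA where
  nub := 𝟙_ (DGMod OF)
  vertex := 𝟙_ (DGMod ℚ)
  β := unitβ
  β_mem n p hp := tmul_mem_tensorGr (add_zero n) (algebraMap_mem_Lgr hp)
    (EvenGraded.one_mem (R := ℚ))
  β_d p := by
    change unitβ 0 = extendL 0 (unitβ p)
    simp [extendL]
  bijective := (bijective_map_iff _).2
    (IsLocalizedModule.of_linearEquiv euler (Algebra.linearMap OF L)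
      (AlgebraTensorModule.rid ℚ OF L).symm)

/-- An isomorphism of `∂A(T)` from isomorphisms of nubs and vertices. -/
def mkIso {A B : DA} (e : A.nub ≅ B.nub) (e' : A.vertex ≅ B.vertex)
    (h : ∀ x, B.β (e.hom.toLin x) = extendL e'.hom.toLin (A.β x)) : A ≅ B where
  hom := ⟨e.hom, e'.hom, h⟩
  inv := ⟨e.inv, e'.inv, fun x => by
    have h1 : e.hom.toLin (e.inv.toLin x) = x :=
      DFunLike.congr_fun (congrArg DGMod.Hom.toLin e.inv_hom_id) x
    have h2 : e'.inv.toLin.comp e'.hom.toLin = LinearMap.id :=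
      congrArg DGMod.Hom.toLin e'.hom_inv_id
    have h3 := h (e.inv.toLin x)
    rw [h1] at h3
    rw [h3]
    refine Eq.trans (extendL_id _).symm ?_
    rw [← h2]
    exact LinearMap.lTensor_comp_apply _ _ _ _⟩
  hom_inv_id := hom_ext e.hom_inv_id e'.hom_inv_id
  inv_hom_id := hom_ext e.inv_hom_id e'.inv_hom_id

theorem combine_assoc {U V W : Type} [AddCommGroup U] [AddCommGroup V] [AddCommGroup W]
    [Module ℚ U] [Module ℚ V] [Module ℚ W] (r : L ⊗[ℚ] U) (s : L ⊗[ℚ] V) (t : L ⊗[ℚ] W) :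
    combine U (V ⊗[ℚ] W) (r ⊗ₜ[OF] combine V W (s ⊗ₜ[OF] t))
      = extendL (TensorProduct.assoc ℚ U V W).toLinearMap
        (combine (U ⊗[ℚ] V) W (combine U V (r ⊗ₜ[OF] s) ⊗ₜ[OF] t)) := by
  induction r using TensorProduct.induction_on with
  | zero => simp
  | add a b ha hb => simp only [map_add, TensorProduct.add_tmul, ha, hb]
  | tmul a u =>
    induction s using TensorProduct.induction_on with
    | zero => simp
    | add a b ha hb => simp only [map_add, TensorProduct.add_tmul, TensorProduct.tmul_add, ha, hb]
    | tmul b v =>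
      induction t using TensorProduct.induction_on with
      | zero => simp
      | add a b ha hb => simp only [map_add, TensorProduct.tmul_add, ha, hb]
      | tmul c w => simp [mul_assoc]

theorem combine_unit_left {V : Type} [AddCommGroup V] [Module ℚ V] (p : OF) (t : L ⊗[ℚ] V) :
    p • t = extendL (TensorProduct.lid ℚ V).toLinearMap (combine ℚ V (unitβ p ⊗ₜ[OF] t)) := by
  induction t using TensorProduct.induction_on with
  | zero =>  simp
  | add a b ha hb =>
    refine (smul_add p a b).trans ?_
    rw [ha, hb, TensorProduct.tmul_add, map_add, map_add]
  | tmul b v => simp [unitβ_apply, TensorProduct.smul_tmul', Algebra.smul_def]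

theorem combine_unit_right {V : Type} [AddCommGroup V] [Module ℚ V] (p : OF) (t : L ⊗[ℚ] V) :
    p • t = extendL (TensorProduct.rid ℚ V).toLinearMap (combine V ℚ (t ⊗ₜ[OF] unitβ p)) := by
  induction t using TensorProduct.induction_on with
  | zero =>  simp
  | add a b ha hb =>
    refine (smul_add p a b).trans ?_
    rw [ha, hb, TensorProduct.add_tmul, map_add, map_add]
  | tmul b v => simp [unitβ_apply, TensorProduct.smul_tmul', Algebra.smul_def, mul_comm]

/-- The associator. -/
noncomputable def assoc (A B C : DA) : tensor (tensor A B) C ≅ tensor A (tensor B C) :=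
  mkIso (α_ A.nub B.nub C.nub) (α_ A.vertex B.vertex C.vertex) (fun t => by
    have : (tensorβ A (tensor B C)).comp (TensorProduct.assoc OF A.nub B.nub C.nub).toLinearMap
        = (extendL (TensorProduct.assoc ℚ A.vertex B.vertex C.vertex).toLinearMap).comp
          (tensorβ (tensor A B) C) :=
      TensorProduct.ext_threefold fun x y z => combine_assoc (A.β x) (B.β y) (C.β z)
    exact DFunLike.congr_fun this t)

/-- The left unitor. -/
noncomputable def leftUnitor (A : DA) : tensor unit A ≅ A :=
  mkIso (λ_ A.nub) (λ_ A.vertex) (fun t => by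
    have : A.β.comp (TensorProduct.lid OF A.nub).toLinearMap
        = (extendL (TensorProduct.lid ℚ A.vertex).toLinearMap).comp (tensorβ unit A) :=
      TensorProduct.ext' fun (p : OF) x =>
        (A.β.map_smul p x).trans (combine_unit_left p (A.β x))
    exact DFunLike.congr_fun this t)

/-- The right unitor. -/
noncomputable def rightUnitor (A : DA) : tensor A unit ≅ A :=
  mkIso (ρ_ A.nub) (ρ_ A.vertex) (fun t => by
    have : A.β.comp (TensorProduct.rid OF A.nub).toLinearMap
        = (extendL (TensorProduct.rid ℚ A.vertex).toLinearMap).comp (tensorβ A unit) :=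
      TensorProduct.ext' fun x (p : OF) =>
        (A.β.map_smul p x).trans (combine_unit_right p (A.β x))
    exact DFunLike.congr_fun this t)

noncomputable instance : MonoidalCategoryStruct DA where
  tensorObj := tensor
  tensorUnit := unit
  tensorHom := tensorMap
  whiskerLeft A _ _ f := tensorMap (𝟙 A) f
  whiskerRight f B := tensorMap f (𝟙 B)
  associator := assoc
  leftUnitor := leftUnitor
  rightUnitor := rightUnitor

noncomputable instance : MonoidalCategory DA := MonoidalCategory.ofTensorHom
  (id_tensorHom_id := fun _ _ => hom_ext (id_tensorHom_id _ _) (id_tensorHom_id _ _))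
  (id_tensorHom := fun _ _ _ _ => rfl)
  (tensorHom_id := fun _ _ => rfl)
  (tensorHom_comp_tensorHom := fun _ _ _ _ => hom_ext (tensorHom_comp_tensorHom _ _ _ _)
    (tensorHom_comp_tensorHom _ _ _ _))
  (associator_naturality := fun _ _ _ => hom_ext (associator_naturality _ _ _)
    (associator_naturality _ _ _))
  (leftUnitor_naturality := fun f => hom_ext (leftUnitor_naturality f.nub)
    (leftUnitor_naturality f.vertex))
  (rightUnitor_naturality := fun f => hom_ext (rightUnitor_naturality f.nub)
    (rightUnitor_naturality f.vertex))
  (pentagon := fun _ _ _ _ => hom_ext (pentagon _ _ _ _) (pentagon _ _ _ _))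
  (triangle := fun _ _ => hom_ext (triangle _ _) (triangle _ _))

theorem combine_swap {V W : DGMod ℚ} {i j : ℤ} {s : L ⊗[ℚ] V} {t : L ⊗[ℚ] W}
    (hs : s ∈ tensorGr ℚ Lgr V.gr i) (ht : t ∈ tensorGr ℚ Lgr W.gr j) :
    extendL (DGMod.swap V W) (combine V W (s ⊗ₜ[OF] t))
      = if Even i ∨ Even j then combine W V (t ⊗ₜ[OF] s) else -combine W V (t ⊗ₜ[OF] s) := by
  have pure : ∀ a (v : V), ∀ b (w : W), combine W V ((b ⊗ₜ[ℚ] w) ⊗ₜ[OF] (a ⊗ₜ[ℚ] v))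
      = (a * b) ⊗ₜ[ℚ] (w ⊗ₜ[ℚ] v) := fun a v b w => by rw [combine_tmul, mul_comm]
  let c : ℤ := if Even i ∨ Even j then 1 else -1
  let F : (L ⊗[ℚ] V) ⊗[OF] (L ⊗[ℚ] W) →ₗ[OF] L ⊗[ℚ] (W ⊗[ℚ] V) :=
    (extendL (DGMod.swap V W)).comp (combine V W).toLinearMap
      - c • (combine W V).toLinearMap.comp (TensorProduct.comm OF _ _).toLinearMap
  have key : F (s ⊗ₜ[OF] t) ∈ (⊥ : AddSubgroup (L ⊗[ℚ] (W ⊗[ℚ] V))) := by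
    refine map_mem_of_tmul
      (F.toAddMonoidHom.comp ((TensorProduct.mk OF (L ⊗[ℚ] V) (L ⊗[ℚ] W)).flip t).toAddMonoidHom) _
      (fun k l hkl a ha v hv => ?_) hs
    refine map_mem_of_tmul
      (F.toAddMonoidHom.comp
        (TensorProduct.mk OF (L ⊗[ℚ] V) (L ⊗[ℚ] W) (a ⊗ₜ[ℚ] v)).toAddMonoidHom) _
      (fun k' l' hkl' b hb w hw => ?_) ht
    change extendL (DGMod.swap V W) (combine V W ((a ⊗ₜ[ℚ] v) ⊗ₜ[OF] (b ⊗ₜ[ℚ] w)))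
      - c • combine W V ((b ⊗ₜ[ℚ] w) ⊗ₜ[OF] (a ⊗ₜ[ℚ] v)) = 0
    rw [pure, combine_tmul]
    change (a * b) ⊗ₜ[ℚ] DGMod.swap V W (v ⊗ₜ[ℚ] w) - c • ((a * b) ⊗ₜ[ℚ] (w ⊗ₜ[ℚ] v)) = 0
    by_cases hk : Even k
    · by_cases hk' : Even k'
      · rw [DGMod.swap_tmul' V W hv hw, sub_eq_zero]
        have e1 : Even i ↔ Even l := by rw [← hkl]; simp [Int.even_add, hk]
        have e2 : Even j ↔ Even l' := by rw [← hkl']; simp [Int.even_add, hk']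
        by_cases h : Even l ∨ Even l'
        · simp [c, e1, e2, h]
        · simp [c, e1, e2, h, TensorProduct.tmul_neg]
      · rw [Lgr_odd hk' hb]; simp
    · rw [Lgr_odd hk ha]; simp
  have h0 : extendL (DGMod.swap V W) (combine V W (s ⊗ₜ[OF] t))
      - c • combine W V (t ⊗ₜ[OF] s) = 0 := key
  rw [sub_eq_zero.1 h0]
  by_cases h : Even i ∨ Even j <;> simp [c, h]

/-- The symmetry. -/
noncomputable def braid (A B : DA) : tensor A B ≅ tensor B A :=
  mkIso (β_ A.nub B.nub) (β_ A.vertex B.vertex) (fun t => by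
    have : ((tensorβ B A).comp (DGMod.swap A.nub B.nub)).toAddMonoidHom
        = ((extendL (DGMod.swap A.vertex B.vertex)).comp (tensorβ A B)).toAddMonoidHom := by
      refine tensor_hom_ext (S := OF) A.nub.isInternal B.nub.isInternal fun i j x hx y hy => ?_
      change tensorβ B A (DGMod.swap A.nub B.nub (x ⊗ₜ[OF] y))
        = extendL (DGMod.swap A.vertex B.vertex) (combine _ _ (A.β x ⊗ₜ[OF] B.β y))
      rw [combine_swap (A.β_mem i x hx) (B.β_mem j y hy), DGMod.swap_tmul' _ _ hx hy]
      split_ifs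
      · rfl
      · rw [map_neg]; rfl
    exact DFunLike.congr_fun this t)

noncomputable instance : SymmetricCategory DA where
  braiding := braid
  braiding_naturality_right _ _ _ f := hom_ext
    (BraidedCategory.braiding_naturality_right _ f.nub)
    (BraidedCategory.braiding_naturality_right _ f.vertex)
  braiding_naturality_left f _ := hom_ext
    (BraidedCategory.braiding_naturality_left f.nub _)
    (BraidedCategory.braiding_naturality_left f.vertex _)
  hexagon_forward _ _ _ := hom_ext (BraidedCategory.hexagon_forward _ _ _)
    (BraidedCategory.hexagon_forward _ _ _)
  hexagon_reverse _ _ _ := hom_ext (BraidedCategory.hexagon_reverse _ _ _)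
    (BraidedCategory.hexagon_reverse _ _ _)
  symmetry _ _ := hom_ext (SymmetricCategory.symmetry _ _) (SymmetricCategory.symmetry _ _)

end DA

namespace DGMod
variable {R : Type} [CommRing R] [EvenGraded R]

/-- The homology `ker d / im d`. -/
abbrev homology (M : DGMod R) : Type :=
  LinearMap.ker M.d ⧸ LinearMap.range (M.d.codRestrict (LinearMap.ker M.d) M.d_d)

/-- The map induced on homology. -/
def homologyMap {M N : DGMod R} (f : M ⟶ N) : M.homology →ₗ[R] N.homology :=
  Submodule.mapQ _ _
    (f.toLin.restrict (p := LinearMap.ker M.d) (q := LinearMap.ker N.d) fun x hx => by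
      rw [LinearMap.mem_ker] at hx ⊢
      rw [← f.map_d, hx, map_zero])
    (by
      rintro _ ⟨x, rfl⟩
      exact ⟨f.toLin x, Subtype.ext (f.map_d x).symm⟩)

end DGMod

/-- The graded vector space `ℚ` in degree `n`. -/
def lineGr (n k : ℤ) : AddSubgroup ℚ where
  carrier := {x | k ≠ n → x = 0}
  zero_mem' _ := rfl
  add_mem' hx hy h := by rw [hx h, hy h, add_zero]
  neg_mem' hx h := by rw [hx h, neg_zero]

theorem lineGr_smul (n i j : ℤ) (a : ℚ) (ha : a ∈ EvenGraded.gr (R := ℚ) i) (x : ℚ)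
    (hx : x ∈ lineGr n j) : a • x ∈ lineGr n (i + j) := by
  by_cases hi : i = 0
  · intro h
    rw [hx (by rintro rfl; exact h (by rw [hi, zero_add])), smul_zero]
  · have : a = 0 := by simpa [EvenGraded.gr, hi] using ha
    simp [this]

/-- The complex `S^n`: `ℚ` in degree `n`. -/
noncomputable def sphere (n : ℤ) : DGMod ℚ where
  carrier := ℚ
  gr := lineGr n
  isInternal := isInternal_of_proj _ (Finsupp.singleAddHom n)
    (fun k x hx => by
      by_cases hk : k = n
      · simp [hk]
      · simp [hx hk])
    (by
      rw [eq_top_iff]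
      intro x _
      exact (le_iSup (lineGr n) n) (fun h => absurd rfl h))
  smul_mem := lineGr_smul n
  d := 0
  d_mem _ _ _ := zero_mem _
  d_d _ := rfl

/-- The complex `D^n`: the identity `ℚ → ℚ`, in degrees `n` and `n - 1`. -/
noncomputable def disk (n : ℤ) : DGMod ℚ where
  carrier := ℚ × ℚ
  gr k := (lineGr n k).prod (lineGr (n - 1) k)
  isInternal := isInternal_of_proj _
    (((Finsupp.singleAddHom n).comp ((AddMonoidHom.inl ℚ ℚ).comp (AddMonoidHom.fst ℚ ℚ)))
      + ((Finsupp.singleAddHom (n - 1)).comp ((AddMonoidHom.inr ℚ ℚ).comp (AddMonoidHom.snd ℚ ℚ))))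
    (by
      rintro k ⟨x, y⟩ ⟨hx, hy⟩
      by_cases h1 : k = n
      · have h2 : y = 0 := hy (by lia)
        simp [h1, h2]
      · have h3 : x = 0 := hx h1
        by_cases h2 : k = n - 1
        · simp [h2, h3]
        · have h4 : y = 0 := hy h2
          have h5 : ((0 : ℚ), (0 : ℚ)) = 0 := rfl
          simp [h4, h3, h5])
    (by
      rw [eq_top_iff]
      rintro ⟨x, y⟩ -
      have h1 : (x, (0 : ℚ)) ∈ (lineGr n n).prod (lineGr (n - 1) n) :=
        ⟨fun h => absurd rfl h, fun _ => rfl⟩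
      have h2 : ((0 : ℚ), y) ∈ (lineGr n (n - 1)).prod (lineGr (n - 1) (n - 1)) :=
        ⟨fun _ => rfl, fun h => absurd rfl h⟩
      have h3 := add_mem
        (le_iSup (fun k : ℤ => (lineGr n k).prod (lineGr (n - 1) k)) n h1)
        (le_iSup (fun k : ℤ => (lineGr n k).prod (lineGr (n - 1) k)) (n - 1) h2)
      rwa [Prod.mk_add_mk, add_zero, zero_add] at h3)
  smul_mem i j a ha x hx := ⟨lineGr_smul n i j a ha x.1 hx.1,
    lineGr_smul (n - 1) i j a ha x.2 hx.2⟩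
  d := (LinearMap.inr ℚ ℚ ℚ).comp (LinearMap.fst ℚ ℚ ℚ)
  d_mem k x hx := ⟨fun _ => rfl, fun h => hx.1 fun h' => h (by rw [h'])⟩
  d_d _ := rfl

/-- The inclusion `S^(n-1) → D^n`. -/
noncomputable def sphereToDisk (n : ℤ) : sphere (n - 1) ⟶ disk n where
  toLin := LinearMap.inr ℚ ℚ ℚ
  map_mem k x hx := ⟨zero_mem _, hx⟩
  map_d x := by
    change ((0 : ℚ), (0 : ℚ)) = _
    rfl

/-- The functor `K ↦ S^0 ⊗ K = (O_F ⊗ K → L ⊗ K)` from rational chain complexes to `∂A(T)`. -/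
noncomputable def free : DGMod ℚ ⥤ DA where
  obj K :=
    { nub :=
        { carrier := OF ⊗[ℚ] K
          gr := tensorGr ℚ (EvenGraded.gr (R := OF)) K.gr
          isInternal := isInternal_tensorGr (gS := EvenGraded.gr) EvenGraded.isInternal
            EvenGraded.isInternal K.isInternal
            (fun i j a ha x hx => by
              by_cases hi : i = 0
              · intro H k hk
                rw [hi, zero_add]
                exact hx H k fun h => hk (by rw [compAt_smul, coeff_smul, h, smul_zero])
              · have : a = 0 := by simpa [EvenGraded.gr, hi] using ha
                simp [this])
            K.smul_mem
          smul_mem := fun i j p hp t ht =>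
            map_mem_of_tmul (DistribSMul.toAddMonoidHom (OF ⊗[ℚ] K) p) _
            (fun k l hkl x hx y hy => by
              simpa [TensorProduct.smul_tmul'] using
                tmul_mem_tensorGr (by rw [← hkl, add_assoc])
                  (EvenGraded.mul_mem (R := OF) i k p hp x hx) hy) ht
          d := AlgebraTensorModule.lTensor OF OF K.d
          d_mem := fun n t ht => map_mem_of_tmul
            (AlgebraTensorModule.lTensor OF OF K.d).toAddMonoidHom _
            (fun i j hij x hx y hy => tmul_mem_tensorGr (by lia) hx (K.d_mem j y hy)) ht
          d_d := fun t => by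
            induction t using TensorProduct.induction_on with
            | zero => simp
            | add a b ha hb => rw [map_add, map_add, ha, hb, add_zero]
            | tmul x y => simp [K.d_d] }
      vertex := K
      β := DA.freeβ K
      β_mem := fun n t ht => map_mem_of_tmul (DA.freeβ K).toAddMonoidHom _
        (fun i j hij p hp y hy => tmul_mem_tensorGr hij (algebraMap_mem_Lgr hp) hy) ht
      β_d := fun t => by
        have : (DA.freeβ K).comp (AlgebraTensorModule.lTensor OF OF K.d)
            = (extendL K.d).comp (DA.freeβ K) := by
          ext; rfl
        exact DFunLike.congr_fun this t
      bijective := (bijective_map_iff _).2 (by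
        unfold DA.freeβ
        infer_instance) }
  map {K K'} f :=
    { nub :=
        { toLin := AlgebraTensorModule.lTensor OF OF f.toLin
          map_mem := fun n t ht => map_mem_of_tmul
            (AlgebraTensorModule.lTensor OF OF f.toLin).toAddMonoidHom _
            (fun i j hij x hx y hy => tmul_mem_tensorGr hij hx (f.map_mem j y hy)) ht
          map_d := fun t => by
            have : (AlgebraTensorModule.lTensor OF OF f.toLin).comp
                (AlgebraTensorModule.lTensor OF OF K.d)
                = (AlgebraTensorModule.lTensor OF OF K'.d).comp
                  (AlgebraTensorModule.lTensor OF OF f.toLin) := by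
              ext x
              simp [f.map_d]
            exact DFunLike.congr_fun this t }
      vertex := f
      comm := fun t => by
        have : (DA.freeβ K').comp (AlgebraTensorModule.lTensor OF OF f.toLin)
            = (extendL f.toLin).comp (DA.freeβ K) := by
          ext; rfl
        exact DFunLike.congr_fun this t }
  map_id K := DA.hom_ext (DGMod.hom_ext (LinearMap.ext fun t => LinearMap.lTensor_id_apply _ _ t))
    rfl
  map_comp f g := DA.hom_ext
    (DGMod.hom_ext (LinearMap.ext fun t => LinearMap.lTensor_comp_apply _ _ _ t)) rfl

/-- The objects with zero differential. -/
def zeroDiff : ObjectProperty DA := fun A => A.nub.d = 0 ∧ A.vertex.d = 0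

theorem tensorD_zero {R : Type} [CommRing R] [EvenGraded R] {M N : DGMod R} (hM : M.d = 0)
    (hN : N.d = 0) : DGMod.tensorD M N = 0 := by
  simp [DGMod.tensorD, hM, hN]

instance : zeroDiff.IsMonoidal where
  prop_unit := ⟨rfl, rfl⟩
  prop_tensor _ _ h h' := ⟨tensorD_zero h.1 h'.1, tensorD_zero h.2 h'.2⟩

/-- The category `A(T)`, as the full monoidal subcategory of `∂A(T)` of the objects with zero
differential. -/
abbrev GrA : Type 1 := zeroDiff.FullSubcategory

/-- The canonical map `F(P, S^0) ⊗ B → F(P, B)`, where the function object `F(P, -)` is the right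
adjoint of `P ⊗ -`. -/
noncomputable def dualComparison (P : GrA) [Closed P] (B : GrA) : (ihom P).obj (𝟙_ GrA) ⊗ B ⟶ (ihom P).obj B :=
  MonoidalClosed.curry
    ((α_ P ((ihom P).obj (𝟙_ GrA)) B).inv ≫ ((ihom.ev P).app (𝟙_ GrA)) ▷ B ≫ (λ_ B).hom)

/-- `P` is dualisable if `F(P, S^0) ⊗ B → F(P, B)` is an isomorphism for every `B` in `A(T)`. -/
def IsDualisable (P : GrA) : Prop := ∃ _ : Closed P, ∀ B : GrA, IsIso (dualComparison P B)

/-- The homology isomorphisms. The homology of `N → L ⊗ V` is the object `H N → L ⊗ H V` of `A(T)`,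
so these are the maps that are bijective on the homology of the nubs and of the vertices. -/
def homologyIso : MorphismProperty DA := fun _ _ f =>
  Function.Bijective (DGMod.homologyMap (DA.Hom.nub f)) ∧
    Function.Bijective (DGMod.homologyMap (DA.Hom.vertex f))

/-- The maps `S^(n-1) ⊗ P → D^n ⊗ P`, for `P` in `S` and `n` an integer. -/
inductive generatingCofibrations (S : Set GrA) : MorphismProperty DA
  | mk (P : GrA) (hP : P ∈ S) (n : ℤ) :
      generatingCofibrations S (free.map (sphereToDisk n) ▷ P.obj)

section ModelStructures

universe v u v' u'

/-- The model structure is cofibrantly generated, with `I` as the set of generating cofibrations: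
there is a set `J` (of generating trivial cofibrations) such that `I` and `J` permit the small
object argument, the trivial fibrations are the maps with the right lifting property with respect
to `I`, and the fibrations are those with the right lifting property with respect to `J`. -/
structure IsCofibrantlyGeneratedBy {C : Type u} [Category.{v} C] (_ : ModelCategory C)
    (I : MorphismProperty C) : Prop where
  small : MorphismProperty.HasSmallObjectArgument.{0} I
  trivialFibrations_eq : trivialFibrations C = I.rlp
  exists_trivial : ∃ J : MorphismProperty C, MorphismProperty.HasSmallObjectArgument.{0} J ∧
    fibrations C = J.rlp

/-- Left and right properness. -/
structure IsProper {C : Type u} [Category.{v} C] (_ : ModelCategory C) : Prop where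
  left : ∀ ⦃W X Y Z : C⦄ (f : W ⟶ X) (i : W ⟶ Y) (i' : X ⟶ Z) (f' : Y ⟶ Z),
    IsPushout f i i' f' → cofibrations C i → weakEquivalences C f → weakEquivalences C f'
  right : ∀ ⦃W X Y Z : C⦄ (p' : W ⟶ X) (f' : W ⟶ Y) (f : X ⟶ Z) (p : Y ⟶ Z),
    IsPullback p' f' f p → fibrations C p → weakEquivalences C f → weakEquivalences C f'

/-- A monoidal model category: closed symmetric monoidal, with the pushout product axiom and
the unit axiom. -/
structure IsMonoidalModelCategory {C : Type u} [Category.{v} C] [MonoidalCategory C]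
    [SymmetricCategory C] (_ : ModelCategory C) : Prop where
  closed : Nonempty (MonoidalClosed C)
  pushoutProduct : ∀ ⦃W X Y Z : C⦄ (f : W ⟶ X) (g : Y ⟶ Z), cofibrations C f → cofibrations C g →
    cofibrations C ((Arrow.pushoutProduct.obj (Arrow.mk f)).obj (Arrow.mk g)).hom ∧
    (weakEquivalences C f ∨ weakEquivalences C g →
      weakEquivalences C ((Arrow.pushoutProduct.obj (Arrow.mk f)).obj (Arrow.mk g)).hom)
  unit : ∀ ⦃Q : C⦄ (q : Q ⟶ 𝟙_ C), IsCofibrant Q → weakEquivalences C q →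
    ∀ X : C, IsCofibrant X → weakEquivalences C (q ▷ X)

/-- The maps `j ⊗ Z`, for `j` a trivial cofibration and `Z` any object. -/
inductive trivialCofibrationTensor {C : Type u} [Category.{v} C] [MonoidalCategory C]
    (M : ModelCategory C) : MorphismProperty C
  | mk {X Y : C} (j : X ⟶ Y) (hj : trivialCofibrations C j) (Z : C) :
      trivialCofibrationTensor M (j ▷ Z)

/-- The monoid axiom: transfinite compositions of pushouts of maps `j ⊗ Z`, with `j` a trivial
cofibration, are weak equivalences. -/
def MonoidAxiom {C : Type u} [Category.{v} C] [MonoidalCategory C] (M : ModelCategory C) : Prop :=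
  MorphismProperty.transfiniteCompositions.{0} (trivialCofibrationTensor M).pushouts
    ≤ weakEquivalences C

/-- The adjunction `F ⊣ G` is a Quillen equivalence: `F` preserves cofibrations and trivial
cofibrations, and a map `F X → Y` with `X` cofibrant and `Y` fibrant is a weak equivalence if and
only if its adjoint `X → G Y` is one. -/
structure IsQuillenEquivalence {C : Type u} [Category.{v} C] {D : Type u'} [Category.{v'} D]
    (_ : ModelCategory C) (_ : ModelCategory D) {F : C ⥤ D} {G : D ⥤ C} (adj : F ⊣ G) : Prop where
  map_cofibrations : ∀ ⦃X Y : C⦄ (f : X ⟶ Y), cofibrations C f → cofibrations D (F.map f)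
  map_trivialCofibrations : ∀ ⦃X Y : C⦄ (f : X ⟶ Y),
    trivialCofibrations C f → trivialCofibrations D (F.map f)
  equivalence : ∀ ⦃X : C⦄ ⦃Y : D⦄ (f : F.obj X ⟶ Y), IsCofibrant X → IsFibrant Y →
    (weakEquivalences D f ↔ weakEquivalences C (adj.homEquiv X Y f))

end ModelStructures


end AlgModel

/-! Everything is done inside `DA` with elements of nubs. A structure map is a localisation: its
kernel is torsion, and every `1 ⊗ v` becomes a value after multiplication by an Euler class. Hence
maps of vertices, isomorphisms and homology isomorphisms are all controlled by the nub
(`DA.hom_ext_nub`, `DA.isIso_of_bijective`, `DA.homologyIso_iff`). Kernels, cokernels and direct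
sums are formed on nubs and vertices, and the faithful functor `DA.nubMod` to `OF`-modules makes
`DA` abelian with exact filtered colimits.

The main input is that there are enough dualisable objects. A matrix object (`MatData`) has a free
nub, whose generators may have different degrees at different subgroups, and a finite dimensional
vertex; its structure map is a matrix invertible over `L`, and the inverse matrix defines the dual
(`MatData.isDualisable`). Given a homogeneous `x` in any nub, write `β x = ∑ q i ⊗ v i`, lift
suitable `c^(ν i) ⊗ v i` to the nub and adjoin one generator for `x`: some matrix object then has a
degree 0 map, not necessarily commuting with `d`, that hits `x` (`DA.exists_cover`). There are two
consequences. The disks `D^0 ⊗ D` on matrix objects form a small separating family, so `DA` is a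
Grothendieck category; it has all limits, and it is closed because tensoring preserves colimits. And
a map with the right lifting property against the maps `S^(n-1) ⊗ D → D^n ⊗ D` is surjective with
acyclic kernel, hence a homology isomorphism (`homologyIso_of_rlp_mat`).

Model structures come from Smith's theorem, for a small set `I` of monomorphisms such that `I.rlp`
consists of homology isomorphisms (`DA.exists_modelCategory`). Monomorphisms that are homology
isomorphisms are closed under pushouts, coproducts, transfinite compositions and retracts. The
solution set condition is a cardinality argument (`exists_factorization`): adding an injective
object, which is acyclic, to the target turns a homology isomorphism into a monomorphism, and the
image of a small object can be enclosed in a small trivial monomorphism. The generating cofibrations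
give `∂A_qd`; the inclusions of subobjects of a separator give the injective structure. Dualisable
nubs are finitely generated, so dualisable objects form a set up to isomorphism
(`small_dualisable`).

For the monoidal statements, a dualisable object has a finitely generated projective, hence flat,
nub. The pushout product of two generating cofibrations attaches a single cell on `P ⊗ Q`; the
pushout product of a generating cofibration with a monomorphism, or with a trivial one, is again of
that kind; lifting adjunctions pass from generators to all cofibrations. It follows that tensoring
with a cofibrant object preserves homology isomorphisms, which is the unit axiom. For an acyclic
cofibration `j` and any `Z`, the map `j ⊗ Z` is a monomorphism with cokernel `C ⊗ Z`, where `C` is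
cofibrant and acyclic; replacing `Z` by a cofibrant object shows that `C ⊗ Z` is acyclic, and the
monoid axiom follows. Properness is a diagram chase, since cofibrations are injective and fibrations
are surjective. The identity is a Quillen equivalence because the weak equivalences agree and
cofibrations of `∂A_qd` are monomorphisms. -/

namespace AlgModel

/-! ### Homogeneous parts in an internally graded group -/

section Projections

variable {X : Type} [AddCommGroup X] {gr : ℤ → AddSubgroup X}

/-- The projection onto the homogeneous part of degree `n`. -/
noncomputable def proj (h : DirectSum.IsInternal gr) (n : ℤ) : X →+ X :=
  byDegree h fun m => if m = n then AddMonoidHom.id X else 0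

theorem proj_of_mem (h : DirectSum.IsInternal gr) {m : ℤ} (n : ℤ) {x : X} (hx : x ∈ gr m) :
    proj h n x = if m = n then x else 0 := by
  rw [proj, byDegree_of_mem h _ hx]
  split_ifs <;> rfl

theorem proj_self (h : DirectSum.IsInternal gr) {n : ℤ} {x : X} (hx : x ∈ gr n) :
    proj h n x = x := by
  rw [proj_of_mem h n hx, if_pos rfl]

theorem proj_mem (h : DirectSum.IsInternal gr) (n : ℤ) (x : X) : proj h n x ∈ gr n := by
  induction x using homogeneous_induction h with
  | zero => simp
  | add a b ha hb => rw [map_add]; exact add_mem ha hb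
  | mem m x hx =>
    rw [proj_of_mem h n hx]
    split_ifs with e
    exacts [e ▸ hx, zero_mem _]

/-- The sum is allowed to run over any finite set containing the support, so that the supports of
two summands can be merged in the additive step. -/
theorem exists_sum_proj (h : DirectSum.IsInternal gr) (x : X) :
    ∃ s : Finset ℤ, ∀ t, s ⊆ t → x = ∑ n ∈ t, proj h n x := by
  induction x using homogeneous_induction h with
  | zero => exact ⟨∅, fun t _ => by simp⟩
  | add a b ha hb =>
    obtain ⟨s, hs⟩ := ha
    obtain ⟨s', hs'⟩ := hb
    refine ⟨s ∪ s', fun t ht => ?_⟩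
    simp only [map_add, Finset.sum_add_distrib]
    rw [← hs t (Finset.union_subset_left ht), ← hs' t (Finset.union_subset_right ht)]
  | mem m x hx =>
    refine ⟨{m}, fun t ht => ?_⟩
    rw [Finset.sum_congr rfl fun n _ => proj_of_mem h n hx]
    simp [ht (Finset.mem_singleton_self m)]

theorem eq_zero_of_proj (h : DirectSum.IsInternal gr) {x : X} (hx : ∀ n, proj h n x = 0) :
    x = 0 := by
  obtain ⟨s, hs⟩ := exists_sum_proj h x
  rw [hs s subset_rfl]
  exact Finset.sum_eq_zero fun n _ => hx n

theorem mem_of_proj_eq (h : DirectSum.IsInternal gr) {n : ℤ} {x : X} (hx : proj h n x = x) :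
    x ∈ gr n := hx ▸ proj_mem h n x

variable {Y : Type} [AddCommGroup Y] {gr' : ℤ → AddSubgroup Y}

theorem map_proj_shift (h : DirectSum.IsInternal gr) (h' : DirectSum.IsInternal gr') (f : X →+ Y)
    (k : ℤ) (hf : ∀ n, ∀ x ∈ gr n, f x ∈ gr' (n + k)) (n : ℤ) (x : X) :
    f (proj h n x) = proj h' (n + k) (f x) := by
  induction x using homogeneous_induction h with
  | zero => simp
  | add a b ha hb => simp only [map_add, ha, hb]
  | mem m x hx =>
    rw [proj_of_mem h n hx, proj_of_mem h' _ (hf m x hx)]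
    by_cases e : m = n <;> simp [e]

theorem map_proj (h : DirectSum.IsInternal gr) (h' : DirectSum.IsInternal gr') (f : X →+ Y)
    (hf : ∀ n, ∀ x ∈ gr n, f x ∈ gr' n) (n : ℤ) (x : X) :
    f (proj h n x) = proj h' n (f x) := by
  simpa using map_proj_shift h h' f 0 (by simpa using hf) n x

/-- Degree-preserving maps commute with the projections, so an injective one detects whether an
element equals its own part of degree `n`. -/
theorem mem_of_map_mem (h : DirectSum.IsInternal gr) (h' : DirectSum.IsInternal gr') (f : X →+ Y)
    (hf : ∀ n, ∀ x ∈ gr n, f x ∈ gr' n) (inj : Function.Injective f) {n : ℤ} {x : X}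
    (hx : f x ∈ gr' n) : x ∈ gr n :=
  mem_of_proj_eq h (inj (by rw [map_proj h h' f hf, proj_self h' hx]))

/-- Each coordinate `c i` sees only the degree `deg i`, so on a sum of homogeneous parts it reads
off one part, and joint injectivity makes the parts unique. The coordinates need not be projections:
coefficients of polynomials and Laurent polynomials serve as well. -/
theorem isInternal_of_coeff {ι Z : Type} [AddCommGroup Z] (c : ι → X →+ Z) (deg : ι → ℤ)
    (hdeg : ∀ n, ∀ x ∈ gr n, ∀ i, c i x ≠ 0 → n = deg i) (inj : ∀ x, (∀ i, c i x = 0) → x = 0)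
    (hs : ⨆ n, gr n = ⊤) : DirectSum.IsInternal gr := by
  have key : ∀ (y : DirectSum ℤ fun n => gr n) (i : ι),
      c i (DirectSum.coeAddMonoidHom gr y) = c i (y (deg i) : X) := by
    intro y i
    induction y using DirectSum.induction_on with
    | zero => simp
    | of n x =>
      rw [DirectSum.coeAddMonoidHom_of, DirectSum.coe_of_apply]
      split_ifs with e
      · rfl
      · rw [AddSubgroup.coe_zero, map_zero]
        by_contra h0
        exact e (hdeg n x x.2 i h0)
    | add a b ha hb => simp [ha, hb]
  constructor
  · rw [injective_iff_map_eq_zero]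
    intro y hy
    ext n
    refine inj _ fun i => ?_
    by_contra h0
    have e : n = deg i := hdeg n _ (y n).2 i h0
    subst e
    rw [← key, hy, map_zero] at h0
    exact h0 rfl
  · intro x
    have hx : x ∈ ⨆ n, gr n := by rw [hs]; trivial
    induction hx using AddSubgroup.iSup_induction' with
    | hp n x hx => exact ⟨DirectSum.of (fun n => gr n) n ⟨x, hx⟩, by simp⟩
    | h1 => exact ⟨0, by simp⟩
    | hadd x y _ _ hx hy =>
      obtain ⟨a, rfl⟩ := hx
      obtain ⟨b, rfl⟩ := hy
      exact ⟨a + b, by simp⟩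

end Projections

/-! ### Gradings of `OF` twisted by a degree function on the finite subgroups -/

section Twist

/-- The grading of `O_F` for which the unit of the factor at `H` has degree `t H`. -/
def twGr (t : FinSub → ℤ) (n : ℤ) : AddSubgroup OF where
  carrier := {p | ∀ H (k : ℕ), (compAt H p).coeff k ≠ 0 → n = t H - 2 * k}
  zero_mem' := by simp
  add_mem' {p q} hp hq H k h := by
    by_contra hk
    have h1 : (compAt H p).coeff k = 0 := by_contra fun h => hk (hp H k h)
    have h2 : (compAt H q).coeff k = 0 := by_contra fun h => hk (hq H k h)
    simp [h1, h2] at h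
  neg_mem' {p} hp H k h := hp H k (by simpa using h)

theorem twGr_zero (n : ℤ) : twGr (fun _ => 0) n = EvenGraded.gr (R := OF) n := by
  ext p
  change (∀ H (k : ℕ), _ → n = 0 - 2 * (k : ℤ)) ↔ ∀ H (k : ℕ), _ → n = -2 * (k : ℤ)
  simp

theorem mul_mem_twGr {t u : FinSub → ℤ} {i j : ℤ} {p q : OF} (hp : p ∈ twGr t i)
    (hq : q ∈ twGr u j) : p * q ∈ twGr (fun H => t H + u H) (i + j) := by
  intro H k hk
  rw [map_mul, coeff_mul] at hk
  obtain ⟨⟨l, m⟩, hlm, h⟩ := Finset.exists_ne_zero_of_sum_ne_zero hk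
  replace hlm : l + m = k := Finset.HasAntidiagonal.mem_antidiagonal.1 hlm
  have h1 := hp H l (left_ne_zero_of_mul h)
  have h2 := hq H m (right_ne_zero_of_mul h)
  simp only
  rw [← hlm]
  push_cast
  lia

theorem OF_natDegree (p : OF) : ∃ N : ℕ, ∀ H, (compAt H p).natDegree ≤ N := p.2

/-- The part of `p` of degree `m`. -/
noncomputable def twPart (t : FinSub → ℤ) (m : ℤ) (p : OF) : OF :=
  -- The test rejects the odd and the negative values of `t H - m`, which the division and `toNat`
  -- would silently round.
  ⟨fun H => if t H - 2 * ((t H - m) / 2).toNat = m then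
      monomial ((t H - m) / 2).toNat ((compAt H p).coeff ((t H - m) / 2).toNat) else 0, by
    obtain ⟨N, hN⟩ := OF_natDegree p
    refine ⟨N, fun H => ?_⟩
    dsimp only
    split_ifs
    · by_cases h : ((t H - m) / 2).toNat ≤ N
      · exact (natDegree_monomial_le _).trans h
      · rw [coeff_eq_zero_of_natDegree_lt ((hN H).trans_lt (not_le.1 h))]
        simp
    · simp⟩

theorem coeff_twPart (t : FinSub → ℤ) (m : ℤ) (p : OF) (H : FinSub) (j : ℕ) :
    (compAt H (twPart t m p)).coeff j = if m = t H - 2 * j then (compAt H p).coeff j else 0 := by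
  change Polynomial.coeff (if t H - 2 * ((t H - m) / 2).toNat = m then
      monomial ((t H - m) / 2).toNat ((compAt H p).coeff ((t H - m) / 2).toNat) else 0) j = _
  by_cases h : m = t H - 2 * j
  · have h1 : ((t H - m) / 2).toNat = j := by lia
    have h2 : t H - 2 * ((t H - m) / 2).toNat = m := by lia
    rw [if_pos h, if_pos h2, h1, coeff_monomial, if_pos rfl]
  · rw [if_neg h]
    split_ifs with h2
    · rw [coeff_monomial, if_neg]
      rintro rfl
      exact h h2.symm
    · simp

theorem twPart_mem (t : FinSub → ℤ) (m : ℤ) (p : OF) : twPart t m p ∈ twGr t m := by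
  intro H k hk
  rw [coeff_twPart] at hk
  by_contra h
  exact hk (if_neg h)

/-- A function with finitely many values. -/
def Bdd (t : FinSub → ℤ) : Prop := (Set.range t).Finite

/-- The degrees that occur are `t H - 2 * j` with `j` below a common bound. They form a finite set
because `t` has finite range; for unbounded `t` even `1` would have infinitely many nonzero parts.
-/
theorem twGr_iSup {t : FinSub → ℤ} (ht : Bdd t) : ⨆ n, twGr t n = ⊤ := by
  rw [eq_top_iff]
  intro p _
  obtain ⟨N, hN⟩ := OF_natDegree p
  let s : Finset ℤ := (ht.toFinset ×ˢ Finset.range (N + 1)).image fun x => x.1 - 2 * (x.2 : ℤ)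
  have : p = ∑ m ∈ s, twPart t m p := by
    refine OF_ext fun H => ?_
    rw [map_sum]
    ext j
    rw [finsetSum_coeff]
    simp only [coeff_twPart]
    rw [Finset.sum_ite_eq']
    split_ifs with h
    · rfl
    · refine coeff_eq_zero_of_natDegree_lt ((hN H).trans_lt (not_le.1 fun hj => h ?_))
      refine Finset.mem_image.2 ⟨(t H, j), Finset.mem_product.2 ⟨?_, ?_⟩, rfl⟩
      · exact ht.mem_toFinset.2 ⟨H, rfl⟩
      · exact Finset.mem_range.2 (Nat.lt_succ_of_le hj)
  rw [this]
  exact sum_mem fun m _ => (le_iSup (twGr t) m) (twPart_mem t m p)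

theorem twGr_isInternal {t : FinSub → ℤ} (ht : Bdd t) : DirectSum.IsInternal (twGr t) :=
  isInternal_of_coeff (ι := FinSub × ℕ)
    (fun i => ((lcoeff ℚ i.2).toAddMonoidHom).comp (compAt i.1).toAddMonoidHom)
    (fun i => t i.1 - 2 * i.2) (fun _ _ hp i hi => hp i.1 i.2 hi)
    (fun p hp => OF_ext fun H => by
      ext k
      simpa using hp (H, k)) (twGr_iSup ht)

end Twist

/-! ### The localisation `L` is internally graded -/

section GradedL

theorem eulerClass_mem (ν : FinSub →₀ ℕ) : eulerClass ν ∈ euler := ⟨ν, rfl⟩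

theorem euler_regular {s p : OF} (hs : s ∈ euler) (h : s * p = 0) : p = 0 := by
  obtain ⟨ν, rfl⟩ := hs
  refine OF_ext fun H => ?_
  have := congrArg (compAt H) h
  rw [map_mul, map_zero, compAt_eulerClass] at this
  rw [map_zero]
  exact (mul_eq_zero.1 this).resolve_left (pow_ne_zero _ X_ne_zero)

theorem euler_isUnit {s : OF} (hs : s ∈ euler) : IsUnit (algebraMap OF L s) :=
  IsLocalization.map_units L (⟨s, hs⟩ : euler)

theorem euler_smul_eq_zero {T : Type} [AddCommGroup T] [Module OF T] [Module L T]
    [IsScalarTower OF L T] {s : OF} (hs : s ∈ euler) {y : T} (h : s • y = 0) : y = 0 := by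
  rw [← algebraMap_smul L s y] at h
  exact (euler_isUnit hs).smul_eq_zero.1 h

theorem algebraMap_OF_injective : Function.Injective (algebraMap OF L) :=
  IsLocalization.injective L (M := euler) fun _ hs => mem_nonZeroDivisors_iff.2
    ⟨fun _ h => euler_regular hs h, fun _ h => euler_regular hs (by rwa [mul_comm])⟩

/-- The component at `H` of an element of `L`, as a Laurent polynomial. -/
noncomputable def laurentAt (H : FinSub) : L →+* LaurentPolynomial ℚ :=
  IsLocalization.lift (M := euler) (g := (toLaurent (R := ℚ)).comp (compAt H)) (by
    rintro ⟨_, ν, rfl⟩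
    rw [RingHom.comp_apply, compAt_eulerClass, map_pow, toLaurent_X]
    exact (LaurentPolynomial.isUnit_T 1).pow _)

theorem laurentAt_algebraMap (H : FinSub) (p : OF) :
    laurentAt H (algebraMap OF L p) = toLaurent (compAt H p) :=
  IsLocalization.lift_eq _ _

theorem laurentAt_injective {x : L} (h : ∀ H, laurentAt H x = 0) : x = 0 := by
  obtain ⟨⟨p, s⟩, hx⟩ := IsLocalization.surj euler x
  have : p = 0 := OF_ext fun H => by
    rw [map_zero]
    refine Polynomial.toLaurent_injective ?_
    rw [← laurentAt_algebraMap, ← hx, map_mul, h, zero_mul, map_zero]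
  rw [this, map_zero] at hx
  exact (IsUnit.mul_left_eq_zero (IsLocalization.map_units L s)).1 hx

/-- At `H` the denominator is the monomial `T (ν H)`, which only shifts exponents: the coefficient
of `x` at `j` is the coefficient of the numerator at `ν H + j`, where the degree is prescribed. -/
theorem laurentAt_coeff {n : ℤ} {x : L} (hx : x ∈ Lgr n) (H : FinSub) (j : ℤ)
    (h : (laurentAt H x).coeff j ≠ 0) : n = -2 * j := by
  obtain ⟨ν, p, hx, hp⟩ := hx
  have h1 := congrArg (laurentAt H) hx
  rw [map_mul, laurentAt_algebraMap, laurentAt_algebraMap, compAt_eulerClass, map_pow,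
    toLaurent_X, LaurentPolynomial.T_pow, mul_one] at h1
  have h2 : (toLaurent (compAt H p)).coeff (ν H + j) = (laurentAt H x).coeff j := by
    rw [← h1]
    exact (AddMonoidAlgebra.coeff_single_mul_eq_mul_coeff j fun m _ => by
      rw [add_right_inj]).trans (one_mul _)
  rw [← h2] at h
  have h3 : (ν H : ℤ) + j ∈ (toLaurent (compAt H p)).coeff.support := Finsupp.mem_support_iff.2 h
  rw [LaurentPolynomial.support_coeff_toLaurent, Finset.mem_map] at h3
  obtain ⟨k, hk, e⟩ := h3
  have := hp H k (Polynomial.mem_support_iff.1 hk)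
  simp only [Nat.castEmbedding_apply] at e
  lia

/-- In a fraction `p / c^ν` the numerator is decomposed for the grading twisted by `2 * ν H`, which
makes each part of the fraction homogeneous. The twist is bounded because `ν` has finite support. -/
theorem Lgr_iSup : ⨆ n, Lgr n = ⊤ := by
  rw [eq_top_iff]
  intro x _
  obtain ⟨⟨p, ⟨_, ν, rfl⟩⟩, hx⟩ := IsLocalization.surj euler x
  obtain ⟨u, hu⟩ := (euler_isUnit (eulerClass_mem ν)).exists_left_inv
  have hx' : x = u * algebraMap OF L p := by
    rw [← hx, mul_left_comm, hu, mul_one]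
  rw [hx']
  clear hx hx'
  have hb : Bdd fun H => 2 * (ν H : ℤ) := by
    refine (ν.finite_range.image fun k : ℕ => 2 * (k : ℤ)).subset ?_
    rintro _ ⟨H, rfl⟩
    exact ⟨ν H, ⟨H, rfl⟩, rfl⟩
  induction p using homogeneous_induction (twGr_isInternal hb) with
  | zero => simp
  | add a b ha hb => rw [map_add, mul_add]; exact add_mem ha hb
  | mem m p hp =>
    refine (le_iSup Lgr m) ⟨ν, p, ?_, fun H k h => hp H k h⟩
    rw [← mul_assoc, mul_comm _ u, hu, one_mul]

theorem Lgr_isInternal : DirectSum.IsInternal Lgr :=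
  isInternal_of_coeff (ι := FinSub × ℤ)
    (fun i => (Finsupp.applyAddHom i.2).comp
      (AddMonoidHom.mk' (fun x => (laurentAt i.1 x).coeff) fun a b => by simp))
    (fun i => -2 * i.2) (fun _ _ hx i hi => laurentAt_coeff hx i.1 i.2 hi)
    (fun x hx => laurentAt_injective fun H => LaurentPolynomial.ext fun k => hx (H, k)) Lgr_iSup

theorem algebraMap_rat_mem_Lgr (r : ℚ) : algebraMap ℚ L r ∈ Lgr 0 := by
  refine algebraMap_mem_Lgr fun H k hk => ?_
  change (C r : ℚ[X]).coeff k ≠ 0 at hk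
  rw [coeff_C] at hk
  by_contra h
  exact hk (if_neg fun e => h (by simp [e]))

theorem Lgr_smul_mem (i j : ℤ) (a : ℚ) (ha : a ∈ EvenGraded.gr (R := ℚ) i) (x : L)
    (hx : x ∈ Lgr j) : a • x ∈ Lgr (i + j) := by
  by_cases hi : i = 0
  · rw [Algebra.smul_def, hi]
    exact Lgr_mul (algebraMap_rat_mem_Lgr a) hx
  · have : a = 0 := by simpa [EvenGraded.gr, hi] using ha
    simp [this]

/-- `L ⊗ V` as a differential graded `O_F`-module. -/
@[reducible] noncomputable def extend (V : DGMod ℚ) : DGMod OF where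
  carrier := L ⊗[ℚ] V
  gr := tensorGr ℚ Lgr V.gr
  isInternal := isInternal_tensorGr (gS := EvenGraded.gr) EvenGraded.isInternal Lgr_isInternal
    V.isInternal Lgr_smul_mem V.smul_mem
  smul_mem i j a ha t ht := map_mem_of_tmul (DistribSMul.toAddMonoidHom (L ⊗[ℚ] V) a) _
    (fun k l hkl x hx y hy => by
      have : a • x ∈ Lgr (i + k) := by
        rw [Algebra.smul_def]
        exact Lgr_mul (algebraMap_mem_Lgr ha) hx
      simpa [TensorProduct.smul_tmul'] using tmul_mem_tensorGr (by rw [← hkl, add_assoc]) this hy)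
      ht
  d := extendL V.d
  d_mem n t ht := map_mem_of_tmul (extendL V.d).toAddMonoidHom _
    (fun i j hij x hx y hy => tmul_mem_tensorGr (by lia) hx (V.d_mem j y hy)) ht
  d_d t := by
    rw [← LinearMap.comp_apply]
    induction t using TensorProduct.induction_on with
    | zero => simp
    | add a b ha hb => rw [map_add, ha, hb, add_zero]
    | tmul x y => simp [V.d_d]

theorem extendL_mem {V W : DGMod ℚ} (f : V ⟶ W) (n : ℤ) (t : L ⊗[ℚ] V)
    (ht : t ∈ tensorGr ℚ Lgr V.gr n) : extendL f.toLin t ∈ tensorGr ℚ Lgr W.gr n :=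
  map_mem_of_tmul (extendL f.toLin).toAddMonoidHom _
    (fun _ _ hij _ hx y hy => tmul_mem_tensorGr hij hx (f.map_mem _ y hy)) ht

end GradedL

/-! ### Localisation expressed by torsion and fractions -/

section Criterion

variable {N V W : Type} [AddCommGroup N] [AddCommGroup V] [AddCommGroup W] [Module OF N]
  [Module ℚ V] [Module ℚ W]

theorem extendL_injective {f : V →ₗ[ℚ] W} (hf : Function.Injective f) :
    Function.Injective (extendL f) :=
  Module.Flat.lTensor_preserves_injective_linearMap (M := L) f hf

instance : Nontrivial OF :=
  (compAt ⟨⊥, inferInstance⟩).domain_nontrivial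

instance : Nontrivial L := algebraMap_OF_injective.nontrivial

/-- `L` is faithfully flat over the field `ℚ`. Together with `euler_smul_eq_zero` this lets
relations between vertex elements be verified in `L ⊗ V` after multiplication by Euler classes. -/
theorem one_tmul_injective {v : V} (h : (1 : L) ⊗ₜ[ℚ] v = 0) : v = 0 := by
  have h1 := Module.FaithfullyFlat.tensorProduct_mk_injective (A := ℚ) (B := L) V
  exact h1 (h.trans (TensorProduct.tmul_zero _ _).symm)

theorem euler_smul_of_span {β : N →ₗ[OF] L ⊗[ℚ] V}
    (h : ∀ v : V, ∃ s ∈ euler, ∃ x, β x = s • (1 : L) ⊗ₜ[ℚ] v) (y : L ⊗[ℚ] V) :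
    ∃ s ∈ euler, ∃ x, β x = s • y := by
  induction y using TensorProduct.induction_on with
  | zero => exact ⟨1, one_mem _, 0, by simp⟩
  | add a b ha hb =>
    obtain ⟨s, hs, x, hx⟩ := ha
    obtain ⟨t, ht, y, hy⟩ := hb
    exact ⟨s * t, mul_mem hs ht, t • x + s • y, by
      rw [map_add, map_smul, map_smul, hx, hy, smul_smul, smul_smul, mul_comm t s, smul_add]⟩
  | tmul a v =>
    obtain ⟨s, hs, x, hx⟩ := h v
    obtain ⟨⟨p, ⟨t, ht⟩⟩, hp⟩ := IsLocalization.surj euler a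
    refine ⟨t * s, mul_mem ht hs, p • x, ?_⟩
    have e : p • (1 : L) ⊗ₜ[ℚ] v = t • a ⊗ₜ[ℚ] v := by
      rw [TensorProduct.smul_tmul', TensorProduct.smul_tmul', Algebra.smul_def p,
        Algebra.smul_def t, mul_one, ← hp, mul_comm]
    rw [map_smul, hx, smul_smul, mul_comm p s, mul_comm t s, ← smul_smul, ← smul_smul, e]

/-- `β : N → L ⊗ V` is a localisation if and only if its kernel is torsion and every `1 ⊗ v` is
a fraction of an element of the image. -/
theorem bijective_iff (β : N →ₗ[OF] L ⊗[ℚ] V) :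
    Function.Bijective (LocalizedModule.map euler β) ↔
      (∀ x, β x = 0 → ∃ s ∈ euler, s • x = 0) ∧
        ∀ v : V, ∃ s ∈ euler, ∃ x, β x = s • (1 : L) ⊗ₜ[ℚ] v := by
  rw [bijective_map_iff]
  constructor
  · intro h
    refine ⟨fun x hx => ?_, fun v => ?_⟩
    · obtain ⟨s, hs⟩ := (IsLocalizedModule.eq_zero_iff euler β).1 hx
      exact ⟨s, s.2, hs⟩
    · obtain ⟨⟨x, s⟩, hx⟩ := IsLocalizedModule.surj euler β ((1 : L) ⊗ₜ[ℚ] v)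
      exact ⟨s, s.2, x, hx.symm⟩
  · rintro ⟨h1, h2⟩
    refine ⟨?_, ?_, ?_⟩
    · rintro ⟨s, hs⟩
      have : IsLocalizedModule euler (LinearMap.id : L ⊗[ℚ] V →ₗ[OF] L ⊗[ℚ] V) :=
        isLocalizedModule_id euler _ L
      exact IsLocalizedModule.map_units (LinearMap.id : L ⊗[ℚ] V →ₗ[OF] L ⊗[ℚ] V) ⟨s, hs⟩
    · intro y
      obtain ⟨s, hs, x, hx⟩ := euler_smul_of_span h2 y
      exact ⟨⟨x, ⟨s, hs⟩⟩, hx.symm⟩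
    · intro x y hxy
      obtain ⟨s, hs, h⟩ := h1 (x - y) (by rw [map_sub, hxy, sub_self])
      exact ⟨⟨s, hs⟩, by rwa [smul_sub, sub_eq_zero] at h⟩

end Criterion

/-! ### Submodules, quotients and direct sums of differential graded modules -/

namespace DGMod

variable {R : Type} [CommRing R] [EvenGraded R]

/-- The projection onto the part of degree `n`. -/
noncomputable def pr (M : DGMod R) (n : ℤ) : M →+ M := proj M.isInternal n

theorem hom_pr {M N : DGMod R} (f : M ⟶ N) (n : ℤ) (x : M) :
    f.toLin (M.pr n x) = N.pr n (f.toLin x) :=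
  map_proj M.isInternal N.isInternal f.toLin.toAddMonoidHom f.map_mem n x

theorem d_pr (M : DGMod R) (n : ℤ) (x : M) : M.d (M.pr n x) = M.pr (n - 1) (M.d x) :=
  map_proj_shift M.isInternal M.isInternal M.d.toAddMonoidHom (-1) M.d_mem n x

/-- A submodule that contains the homogeneous parts and the differentials of its elements. -/
structure IsSub (M : DGMod R) (p : Submodule R M) : Prop where
  pr : ∀ n, ∀ x ∈ p, M.pr n x ∈ p
  d : ∀ x ∈ p, M.d x ∈ p

theorem IsSub.isInternal {M : DGMod R} {p : Submodule R M} (hp : M.IsSub p) :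
    DirectSum.IsInternal fun n => (M.gr n).comap p.subtype.toAddMonoidHom :=
  isInternal_of_coeff (ι := ℤ) (fun n => (M.pr n).comp p.subtype.toAddMonoidHom) id
    (fun m x hx n hn => by
      by_contra h
      exact hn ((proj_of_mem M.isInternal n hx).trans (if_neg h)))
    (fun x hx => Subtype.ext (eq_zero_of_proj M.isInternal hx)) (by
      rw [eq_top_iff]
      rintro x -
      obtain ⟨s, hs⟩ := exists_sum_proj M.isInternal (x : M)
      have : x = ∑ n ∈ s, (⟨M.pr n x, hp.pr n x x.2⟩ : p) := Subtype.ext (by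
        rw [AddSubmonoidClass.coe_finsetSum]
        exact hs s subset_rfl)
      rw [this]
      exact sum_mem fun n _ =>
        (le_iSup (fun n => (M.gr n).comap p.subtype.toAddMonoidHom) n) (proj_mem M.isInternal n _))

/-- A submodule as a differential graded module. -/
@[reducible] def IsSub.toDGMod {M : DGMod R} {p : Submodule R M} (hp : M.IsSub p) : DGMod R where
  carrier := p
  gr n := (M.gr n).comap p.subtype.toAddMonoidHom
  isInternal := hp.isInternal
  smul_mem i j a ha x hx := M.smul_mem i j a ha x hx
  d := M.d.restrict hp.d
  d_mem n x hx := M.d_mem n x hx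
  d_d x := Subtype.ext (M.d_d x)

/-- The inclusion of a submodule. -/
def IsSub.incl {M : DGMod R} {p : Submodule R M} (hp : M.IsSub p) : hp.toDGMod ⟶ M where
  toLin := p.subtype
  map_mem _ _ hx := hx
  map_d _ := rfl

/-- The projection of a quotient onto the part of degree `n`. -/
noncomputable def IsSub.quotPr {M : DGMod R} {p : Submodule R M} (hp : M.IsSub p) (n : ℤ) : M ⧸ p →+ M ⧸ p :=
  QuotientAddGroup.map p.toAddSubgroup p.toAddSubgroup (M.pr n) (hp.pr n)

theorem IsSub.quotPr_mk {M : DGMod R} {p : Submodule R M} (hp : M.IsSub p) (n : ℤ) (x : M) :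
    hp.quotPr n (p.mkQ x) = p.mkQ (M.pr n x) := rfl

/-- The quotient by a submodule as a differential graded module. -/
@[reducible] noncomputable def IsSub.quot {M : DGMod R} {p : Submodule R M} (hp : M.IsSub p) : DGMod R where
  carrier := M ⧸ p
  gr n := (M.gr n).map p.mkQ.toAddMonoidHom
  isInternal := isInternal_of_coeff (ι := ℤ) hp.quotPr id
    (by
      rintro m _ ⟨x, hx, rfl⟩ n hn
      by_contra h
      refine hn ((hp.quotPr_mk n x).trans ?_)
      have : M.pr n x = 0 := (proj_of_mem M.isInternal n hx).trans (if_neg h)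
      rw [this, map_zero])
    (by
      intro y hy
      obtain ⟨x, rfl⟩ := p.mkQ_surjective y
      obtain ⟨s, hs⟩ := exists_sum_proj M.isInternal x
      rw [hs s subset_rfl, map_sum]
      exact Finset.sum_eq_zero fun n _ => hy n)
    (by
      rw [eq_top_iff]
      rintro y -
      obtain ⟨x, rfl⟩ := p.mkQ_surjective y
      obtain ⟨s, hs⟩ := exists_sum_proj M.isInternal x
      rw [hs s subset_rfl, map_sum]
      exact sum_mem fun n _ => (le_iSup (fun n => (M.gr n).map p.mkQ.toAddMonoidHom) n)
        ⟨_, proj_mem M.isInternal n x, rfl⟩)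
  smul_mem i j a ha := by
    rintro _ ⟨x, hx, rfl⟩
    exact ⟨a • x, M.smul_mem i j a ha x hx, map_smul p.mkQ a x⟩
  d := p.mapQ p M.d hp.d
  d_mem n := by
    rintro _ ⟨x, hx, rfl⟩
    exact ⟨M.d x, M.d_mem n x hx, rfl⟩
  d_d y := by
    obtain ⟨x, rfl⟩ := p.mkQ_surjective y
    change p.mkQ (M.d (M.d x)) = 0
    rw [M.d_d, map_zero]

/-- The projection to a quotient. -/
noncomputable def IsSub.proj {M : DGMod R} {p : Submodule R M} (hp : M.IsSub p) : M ⟶ hp.quot where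
  toLin := p.mkQ
  map_mem _ x hx := ⟨x, hx, rfl⟩
  map_d _ := rfl

theorem isSub_ker {M N : DGMod R} (f : M ⟶ N) : M.IsSub (LinearMap.ker f.toLin) where
  pr n x hx := by
    rw [LinearMap.mem_ker] at hx ⊢
    rw [hom_pr, hx, map_zero]
  d x hx := by
    rw [LinearMap.mem_ker] at hx ⊢
    rw [f.map_d, hx, map_zero]

theorem isSub_range {M N : DGMod R} (f : M ⟶ N) : N.IsSub (LinearMap.range f.toLin) where
  pr n x hx := by
    obtain ⟨y, rfl⟩ := hx
    exact ⟨M.pr n y, hom_pr f n y⟩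
  d x hx := by
    obtain ⟨y, rfl⟩ := hx
    exact ⟨M.d y, f.map_d y⟩

theorem isSub_iSup {M : DGMod R} {ι : Type*} {p : ι → Submodule R M} (hp : ∀ i, M.IsSub (p i)) :
    M.IsSub (⨆ i, p i) where
  pr n x hx := by
    induction hx using Submodule.iSup_induction' with
    | mem i x hx => exact (le_iSup p i) ((hp i).pr n x hx)
    | zero => simp
    | add x y _ _ hx hy => rw [map_add]; exact add_mem hx hy
  d x hx := by
    induction hx using Submodule.iSup_induction' with
    | mem i x hx => exact (le_iSup p i) ((hp i).d x hx)
    | zero => simp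
    | add x y _ _ hx hy => rw [map_add]; exact add_mem hx hy

theorem isSub_cycles (M : DGMod R) : M.IsSub (LinearMap.ker M.d) where
  pr n x hx := by
    rw [LinearMap.mem_ker] at hx ⊢
    rw [d_pr, hx, map_zero]
  d x _ := M.d_d x

/-- The factorisation of a map through a submodule that contains its image. -/
def IsSub.lift {M N : DGMod R} {p : Submodule R M} (hp : M.IsSub p) (f : N ⟶ M)
    (h : ∀ x, f.toLin x ∈ p) : N ⟶ hp.toDGMod where
  toLin := f.toLin.codRestrict p h
  map_mem n x hx := f.map_mem n x hx
  map_d x := Subtype.ext (f.map_d x)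

/-- The map out of a quotient induced by a map that vanishes on the submodule. -/
noncomputable def IsSub.desc {M N : DGMod R} {p : Submodule R M} (hp : M.IsSub p) (f : M ⟶ N)
    (h : p ≤ LinearMap.ker f.toLin) : hp.quot ⟶ N where
  toLin := p.liftQ f.toLin h
  map_mem n := by
    rintro _ ⟨x, hx, rfl⟩
    exact f.map_mem n x hx
  map_d y := by
    obtain ⟨x, rfl⟩ := p.mkQ_surjective y
    exact f.map_d x

section DirectSum

variable {ι : Type} (M : ι → DGMod R)

open scoped Classical in
/-- The direct sum. -/
@[reducible] noncomputable def dsum : DGMod R where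
  carrier := DirectSum ι fun i => M i
  gr n :=
    { carrier := {x | ∀ i, x i ∈ (M i).gr n}
      zero_mem' := fun i => zero_mem _
      add_mem' := fun hx hy i => add_mem (hx i) (hy i)
      neg_mem' := fun hx i => neg_mem (hx i) }
  isInternal := isInternal_of_coeff (ι := ℤ) (fun n => DirectSum.map fun i => (M i).pr n) id
    (fun m x hx n hn => by
      by_contra h
      refine hn (DFinsupp.ext fun i => ?_)
      rw [DirectSum.map_apply]
      exact (proj_of_mem (M i).isInternal n (hx i)).trans (if_neg h))
    (fun x hx => DFinsupp.ext fun i => eq_zero_of_proj (M i).isInternal fun n => by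
      have := DFunLike.congr_fun (hx n) i
      rwa [DirectSum.map_apply] at this)
    (by
      rw [eq_top_iff]
      rintro x -
      induction x using DirectSum.induction_on with
      | zero => exact zero_mem _
      | add x y hx hy => exact add_mem hx hy
      | of i x =>
        induction x using homogeneous_induction (M i).isInternal with
        | zero => rw [map_zero]; exact zero_mem _
        | add x y hx hy => rw [map_add]; exact add_mem hx hy
        | mem n x hx =>
          refine AddSubgroup.mem_iSup_of_mem n fun j => ?_
          by_cases h : i = j
          · subst h; rwa [DirectSum.of_eq_same]
          · rw [DirectSum.of_eq_of_ne _ _ _ (Ne.symm h)]; exact zero_mem _)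
  smul_mem i j a ha x hx k := (M k).smul_mem i j a ha _ (hx k)
  d := DirectSum.lmap fun i => (M i).d
  d_mem n x hx i := by
    rw [DirectSum.lmap_apply]
    exact (M i).d_mem n _ (hx i)
  d_d x := DFinsupp.ext fun i => by
    rw [DirectSum.lmap_apply, DirectSum.lmap_apply]
    exact (M i).d_d _

open scoped Classical in
/-- The inclusion of a summand. -/
noncomputable def dsumι (i : ι) : M i ⟶ dsum M where
  toLin := DirectSum.lof R ι (fun i => M i) i
  map_mem n x hx j := by
    by_cases h : i = j
    · subst h
      change DirectSum.of (fun i => M i) i x i ∈ _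
      rwa [DirectSum.of_eq_same]
    · change DirectSum.of (fun i => M i) i x j ∈ _
      rw [DirectSum.of_eq_of_ne _ _ _ (Ne.symm h)]
      exact zero_mem _
  map_d x := (DirectSum.lmap_lof (fun i => (M i).d) i x).symm

theorem dsum_induction {p : dsum M → Prop} (zero : p 0)
    (mem : ∀ i x, p ((dsumι M i).toLin x)) (add : ∀ x y, p x → p y → p (x + y)) (x : dsum M) :
    p x := by
  classical
  refine DirectSum.induction_on (motive := p) x zero (fun i x => ?_) add
  convert! mem i x

/-- The component at `i`. -/
def dsumComp (i : ι) : dsum M →ₗ[R] M i := DirectSum.component R ι (fun i => M i) i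

theorem dsumComp_mem {n : ℤ} {x : dsum M} (hx : x ∈ (dsum M).gr n) (i : ι) :
    dsumComp M i x ∈ (M i).gr n := hx i

theorem dsumComp_d (i : ι) (x : dsum M) : dsumComp M i ((dsum M).d x) = (M i).d (dsumComp M i x) :=
  DirectSum.lmap_apply (fun i => (M i).d) x i

theorem dsumComp_ι_self (i : ι) (x : M i) : dsumComp M i ((dsumι M i).toLin x) = x := by
  classical
  exact DirectSum.of_eq_same (β := fun i => M i) i x

theorem dsumComp_ι_ne {i j : ι} (h : i ≠ j) (x : M i) : dsumComp M j ((dsumι M i).toLin x) = 0 := by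
  classical
  exact DirectSum.of_eq_of_ne (β := fun i => M i) i j x h.symm

theorem dsum_sum (x : dsum M) : ∃ s : Finset ι, x = ∑ i ∈ s, (dsumι M i).toLin (dsumComp M i x) := by
  classical
  refine ⟨DFinsupp.support (β := fun i => M i) x, ?_⟩
  convert! (DirectSum.sum_support_of (β := fun i => M i) x).symm

open scoped Classical in
/-- The linear map out of a direct sum. -/
noncomputable def dsumLin {N : Type} [AddCommGroup N] [Module R N] (f : ∀ i, M i →ₗ[R] N) :
    dsum M →ₗ[R] N :=
  DirectSum.toModule R ι N f

theorem dsumLin_ι {N : Type} [AddCommGroup N] [Module R N] (f : ∀ i, M i →ₗ[R] N) (i : ι)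
    (x : M i) : dsumLin M f ((dsumι M i).toLin x) = f i x := by
  classical
  exact DirectSum.toModule_lof (M := fun i => M i) R i x

theorem dsumLin_mem {N : Type} [AddCommGroup N] [Module R N] (f : ∀ i, M i →ₗ[R] N) {n : ℤ}
    {K : AddSubgroup N} (h : ∀ i, ∀ x ∈ (M i).gr n, f i x ∈ K) {x : dsum M}
    (hx : x ∈ (dsum M).gr n) : dsumLin M f x ∈ K := by
  obtain ⟨s, hs⟩ := dsum_sum M x
  rw [hs, map_sum]
  refine sum_mem fun i _ => ?_
  rw [dsumLin_ι]
  exact h i _ (dsumComp_mem M hx i)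

theorem dsum_hom_ext {N : Type} [AddCommGroup N] [Module R N] {f g : dsum M →ₗ[R] N}
    (h : ∀ i x, f ((dsumι M i).toLin x) = g ((dsumι M i).toLin x)) : f = g := by
  ext x
  induction x using dsum_induction with
  | zero => rw [map_zero, map_zero]
  | add x y hx hy => rw [map_add, map_add, hx, hy]
  | mem i x => exact h i x

/-- The map out of a direct sum. -/
noncomputable def dsumDesc {N : DGMod R} (f : ∀ i, M i ⟶ N) : dsum M ⟶ N where
  toLin := dsumLin M fun i => (f i).toLin
  map_mem n _ hx := dsumLin_mem M _ (fun i x hx => (f i).map_mem n x hx) hx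
  map_d x := by
    have : (dsumLin M fun i => (f i).toLin).comp (dsum M).d
        = N.d.comp (dsumLin M fun i => (f i).toLin) := dsum_hom_ext M fun i x => by
      rw [LinearMap.comp_apply, LinearMap.comp_apply, ← (dsumι M i).map_d, dsumLin_ι, dsumLin_ι,
        (f i).map_d]
    exact DFunLike.congr_fun this x

end DirectSum

section Preadditive

variable {M N : DGMod R}

instance : Add (M ⟶ N) := ⟨fun f g => ⟨f.toLin + g.toLin,
  fun n x hx => add_mem (f.map_mem n x hx) (g.map_mem n x hx), fun x => by
    rw [LinearMap.add_apply, LinearMap.add_apply, f.map_d, g.map_d, map_add]⟩⟩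

instance : Zero (M ⟶ N) := ⟨⟨0, fun _ _ _ => zero_mem _, fun x => by simp⟩⟩

instance : Neg (M ⟶ N) := ⟨fun f => ⟨-f.toLin,
  fun n x hx => neg_mem (f.map_mem n x hx), fun x => by
    rw [LinearMap.neg_apply, LinearMap.neg_apply, f.map_d, map_neg]⟩⟩

instance : Preadditive (DGMod R) where
  homGroup M N := 
    { add_assoc := fun f g h => hom_ext (add_assoc f.toLin g.toLin h.toLin)
      zero_add := fun f => hom_ext (zero_add f.toLin)
      add_zero := fun f => hom_ext (add_zero f.toLin)
      nsmul := nsmulRec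
      zsmul := zsmulRec
      neg_add_cancel := fun f => hom_ext (neg_add_cancel f.toLin)
      add_comm := fun f g => hom_ext (add_comm f.toLin g.toLin) }
  add_comp _ _ _ f f' g := hom_ext (LinearMap.ext fun x => map_add g.toLin (f.toLin x) (f'.toLin x))
  comp_add _ _ _ _ _ _ := rfl

@[simp] theorem add_toLin (f g : M ⟶ N) : Hom.toLin (f + g) = f.toLin + g.toLin := rfl

@[simp] theorem zero_toLin : Hom.toLin (0 : M ⟶ N) = 0 := rfl

end Preadditive

end DGMod

theorem extendL_comp {U V W : Type} [AddCommGroup U] [AddCommGroup V] [AddCommGroup W]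
    [Module ℚ U] [Module ℚ V] [Module ℚ W] (g : V →ₗ[ℚ] W) (f : U →ₗ[ℚ] V) (t : L ⊗[ℚ] U) :
    extendL (g.comp f) t = extendL g (extendL f t) :=
  LinearMap.lTensor_comp_apply _ _ _ _

theorem extendL_tmul {V W : Type} [AddCommGroup V] [AddCommGroup W]
    [Module ℚ V] [Module ℚ W] (f : V →ₗ[ℚ] W) (a : L) (v : V) :
    extendL f (a ⊗ₜ v) = a ⊗ₜ f v := rfl

theorem extendL_zero {V W : Type} [AddCommGroup V] [AddCommGroup W]
    [Module ℚ V] [Module ℚ W] (t : L ⊗[ℚ] V) : extendL (0 : V →ₗ[ℚ] W) t = 0 := by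
  simp [extendL]

theorem extendL_smul_one {V W : Type} [AddCommGroup V] [AddCommGroup W]
    [Module ℚ V] [Module ℚ W] (f : V →ₗ[ℚ] W) (s : OF) (v : V) :
    extendL f (s • (1 : L) ⊗ₜ v) = s • (1 : L) ⊗ₜ f v := by
  rw [map_smul, extendL_tmul]

theorem extendL_exact {U V W : Type} [AddCommGroup U] [AddCommGroup V] [AddCommGroup W]
    [Module ℚ U] [Module ℚ V] [Module ℚ W] {f : U →ₗ[ℚ] V} {g : V →ₗ[ℚ] W}
    (h : Function.Exact f g) : Function.Exact (extendL f) (extendL g) :=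
  Module.Flat.lTensor_exact L h

/-! ### Subobjects, quotients and direct sums in `DA` -/

namespace DA

variable {A B : DA}

theorem torsion (A : DA) {x : A.nub} (h : A.β x = 0) : ∃ s ∈ euler, s • x = 0 :=
  ((bijective_iff A.β).1 A.bijective).1 x h

theorem fraction (A : DA) (v : A.vertex) : ∃ s ∈ euler, ∃ x, A.β x = s • (1 : L) ⊗ₜ[ℚ] v :=
  ((bijective_iff A.β).1 A.bijective).2 v

/-- A multiple `s • (1 ⊗ v)` is the value of `β` at some `x`. If `v` maps to zero, the image of `x`
is torsion; injectivity on nubs makes `x` torsion, and Euler classes act injectively on `L ⊗ V`. -/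
theorem vertex_injective (f : A ⟶ B) (h : Function.Injective f.nub.toLin) :
    Function.Injective f.vertex.toLin := by
  rw [injective_iff_map_eq_zero] at h ⊢
  intro v hv
  obtain ⟨s, hs, x, hx⟩ := A.fraction v
  have h1 : B.β (f.nub.toLin x) = 0 := by
    rw [f.comm, hx, extendL_smul_one, hv, TensorProduct.tmul_zero, smul_zero]
  obtain ⟨t, ht, h2⟩ := B.torsion h1
  rw [← map_smul] at h2
  have h3 := congrArg A.β (h _ h2)
  rw [map_smul, hx, map_zero] at h3
  exact one_tmul_injective (euler_smul_eq_zero hs (euler_smul_eq_zero ht h3))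

/-- It suffices that `w` dies in the quotient of the target vertex by the image. There `s • (1 ⊗ w)`
vanishes, because it lifts to the nub of the source. -/
theorem vertex_surjective (f : A ⟶ B) (h : Function.Surjective f.nub.toLin) :
    Function.Surjective f.vertex.toLin := by
  intro w
  obtain ⟨s, hs, y, hy⟩ := B.fraction w
  obtain ⟨x, rfl⟩ := h y
  have h1 : extendL (LinearMap.range f.vertex.toLin).mkQ (B.β (f.nub.toLin x)) = 0 := by
    rw [f.comm, ← extendL_comp, LinearMap.range_mkQ_comp, extendL_zero]
  rw [hy, extendL_smul_one] at h1
  have h2 := one_tmul_injective (euler_smul_eq_zero hs h1)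
  exact (Submodule.Quotient.mk_eq_zero _).1 h2

/-- Bijectivity on the nubs carries over to the vertices, and the inverse preserves degrees since
maps commute with projections. This is what makes `nubMod` reflect isomorphisms, so that exactness
can be imported from modules. -/
theorem isIso_of_bijective (f : A ⟶ B) (h : Function.Bijective f.nub.toLin) : IsIso f := by
  have hv : Function.Bijective f.vertex.toLin :=
    ⟨vertex_injective f h.1, vertex_surjective f h.2⟩
  let e := DGMod.mkIso (LinearEquiv.ofBijective f.nub.toLin h) f.nub.map_mem
    (fun n x hx => mem_of_map_mem A.nub.isInternal B.nub.isInternal f.nub.toLin.toAddMonoidHom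
      f.nub.map_mem h.1 (by
        have : f.nub.toLin ((LinearEquiv.ofBijective f.nub.toLin h).symm x) = x :=
          (LinearEquiv.ofBijective f.nub.toLin h).apply_symm_apply x
        exact Set.mem_of_eq_of_mem this hx)) f.nub.map_d
  let e' := DGMod.mkIso (LinearEquiv.ofBijective f.vertex.toLin hv) f.vertex.map_mem
    (fun n x hx => mem_of_map_mem A.vertex.isInternal B.vertex.isInternal
      f.vertex.toLin.toAddMonoidHom f.vertex.map_mem hv.1 (by
        have : f.vertex.toLin ((LinearEquiv.ofBijective f.vertex.toLin hv).symm x) = x :=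
          (LinearEquiv.ofBijective f.vertex.toLin hv).apply_symm_apply x
        exact Set.mem_of_eq_of_mem this hx)) f.vertex.map_d
  exact (mkIso e e' f.comm).isIso_hom

/-- Values of the vertex map are fractions of values of the nub map, so the functor to nubs is
faithful. -/
theorem hom_ext_nub {f g : A ⟶ B} (h : f.nub.toLin = g.nub.toLin) : f = g := by
  refine hom_ext (DGMod.hom_ext h) (DGMod.hom_ext (LinearMap.ext fun v => ?_))
  obtain ⟨s, hs, x, hx⟩ := A.fraction v
  have h1 := f.comm x
  rw [h, g.comm, hx, extendL_smul_one, extendL_smul_one] at h1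
  have h2 : s • (1 : L) ⊗ₜ[ℚ] (f.vertex.toLin v - g.vertex.toLin v) = 0 := by
    rw [TensorProduct.tmul_sub, smul_sub, sub_eq_zero]
    exact h1.symm
  exact sub_eq_zero.1 (one_tmul_injective (euler_smul_eq_zero hs h2))

section Preadditive

noncomputable instance : Add (A ⟶ B) := ⟨fun f g => ⟨f.nub + g.nub, f.vertex + g.vertex, fun x => by
  rw [DGMod.add_toLin, DGMod.add_toLin, LinearMap.add_apply, map_add, f.comm, g.comm, extendL_add]⟩⟩

noncomputable instance : Zero (A ⟶ B) := ⟨⟨0, 0, fun x => by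
  rw [DGMod.zero_toLin, DGMod.zero_toLin, LinearMap.zero_apply, map_zero, extendL_zero]⟩⟩

noncomputable instance : Neg (A ⟶ B) := ⟨fun f => ⟨-f.nub, -f.vertex, fun x => by
  change B.β (-f.nub.toLin x) = extendL (-f.vertex.toLin) (A.β x)
  rw [map_neg, f.comm, eq_comm, eq_neg_iff_add_eq_zero, ← extendL_add, neg_add_cancel,
    extendL_zero]⟩⟩

noncomputable instance : Preadditive DA where
  homGroup A B :=
    { add_assoc := fun f g h => hom_ext (add_assoc f.nub g.nub h.nub)
        (add_assoc f.vertex g.vertex h.vertex)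
      zero_add := fun f => hom_ext (zero_add f.nub) (zero_add f.vertex)
      add_zero := fun f => hom_ext (add_zero f.nub) (add_zero f.vertex)
      nsmul := nsmulRec
      zsmul := zsmulRec
      neg_add_cancel := fun f => hom_ext (neg_add_cancel f.nub) (neg_add_cancel f.vertex)
      add_comm := fun f g => hom_ext (add_comm f.nub g.nub) (add_comm f.vertex g.vertex) }
  add_comp _ _ _ f f' g := hom_ext (Preadditive.add_comp _ _ _ f.nub f'.nub g.nub)
    (Preadditive.add_comp _ _ _ f.vertex f'.vertex g.vertex)
  comp_add _ _ _ f g g' := hom_ext (Preadditive.comp_add _ _ _ f.nub g.nub g'.nub)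
    (Preadditive.comp_add _ _ _ f.vertex g.vertex g'.vertex)

end Preadditive

/-- A subobject, given by submodules of the nub and of the vertex. -/
structure Sub (A : DA) where
  nub : Submodule OF A.nub
  vertex : Submodule ℚ A.vertex
  isSub_nub : A.nub.IsSub nub
  isSub_vertex : A.vertex.IsSub vertex
  β_mem : ∀ x ∈ nub, A.β x ∈ LinearMap.range (extendL vertex.subtype)
  fraction : ∀ v ∈ vertex, ∃ s ∈ euler, ∃ x ∈ nub, A.β x = s • (1 : L) ⊗ₜ[ℚ] v

namespace Sub

variable (S : Sub A)

/-- The inclusion `L ⊗ V' → L ⊗ V` as an equivalence onto its image. -/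
noncomputable def equivRange :
    L ⊗[ℚ] S.vertex ≃ₗ[OF] LinearMap.range (extendL S.vertex.subtype) :=
  LinearEquiv.ofInjective _ (extendL_injective S.vertex.injective_subtype)

/-- The restriction of the structure map. -/
noncomputable def resβ : S.nub →ₗ[OF] L ⊗[ℚ] S.vertex :=
  S.equivRange.symm.toLinearMap.comp (A.β.restrict S.β_mem)

theorem extendL_resβ (x : S.nub) : extendL S.vertex.subtype (S.resβ x) = A.β x :=
  congrArg Subtype.val (S.equivRange.apply_symm_apply (A.β.restrict S.β_mem x))

theorem extendL_subtype_injective : Function.Injective (extendL S.vertex.subtype) :=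
  extendL_injective S.vertex.injective_subtype

/-- A subobject as an object. -/
@[reducible] noncomputable def toDA : DA where
  nub := S.isSub_nub.toDGMod
  vertex := S.isSub_vertex.toDGMod
  β := S.resβ
  β_mem n x hx := mem_of_map_mem (extend S.isSub_vertex.toDGMod).isInternal
    (extend A.vertex).isInternal (extendL S.vertex.subtype).toAddMonoidHom
    (extendL_mem S.isSub_vertex.incl) S.extendL_subtype_injective
    (Set.mem_of_eq_of_mem (S.extendL_resβ x) (A.β_mem n x hx))
  β_d x := S.extendL_subtype_injective (by
    rw [← extendL_comp, S.extendL_resβ]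
    refine (A.β_d x).trans ?_
    rw [← S.extendL_resβ x, ← extendL_comp]
    rfl)
  bijective := (bijective_iff _).2 ⟨fun x hx => by
    have h1 : A.β x = 0 := by
      rw [← S.extendL_resβ x]
      exact (congrArg _ hx).trans (map_zero _)
    obtain ⟨s, hs, h2⟩ := A.torsion h1
    exact ⟨s, hs, Subtype.ext h2⟩, fun v => by
    obtain ⟨s, hs, x, hx, h⟩ := S.fraction v v.2
    refine ⟨s, hs, ⟨x, hx⟩, S.extendL_subtype_injective ?_⟩
    rw [extendL_smul_one]
    exact (S.extendL_resβ ⟨x, hx⟩).trans h⟩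

/-- The inclusion of a subobject. -/
noncomputable def incl : S.toDA ⟶ A where
  nub := S.isSub_nub.incl
  vertex := S.isSub_vertex.incl
  comm x := (S.extendL_resβ x).symm

theorem incl_injective : Function.Injective S.incl.nub.toLin := S.nub.injective_subtype

/-- The factorisation of a map through a subobject. -/
noncomputable def lift {C : DA} (f : C ⟶ A) (h : ∀ x, f.nub.toLin x ∈ S.nub)
    (h' : ∀ x, f.vertex.toLin x ∈ S.vertex) : C ⟶ S.toDA where
  nub := S.isSub_nub.lift f.nub h
  vertex := S.isSub_vertex.lift f.vertex h'
  comm x := S.extendL_subtype_injective (by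
    rw [← extendL_comp]
    refine (S.extendL_resβ ⟨f.nub.toLin x, h x⟩).trans ?_
    exact f.comm x)

@[simp] theorem lift_incl {C : DA} (f : C ⟶ A) (h : ∀ x, f.nub.toLin x ∈ S.nub)
    (h' : ∀ x, f.vertex.toLin x ∈ S.vertex) : S.lift f h h' ≫ S.incl = f := rfl

theorem le_ker : S.nub ≤ LinearMap.ker ((extendL S.vertex.mkQ).comp A.β) := by
  intro x hx
  obtain ⟨y, hy⟩ := S.β_mem x hx
  rw [LinearMap.mem_ker, LinearMap.comp_apply, ← hy, ← extendL_comp,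
    (LinearMap.exact_subtype_mkQ S.vertex).linearMap_comp_eq_zero, extendL_zero]

/-- The quotient by a subobject. -/
@[reducible] noncomputable def quot : DA where
  nub := S.isSub_nub.quot
  vertex := S.isSub_vertex.quot
  β := S.nub.liftQ _ S.le_ker
  β_mem n := by
    rintro _ ⟨x, hx, rfl⟩
    exact extendL_mem S.isSub_vertex.proj n _ (A.β_mem n x hx)
  β_d y := by
    obtain ⟨x, rfl⟩ := S.nub.mkQ_surjective y
    change extendL S.vertex.mkQ (A.β (A.nub.d x))
      = extendL S.isSub_vertex.quot.d (extendL S.vertex.mkQ (A.β x))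
    rw [A.β_d, ← extendL_comp, ← extendL_comp]
    rfl
  bijective := (bijective_iff _).2 ⟨fun y hy => by
    obtain ⟨x, rfl⟩ := S.nub.mkQ_surjective y
    have hy' : extendL S.vertex.mkQ (A.β x) = 0 := hy
    -- By flatness `β x` comes from `L ⊗ V'`. A multiple of it is `β` of an element of the
    -- subobject, so the same multiple of `x` differs from that element by torsion.
    obtain ⟨z, hz⟩ := ((extendL_exact (LinearMap.exact_subtype_mkQ S.vertex)) _).1 hy'
    obtain ⟨s, hs, x', hx'⟩ := euler_smul_of_span S.toDA.fraction z
    have h1 : A.β (s • x - S.nub.subtype x') = 0 := by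
      rw [map_sub, map_smul, ← hz, ← map_smul, ← hx', sub_eq_zero]
      exact S.extendL_resβ x'
    obtain ⟨t, ht, h2⟩ := A.torsion h1
    refine ⟨t * s, mul_mem ht hs, ?_⟩
    rw [smul_sub, sub_eq_zero, smul_smul] at h2
    change S.nub.mkQ ((t * s) • x) = 0
    rw [h2, Submodule.mkQ_apply, Submodule.Quotient.mk_eq_zero]
    exact S.nub.smul_mem t x'.2, fun w => by
    obtain ⟨v, rfl⟩ := S.vertex.mkQ_surjective w
    obtain ⟨s, hs, x, hx⟩ := A.fraction v
    refine ⟨s, hs, S.nub.mkQ x, ?_⟩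
    change extendL S.vertex.mkQ (A.β x) = _
    rw [hx, extendL_smul_one]⟩

/-- The projection to the quotient. -/
noncomputable def proj : A ⟶ S.quot where
  nub := S.isSub_nub.proj
  vertex := S.isSub_vertex.proj
  comm _ := rfl

theorem proj_surjective : Function.Surjective S.proj.nub.toLin := S.nub.mkQ_surjective

theorem proj_eq_zero {x : A.nub} : S.proj.nub.toLin x = 0 ↔ x ∈ S.nub :=
  Submodule.Quotient.mk_eq_zero _

/-- The map out of a quotient. -/
noncomputable def desc {C : DA} (f : A ⟶ C) (h : S.nub ≤ LinearMap.ker f.nub.toLin)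
    (h' : S.vertex ≤ LinearMap.ker f.vertex.toLin) : S.quot ⟶ C where
  nub := S.isSub_nub.desc f.nub h
  vertex := S.isSub_vertex.desc f.vertex h'
  comm y := by
    obtain ⟨x, rfl⟩ := S.nub.mkQ_surjective y
    change C.β (f.nub.toLin x) = extendL (S.vertex.liftQ f.vertex.toLin h')
      (extendL S.vertex.mkQ (A.β x))
    rw [f.comm, ← extendL_comp, Submodule.liftQ_mkQ]

@[simp] theorem proj_desc {C : DA} (f : A ⟶ C) (h : S.nub ≤ LinearMap.ker f.nub.toLin)
    (h' : S.vertex ≤ LinearMap.ker f.vertex.toLin) : S.proj ≫ S.desc f h h' = f := rfl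

/-- The kernel. -/
noncomputable def ker (f : A ⟶ B) : Sub A where
  nub := LinearMap.ker f.nub.toLin
  vertex := LinearMap.ker f.vertex.toLin
  isSub_nub := DGMod.isSub_ker _
  isSub_vertex := DGMod.isSub_ker _
  β_mem x hx := by
    refine ((extendL_exact (LinearMap.exact_subtype_ker_map f.vertex.toLin)) _).1 ?_
    rw [← f.comm, hx, map_zero]
  fraction v hv := by
    obtain ⟨s, hs, x, hx⟩ := A.fraction v
    have h1 : B.β (f.nub.toLin x) = 0 := by
      rw [f.comm, hx, extendL_smul_one, hv, TensorProduct.tmul_zero, smul_zero]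
    -- The element `x` need not lie in the kernel, but its image is torsion, so a further Euler
    -- class moves it there.
    obtain ⟨t, ht, h2⟩ := B.torsion h1
    refine ⟨t * s, mul_mem ht hs, t • x, ?_, ?_⟩
    · rw [LinearMap.mem_ker, map_smul, h2]
    · rw [map_smul, hx, smul_smul]

/-- The image. -/
noncomputable def range (f : A ⟶ B) : Sub B where
  nub := LinearMap.range f.nub.toLin
  vertex := LinearMap.range f.vertex.toLin
  isSub_nub := DGMod.isSub_range _
  isSub_vertex := DGMod.isSub_range _
  β_mem := by
    rintro _ ⟨x, rfl⟩
    rw [f.comm]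
    exact ⟨extendL f.vertex.toLin.rangeRestrict (A.β x), by rw [← extendL_comp]; rfl⟩
  fraction := by
    rintro _ ⟨v, rfl⟩
    obtain ⟨s, hs, x, hx⟩ := A.fraction v
    exact ⟨s, hs, _, ⟨x, rfl⟩, by rw [f.comm, hx, extendL_smul_one]⟩

theorem range_extendL_mono {V : Type} [AddCommGroup V] [Module ℚ V] {p q : Submodule ℚ V}
    (h : p ≤ q) : LinearMap.range (extendL p.subtype) ≤ LinearMap.range (extendL q.subtype) := by
  rintro _ ⟨t, rfl⟩
  exact ⟨extendL (Submodule.inclusion h) t, by rw [← extendL_comp]; rfl⟩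

theorem fraction_add {x y : A.nub} {v w : A.vertex} {s t : OF}
    (hx : A.β x = s • (1 : L) ⊗ₜ[ℚ] v) (hy : A.β y = t • (1 : L) ⊗ₜ[ℚ] w) :
    A.β (t • x + s • y) = (s * t) • (1 : L) ⊗ₜ[ℚ] (v + w) := by
  rw [map_add, map_smul, map_smul, hx, hy, smul_smul, smul_smul, mul_comm t s, ← smul_add,
    TensorProduct.tmul_add]

/-- The supremum of a family of subobjects. -/
noncomputable def iSup {ι : Type*} (T : ι → Sub A) : Sub A where
  nub := ⨆ i, (T i).nub
  vertex := ⨆ i, (T i).vertex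
  isSub_nub := DGMod.isSub_iSup fun i => (T i).isSub_nub
  isSub_vertex := DGMod.isSub_iSup fun i => (T i).isSub_vertex
  β_mem x hx := by
    induction hx using Submodule.iSup_induction' with
    | mem i x hx => exact range_extendL_mono (le_iSup (fun i => (T i).vertex) i) ((T i).β_mem x hx)
    | zero => rw [map_zero]; exact zero_mem _
    | add x y _ _ hx hy => rw [map_add]; exact add_mem hx hy
  fraction v hv := by
    induction hv using Submodule.iSup_induction' with
    | mem i v hv =>
      obtain ⟨s, hs, x, hx, h⟩ := (T i).fraction v hv
      exact ⟨s, hs, x, (le_iSup (fun i => (T i).nub) i) hx, h⟩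
    | zero => exact ⟨1, one_mem _, 0, zero_mem _, by simp⟩
    | add v w _ _ hv hw =>
      obtain ⟨s, hs, x, hx, h⟩ := hv
      obtain ⟨t, ht, y, hy, h'⟩ := hw
      exact ⟨s * t, mul_mem hs ht, t • x + s • y, add_mem (Submodule.smul_mem _ _ hx)
        (Submodule.smul_mem _ _ hy), fraction_add h h'⟩

end Sub

section DirectSum

variable {ι : Type} (F : ι → DA)

/-- The structure map of a direct sum. -/
noncomputable def dsumβ :
    DGMod.dsum (fun i => (F i).nub) →ₗ[OF] L ⊗[ℚ] DGMod.dsum fun i => (F i).vertex :=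
  DGMod.dsumLin _ fun i => (extendL (DGMod.dsumι (fun i => (F i).vertex) i).toLin).comp (F i).β

theorem dsumβ_ι (i : ι) (x : (F i).nub) :
    dsumβ F ((DGMod.dsumι (fun i => (F i).nub) i).toLin x)
      = extendL (DGMod.dsumι (fun i => (F i).vertex) i).toLin ((F i).β x) :=
  DGMod.dsumLin_ι (fun i => (F i).nub) _ i x

theorem dsumβ_comp (i : ι) (x : DGMod.dsum fun i => (F i).nub) :
    extendL (DGMod.dsumComp (fun i => (F i).vertex) i) (dsumβ F x)
      = (F i).β (DGMod.dsumComp (fun i => (F i).nub) i x) := by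
  induction x using DGMod.dsum_induction with
  | zero => simp only [map_zero]
  | add x y hx hy => simp only [map_add, hx, hy]
  | mem j x =>
    rw [dsumβ_ι, ← extendL_comp]
    by_cases h : j = i
    · subst h
      have : (DGMod.dsumComp (fun i => (F i).vertex) j).comp
          (DGMod.dsumι (fun i => (F i).vertex) j).toLin = LinearMap.id :=
        LinearMap.ext (DGMod.dsumComp_ι_self (fun i => (F i).vertex) j)
      rw [this, extendL_id, DGMod.dsumComp_ι_self]
    · have : (DGMod.dsumComp (fun i => (F i).vertex) i).comp
          (DGMod.dsumι (fun i => (F i).vertex) j).toLin = 0 :=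
        LinearMap.ext (DGMod.dsumComp_ι_ne (fun i => (F i).vertex) h)
      rw [this, extendL_zero, DGMod.dsumComp_ι_ne _ h, map_zero]

/-- The direct sum. -/
@[reducible] noncomputable def dsum : DA where
  nub := DGMod.dsum fun i => (F i).nub
  vertex := DGMod.dsum fun i => (F i).vertex
  β := dsumβ F
  β_mem n x hx := DGMod.dsumLin_mem _ _
    (fun i x hx => extendL_mem (DGMod.dsumι (fun i => (F i).vertex) i) n _ ((F i).β_mem n x hx)) hx
  β_d x := by
    have : (dsumβ F).comp (DGMod.dsum fun i => (F i).nub).d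
        = (extendL (DGMod.dsum fun i => (F i).vertex).d).comp (dsumβ F) :=
      DGMod.dsum_hom_ext _ fun i x => by
        rw [LinearMap.comp_apply, LinearMap.comp_apply, ← (DGMod.dsumι _ i).map_d, dsumβ_ι,
          dsumβ_ι, (F i).β_d, ← extendL_comp, ← extendL_comp]
        congr 2
        exact LinearMap.ext (DGMod.dsumι (fun i => (F i).vertex) i).map_d
    exact DFunLike.congr_fun this x
  bijective := (bijective_iff _).2 ⟨fun x hx => by
    have h1 : ∀ i, ∃ s ∈ euler, s • DGMod.dsumComp (fun i => (F i).nub) i x = 0 := fun i =>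
      (F i).torsion (by rw [← dsumβ_comp, hx, map_zero])
    obtain ⟨s, hs⟩ := DGMod.dsum_sum (fun i => (F i).nub) x
    choose t ht h2 using h1
    classical
    -- Only the finitely many components in `s` matter, so the product of their annihilators is an
    -- Euler class that kills `x`.
    refine ⟨∏ i ∈ s, t i, prod_mem fun i _ => ht i, ?_⟩
    rw [hs, Finset.smul_sum]
    refine Finset.sum_eq_zero fun i hi => ?_
    rw [← map_smul, ← Finset.prod_erase_mul s t hi, mul_smul, h2, smul_zero, map_zero], fun v => by
    induction v using DGMod.dsum_induction with
    | zero => exact ⟨1, one_mem _, 0, by simp⟩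
    | add v w hv hw =>
      obtain ⟨s, hs, x, h⟩ := hv
      obtain ⟨t, ht, y, h'⟩ := hw
      refine ⟨s * t, mul_mem hs ht, t • x + s • y, ?_⟩
      rw [map_add, map_smul, map_smul, h, h', smul_smul, smul_smul, mul_comm t s, ← smul_add,
        TensorProduct.tmul_add]
    | mem i v =>
      obtain ⟨s, hs, x, hx⟩ := (F i).fraction v
      exact ⟨s, hs, (DGMod.dsumι (fun i => (F i).nub) i).toLin x, by
        rw [dsumβ_ι, hx, extendL_smul_one]⟩⟩

/-- The inclusion of a summand. -/
noncomputable def dsumι (i : ι) : F i ⟶ dsum F where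
  nub := DGMod.dsumι (fun i => (F i).nub) i
  vertex := DGMod.dsumι (fun i => (F i).vertex) i
  comm x := dsumβ_ι F i x

/-- The map out of a direct sum. -/
noncomputable def dsumDesc {C : DA} (f : ∀ i, F i ⟶ C) : dsum F ⟶ C where
  nub := DGMod.dsumDesc (fun i => (F i).nub) fun i => (f i).nub
  vertex := DGMod.dsumDesc (fun i => (F i).vertex) fun i => (f i).vertex
  comm x := by
    have : C.β.comp (DGMod.dsumDesc (fun i => (F i).nub) fun i => (f i).nub).toLin
        = (extendL (DGMod.dsumDesc (fun i => (F i).vertex) fun i => (f i).vertex).toLin).comp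
          (dsumβ F) := DGMod.dsum_hom_ext _ fun i x => by
      rw [LinearMap.comp_apply, LinearMap.comp_apply, dsumβ_ι, ← extendL_comp]
      refine (congrArg C.β (DGMod.dsumLin_ι (fun i => (F i).nub) (fun i => (f i).nub.toLin) i x)).trans (((f i).comm x).trans ?_)
      congr 2
      exact LinearMap.ext fun v => (DGMod.dsumLin_ι (fun i => (F i).vertex) (fun i => (f i).vertex.toLin) i v).symm
    exact DFunLike.congr_fun this x

@[simp] theorem dsumι_desc {C : DA} (f : ∀ i, F i ⟶ C) (i : ι) : dsumι F i ≫ dsumDesc F f = f i :=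
  hom_ext_nub (LinearMap.ext fun x =>
    DGMod.dsumLin_ι (fun i => (F i).nub) (fun i => (f i).nub.toLin) i x)

theorem dsum_hom_ext {C : DA} {f g : dsum F ⟶ C} (h : ∀ i, dsumι F i ≫ f = dsumι F i ≫ g) :
    f = g :=
  hom_ext_nub (DGMod.dsum_hom_ext _ fun i x =>
    congrArg (fun f : F i ⟶ C => f.nub.toLin x) (h i))

/-- The direct sum is the coproduct. -/
noncomputable def dsumIsColimit : IsColimit (Cofan.mk (dsum F) (dsumι F)) :=
  Cofan.IsColimit.mk _ (fun s => dsumDesc F s.inj) (fun s i => dsumι_desc F s.inj i)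
    (fun s m hm => dsum_hom_ext F fun i => (hm i).trans (dsumι_desc F s.inj i).symm)

end DirectSum

end DA

/-! ### The abelian structure, transported along `nubMod` -/

namespace DA

/-- The underlying module of the nub. -/
noncomputable def nubMod : DA ⥤ ModuleCat.{0} OF where
  obj A := ModuleCat.of OF A.nub
  map f := ModuleCat.ofHom f.nub.toLin
  map_id _ := rfl
  map_comp _ _ := rfl

instance : nubMod.Additive where
  map_add := rfl

instance : nubMod.ReflectsIsomorphisms where
  reflects f _ := isIso_of_bijective f ((ConcreteCategory.isIso_iff_bijective (nubMod.map f)).1 inferInstance)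

variable {A B : DA} (f : A ⟶ B)

theorem Sub.ker_incl_comp : (Sub.ker f).incl ≫ f = 0 :=
  hom_ext_nub (LinearMap.ext fun x => x.2)

/-- The kernel. -/
noncomputable def kerIsLimit : IsLimit (KernelFork.ofι (Sub.ker f).incl (Sub.ker_incl_comp f)) :=
  KernelFork.IsLimit.ofι _ _
    (fun g hg => (Sub.ker f).lift g
      (fun x => DFunLike.congr_fun (congrArg (fun h : _ ⟶ B => h.nub.toLin) hg) x)
      (fun x => DFunLike.congr_fun (congrArg (fun h : _ ⟶ B => h.vertex.toLin) hg) x))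
    (fun g hg => rfl)
    (fun g hg m hm => hom_ext_nub (LinearMap.ext fun x =>
      Subtype.ext (DFunLike.congr_fun (congrArg (fun h => h.nub.toLin) hm) x)))

theorem Sub.comp_range_proj : f ≫ (Sub.range f).proj = 0 :=
  hom_ext_nub (LinearMap.ext fun x => (Sub.range f).proj_eq_zero.2 ⟨x, rfl⟩)

/-- The cokernel. -/
noncomputable def cokerIsColimit :
    IsColimit (CokernelCofork.ofπ (Sub.range f).proj (Sub.comp_range_proj f)) :=
  CokernelCofork.IsColimit.ofπ _ _
    (fun g hg => (Sub.range f).desc g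
      (by
        rintro _ ⟨x, rfl⟩
        exact DFunLike.congr_fun (congrArg (fun h => h.nub.toLin) hg) x)
      (by
        rintro _ ⟨x, rfl⟩
        exact DFunLike.congr_fun (congrArg (fun h => h.vertex.toLin) hg) x))
    (fun g hg => rfl)
    (fun g hg m hm => hom_ext_nub (LinearMap.ext fun x => by
      obtain ⟨x, rfl⟩ := (Sub.range f).proj_surjective x
      exact DFunLike.congr_fun (congrArg (fun h => h.nub.toLin) hm) x))

instance : HasKernels DA := ⟨fun f => ⟨⟨_, kerIsLimit f⟩⟩⟩
instance : HasCokernels DA := ⟨fun f => ⟨⟨_, cokerIsColimit f⟩⟩⟩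

instance : PreservesLimit (parallelPair f 0) nubMod :=
  preservesLimit_of_preserves_limit_cone (kerIsLimit f)
    ((KernelFork.isLimitMapConeEquiv _ _).symm
      (ModuleCat.isLimitKernelFork (nubMod.map (Sub.ker f).incl) (nubMod.map f)
        (LinearMap.exact_subtype_ker_map f.nub.toLin) (Sub.ker f).incl_injective))

instance : PreservesColimit (parallelPair f 0) nubMod :=
  preservesColimit_of_preserves_colimit_cocone (cokerIsColimit f)
    ((CokernelCofork.isColimitMapCoconeEquiv _ _).symm
      (ModuleCat.isColimitCokernelCofork (nubMod.map f) (nubMod.map (Sub.range f).proj)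
        (LinearMap.exact_map_mkQ_range f.nub.toLin) (Sub.range f).proj_surjective))

theorem hasColimit_discrete {ι : Type} (F : Discrete ι ⥤ DA) : HasColimit F :=
  have : HasCoproduct (F.obj ∘ Discrete.mk) := ⟨⟨_, dsumIsColimit _⟩⟩
  hasColimit_of_iso Discrete.natIsoFunctor

instance : HasCoproducts.{0} DA := fun _ => ⟨hasColimit_discrete⟩

open scoped Classical in
noncomputable instance {ι : Type} : PreservesColimitsOfShape (Discrete ι) nubMod :=
  have (F : ι → DA) : PreservesColimit (Discrete.functor F) nubMod :=
    preservesColimit_of_preserves_colimit_cocone (dsumIsColimit F)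
      ((Cofan.isColimitMapCoconeEquiv _ _ _).symm
        (ModuleCat.coproductCoconeIsColimit fun i => nubMod.obj (F i)))
  preservesColimitsOfShape_of_discrete _

instance : HasFiniteCoproducts DA := hasFiniteCoproducts_of_hasCoproducts DA
instance : HasFiniteBiproducts DA := HasFiniteBiproducts.of_hasFiniteCoproducts
instance : HasBinaryBiproducts DA := hasBinaryBiproducts_of_finite_biproducts _
instance : HasEqualizers DA := Preadditive.hasEqualizers_of_hasKernels
instance : HasCoequalizers DA := Preadditive.hasCoequalizers_of_hasCokernels
instance : HasZeroObject DA := hasZeroObject_of_hasFiniteBiproducts _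

noncomputable instance : PreservesFiniteLimits nubMod :=
  Functor.preservesFiniteLimits_of_preservesKernels nubMod

noncomputable instance : PreservesColimitsOfShape WalkingParallelPair nubMod :=
  Functor.preservesCoequalizers_of_preservesCokernels nubMod

noncomputable instance : PreservesColimitsOfSize.{0, 0} nubMod :=
  preservesColimits_of_preservesCoequalizers_and_coproducts nubMod

instance : HasColimits DA := has_colimits_of_hasCoequalizers_and_coproducts

/-- `nubMod` preserves kernels and cokernels, so it sends the comparison from coimage to image to
the one for modules, which is invertible; and `nubMod` reflects isomorphisms. -/
noncomputable instance : Abelian DA :=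
  have (A B : DA) (f : A ⟶ B) : IsIso (Abelian.coimageImageComparison f) := by
    have : IsIso (nubMod.map (Abelian.coimageImageComparison f)) := by
      have e := Abelian.PreservesCoimageImageComparison.iso nubMod f
      exact ((MorphismProperty.isomorphisms _).arrow_mk_iso_iff e).2
        (MorphismProperty.isomorphisms.infer_property _)
    exact isIso_of_reflects_iso _ nubMod
  Abelian.ofCoimageImageComparisonIsIso

instance : AB5OfSize.{0, 0} DA where
  ofShape J _ _ := HasExactColimitsOfShape.domain_of_functor J nubMod

theorem mono_iff : Mono f ↔ Function.Injective f.nub.toLin := by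
  rw [← nubMod.mono_map_iff_mono, ModuleCat.mono_iff_injective]
  rfl

theorem epi_iff : Epi f ↔ Function.Surjective f.nub.toLin := by
  rw [← nubMod.epi_map_iff_epi, ModuleCat.epi_iff_surjective]
  rfl

end DA

/-! ### Dualisability and exact pairings -/

section Duality

variable {C : Type*} [Category C] [MonoidalCategory C]

/-- The canonical map `F(P, 1) ⊗ B → F(P, B)`. -/
noncomputable def comparison (P : C) [Closed P] (B : C) :
    (ihom P).obj (𝟙_ C) ⊗ B ⟶ (ihom P).obj B :=
  MonoidalClosed.curry
    ((α_ P ((ihom P).obj (𝟙_ C)) B).inv ≫ ((ihom.ev P).app (𝟙_ C)) ▷ B ≫ (λ_ B).hom)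

/-- An exact pairing makes `Q ⊗ -` right adjoint to `P ⊗ -`. For this choice of function object the
comparison is the coherence isomorphism `(Q ⊗ 1) ⊗ B ≅ Q ⊗ B`. -/
theorem exists_closed_of_exactPairing (Q P : C) [ExactPairing Q P] :
    ∃ _ : Closed P, ∀ B, IsIso (comparison P B) := by
  let c : Closed P := ⟨tensorLeft Q, tensorLeftAdjunction Q P⟩
  refine ⟨c, fun B => ?_⟩
  have h : ∀ X : C, (ihom.ev P).app X
      = (α_ P Q X).inv ≫ ExactPairing.evaluation Q P ▷ X ≫ (λ_ X).hom := fun X => by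
    change (tensorLeftHomEquiv (Q ⊗ X) Q P X).symm (𝟙 _) = _
    simp [tensorLeftHomEquiv]
  let g : (ihom P).obj (𝟙_ C) ⊗ B ⟶ (ihom P).obj B := (α_ Q (𝟙_ C) B).hom ≫ Q ◁ (λ_ B).hom
  have h1 : comparison P B = g := by
    apply MonoidalClosed.uncurry_injective
    rw [comparison, MonoidalClosed.uncurry_curry, MonoidalClosed.uncurry_eq, h, h]
    change (α_ P (Q ⊗ 𝟙_ C) B).inv ≫ ((α_ P Q (𝟙_ C)).inv ≫
      ExactPairing.evaluation Q P ▷ 𝟙_ C ≫ (λ_ (𝟙_ C)).hom) ▷ B ≫ (λ_ B).hom =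
      P ◁ ((α_ Q (𝟙_ C) B).hom ≫ Q ◁ (λ_ B).hom) ≫
      (α_ P Q B).inv ≫ ExactPairing.evaluation Q P ▷ B ≫ (λ_ B).hom
    monoidal
  rw [h1]
  change IsIso ((α_ Q (𝟙_ C) B).hom ≫ Q ◁ (λ_ B).hom)
  infer_instance

/-- The target is isomorphic to `F(P, B)`, so by adjunction two maps into it agree once they agree
after evaluation on `P`. -/
theorem eq_of_comparison {P : C} [Closed P] (h : ∀ B, IsIso (comparison P B)) {X B : C}
    {f g : X ⟶ (ihom P).obj (𝟙_ C) ⊗ B}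
    (hfg : P ◁ f ≫ (α_ _ _ _).inv ≫ ((ihom.ev P).app (𝟙_ C)) ▷ B
      = P ◁ g ≫ (α_ _ _ _).inv ≫ ((ihom.ev P).app (𝟙_ C)) ▷ B) : f = g := by
  rw [← cancel_mono (comparison P B)]
  apply MonoidalClosed.uncurry_injective
  rw [MonoidalClosed.uncurry_natural_left, MonoidalClosed.uncurry_natural_left, comparison,
    MonoidalClosed.uncurry_curry]
  simpa using! hfg =≫ (λ_ B).hom

/-- If the maps `F(P, 1) ⊗ B → F(P, B)` are isomorphisms then `F(P, 1)` is dual to `P`. -/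
noncomputable def exactPairingOfComparison (P : C) [Closed P] (h : ∀ B, IsIso (comparison P B)) :
    ExactPairing ((ihom P).obj (𝟙_ C)) P :=
  let Q := (ihom P).obj (𝟙_ C)
  let ev : P ⊗ Q ⟶ 𝟙_ C := (ihom.ev P).app (𝟙_ C)
  -- The coevaluation is the point of `F(P, 1) ⊗ P` that corresponds to the identity of `P` in `F(P,
  -- P)`.
  let coev : 𝟙_ C ⟶ Q ⊗ P := MonoidalClosed.curry (ρ_ P).hom ≫ inv (comparison P P)
  have h1 : P ◁ coev ≫ (α_ P Q P).inv ≫ ev ▷ P = (ρ_ P).hom ≫ (λ_ P).inv := by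
    have h2 : MonoidalClosed.uncurry (coev ≫ comparison P P) = (ρ_ P).hom := by
      simp only [coev, Category.assoc, IsIso.inv_hom_id, Category.comp_id,
        MonoidalClosed.uncurry_curry]
    rw [MonoidalClosed.uncurry_natural_left, comparison, MonoidalClosed.uncurry_curry] at h2
    rw [Iso.eq_comp_inv, ← h2]
    simp [ev, Q]
  { coevaluation' := coev
    evaluation' := ev
    coevaluation_evaluation' := h1
    evaluation_coevaluation' := by
      -- After evaluation, the second triangle identity follows from the first by the interchange
      -- law.
      apply eq_of_comparison h
      change P ◁ (coev ▷ Q ≫ (α_ Q P Q).hom ≫ Q ◁ ev) ≫ (α_ P Q (𝟙_ C)).inv ≫ ev ▷ 𝟙_ C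
        = P ◁ ((λ_ Q).hom ≫ (ρ_ Q).inv) ≫ (α_ P Q (𝟙_ C)).inv ≫ ev ▷ 𝟙_ C
      calc
        _ = P ◁ coev ▷ Q ⊗≫ ((P ⊗ Q) ◁ ev ≫ ev ▷ 𝟙_ C) := by monoidal
        _ = 𝟙 _ ⊗≫ (P ◁ coev ≫ (α_ P Q P).inv ≫ ev ▷ P) ▷ Q ⊗≫ 𝟙_ C ◁ ev := by
          rw [whisker_exchange]; monoidal
        _ = _ := by rw [h1]; monoidal }

end Duality

theorem isDualisable_of_exactPairing (Q P : GrA) [ExactPairing Q P] : IsDualisable P :=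
  exists_closed_of_exactPairing Q P

theorem IsDualisable.exists_exactPairing {P : GrA} (h : IsDualisable P) :
    ∃ Q : GrA, Nonempty (ExactPairing Q P) := by
  obtain ⟨_, h⟩ := h
  exact ⟨_, ⟨exactPairingOfComparison P h⟩⟩

/-- Exact pairings can be tensored, whereas the definition through function objects gives no direct
access to `P ⊗ P'`. -/
theorem IsDualisable.tensor {P P' : GrA} (h : IsDualisable P) (h' : IsDualisable P') :
    IsDualisable (P ⊗ P') := by
  obtain ⟨Q, ⟨_⟩⟩ := h.exists_exactPairing
  obtain ⟨Q', ⟨_⟩⟩ := h'.exists_exactPairing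
  exact isDualisable_of_exactPairing (Q' ⊗ Q) (P ⊗ P')

/-! ### Objects given by invertible matrices over `L` -/

/-- The module `OF` with a generator of degree `t H` at `H`. -/
@[reducible] noncomputable def tw (t : FinSub → ℤ) (ht : Bdd t) : DGMod OF where
  carrier := OF
  gr := twGr t
  isInternal := twGr_isInternal ht
  smul_mem i j a ha x hx := by
    rw [← twGr_zero] at ha
    simpa using! mul_mem_twGr ha hx
  d := 0
  d_mem _ _ _ := zero_mem _
  d_d _ := rfl

theorem Bdd.neg {t : FinSub → ℤ} (ht : Bdd t) : Bdd fun H => -t H :=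
  (ht.image fun z => -z).subset (by
    rintro _ ⟨H, rfl⟩
    exact ⟨t H, ⟨H, rfl⟩, rfl⟩)

open scoped Classical in
/-- The idempotent of the set of all `H` with `t H = z`. -/
noncomputable def indic (t : FinSub → ℤ) (z : ℤ) : OF :=
  ⟨fun H => if t H = z then 1 else 0, 0, fun H => by dsimp only; split_ifs <;> simp⟩

open scoped Classical in
theorem compAt_indic (t : FinSub → ℤ) (z : ℤ) (H : FinSub) :
    compAt H (indic t z) = if t H = z then 1 else 0 := rfl

theorem indic_mem (t : FinSub → ℤ) (z : ℤ) : indic t z ∈ twGr t z := by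
  intro H k hk
  rw [compAt_indic] at hk
  split_ifs at hk with h
  · rw [coeff_one] at hk
    have : k = 0 := by
      by_contra h0
      exact hk (if_neg h0)
    simp [this, h]
  · simp at hk

theorem indic_neg (t : FinSub → ℤ) (z : ℤ) : indic (fun H => -t H) (-z) = indic t z :=
  OF_ext fun H => by simp [compAt_indic]

theorem indic_mul_self (t : FinSub → ℤ) (z : ℤ) : indic t z * indic t z = indic t z :=
  OF_ext fun H => by simp [compAt_indic]

theorem sum_indic {t : FinSub → ℤ} (ht : Bdd t) : ∑ z ∈ ht.toFinset, indic t z = 1 :=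
  OF_ext fun H => by
    simp only [map_sum, compAt_indic, map_one, Finset.sum_ite_eq]
    rw [if_pos (ht.mem_toFinset.2 ⟨H, rfl⟩)]

/-- On the support of the idempotent the twist is the constant `z`, so there the twisted grading is
the ordinary one shifted by `z`. -/
theorem mul_indic_mem {t : FinSub → ℤ} {m : ℤ} {p : OF} (hp : p ∈ twGr t m) (z : ℤ) :
    p * indic t z ∈ EvenGraded.gr (R := OF) (m - z) := by
  rw [← twGr_zero]
  intro H k hk
  rw [map_mul, compAt_indic] at hk
  split_ifs at hk with h
  · rw [mul_one] at hk
    have := hp H k hk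
    lia
  · simp at hk

/-- A map of degree `n`, not necessarily compatible with the differentials. -/
structure GHom (n : ℤ) (P A : DA) where
  nub : P.nub →ₗ[OF] A.nub
  vertex : P.vertex →ₗ[ℚ] A.vertex
  nub_mem : ∀ m, ∀ x ∈ P.nub.gr m, nub x ∈ A.nub.gr (m + n)
  vertex_mem : ∀ m, ∀ x ∈ P.vertex.gr m, vertex x ∈ A.vertex.gr (m + n)
  comm : ∀ x, A.β (nub x) = extendL vertex (P.β x)

/-- `a` has degree `t H - n` at `H`. -/
def TwDeg (t : FinSub → ℤ) (n : ℤ) (a : L) : Prop :=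
  ∀ m, ∀ p ∈ twGr t m, algebraMap OF L p * a ∈ Lgr (m - n)

/-- The data of an object with a free nub and a finite dimensional vertex: the degrees `t j` of
the basis elements of the nub, the degrees `n i` of the basis elements of the vertex, and the
matrix `M` of the structure map, with its inverse `N`. -/
structure MatData where
  m : ℕ
  t : Fin m → FinSub → ℤ
  bdd : ∀ j, Bdd (t j)
  n : Fin m → ℤ
  M : Fin m → Fin m → L
  N : Fin m → Fin m → L
  M_mul_N : ∀ i k, ∑ j, M i j * N j k = if i = k then 1 else 0
  N_mul_M : ∀ i k, ∑ j, N i j * M j k = if i = k then 1 else 0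
  deg_M : ∀ i j, TwDeg (t j) (n i) (M i j)
  deg_N : ∀ i j, TwDeg (fun H => -t j H) (-n i) (N j i)

namespace MatData

variable (D : MatData)

/-- The dual. -/
@[reducible] def dual : MatData where
  m := D.m
  t j H := -D.t j H
  bdd j := (D.bdd j).neg
  n i := -D.n i
  M i j := D.N j i
  N i j := D.M j i
  M_mul_N i k := by simpa only [mul_comm, eq_comm] using D.M_mul_N k i
  N_mul_M i k := by simpa only [mul_comm, eq_comm] using D.N_mul_M k i
  deg_M i j := D.deg_N i j
  deg_N i j := by simpa only [neg_neg] using! D.deg_M i j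

/-- The nub. -/
noncomputable def nub : DGMod OF := DGMod.dsum fun j => tw (D.t j) (D.bdd j)

/-- The vertex. -/
noncomputable def vertex : DGMod ℚ := DGMod.dsum fun i => sphere (D.n i)

/-- The basis of the nub. -/
noncomputable def e (j : Fin D.m) : D.nub :=
  (DGMod.dsumι (fun j => tw (D.t j) (D.bdd j)) j).toLin (1 : OF)

/-- The basis of the vertex. -/
noncomputable def f (i : Fin D.m) : D.vertex :=
  (DGMod.dsumι (fun i => sphere (D.n i)) i).toLin (1 : ℚ)

/-- The coordinates of an element of the nub. -/
noncomputable def c (j : Fin D.m) : D.nub →ₗ[OF] OF :=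
  DGMod.dsumComp (fun j => tw (D.t j) (D.bdd j)) j

/-- The coordinates of an element of the vertex. -/
noncomputable def g (i : Fin D.m) : D.vertex →ₗ[ℚ] ℚ :=
  DGMod.dsumComp (fun i => sphere (D.n i)) i

theorem c_e (i j : Fin D.m) : D.c i (D.e j) = if i = j then 1 else 0 := by
  split_ifs with h
  · subst h
    exact DGMod.dsumComp_ι_self (fun j => tw (D.t j) (D.bdd j)) i 1
  · exact DGMod.dsumComp_ι_ne (fun j => tw (D.t j) (D.bdd j)) (Ne.symm h) 1

theorem g_f (i j : Fin D.m) : D.g i (D.f j) = if i = j then 1 else 0 := by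
  split_ifs with h
  · subst h
    exact DGMod.dsumComp_ι_self (fun i => sphere (D.n i)) i (1 : ℚ)
  · exact DGMod.dsumComp_ι_ne (fun i => sphere (D.n i)) (Ne.symm h) (1 : ℚ)

theorem smul_e (j : Fin D.m) (p : OF) :
    (DGMod.dsumι (fun j => tw (D.t j) (D.bdd j)) j).toLin p = p • D.e j := by
  refine Eq.trans ?_ ((DGMod.dsumι (fun j => tw (D.t j) (D.bdd j)) j).toLin.map_smul p (1 : OF))
  exact congrArg _ (mul_one p).symm

theorem smul_f (i : Fin D.m) (p : ℚ) :
    (DGMod.dsumι (fun i => sphere (D.n i)) i).toLin p = p • D.f i := by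
  refine Eq.trans ?_ ((DGMod.dsumι (fun i => sphere (D.n i)) i).toLin.map_smul p (1 : ℚ))
  exact congrArg _ (mul_one p).symm

theorem nub_ext {Z : Type} [AddCommGroup Z] [Module OF Z] {φ ψ : D.nub →ₗ[OF] Z}
    (h : ∀ j, φ (D.e j) = ψ (D.e j)) : φ = ψ :=
  have hp : ∀ j (p : OF), φ (p • D.e j) = ψ (p • D.e j) := fun j p => by
    rw [map_smul, map_smul, h]
  DGMod.dsum_hom_ext _ fun j p => (congrArg φ (D.smul_e j p)).trans
    ((hp j p).trans (congrArg ψ (D.smul_e j p)).symm)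

theorem vertex_ext {Z : Type} [AddCommGroup Z] [Module ℚ Z] {φ ψ : D.vertex →ₗ[ℚ] Z}
    (h : ∀ j, φ (D.f j) = ψ (D.f j)) : φ = ψ :=
  have hp : ∀ j (p : ℚ), φ (p • D.f j) = ψ (p • D.f j) := fun j p => by
    rw [map_smul, map_smul, h]
  DGMod.dsum_hom_ext _ fun j p => (congrArg φ (D.smul_f j p)).trans
    ((hp j p).trans (congrArg ψ (D.smul_f j p)).symm)

/-- The linear map with given values on the basis. -/
noncomputable def nubLin {Z : Type} [AddCommGroup Z] [Module OF Z] (z : Fin D.m → Z) :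
    D.nub →ₗ[OF] Z :=
  ∑ j, (LinearMap.toSpanSingleton OF Z (z j)).comp (D.c j)

theorem nubLin_apply {Z : Type} [AddCommGroup Z] [Module OF Z] (z : Fin D.m → Z) (x : D.nub) :
    D.nubLin z x = ∑ j, D.c j x • z j := by
  simp [nubLin]

theorem nubLin_e {Z : Type} [AddCommGroup Z] [Module OF Z] (z : Fin D.m → Z) (j : Fin D.m) :
    D.nubLin z (D.e j) = z j := by
  simp [nubLin_apply, c_e]

/-- The linear map with given values on the basis. -/
noncomputable def vertexLin {Z : Type} [AddCommGroup Z] [Module ℚ Z] (z : Fin D.m → Z) :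
    D.vertex →ₗ[ℚ] Z :=
  ∑ j, (LinearMap.toSpanSingleton ℚ Z (z j)).comp (D.g j)

theorem vertexLin_apply {Z : Type} [AddCommGroup Z] [Module ℚ Z] (z : Fin D.m → Z)
    (x : D.vertex) : D.vertexLin z x = ∑ j, D.g j x • z j := by
  simp [vertexLin]

theorem vertexLin_f {Z : Type} [AddCommGroup Z] [Module ℚ Z] (z : Fin D.m → Z) (j : Fin D.m) :
    D.vertexLin z (D.f j) = z j := by
  simp [vertexLin_apply, g_f]

theorem sum_c (x : D.nub) : ∑ j, D.c j x • D.e j = x := by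
  have : D.nubLin D.e = LinearMap.id := D.nub_ext fun j => D.nubLin_e _ j
  rw [← D.nubLin_apply, this, LinearMap.id_apply]

theorem sum_g (x : D.vertex) : ∑ j, D.g j x • D.f j = x := by
  have : D.vertexLin D.f = LinearMap.id := D.vertex_ext fun j => D.vertexLin_f _ j
  rw [← D.vertexLin_apply, this, LinearMap.id_apply]

theorem c_mem {n : ℤ} {x : D.nub} (hx : x ∈ D.nub.gr n) (j : Fin D.m) : D.c j x ∈ twGr (D.t j) n :=
  hx j

theorem smul_e_mem {n : ℤ} {j : Fin D.m} {p : OF} (hp : p ∈ twGr (D.t j) n) :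
    p • D.e j ∈ D.nub.gr n := by
  rw [← smul_e]
  exact (DGMod.dsumι (fun j => tw (D.t j) (D.bdd j)) j).map_mem n p hp

theorem f_mem (i : Fin D.m) : D.f i ∈ D.vertex.gr (D.n i) :=
  (DGMod.dsumι (fun i => sphere (D.n i)) i).map_mem _ (1 : ℚ) fun h => absurd rfl h

theorem vertexLin_mem {Z : Type} [AddCommGroup Z] [Module ℚ Z] {z : Fin D.m → Z} {n : ℤ}
    {K : AddSubgroup Z} (hK : ∀ q : ℚ, ∀ z ∈ K, q • z ∈ K) (h : ∀ i, D.n i = n → z i ∈ K)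
    {x : D.vertex} (hx : x ∈ D.vertex.gr n) : D.vertexLin z x ∈ K := by
  rw [vertexLin_apply]
  refine sum_mem fun i _ => ?_
  by_cases hi : D.n i = n
  · exact hK _ _ (h i hi)
  · have : D.g i x = 0 := hx i (Ne.symm hi)
    rw [this, zero_smul]
    exact zero_mem _

/-- The structure map. -/
noncomputable def β : D.nub →ₗ[OF] L ⊗[ℚ] D.vertex :=
  D.nubLin fun j => ∑ i, D.M i j ⊗ₜ[ℚ] D.f i

/-- The coordinates of an element of `L ⊗ V`. -/
noncomputable def gL (i : Fin D.m) : L ⊗[ℚ] D.vertex →ₗ[OF] L :=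
  (AlgebraTensorModule.rid ℚ OF L).toLinearMap.comp (extendL (D.g i))

theorem gL_tmul (i : Fin D.m) (a : L) (v : D.vertex) : D.gL i (a ⊗ₜ v) = D.g i v • a := rfl

theorem gL_β (i : Fin D.m) (x : D.nub) :
    D.gL i (D.β x) = ∑ j, D.M i j * algebraMap OF L (D.c j x) := by
  simp only [β, nubLin_apply, map_sum, map_smul, gL_tmul, g_f, ite_smul, one_smul, zero_smul]
  simp [Algebra.smul_def, mul_comm]

/-- Multiplying by the inverse matrix `N` recovers the coordinates of `x`, and `OF` embeds in `L`.
-/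
theorem β_torsion (x : D.nub) (hx : D.β x = 0) : x = 0 := by
  have h : ∀ i, ∑ j, D.M i j * algebraMap OF L (D.c j x) = 0 := fun i => by
    rw [← D.gL_β i x, hx, map_zero]
  rw [← D.sum_c x]
  refine Finset.sum_eq_zero fun k _ => ?_
  have h1 : ∑ i, D.N k i * ∑ j, D.M i j * algebraMap OF L (D.c j x) = algebraMap OF L (D.c k x) := by
    simp only [Finset.mul_sum, ← mul_assoc]
    rw [Finset.sum_comm]
    simp only [← Finset.sum_mul, D.N_mul_M, ite_mul, one_mul, zero_mul, Finset.sum_ite_eq,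
      Finset.mem_univ, if_true]
  simp only [h, mul_zero, Finset.sum_const_zero] at h1
  rw [algebraMap_OF_injective (h1.symm.trans (map_zero _).symm), zero_smul]

/-- The coordinates of a preimage of `1 ⊗ v` are given by `N`. A common denominator `s` of the
entries of `N` brings them into `OF`. -/
theorem β_fraction (v : D.vertex) : ∃ s ∈ euler, ∃ x, D.β x = s • (1 : L) ⊗ₜ[ℚ] v := by
  refine D.sum_g v ▸ ?_
  obtain ⟨s, hs⟩ := IsLocalization.exist_integer_multiples_of_finite euler
    (fun k : Fin D.m × Fin D.m => D.N k.1 k.2)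
  choose p hp using hs
  refine ⟨s, s.2, ∑ j, (∑ i, D.g i v • p (j, i)) • D.e j, ?_⟩
  have key : ∀ k, ∑ j, D.M k j * algebraMap OF L (∑ i, D.g i v • p (j, i))
      = D.g k v • algebraMap OF L s := fun k => by
    have h1 : ∀ j, algebraMap OF L (∑ i, D.g i v • p (j, i))
        = ∑ i, (algebraMap OF L s * D.N j i) * algebraMap ℚ L (D.g i v) := fun j => by
      rw [map_sum]
      refine Finset.sum_congr rfl fun i _ => ?_
      rw [Algebra.smul_def, map_mul, mul_comm, hp (j, i), Algebra.smul_def]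
      rfl
    have h2 : ∑ i, (∑ j, D.M k j * D.N j i) * algebraMap ℚ L (D.g i v)
        = algebraMap ℚ L (D.g k v) := by simp [D.M_mul_N]
    rw [Algebra.smul_def, ← h2]
    simp only [h1, Finset.sum_mul, Finset.mul_sum]
    rw [Finset.sum_comm]
    refine Finset.sum_congr rfl fun j _ => Finset.sum_congr rfl fun i _ => ?_
    ring
  simp only [map_sum, map_smul, β, nubLin_e, Finset.smul_sum, TensorProduct.tmul_sum]
  rw [Finset.sum_comm]
  refine Finset.sum_congr rfl fun k _ => ?_
  simp only [TensorProduct.smul_tmul', TensorProduct.tmul_smul, ← TensorProduct.sum_tmul]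
  congr 1
  simp only [Algebra.smul_def, mul_one] at key ⊢
  rw [mul_comm (algebraMap OF L s), ← key k]
  exact Finset.sum_congr rfl fun j _ => mul_comm _ _

theorem nub_d : D.nub.d = 0 := D.nub_ext fun j =>
  ((DGMod.dsumι (fun j => tw (D.t j) (D.bdd j)) j).map_d (1 : OF)).symm.trans (map_zero _)

theorem vertex_d : D.vertex.d = 0 := D.vertex_ext fun j =>
  ((DGMod.dsumι (fun i => sphere (D.n i)) j).map_d (1 : ℚ)).symm.trans (map_zero _)

/-- The object of `∂A(T)`. -/
@[reducible] noncomputable def obj : DA where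
  nub := D.nub
  vertex := D.vertex
  β := D.β
  β_mem n x hx := by
    rw [β, nubLin_apply]
    refine sum_mem fun j _ => ?_
    rw [Finset.smul_sum]
    refine sum_mem fun i _ => ?_
    rw [TensorProduct.smul_tmul', Algebra.smul_def]
    exact tmul_mem_tensorGr (sub_add_cancel n (D.n i)) (D.deg_M i j n _ (D.c_mem hx j)) (D.f_mem i)
  β_d x := by
    rw [D.nub_d, D.vertex_d, extendL_zero, LinearMap.zero_apply, map_zero]
  bijective := (bijective_iff _).2
    ⟨fun x hx => ⟨1, one_mem _, by rw [D.β_torsion x hx, smul_zero]⟩, D.β_fraction⟩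

theorem zeroDiff_obj : zeroDiff D.obj := ⟨D.nub_d, D.vertex_d⟩

/-- The object of `A(T)`. -/
noncomputable def toGrA : GrA := ⟨D.obj, D.zeroDiff_obj⟩

/-- The map out of the object given by the images of the bases. -/
noncomputable def desc {A : DA} {n : ℤ} (z : Fin D.m → A.nub) (v : Fin D.m → A.vertex)
    (hz : ∀ j m, ∀ p ∈ twGr (D.t j) m, p • z j ∈ A.nub.gr (m + n))
    (hv : ∀ i, v i ∈ A.vertex.gr (D.n i + n))
    (h : ∀ j, A.β (z j) = ∑ i, D.M i j ⊗ₜ[ℚ] v i) : GHom n D.obj A where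
  nub := D.nubLin z
  vertex := D.vertexLin v
  nub_mem m x hx := by
    rw [nubLin_apply]
    exact sum_mem fun j _ => hz j m _ (D.c_mem hx j)
  vertex_mem m x hx := D.vertexLin_mem
    (fun q z hz => by
      simpa using A.vertex.smul_mem 0 _ q (by simp [EvenGraded.gr]) z hz)
    (fun i hi => hi ▸ hv i) hx
  comm x := by
    have : A.β.comp (D.nubLin z) = (extendL (D.vertexLin v)).comp D.β := D.nub_ext fun j => by
      rw [LinearMap.comp_apply, LinearMap.comp_apply, nubLin_e, β, nubLin_e, h, map_sum]
      refine Finset.sum_congr rfl fun i _ => ?_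
      rw [extendL_tmul, vertexLin_f]
    exact DFunLike.congr_fun this x

end MatData

/-! ### Covering an arbitrary object by matrix objects -/

theorem exists_tensor_sum {V : DGMod ℚ} {n : ℤ} {t : L ⊗[ℚ] V} (ht : t ∈ tensorGr ℚ Lgr V.gr n) :
    ∃ (k : ℕ) (q : Fin k → L) (v : Fin k → V) (d : Fin k → ℤ), (∀ i, q i ∈ Lgr (n - d i)) ∧
      (∀ i, v i ∈ V.gr (d i)) ∧ t = ∑ i, q i ⊗ₜ[ℚ] v i := by
  induction ht using AddSubgroup.closure_induction with
  | mem t ht =>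
    obtain ⟨i, j, hij, x, hx, y, hy, rfl⟩ := ht
    exact ⟨1, fun _ => x, fun _ => y, fun _ => j, fun _ => by rwa [← hij, add_sub_cancel_right],
      fun _ => hy, by simp⟩
  | zero => exact ⟨0, Fin.elim0, Fin.elim0, Fin.elim0, fun i => i.elim0, fun i => i.elim0, by simp⟩
  | add s t _ _ hs ht =>
    obtain ⟨k, q, v, d, hq, hv, rfl⟩ := hs
    obtain ⟨k', q', v', d', hq', hv', rfl⟩ := ht
    refine ⟨k + k', Fin.append q q', Fin.append v v', Fin.append d d', ?_, ?_, ?_⟩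
    · intro i
      induction i using Fin.addCases with
      | left i => simpa using hq i
      | right i => simpa using hq' i
    · intro i
      induction i using Fin.addCases with
      | left i => simpa using hv i
      | right i => simpa using hv' i
    · simp [Fin.sum_univ_add]
  | neg t _ ht =>
    obtain ⟨k, q, v, d, hq, hv, rfl⟩ := ht
    exact ⟨k, fun i => -q i, v, d, fun i => neg_mem (hq i), hv, by
      simp [TensorProduct.neg_tmul]⟩

/-- The degrees of a generator `c^ν ⊗ v` with `v` of degree `d`. -/
def eulerDeg (ν : FinSub →₀ ℕ) (d : ℤ) (H : FinSub) : ℤ := d - 2 * ν H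

theorem bdd_eulerDeg (ν : FinSub →₀ ℕ) (d : ℤ) : Bdd (eulerDeg ν d) := by
  refine ((ν.support.finite_toSet.image (eulerDeg ν d)).union (Set.finite_singleton d)).subset ?_
  rintro _ ⟨H, rfl⟩
  by_cases h : H ∈ ν.support
  · exact Or.inl ⟨H, h, rfl⟩
  · right
    simp [eulerDeg, Finsupp.notMem_support_iff.1 h]

theorem twDeg_eulerClass (ν : FinSub →₀ ℕ) (d : ℤ) :
    TwDeg (eulerDeg ν d) d (algebraMap OF L (eulerClass ν)) := by
  intro m p hp
  rw [← map_mul]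
  refine algebraMap_mem_Lgr fun H k hk => ?_
  rw [map_mul, compAt_eulerClass, coeff_mul_X_pow'] at hk
  split_ifs at hk with h
  · have := hp H _ hk
    rw [eulerDeg] at this
    push_cast [h] at this
    lia
  · exact absurd rfl hk

theorem twDeg_inv_eulerClass (ν : FinSub →₀ ℕ) (d : ℤ) {u : L}
    (hu : algebraMap OF L (eulerClass ν) * u = 1) : TwDeg (fun H => -eulerDeg ν d H) (-d) u := by
  intro m p hp
  refine ⟨ν, p, by rw [mul_left_comm, hu, mul_one], fun H k hk => ?_⟩
  have : m = -(d - 2 * (ν H : ℤ)) - 2 * k := hp H k hk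
  lia

theorem TwDeg.mul {t : FinSub → ℤ} {n d : ℤ} {a b : L} (ha : TwDeg t n a) (hb : b ∈ Lgr (n - d)) :
    TwDeg t d (a * b) := by
  intro m p hp
  rw [← mul_assoc]
  have := Lgr_mul (ha m p hp) hb
  rwa [sub_add_sub_cancel] at this

theorem TwDeg.neg {t : FinSub → ℤ} {n : ℤ} {a : L} (ha : TwDeg t n a) : TwDeg t n (-a) := by
  intro m p hp
  rw [mul_neg]
  exact neg_mem (ha m p hp)

theorem twDeg_zero (t : FinSub → ℤ) (n : ℤ) : TwDeg t n 0 := by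
  intro m p hp
  rw [mul_zero]
  exact zero_mem _

namespace DA

/-- The element `c^ν ⊗ v` is not homogeneous: its degree at `H` is `d - 2 * ν H`, which takes
finitely many values `z`. A lift with the same degrees is glued from the parts of degree `z` of an
arbitrary lift, using the idempotents of the sets where the degree is `z`. -/
theorem exists_twisted (A : DA) {d : ℤ} {v : A.vertex} (hv : v ∈ A.vertex.gr d) :
    ∃ (ν : FinSub →₀ ℕ) (E : A.nub), A.β E = algebraMap OF L (eulerClass ν) ⊗ₜ[ℚ] v ∧
      ∀ m, ∀ p ∈ twGr (eulerDeg ν d) m, p • E ∈ A.nub.gr m := by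
  obtain ⟨_, ⟨ν, rfl⟩, x, hx⟩ := A.fraction v
  have hx' : A.β x = algebraMap OF L (eulerClass ν) ⊗ₜ[ℚ] v := by
    rw [hx, TensorProduct.smul_tmul', Algebra.smul_def, mul_one]
  let t := eulerDeg ν d
  have ht : Bdd t := bdd_eulerDeg ν d
  let y : ℤ → (extend A.vertex) := fun z =>
    algebraMap OF L (indic t z * eulerClass ν) ⊗ₜ[ℚ] v
  have hy : ∀ z, y z ∈ (extend A.vertex).gr z := fun z => by
    refine tmul_mem_tensorGr (sub_add_cancel z d) ?_ hv
    rw [map_mul]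
    exact twDeg_eulerClass ν d z _ (indic_mem t z)
  have hsum : A.β x = ∑ z ∈ ht.toFinset, y z := by
    refine hx'.trans ?_
    refine Eq.trans ?_ (TensorProduct.sum_tmul (R := ℚ) ht.toFinset
      (fun z => algebraMap OF L (indic t z * eulerClass ν)) v)
    rw [← map_sum, ← Finset.sum_mul, sum_indic, one_mul]
  -- The part of degree `z` of `c^ν ⊗ v` is supported where the twist equals `z`, so the idempotent
  -- fixes it; for a `z` outside the range of the twist both sides vanish.
  have hpr : ∀ z, indic t z • A.β (A.nub.pr z x) = y z := fun z => by
    have h1 : A.β (A.nub.pr z x) = (extend A.vertex).pr z (A.β x) :=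
      map_proj A.nub.isInternal (extend A.vertex).isInternal A.β.toAddMonoidHom A.β_mem z x
    have h2 : (extend A.vertex).pr z (A.β x) = if z ∈ ht.toFinset then y z else 0 := by
      rw [hsum, map_sum]
      rw [← Finset.sum_ite_eq' ht.toFinset z y]
      exact Finset.sum_congr rfl fun w _ => proj_of_mem (extend A.vertex).isInternal z (hy w)
    have h3 : indic t z • y z = y z := by
      change (indic t z • _ : L) ⊗ₜ[ℚ] v = _
      rw [Algebra.smul_def, ← map_mul, ← mul_assoc, indic_mul_self]
    have h4 : A.β (A.nub.pr z x) = if z ∈ ht.toFinset then y z else 0 := h1.trans h2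
    rw [h4]
    split_ifs with h
    · exact h3
    · rw [smul_zero]
      have : indic t z = 0 := OF_ext fun H => by
        rw [compAt_indic, if_neg, map_zero]
        intro hH
        exact h (ht.mem_toFinset.2 ⟨H, hH⟩)
      change 0 = algebraMap OF L (indic t z * eulerClass ν) ⊗ₜ[ℚ] v
      rw [this, zero_mul, map_zero, TensorProduct.zero_tmul]
  refine ⟨ν, ∑ z ∈ ht.toFinset, indic t z • A.nub.pr z x, ?_, fun m p hp => ?_⟩
  · rw [map_sum, ← hx']
    refine Eq.trans ?_ hsum.symm
    exact Finset.sum_congr rfl fun z _ => by rw [map_smul, hpr]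
  · rw [Finset.smul_sum]
    refine sum_mem fun z _ => ?_
    rw [smul_smul]
    have := A.nub.smul_mem _ _ _ (mul_indic_mem hp z) _ (proj_mem A.nub.isInternal z x)
    rwa [sub_add_cancel] at this

end DA

/-- The object with generators `E i`, for `β (E i) = c^(ν i) ⊗ v i`, and a generator `s` of
degree `n` with `β s = 1 ⊗ w + ∑ q i ⊗ v i`. -/
noncomputable def coverData {k : ℕ} (n : ℤ) (ν : Fin k → FinSub →₀ ℕ) (d : Fin k → ℤ)
    (q u : Fin k → L) (hq : ∀ i, q i ∈ Lgr (n - d i))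
    (hu : ∀ i, algebraMap OF L (eulerClass (ν i)) * u i = 1) : MatData where
  m := k + 1
  t := Fin.cons (eulerDeg 0 n) fun i => eulerDeg (ν i) (d i)
  bdd := Fin.cases (bdd_eulerDeg _ _) fun i => bdd_eulerDeg _ _
  n := Fin.cons n d
  -- The matrix is lower triangular: the first column is `1` followed by the `q i`, and the rest of
  -- the diagonal consists of Euler classes. Its inverse therefore needs only the inverses `u i`.
  M := Fin.cons (Fin.cons 1 fun _ => 0)
    fun i => Fin.cons (q i) fun j => if i = j then algebraMap OF L (eulerClass (ν i)) else 0
  N := Fin.cons (Fin.cons 1 fun _ => 0)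
    fun i => Fin.cons (-(u i * q i)) fun j => if i = j then u i else 0
  M_mul_N := by
    refine Fin.cases (Fin.cases ?_ fun k => ?_) fun i => Fin.cases ?_ fun k => ?_
    · simp [Fin.sum_univ_succ]
    · simp [Fin.sum_univ_succ, (Fin.succ_ne_zero k).symm]
    · simp [Fin.sum_univ_succ, ← mul_assoc, hu]
    · simp only [Fin.sum_univ_succ, Fin.cons_zero, Fin.cons_succ, mul_zero, zero_add, ite_mul,
        zero_mul, Finset.sum_ite_eq, Finset.sum_ite_eq', Finset.mem_univ, if_true, mul_ite, Fin.succ_inj]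
      split_ifs with h
      · rw [h, hu]
      · rfl
  N_mul_M := by
    refine Fin.cases (Fin.cases ?_ fun k => ?_) fun i => Fin.cases ?_ fun k => ?_
    · simp [Fin.sum_univ_succ]
    · simp [Fin.sum_univ_succ, (Fin.succ_ne_zero k).symm]
    · simp [Fin.sum_univ_succ]
    · simp only [Fin.sum_univ_succ, Fin.cons_zero, Fin.cons_succ, mul_zero, zero_add, ite_mul,
        zero_mul, Finset.sum_ite_eq, Finset.sum_ite_eq', Finset.mem_univ, if_true, mul_ite, Fin.succ_inj]
      split_ifs with h
      · rw [h, mul_comm, hu]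
      · rfl
  deg_M := by
    have h1 : TwDeg (eulerDeg 0 n) n 1 := by
      simpa [eulerClass_zero] using twDeg_eulerClass 0 n
    refine Fin.cases (Fin.cases h1 fun j => twDeg_zero _ _) fun i => Fin.cases ?_ fun j => ?_
    · simpa using! h1.mul (hq i)
    · change TwDeg (eulerDeg (ν j) (d j)) (d i) (if i = j then _ else 0)
      split_ifs with h
      · subst h
        exact twDeg_eulerClass _ _
      · exact twDeg_zero _ _
  deg_N := by
    have h1 : TwDeg (fun H => -eulerDeg 0 n H) (-n) 1 :=
      twDeg_inv_eulerClass 0 n (by simp [eulerClass_zero])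
    refine Fin.cases (Fin.cases h1 fun j => ?_) fun i => Fin.cases (twDeg_zero _ _) fun j => ?_
    · refine TwDeg.neg ((twDeg_inv_eulerClass (ν j) (d j) (hu j)).mul ?_)
      convert hq j using 2
      change -(d j) - -n = _
      ring
    · change TwDeg (fun H => -eulerDeg (ν j) (d j) H) (-d i) (if j = i then u j else 0)
      split_ifs with h
      · subst h
        exact twDeg_inv_eulerClass _ _ (hu j)
      · exact twDeg_zero _ _

/-- Write `β x = ∑ q i ⊗ v i` with homogeneous `v i`, lift `c^(ν i) ⊗ v i` to elements `E i`, and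
send one more generator to `x`. The matrix becomes square and invertible by adding a vertex
generator for `x`, which is sent to `0`. -/
theorem DA.exists_cover (A : DA) {n : ℤ} {x : A.nub} (hx : x ∈ A.nub.gr n) :
    ∃ (D : MatData) (φ : GHom 0 D.obj A) (e : D.nub), φ.nub e = x := by
  obtain ⟨k, q, v, d, hq, hv, hs⟩ := exists_tensor_sum (A.β_mem n x hx)
  choose ν E hE hE' using fun i => A.exists_twisted (hv i)
  choose u hu using fun i => (euler_isUnit (eulerClass_mem (ν i))).exists_right_inv
  let D := coverData n ν d q u hq hu
  let z : Fin D.m → A.nub := Fin.cons x E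
  let w : Fin D.m → A.vertex := Fin.cons 0 v
  refine ⟨D, D.desc z w ?_ ?_ ?_, D.e (0 : Fin (k + 1)), D.nubLin_e z (0 : Fin (k + 1))⟩
  · refine Fin.cases (fun m p hp => ?_) fun i m p hp => ?_
    · change p • x ∈ _
      have h1 : p ∈ EvenGraded.gr (R := OF) (m - n) := by
        rw [← twGr_zero]
        intro H l hl
        have : m = eulerDeg 0 n H - 2 * l := hp H l hl
        simp [eulerDeg] at this
        lia
      simpa using A.nub.smul_mem _ _ p h1 x hx
    · rw [add_zero]
      exact hE' i m p hp
  · refine Fin.cases (zero_mem _) fun i => ?_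
    rw [add_zero]
    exact hv i
  · refine Fin.cases ?_ fun j => ?_
    · refine hs.trans (Eq.trans ?_ (Fin.sum_univ_succ _).symm)
      change _ = (1 : L) ⊗ₜ[ℚ] (0 : A.vertex) + ∑ i, q i ⊗ₜ[ℚ] v i
      rw [TensorProduct.tmul_zero, zero_add]
    · refine (hE j).trans (Eq.trans ?_ (Fin.sum_univ_succ _).symm)
      change _ = (0 : L) ⊗ₜ[ℚ] (0 : A.vertex)
        + ∑ i, (if i = j then algebraMap OF L (eulerClass (ν i)) else 0) ⊗ₜ[ℚ] v i
      rw [TensorProduct.tmul_zero, zero_add, Finset.sum_eq_single j, if_pos rfl]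
      · intro i _ hi
        rw [if_neg hi, TensorProduct.zero_tmul]
      · simp

/-! ### Matrix objects are dualisable -/

namespace MatData

open DA

variable (D : MatData)

theorem indic_smul_e_mem (j : Fin D.m) (z : ℤ) : indic (D.t j) z • D.e j ∈ D.nub.gr z :=
  D.smul_e_mem (indic_mem _ _)

/-- Neither factor need be homogeneous. The idempotents of the level sets of the twist split the
tensor into pieces whose factors have degrees `z` and `-z`. -/
theorem e_tmul_e_dual_mem (j : Fin D.m) :
    D.e j ⊗ₜ[OF] D.dual.e j ∈ tensorGr OF D.nub.gr D.dual.nub.gr 0 := by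
  have : D.e j ⊗ₜ[OF] D.dual.e j = ∑ z ∈ (D.bdd j).toFinset,
      (indic (D.t j) z • D.e j) ⊗ₜ[OF] (indic (D.dual.t j) (-z) • D.dual.e j) := by
    have h : ∀ z, (indic (D.t j) z • D.e j) ⊗ₜ[OF] (indic (D.dual.t j) (-z) • D.dual.e j)
        = indic (D.t j) z • (D.e j ⊗ₜ[OF] D.dual.e j) := fun z => by
      rw [show indic (D.dual.t j) (-z) = indic (D.t j) z from indic_neg _ _,
        TensorProduct.tmul_smul, ← TensorProduct.smul_tmul', smul_smul, indic_mul_self]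
    rw [Finset.sum_congr rfl fun z _ => h z, ← Finset.sum_smul, sum_indic, one_smul]
  rw [this]
  exact sum_mem fun z _ => tmul_mem_tensorGr (add_neg_cancel z) (D.indic_smul_e_mem j z)
    (D.dual.indic_smul_e_mem j (-z))

/-- The coevaluation. -/
noncomputable def coev : 𝟙_ DA ⟶ D.obj ⊗ D.dual.obj where
  nub :=
    { toLin := LinearMap.toSpanSingleton OF (D.nub ⊗[OF] D.dual.nub)
        (∑ j, D.e j ⊗ₜ[OF] D.dual.e j)
      map_mem := fun n p hp => by
        have h : ∑ j, D.e j ⊗ₜ[OF] D.dual.e j ∈ (D.nub.tensor D.dual.nub).gr 0 :=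
          sum_mem fun j _ => D.e_tmul_e_dual_mem j
        have := (D.nub.tensor D.dual.nub).smul_mem n 0 p hp _ h
        rwa [add_zero] at this
      map_d := fun p => by
        refine (map_zero _).trans ?_
        change _ = DGMod.tensorD D.nub D.dual.nub _
        exact (DFunLike.congr_fun (tensorD_zero D.nub_d D.dual.nub_d) _).symm }
  vertex :=
    { toLin := LinearMap.toSpanSingleton ℚ (D.vertex ⊗[ℚ] D.dual.vertex)
        (∑ j, D.f j ⊗ₜ[ℚ] D.dual.f j)
      map_mem := fun n p hp => by
        have h : ∑ j, D.f j ⊗ₜ[ℚ] D.dual.f j ∈ (D.vertex.tensor D.dual.vertex).gr 0 :=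
          sum_mem fun j _ => tmul_mem_tensorGr (add_neg_cancel (D.n j)) (D.f_mem j)
            (D.dual.f_mem j)
        have := (D.vertex.tensor D.dual.vertex).smul_mem n 0 p hp _ h
        rwa [add_zero] at this
      map_d := fun p => by
        refine (map_zero _).trans ?_
        change _ = DGMod.tensorD D.vertex D.dual.vertex _
        exact (DFunLike.congr_fun (tensorD_zero D.vertex_d D.dual.vertex_d) _).symm }
  comm := fun (p : OF) => by
    -- The coefficient at `f i ⊗ f k` is the entry of `M * N`, so only the diagonal survives.
    have key : tensorβ D.obj D.dual.obj (∑ j, D.e j ⊗ₜ[OF] D.dual.e j)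
        = (1 : L) ⊗ₜ[ℚ] (∑ j, D.f j ⊗ₜ[ℚ] D.dual.f j) := by
      have h1 : ∀ j, D.β (D.e j) = ∑ i, D.M i j ⊗ₜ[ℚ] D.f i := fun j => D.nubLin_e _ j
      have h2 : ∀ j, D.dual.β (D.dual.e j) = ∑ i, D.N j i ⊗ₜ[ℚ] D.dual.f i := fun j =>
        D.dual.nubLin_e _ j
      have h3 : ∀ j, tensorβ D.obj D.dual.obj (D.e j ⊗ₜ[OF] D.dual.e j)
          = ∑ i, ∑ k, (D.M i j * D.N j k) ⊗ₜ[ℚ] (D.f i ⊗ₜ[ℚ] D.dual.f k) := fun j => by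
        refine (congrArg (combine D.vertex D.dual.vertex)
          (congrArg₂ (fun x y => x ⊗ₜ[OF] y) (h1 j) (h2 j))).trans ?_
        simp only [TensorProduct.sum_tmul, TensorProduct.tmul_sum, map_sum, combine_tmul]
        exact Finset.sum_comm
      rw [map_sum, Finset.sum_congr rfl fun j _ => h3 j, Finset.sum_comm, TensorProduct.tmul_sum]
      refine Finset.sum_congr rfl fun i _ => ?_
      rw [Finset.sum_comm]
      simp only [← TensorProduct.sum_tmul, D.M_mul_N]
      rw [Finset.sum_eq_single i, if_pos rfl]
      · intro k _ hk
        rw [if_neg (Ne.symm hk), TensorProduct.zero_tmul]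
      · simp
    change tensorβ D.obj D.dual.obj (p • ∑ j, D.e j ⊗ₜ[OF] D.dual.e j)
      = extendL (LinearMap.toSpanSingleton ℚ _ (∑ j, D.f j ⊗ₜ[ℚ] D.dual.f j)) (unitβ p)
    rw [map_smul, key, unitβ_apply, extendL_tmul, LinearMap.toSpanSingleton_apply, one_smul,
      TensorProduct.smul_tmul', Algebra.smul_def, mul_one]

/-- The evaluation on the nubs. -/
noncomputable def evNub : D.dual.nub ⊗[OF] D.nub →ₗ[OF] OF :=
  TensorProduct.lift (D.dual.nubLin fun j => D.c j)

theorem evNub_tmul (x : D.dual.nub) (y : D.nub) :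
    D.evNub (x ⊗ₜ[OF] y) = ∑ j, D.dual.c j x * D.c j y := by
  rw [evNub, TensorProduct.lift.tmul, nubLin_apply, LinearMap.sum_apply]
  rfl

/-- The evaluation on the vertices. -/
noncomputable def evVertex : D.dual.vertex ⊗[ℚ] D.vertex →ₗ[ℚ] ℚ :=
  TensorProduct.lift (D.dual.vertexLin fun j => D.g j)

theorem evVertex_tmul (x : D.dual.vertex) (y : D.vertex) :
    D.evVertex (x ⊗ₜ[ℚ] y) = ∑ j, D.dual.g j x * D.g j y := by
  rw [evVertex, TensorProduct.lift.tmul, vertexLin_apply, LinearMap.sum_apply]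
  rfl

theorem evNub_mem {n : ℤ} {t : D.dual.nub ⊗[OF] D.nub}
    (ht : t ∈ tensorGr OF D.dual.nub.gr D.nub.gr n) : D.evNub t ∈ EvenGraded.gr (R := OF) n :=
  map_mem_of_tmul D.evNub.toAddMonoidHom _ (fun i k hik x hx y hy => by
    change D.evNub (x ⊗ₜ[OF] y) ∈ _
    rw [evNub_tmul]
    refine sum_mem fun j _ => ?_
    have := mul_mem_twGr (D.dual.c_mem hx j) (D.c_mem hy j)
    rw [← twGr_zero, ← hik]
    convert this using 2
    exact (neg_add_cancel _).symm) ht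

theorem evVertex_mem {n : ℤ} {t : D.dual.vertex ⊗[ℚ] D.vertex}
    (ht : t ∈ tensorGr ℚ D.dual.vertex.gr D.vertex.gr n) :
    D.evVertex t ∈ EvenGraded.gr (R := ℚ) n :=
  map_mem_of_tmul D.evVertex.toAddMonoidHom _ (fun i k hik x hx y hy => by
    change D.evVertex (x ⊗ₜ[ℚ] y) ∈ _
    rw [evVertex_tmul]
    refine sum_mem fun j _ => ?_
    change D.dual.g j x * D.g j y ∈ if n = 0 then (⊤ : AddSubgroup ℚ) else ⊥
    split_ifs with h
    · trivial
    · rw [AddSubgroup.mem_bot]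
      by_cases h1 : k = D.n j
      · have h2 : D.dual.g j x = 0 := hx j fun h3 => h (by
          have : i = - D.n j := h3
          lia)
        rw [h2, zero_mul]
      · have h2 : D.g j y = 0 := hy j h1
        rw [h2, mul_zero]) ht

/-- On a pair of basis elements the right side is an entry of `N * M = 1`, which matches the pairing
of the dual bases. -/
theorem ev_comm : unitβ.comp D.evNub = (extendL D.evVertex).comp (tensorβ D.dual.obj D.obj) := by
  refine TensorProduct.ext (D.dual.nub_ext fun j => D.nub_ext fun k => ?_)
  change unitβ (D.evNub (D.dual.e j ⊗ₜ[OF] D.e k))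
    = extendL D.evVertex
      (combine D.dual.vertex D.vertex (D.dual.β (D.dual.e j) ⊗ₜ[OF] D.β (D.e k)))
  have h1 : D.β (D.e k) = ∑ i, D.M i k ⊗ₜ[ℚ] D.f i := D.nubLin_e _ k
  have h2 : D.dual.β (D.dual.e j) = ∑ i, D.N j i ⊗ₜ[ℚ] D.dual.f i := D.dual.nubLin_e _ j
  have h3 : D.evNub (D.dual.e j ⊗ₜ[OF] D.e k) = if j = k then 1 else 0 := by
    rw [evNub_tmul, Finset.sum_eq_single j]
    · rw [c_e, c_e, if_pos rfl, one_mul]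
    · intro l _ hl
      rw [c_e, if_neg hl, zero_mul]
    · simp
  have h4 : ∀ i l, D.evVertex (D.dual.f i ⊗ₜ[ℚ] D.f l) = if i = l then 1 else 0 := fun i l => by
    rw [evVertex_tmul, Finset.sum_eq_single i]
    · rw [g_f, g_f, if_pos rfl, one_mul]
    · intro l _ hl
      rw [g_f, if_neg hl, zero_mul]
    · simp
  rw [h1, h2, h3, unitβ_apply]
  simp only [TensorProduct.sum_tmul, TensorProduct.tmul_sum, map_sum, combine_tmul,
    extendL_tmul, h4]
  have h5 : ∀ i : Fin D.m, ∑ l : Fin D.m, (D.N j i * D.M l k) ⊗ₜ[ℚ] (if i = l then (1 : ℚ) else 0)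
      = (D.N j i * D.M i k) ⊗ₜ[ℚ] (1 : ℚ) := fun i => by
    rw [Finset.sum_eq_single i, if_pos rfl]
    · intro l _ hl
      rw [if_neg (Ne.symm hl), TensorProduct.tmul_zero]
    · simp
  rw [Finset.sum_comm]
  refine Eq.trans ?_ (Finset.sum_congr rfl fun i _ => (h5 i).symm)
  rw [← TensorProduct.sum_tmul, D.N_mul_M]
  split_ifs <;> simp

/-- The evaluation. -/
noncomputable def ev : D.dual.obj ⊗ D.obj ⟶ 𝟙_ DA where
  nub :=
    { toLin := D.evNub
      map_mem := fun n t ht => D.evNub_mem ht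
      map_d := fun t => (congrArg D.evNub (DFunLike.congr_fun
        (tensorD_zero D.dual.nub_d D.nub_d) t)).trans (map_zero _) }
  vertex :=
    { toLin := D.evVertex
      map_mem := fun n t ht => D.evVertex_mem ht
      map_d := fun t => (congrArg D.evVertex (DFunLike.congr_fun
        (tensorD_zero D.dual.vertex_d D.vertex_d) t)).trans (map_zero _) }
  comm t := DFunLike.congr_fun D.ev_comm t

theorem coev_ev : D.dual.obj ◁ D.coev ≫ (α_ _ _ _).inv ≫ D.ev ▷ D.dual.obj
    = (ρ_ D.dual.obj).hom ≫ (λ_ D.dual.obj).inv := by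
  refine DA.hom_ext_nub (TensorProduct.ext' fun x (p : OF) => ?_)
  change (TensorProduct.map D.evNub LinearMap.id)
      ((TensorProduct.assoc OF D.dual.nub D.nub D.dual.nub).symm
        (x ⊗ₜ[OF] (p • ∑ j, D.e j ⊗ₜ[OF] D.dual.e j)))
    = (1 : OF) ⊗ₜ[OF] (p • x)
  simp only [TensorProduct.tmul_smul, TensorProduct.tmul_sum, map_sum, map_smul,
    TensorProduct.assoc_symm_tmul, TensorProduct.map_tmul, LinearMap.id_apply]
  congr 1
  have h : ∀ j, D.evNub (x ⊗ₜ[OF] D.e j) = D.dual.c j x := fun j => by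
    rw [evNub_tmul, Finset.sum_eq_single j]
    · rw [c_e, if_pos rfl, mul_one]
    · intro l _ hl
      rw [c_e, if_neg hl, mul_zero]
    · simp
  simp only [h]
  conv_rhs => rw [← D.dual.sum_c x, TensorProduct.tmul_sum]
  refine Finset.sum_congr rfl fun j _ => ?_
  rw [TensorProduct.tmul_smul, TensorProduct.smul_tmul', smul_eq_mul, mul_one]

theorem ev_coev : D.coev ▷ D.obj ≫ (α_ _ _ _).hom ≫ D.obj ◁ D.ev
    = (λ_ D.obj).hom ≫ (ρ_ D.obj).inv := by
  refine DA.hom_ext_nub (TensorProduct.ext' fun (p : OF) x => ?_)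
  change (TensorProduct.map LinearMap.id D.evNub)
      (TensorProduct.assoc OF D.nub D.dual.nub D.nub
        ((p • ∑ j, D.e j ⊗ₜ[OF] D.dual.e j) ⊗ₜ[OF] x))
    = (p • x) ⊗ₜ[OF] (1 : OF)
  have h : ∀ j, D.evNub (D.dual.e j ⊗ₜ[OF] x) = D.c j x := fun j => by
    rw [evNub_tmul, Finset.sum_eq_single j]
    · rw [c_e, if_pos rfl, one_mul]
    · intro l _ hl
      rw [c_e, if_neg hl, zero_mul]
    · simp
  rw [← TensorProduct.smul_tmul', ← TensorProduct.smul_tmul', map_smul, map_smul,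
    TensorProduct.sum_tmul]
  simp only [map_sum, TensorProduct.assoc_tmul, TensorProduct.map_tmul,
    LinearMap.id_apply, h]
  congr 1
  conv_rhs => rw [← D.sum_c x, TensorProduct.sum_tmul]
  refine Finset.sum_congr rfl fun j _ => ?_
  rw [← TensorProduct.smul_tmul', ← TensorProduct.tmul_smul, smul_eq_mul, mul_one]

/-- The duality maps connect objects with zero differential, so the pairing descends to the full
subcategory. It has `D` in the first place; the symmetry exchanges the two objects. -/
theorem isDualisable : IsDualisable D.toGrA := by
  have : ExactPairing (zeroDiff.ι.obj D.toGrA) (zeroDiff.ι.obj D.dual.toGrA) :=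
    { coevaluation' := D.coev
      evaluation' := D.ev
      coevaluation_evaluation' := D.coev_ev
      evaluation_coevaluation' := D.ev_coev }
  have : ExactPairing D.toGrA D.dual.toGrA :=
    { coevaluation' := ObjectProperty.homMk D.coev
      evaluation' := ObjectProperty.homMk D.ev
      coevaluation_evaluation' := ObjectProperty.hom_ext _ D.coev_ev
      evaluation_coevaluation' := ObjectProperty.hom_ext _ D.ev_coev }
  have := BraidedCategory.exactPairing_swap D.toGrA D.dual.toGrA
  exact isDualisable_of_exactPairing D.dual.toGrA D.toGrA

end MatData

/-! ### Disks and spheres, and the maps out of them -/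

section

variable {R : Type} [CommRing R] [EvenGraded R]

/-- A basis `u`, `v = du` with `u` in degree `n`. -/
structure DiskBasis (n : ℤ) (M : DGMod R) where
  u : M
  v : M
  e₁ : M →ₗ[R] R
  e₂ : M →ₗ[R] R
  e₁_u : e₁ u = 1
  e₁_v : e₁ v = 0
  e₂_u : e₂ u = 0
  e₂_v : e₂ v = 1
  rep : ∀ x, x = e₁ x • u + e₂ x • v
  u_mem : u ∈ M.gr n
  e₁_mem : ∀ m, ∀ x ∈ M.gr m, e₁ x ∈ EvenGraded.gr (R := R) (m - n)
  e₂_mem : ∀ m, ∀ x ∈ M.gr m, e₂ x ∈ EvenGraded.gr (R := R) (m - n + 1)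
  d_u : M.d u = v

/-- A basis `w` in degree `n`, with `dw = 0`. -/
structure SphereBasis (n : ℤ) (M : DGMod R) where
  w : M
  e : M →ₗ[R] R
  e_w : e w = 1
  rep : ∀ x, x = e x • w
  w_mem : w ∈ M.gr n
  e_mem : ∀ m, ∀ x ∈ M.gr m, e x ∈ EvenGraded.gr (R := R) (m - n)
  d_w : M.d w = 0

namespace DiskBasis

variable {n : ℤ} {M : DGMod R} (b : DiskBasis n M) {N Z : Type} [AddCommGroup N] [Module R N]
  [AddCommGroup Z] [Module R Z]

theorem d_v : M.d b.v = 0 := by rw [← b.d_u, M.d_d]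

/-- The map with `u ⊗ x ↦ φ x` and `v ⊗ x ↦ ψ x`. -/
noncomputable def lin (φ ψ : N →ₗ[R] Z) : M ⊗[R] N →ₗ[R] Z :=
  TensorProduct.lift ((LinearMap.toSpanSingleton R (N →ₗ[R] Z) φ).comp b.e₁
    + (LinearMap.toSpanSingleton R (N →ₗ[R] Z) ψ).comp b.e₂)

theorem lin_tmul (φ ψ : N →ₗ[R] Z) (y : M) (x : N) :
    b.lin φ ψ (y ⊗ₜ[R] x) = b.e₁ y • φ x + b.e₂ y • ψ x := rfl

@[simp] theorem lin_u (φ ψ : N →ₗ[R] Z) (x : N) : b.lin φ ψ (b.u ⊗ₜ[R] x) = φ x := by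
  rw [lin_tmul, b.e₁_u, b.e₂_u, one_smul, zero_smul, add_zero]

@[simp] theorem lin_v (φ ψ : N →ₗ[R] Z) (x : N) : b.lin φ ψ (b.v ⊗ₜ[R] x) = ψ x := by
  rw [lin_tmul, b.e₁_v, b.e₂_v, one_smul, zero_smul, zero_add]

theorem ext {f g : M ⊗[R] N →ₗ[R] Z} (hu : ∀ x, f (b.u ⊗ₜ[R] x) = g (b.u ⊗ₜ[R] x))
    (hv : ∀ x, f (b.v ⊗ₜ[R] x) = g (b.v ⊗ₜ[R] x)) : f = g :=
  TensorProduct.ext' fun y x => by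
    rw [b.rep y, TensorProduct.add_tmul, map_add, map_add, ← TensorProduct.smul_tmul',
      ← TensorProduct.smul_tmul', map_smul, map_smul, map_smul, map_smul, hu, hv]

theorem tensor_rep (t : M ⊗[R] N) : t = b.u ⊗ₜ[R] b.lin (LinearMap.id : N →ₗ[R] N) 0 t
    + b.v ⊗ₜ[R] b.lin 0 (LinearMap.id : N →ₗ[R] N) t := by
  have : LinearMap.id = (TensorProduct.mk R M N b.u).comp (b.lin LinearMap.id 0)
      + (TensorProduct.mk R M N b.v).comp (b.lin 0 LinearMap.id) :=
    b.ext (fun x => by simp) (fun x => by simp)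
  exact DFunLike.congr_fun this t

theorem flat {n : ℤ} {M : DGMod R} (b : DiskBasis n M) : Module.Flat R M := by
  let e : M ≃ₗ[R] R × R := LinearEquiv.ofLinearMap (b.e₁.prod b.e₂)
    ((LinearMap.toSpanSingleton R M b.u).coprod (LinearMap.toSpanSingleton R M b.v))
    (by ext <;> simp [b.e₁_u, b.e₂_u, b.e₁_v, b.e₂_v])
    (LinearMap.ext fun x => (b.rep x).symm)
  exact Module.Flat.of_linearEquiv e

theorem lin_mem {N Z : DGMod R} (φ : N →ₗ[R] Z) (hφ : ∀ m, ∀ x ∈ N.gr m, φ x ∈ Z.gr (m + n))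
    (ψ : N →ₗ[R] Z) (hψ : ∀ m, ∀ x ∈ N.gr m, ψ x ∈ Z.gr (m + (n - 1))) {m : ℤ} {t : M ⊗[R] N}
    (ht : t ∈ tensorGr R M.gr N.gr m) : b.lin φ ψ t ∈ Z.gr m :=
  map_mem_of_tmul (b.lin φ ψ).toAddMonoidHom _ (fun i j hij y hy x hx => by
    change b.lin φ ψ (y ⊗ₜ[R] x) ∈ _
    rw [lin_tmul]
    have h1 := Z.smul_mem _ _ _ (b.e₁_mem i y hy) _ (hφ j x hx)
    have h2 := Z.smul_mem _ _ _ (b.e₂_mem i y hy) _ (hψ j x hx)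
    rw [show i - n + (j + n) = m by lia] at h1
    rw [show i - n + 1 + (j + (n - 1)) = m by lia] at h2
    exact add_mem h1 h2) ht

theorem sign_u : M.sign b.u = if Even n then b.u else -b.u := M.sign_of_mem b.u_mem

theorem v_mem : b.v ∈ M.gr (n - 1) := b.d_u ▸ M.d_mem n _ b.u_mem

theorem sign_v : M.sign b.v = if Even n then -b.v else b.v := by
  rw [M.sign_of_mem b.v_mem]
  by_cases h : Even n <;> simp [h, Int.even_sub_one]

/-- The disk is contractible. Write `t = u ⊗ p + v ⊗ q`; for a cycle, the coefficient at `v` of the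
boundary forces `p` to be `d q` up to sign, and then `t` is the boundary of `u ⊗ q` up to the same
sign. -/
theorem exact {n : ℤ} {M : DGMod R} (b : DiskBasis n M) (N : DGMod R) (t : M ⊗[R] N) (ht : DGMod.tensorD M N t = 0) :
    ∃ s, DGMod.tensorD M N s = t := by
  let p := b.lin (LinearMap.id : N →ₗ[R] N) 0
  let q := b.lin 0 (LinearMap.id : N →ₗ[R] N)
  -- This is the sign `(-1)^n` from moving `d` past the generator `u` of degree `n`.
  let ε : N →ₗ[R] N := if Even n then LinearMap.id else -LinearMap.id
  have h1 : q.comp (DGMod.tensorD M N) = p - ε.comp (N.d.comp q) := b.ext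
    (fun x => by
      by_cases h : Even n <;>
        simp [p, q, ε, h, DGMod.tensorD_tmul, b.d_u, sign_u, TensorProduct.neg_tmul])
    (fun x => by
      by_cases h : Even n <;>
        simp [p, q, ε, h, DGMod.tensorD_tmul, b.d_v, sign_v, TensorProduct.neg_tmul])
  have h2 : p t = ε (N.d (q t)) := by
    have := DFunLike.congr_fun h1 t
    rw [LinearMap.comp_apply, ht, map_zero] at this
    exact (sub_eq_zero.1 this.symm)
  -- No sign correction is needed: the sign of `u` in the boundary cancels against the `ε` in the
  -- formula for `p t`.
  refine ⟨b.u ⊗ₜ[R] q t, ?_⟩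
  conv_rhs => rw [b.tensor_rep t]
  change _ = b.u ⊗ₜ[R] p t + b.v ⊗ₜ[R] q t
  rw [DGMod.tensorD_tmul, b.d_u, h2, add_comm, sign_u]
  congr 1
  by_cases h : Even n <;> simp [ε, h, TensorProduct.neg_tmul, TensorProduct.tmul_neg]

end DiskBasis

namespace SphereBasis

variable {n : ℤ} {M : DGMod R} (b : SphereBasis n M) {N Z : Type} [AddCommGroup N] [Module R N]
  [AddCommGroup Z] [Module R Z]

/-- The map with `w ⊗ x ↦ φ x`. -/
noncomputable def lin (φ : N →ₗ[R] Z) : M ⊗[R] N →ₗ[R] Z :=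
  TensorProduct.lift ((LinearMap.toSpanSingleton R (N →ₗ[R] Z) φ).comp b.e)

theorem lin_tmul (φ : N →ₗ[R] Z) (y : M) (x : N) : b.lin φ (y ⊗ₜ[R] x) = b.e y • φ x := rfl

@[simp] theorem lin_w (φ : N →ₗ[R] Z) (x : N) : b.lin φ (b.w ⊗ₜ[R] x) = φ x := by
  rw [lin_tmul, b.e_w, one_smul]

theorem ext {f g : M ⊗[R] N →ₗ[R] Z} (hw : ∀ x, f (b.w ⊗ₜ[R] x) = g (b.w ⊗ₜ[R] x)) : f = g :=
  TensorProduct.ext' fun y x => by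
    rw [b.rep y, ← TensorProduct.smul_tmul', map_smul, map_smul, hw]

theorem flat {n : ℤ} {M : DGMod R} (b : SphereBasis n M) : Module.Flat R M := by
  let e : M ≃ₗ[R] R := LinearEquiv.ofLinearMap b.e (LinearMap.toSpanSingleton R M b.w)
    (by ext; simp [b.e_w]) (LinearMap.ext fun x => (b.rep x).symm)
  exact Module.Flat.of_linearEquiv e

theorem lin_mem {N Z : DGMod R} (φ : N →ₗ[R] Z) (hφ : ∀ m, ∀ x ∈ N.gr m, φ x ∈ Z.gr (m + n))
    {m : ℤ} {t : M ⊗[R] N} (ht : t ∈ tensorGr R M.gr N.gr m) : b.lin φ t ∈ Z.gr m :=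
  map_mem_of_tmul (b.lin φ).toAddMonoidHom _ (fun i j hij y hy x hx => by
    change b.lin φ (y ⊗ₜ[R] x) ∈ _
    rw [lin_tmul]
    have h1 := Z.smul_mem _ _ _ (b.e_mem i y hy) _ (hφ j x hx)
    rwa [show i - n + (j + n) = m by lia] at h1) ht

theorem d_eq_zero {n : ℤ} {M : DGMod R} (b : SphereBasis n M) : M.d = 0 := LinearMap.ext fun x => by
  rw [b.rep x, map_smul, b.d_w, smul_zero, LinearMap.zero_apply]

end SphereBasis

end

/-- Bases of the nub and of the vertex, compatible with the structure map. -/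
structure IsDisk (n : ℤ) (K : DA) where
  nub : DiskBasis n K.nub
  vertex : DiskBasis n K.vertex
  β_u : K.β nub.u = (1 : L) ⊗ₜ[ℚ] vertex.u

/-- Bases of the nub and of the vertex, compatible with the structure map. -/
structure IsSphere (n : ℤ) (K : DA) where
  nub : SphereBasis n K.nub
  vertex : SphereBasis n K.vertex
  β_w : K.β nub.w = (1 : L) ⊗ₜ[ℚ] vertex.w

theorem IsDisk.β_v {n : ℤ} {K : DA} (b : IsDisk n K) : K.β b.nub.v = (1 : L) ⊗ₜ[ℚ] b.vertex.v := by
  rw [← b.nub.d_u, K.β_d, b.β_u, extendL_tmul, b.vertex.d_u]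

theorem IsSphere.zeroDiff_obj {n : ℤ} {K : DA} (b : IsSphere n K) : zeroDiff K :=
  ⟨b.nub.d_eq_zero, b.vertex.d_eq_zero⟩

/-- The coordinate functional of `OF ⊗ V` given by a functional on `V`. -/
noncomputable def freeCoord {V : Type} [AddCommGroup V] [Module ℚ V] (f : V →ₗ[ℚ] ℚ) :
    OF ⊗[ℚ] V →ₗ[OF] OF :=
  (AlgebraTensorModule.rid ℚ OF OF).toLinearMap.comp (AlgebraTensorModule.lTensor OF OF f)

theorem freeCoord_tmul {V : Type} [AddCommGroup V] [Module ℚ V] (f : V →ₗ[ℚ] ℚ) (p : OF) (v : V) :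
    freeCoord f (p ⊗ₜ v) = f v • p := rfl

theorem freeCoord_mem {V : DGMod ℚ} {f : V →ₗ[ℚ] ℚ} {k : ℤ}
    (hf : ∀ n, ∀ x ∈ V.gr n, f x ≠ 0 → n = k) {m : ℤ} {t : OF ⊗[ℚ] V}
    (ht : t ∈ (free.obj V).nub.gr m) : freeCoord f t ∈ EvenGraded.gr (R := OF) (m - k) :=
  map_mem_of_tmul (freeCoord f).toAddMonoidHom _ (fun i j hij p hp x hx => by
    change freeCoord f (p ⊗ₜ x) ∈ _
    rw [freeCoord_tmul]
    by_cases h : f x = 0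
    · rw [h, zero_smul]
      exact zero_mem _
    · have : m - k = i := by rw [← hf j x hx h]; lia
      rw [this]
      intro H l hl
      exact hp H l fun h => hl (by rw [compAt_smul, coeff_smul, h, smul_zero])) ht

/-- The basis of the disk. -/
noncomputable def diskVertexBasis (n : ℤ) : DiskBasis n (disk n) where
  u := ((1 : ℚ), (0 : ℚ))
  v := ((0 : ℚ), (1 : ℚ))
  e₁ := LinearMap.fst ℚ ℚ ℚ
  e₂ := LinearMap.snd ℚ ℚ ℚ
  e₁_u := rfl
  e₁_v := rfl
  e₂_u := rfl
  e₂_v := rfl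
  rep := fun (x : ℚ × ℚ) => by
    change x = x.1 • ((1 : ℚ), (0 : ℚ)) + x.2 • ((0 : ℚ), (1 : ℚ))
    simp
  u_mem := ⟨fun h => absurd rfl h, fun _ => rfl⟩
  e₁_mem m x hx := by
    change x.1 ∈ if m - n = 0 then (⊤ : AddSubgroup ℚ) else ⊥
    split_ifs with h
    · trivial
    · exact hx.1 (by lia)
  e₂_mem m x hx := by
    change x.2 ∈ if m - n + 1 = 0 then (⊤ : AddSubgroup ℚ) else ⊥
    split_ifs with h
    · trivial
    · exact hx.2 (by lia)
  d_u := rfl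

/-- The basis of the sphere. -/
noncomputable def sphereVertexBasis (n : ℤ) : SphereBasis n (sphere n) where
  w := (1 : ℚ)
  e := LinearMap.id (M := ℚ)
  e_w := rfl
  rep := fun (x : ℚ) => (mul_one x).symm
  w_mem := fun h => absurd rfl h
  e_mem m x hx := by
    change x ∈ if m - n = 0 then (⊤ : AddSubgroup ℚ) else ⊥
    split_ifs with h
    · trivial
    · exact hx (by lia)
  d_w := rfl

/-- The disk. -/
noncomputable def isDisk (n : ℤ) : IsDisk n (free.obj (disk n)) where
  nub :=
    { u := (1 : OF) ⊗ₜ[ℚ] ((1 : ℚ), (0 : ℚ))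
      v := (1 : OF) ⊗ₜ[ℚ] ((0 : ℚ), (1 : ℚ))
      e₁ := freeCoord (LinearMap.fst ℚ ℚ ℚ)
      e₂ := freeCoord (LinearMap.snd ℚ ℚ ℚ)
      e₁_u := one_smul ℚ (1 : OF)
      e₁_v := zero_smul ℚ (1 : OF)
      e₂_u := zero_smul ℚ (1 : OF)
      e₂_v := one_smul ℚ (1 : OF)
      rep := fun x => by
        have : (LinearMap.id : OF ⊗[ℚ] (ℚ × ℚ) →ₗ[OF] OF ⊗[ℚ] (ℚ × ℚ))
            = (LinearMap.toSpanSingleton OF _ ((1 : OF) ⊗ₜ[ℚ] ((1 : ℚ), (0 : ℚ)))).comp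
              (freeCoord (LinearMap.fst ℚ ℚ ℚ))
            + (LinearMap.toSpanSingleton OF _ ((1 : OF) ⊗ₜ[ℚ] ((0 : ℚ), (1 : ℚ)))).comp
              (freeCoord (LinearMap.snd ℚ ℚ ℚ)) := by
          ext <;> simp [freeCoord_tmul]
        exact DFunLike.congr_fun this x
      u_mem := tmul_mem_tensorGr (zero_add n) (EvenGraded.one_mem (R := OF))
        (diskVertexBasis n).u_mem
      e₁_mem := fun m x hx => freeCoord_mem (V := disk n) (f := LinearMap.fst ℚ ℚ ℚ)
        (fun k x hx h => by_contra fun hk => h (hx.1 hk)) hx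
      e₂_mem := fun m x hx => by
        have := freeCoord_mem (V := disk n) (f := LinearMap.snd ℚ ℚ ℚ) (k := n - 1)
          (fun k x hx h => by_contra fun hk => h (hx.2 hk)) hx
        rwa [show m - (n - 1) = m - n + 1 by lia] at this
      d_u := rfl }
  vertex := diskVertexBasis n
  β_u := by
    change algebraMap OF L 1 ⊗ₜ[ℚ] _ = _
    rw [map_one]
    rfl

/-- The sphere. -/
noncomputable def isSphere (n : ℤ) : IsSphere n (free.obj (sphere n)) where
  nub :=
    { w := (1 : OF) ⊗ₜ[ℚ] (1 : ℚ)
      e := freeCoord (LinearMap.id (M := ℚ))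
      e_w := one_smul ℚ (1 : OF)
      rep := fun x => by
        have : (LinearMap.id : OF ⊗[ℚ] ℚ →ₗ[OF] OF ⊗[ℚ] ℚ)
            = (LinearMap.toSpanSingleton OF _ ((1 : OF) ⊗ₜ[ℚ] (1 : ℚ))).comp
              (freeCoord LinearMap.id) := by
          ext; simp [freeCoord_tmul]
        exact DFunLike.congr_fun this x
      w_mem := tmul_mem_tensorGr (zero_add n) (EvenGraded.one_mem (R := OF))
        (sphereVertexBasis n).w_mem
      e_mem := fun m x hx => freeCoord_mem (V := sphere n) (f := LinearMap.id (M := ℚ))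
        (fun k x hx h => by_contra fun hk => h (hx hk)) hx
      d_w := TensorProduct.tmul_zero _ _ }
  vertex := sphereVertexBasis n
  β_w := by
    change algebraMap OF L 1 ⊗ₜ[ℚ] _ = _
    rw [map_one]
    rfl

/-- The inclusion of the sphere in the disk. -/
noncomputable abbrev sphereInDisk (n : ℤ) : free.obj (sphere (n - 1)) ⟶ free.obj (disk n) :=
  free.map (sphereToDisk n)

theorem DA.vertexLin_ext {P : DA} {V : Type} [AddCommGroup V] [Module ℚ V]
    {f g : P.vertex →ₗ[ℚ] V} (h : ∀ x, extendL f (P.β x) = extendL g (P.β x)) : f = g := by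
  refine LinearMap.ext fun v => ?_
  obtain ⟨s, hs, x, hx⟩ := P.fraction v
  have h1 := h x
  rw [hx, extendL_smul_one, extendL_smul_one] at h1
  have h2 : s • (1 : L) ⊗ₜ[ℚ] (f v - g v) = 0 := by
    rw [TensorProduct.tmul_sub, smul_sub, sub_eq_zero]
    exact h1
  exact sub_eq_zero.1 (one_tmul_injective (euler_smul_eq_zero hs h2))

theorem combine_one_tmul {V W : Type} [AddCommGroup V] [AddCommGroup W] [Module ℚ V]
    [Module ℚ W] (v : V) (t : L ⊗[ℚ] W) :
    combine V W (((1 : L) ⊗ₜ[ℚ] v) ⊗ₜ[OF] t) = extendL (TensorProduct.mk ℚ V W v) t := by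
  induction t using TensorProduct.induction_on with
  | zero => simp
  | add a b ha hb => rw [TensorProduct.tmul_add, map_add, map_add, ha, hb]
  | tmul a w => rw [combine_tmul, one_mul]; rfl

namespace GHom

variable {n : ℤ} {P A B : DA}

/-- The composite with a map. -/
noncomputable def comp (φ : GHom n P A) (f : A ⟶ B) : GHom n P B where
  nub := f.nub.toLin.comp φ.nub
  vertex := f.vertex.toLin.comp φ.vertex
  nub_mem m x hx := f.nub.map_mem _ _ (φ.nub_mem m x hx)
  vertex_mem m x hx := f.vertex.map_mem _ _ (φ.vertex_mem m x hx)
  comm x := by rw [extendL_comp, ← φ.comm, ← f.comm]; rfl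

/-- The composite with the differential. -/
noncomputable def d (φ : GHom n P A) : GHom (n - 1) P A where
  nub := A.nub.d.comp φ.nub
  vertex := A.vertex.d.comp φ.vertex
  nub_mem m x hx := by
    have := A.nub.d_mem _ _ (φ.nub_mem m x hx)
    rwa [add_sub_assoc] at this
  vertex_mem m x hx := by
    have := A.vertex.d_mem _ _ (φ.vertex_mem m x hx)
    rwa [add_sub_assoc] at this
  comm x := by rw [extendL_comp, ← φ.comm, ← A.β_d]; rfl

/-- The zero map. -/
noncomputable def zero (n : ℤ) (P A : DA) : GHom n P A where
  nub := 0
  vertex := 0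
  nub_mem _ _ _ := zero_mem _
  vertex_mem _ _ _ := zero_mem _
  comm x := by rw [extendL_zero]; exact map_zero _

theorem vertex_d_eq_zero (φ : GHom n P A) (h : ∀ x, A.nub.d (φ.nub x) = 0) (x : P.vertex) :
    A.vertex.d (φ.vertex x) = 0 := by
  have : A.vertex.d.comp φ.vertex = 0 := DA.vertexLin_ext fun x => by
    rw [extendL_comp, ← φ.comm, ← A.β_d, h, map_zero, extendL_zero]
  exact DFunLike.congr_fun this x

end GHom

section

variable {n : ℤ} {K P A B : DA}

/-- The map `K ⊗ P ⟶ A` out of a disk given by a map `P → A` of degree `n`. -/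
noncomputable def IsDisk.desc (b : IsDisk n K) (hP : zeroDiff P) (φ : GHom n P A) : K ⊗ P ⟶ A where
  nub :=
    { toLin := b.nub.lin φ.nub (A.nub.d.comp φ.nub)
      map_mem := fun _ _ ht => b.nub.lin_mem (N := P.nub) (Z := A.nub) φ.nub φ.nub_mem
        (A.nub.d.comp φ.nub) φ.d.nub_mem ht
      map_d := by
        have : (b.nub.lin φ.nub (A.nub.d.comp φ.nub)).comp (DGMod.tensorD K.nub P.nub)
            = A.nub.d.comp (b.nub.lin φ.nub (A.nub.d.comp φ.nub)) :=
          b.nub.ext (fun x => by simp [DGMod.tensorD_tmul, b.nub.d_u, hP.1])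
            (fun x => by simp [DGMod.tensorD_tmul, b.nub.d_v, hP.1, A.nub.d_d])
        exact DFunLike.congr_fun this }
  vertex :=
    { toLin := b.vertex.lin φ.vertex (A.vertex.d.comp φ.vertex)
      map_mem := fun _ _ ht => b.vertex.lin_mem (N := P.vertex) (Z := A.vertex) φ.vertex
        φ.vertex_mem (A.vertex.d.comp φ.vertex) φ.d.vertex_mem ht
      map_d := by
        have : (b.vertex.lin φ.vertex (A.vertex.d.comp φ.vertex)).comp
            (DGMod.tensorD K.vertex P.vertex)
            = A.vertex.d.comp (b.vertex.lin φ.vertex (A.vertex.d.comp φ.vertex)) :=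
          b.vertex.ext (fun x => by simp [DGMod.tensorD_tmul, b.vertex.d_u, hP.2])
            (fun x => by simp [DGMod.tensorD_tmul, b.vertex.d_v, hP.2, A.vertex.d_d])
        exact DFunLike.congr_fun this }
  comm := by
    have : A.β.comp (b.nub.lin φ.nub (A.nub.d.comp φ.nub))
        = (extendL (b.vertex.lin φ.vertex (A.vertex.d.comp φ.vertex))).comp (DA.tensorβ K P) :=
      b.nub.ext
        (fun x => by
          rw [LinearMap.comp_apply, LinearMap.comp_apply, DA.tensorβ_tmul, b.β_u,
            combine_one_tmul, ← extendL_comp, b.nub.lin_u, φ.comm]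
          congr 2
          exact LinearMap.ext fun y => (b.vertex.lin_u _ _ y).symm)
        (fun x => by
          rw [LinearMap.comp_apply, LinearMap.comp_apply, DA.tensorβ_tmul, b.β_v,
            combine_one_tmul, ← extendL_comp, b.nub.lin_v]
          refine (φ.d.comm x).trans ?_
          congr 2
          exact LinearMap.ext fun y => (b.vertex.lin_v _ _ y).symm)
    exact DFunLike.congr_fun this

theorem IsDisk.desc_u (b : IsDisk n K) (hP : zeroDiff P) (φ : GHom n P A) (x : P.nub) :
    (b.desc hP φ).nub.toLin (b.nub.u ⊗ₜ[OF] x) = φ.nub x := b.nub.lin_u _ _ x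

theorem IsDisk.desc_v (b : IsDisk n K) (hP : zeroDiff P) (φ : GHom n P A) (x : P.nub) :
    (b.desc hP φ).nub.toLin (b.nub.v ⊗ₜ[OF] x) = A.nub.d (φ.nub x) := b.nub.lin_v _ _ x

/-- The map `P → A` of degree `n` given by a map out of a disk. -/
noncomputable def IsDisk.restr (b : IsDisk n K) (f : K ⊗ P ⟶ A) : GHom n P A where
  nub := (f.nub.toLin : K.nub ⊗[OF] P.nub →ₗ[OF] A.nub).comp (TensorProduct.mk OF K.nub P.nub b.nub.u)
  vertex := (f.vertex.toLin : K.vertex ⊗[ℚ] P.vertex →ₗ[ℚ] A.vertex).comp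
    (TensorProduct.mk ℚ K.vertex P.vertex b.vertex.u)
  nub_mem m x hx := f.nub.map_mem _ _ (tmul_mem_tensorGr (add_comm n m) b.nub.u_mem hx)
  vertex_mem m x hx := f.vertex.map_mem _ _ (tmul_mem_tensorGr (add_comm n m) b.vertex.u_mem hx)
  comm x := by
    refine (f.comm _).trans ?_
    change extendL f.vertex.toLin (DA.tensorβ K P (b.nub.u ⊗ₜ[OF] x)) = _
    rw [DA.tensorβ_tmul, b.β_u, combine_one_tmul]
    exact (extendL_comp _ _ _).symm

theorem IsDisk.restr_d (b : IsDisk n K) (hP : zeroDiff P) (f : K ⊗ P ⟶ A) (x : P.nub) :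
    A.nub.d ((b.restr f).nub x) = f.nub.toLin (b.nub.v ⊗ₜ[OF] x) := by
  refine (f.nub.map_d _).symm.trans (congrArg f.nub.toLin ?_)
  change DGMod.tensorD K.nub P.nub (b.nub.u ⊗ₜ[OF] x) = _
  simp [DGMod.tensorD_tmul, b.nub.d_u, hP.1]

/-- The map `K ⊗ P ⟶ A` out of a sphere given by a map `P → A` of degree `n` into the cycles. -/
noncomputable def IsSphere.desc (b : IsSphere n K) (hP : zeroDiff P) (φ : GHom n P A)
    (hφ : ∀ x, A.nub.d (φ.nub x) = 0) : K ⊗ P ⟶ A where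
  nub :=
    { toLin := b.nub.lin φ.nub
      map_mem := fun _ _ ht => b.nub.lin_mem (N := P.nub) (Z := A.nub) φ.nub φ.nub_mem ht
      map_d := by
        have : (b.nub.lin φ.nub).comp (DGMod.tensorD K.nub P.nub)
            = A.nub.d.comp (b.nub.lin φ.nub) :=
          b.nub.ext (fun x => by simp [DGMod.tensorD_tmul, b.nub.d_w, hP.1, hφ])
        exact DFunLike.congr_fun this }
  vertex :=
    { toLin := b.vertex.lin φ.vertex
      map_mem := fun _ _ ht => b.vertex.lin_mem (N := P.vertex) (Z := A.vertex) φ.vertex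
        φ.vertex_mem ht
      map_d := by
        have : (b.vertex.lin φ.vertex).comp (DGMod.tensorD K.vertex P.vertex)
            = A.vertex.d.comp (b.vertex.lin φ.vertex) :=
          b.vertex.ext (fun x => by
            simp [DGMod.tensorD_tmul, b.vertex.d_w, hP.2, φ.vertex_d_eq_zero hφ])
        exact DFunLike.congr_fun this }
  comm := by
    have : A.β.comp (b.nub.lin φ.nub)
        = (extendL (b.vertex.lin φ.vertex)).comp (DA.tensorβ K P) :=
      b.nub.ext
        (fun x => by
          rw [LinearMap.comp_apply, LinearMap.comp_apply, DA.tensorβ_tmul, b.β_w,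
            combine_one_tmul, ← extendL_comp, b.nub.lin_w, φ.comm]
          congr 2
          exact LinearMap.ext fun y => (b.vertex.lin_w _ y).symm)
    exact DFunLike.congr_fun this

theorem IsSphere.desc_w (b : IsSphere n K) (hP : zeroDiff P) (φ : GHom n P A)
    (hφ : ∀ x, A.nub.d (φ.nub x) = 0) (x : P.nub) :
    (b.desc hP φ hφ).nub.toLin (b.nub.w ⊗ₜ[OF] x) = φ.nub x := b.nub.lin_w _ x

theorem IsSphere.hom_ext (b : IsSphere n K) {f g : K ⊗ P ⟶ A}
    (h : ∀ x : P.nub, f.nub.toLin (b.nub.w ⊗ₜ[OF] x) = g.nub.toLin (b.nub.w ⊗ₜ[OF] x)) : f = g :=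
  DA.hom_ext_nub (b.nub.ext (N := P.nub) (Z := A.nub) h)

/-- The map `P → A` of degree `n` given by a map out of a sphere. -/
noncomputable def IsSphere.restr (b : IsSphere n K) (f : K ⊗ P ⟶ A) : GHom n P A where
  nub := (f.nub.toLin : K.nub ⊗[OF] P.nub →ₗ[OF] A.nub).comp (TensorProduct.mk OF K.nub P.nub b.nub.w)
  vertex := (f.vertex.toLin : K.vertex ⊗[ℚ] P.vertex →ₗ[ℚ] A.vertex).comp
    (TensorProduct.mk ℚ K.vertex P.vertex b.vertex.w)
  nub_mem m x hx := f.nub.map_mem _ _ (tmul_mem_tensorGr (add_comm n m) b.nub.w_mem hx)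
  vertex_mem m x hx := f.vertex.map_mem _ _ (tmul_mem_tensorGr (add_comm n m) b.vertex.w_mem hx)
  comm x := by
    refine (f.comm _).trans ?_
    change extendL f.vertex.toLin (DA.tensorβ K P (b.nub.w ⊗ₜ[OF] x)) = _
    rw [DA.tensorβ_tmul, b.β_w, combine_one_tmul]
    exact (extendL_comp _ _ _).symm

theorem IsSphere.restr_d (b : IsSphere n K) (hP : zeroDiff P) (f : K ⊗ P ⟶ A) (x : P.nub) :
    A.nub.d ((b.restr f).nub x) = 0 := by
  refine (f.nub.map_d _).symm.trans ((congrArg f.nub.toLin ?_).trans (map_zero f.nub.toLin))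
  change DGMod.tensorD K.nub P.nub (b.nub.w ⊗ₜ[OF] x) = (0 : K.nub ⊗[OF] P.nub)
  simp [DGMod.tensorD_tmul, b.nub.d_w, hP.1]

end

/-! ### Lifting problems against the inclusions of spheres in disks -/

variable {X Y : DA} {p : X ⟶ Y}

/-- For `P` with zero differential, a map out of `D^n ⊗ P` amounts to a map of degree `n` out of
`P`, and a map out of `S^(n-1) ⊗ P` to a map of degree `n - 1` into cycles. A commutative square is
then a pair with `p ψ = d φ`. -/
theorem exists_lift_of_hasLiftingProperty {P : DA} (hP : zeroDiff P) (n : ℤ)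
    [HasLiftingProperty (sphereInDisk n ▷ P) p] (φ : GHom n P Y) (ψ : GHom (n - 1) P X)
    (hψ : ∀ x, X.nub.d (ψ.nub x) = 0) (h : ∀ x, p.nub.toLin (ψ.nub x) = Y.nub.d (φ.nub x)) :
    ∃ χ : GHom n P X, (∀ x, p.nub.toLin (χ.nub x) = φ.nub x) ∧
      ∀ x, X.nub.d (χ.nub x) = ψ.nub x := by
  have sq : CommSq ((isSphere (n - 1)).desc hP ψ hψ) (sphereInDisk n ▷ P) p
      ((isDisk n).desc hP φ) := ⟨(isSphere (n - 1)).hom_ext fun x => by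
    refine (congrArg p.nub.toLin ((isSphere (n - 1)).desc_w hP ψ hψ x)).trans ?_
    refine (h x).trans ?_
    exact ((isDisk n).desc_v hP φ x).symm⟩
  refine ⟨(isDisk n).restr sq.lift, fun x => ?_, fun x => ?_⟩
  · have h1 := DFunLike.congr_fun (congrArg (fun f => f.nub.toLin) sq.fac_right)
      ((isDisk n).nub.u ⊗ₜ[OF] x)
    exact h1.trans ((isDisk n).desc_u hP φ x)
  · have h1 := DFunLike.congr_fun (congrArg (fun f => f.nub.toLin) sq.fac_left)
      ((isSphere (n - 1)).nub.w ⊗ₜ[OF] x)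
    exact ((isDisk n).restr_d hP sq.lift x).trans
      (h1.trans ((isSphere (n - 1)).desc_w hP ψ hψ x))

variable {S : Set GrA}

theorem hasLiftingProperty_of_rlp
    (hS : ∀ P : GrA, IsDualisable P → ∃! Q, Q ∈ S ∧ Nonempty (P ≅ Q))
    (hp : (generatingCofibrations S).rlp p) {P : GrA} (hP : IsDualisable P) (n : ℤ) :
    HasLiftingProperty (sphereInDisk n ▷ P.obj) p := by
  obtain ⟨Q, ⟨hQ, ⟨e⟩⟩, -⟩ := hS P hP
  have := hp _ (generatingCofibrations.mk Q hQ n)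
  let e' : P.obj ≅ Q.obj := zeroDiff.ι.mapIso e
  let E : Arrow.mk (sphereInDisk n ▷ P.obj) ≅ Arrow.mk (sphereInDisk n ▷ Q.obj) :=
    Arrow.isoMk (whiskerLeftIso _ e') (whiskerLeftIso _ e') (whisker_exchange _ _)
  exact HasLiftingProperty.of_arrow_iso_left E.symm p

/-! ### Homology isomorphisms -/

namespace DGMod

variable {R : Type} [CommRing R] [EvenGraded R] {M N : DGMod R} (f : M ⟶ N)

theorem homologyMap_injective_iff : Function.Injective (homologyMap f) ↔
    ∀ x y, M.d x = 0 → f.toLin x = N.d y → ∃ z, x = M.d z := by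
  rw [injective_iff_map_eq_zero]
  constructor
  · intro h x y hx hy
    have h1 := h (Submodule.Quotient.mk ⟨x, hx⟩)
      ((Submodule.Quotient.mk_eq_zero _).2 ⟨y, Subtype.ext hy.symm⟩)
    obtain ⟨z, hz⟩ := (Submodule.Quotient.mk_eq_zero _).1 h1
    exact ⟨z, (congrArg Subtype.val hz).symm⟩
  · intro h a ha
    obtain ⟨⟨x, hx⟩, rfl⟩ := Submodule.Quotient.mk_surjective _ a
    obtain ⟨y, hy⟩ := (Submodule.Quotient.mk_eq_zero _).1 ha
    obtain ⟨z, hz⟩ := h x y hx (congrArg Subtype.val hy).symm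
    exact (Submodule.Quotient.mk_eq_zero _).2 ⟨z, Subtype.ext hz.symm⟩

theorem homologyMap_surjective_iff : Function.Surjective (homologyMap f) ↔
    ∀ y, N.d y = 0 → ∃ x z, M.d x = 0 ∧ y = f.toLin x + N.d z := by
  constructor
  · intro h y hy
    obtain ⟨a, ha⟩ := h (Submodule.Quotient.mk ⟨y, hy⟩)
    obtain ⟨⟨x, hx⟩, rfl⟩ := Submodule.Quotient.mk_surjective _ a
    obtain ⟨z, hz⟩ := (Submodule.Quotient.eq _).1 ha.symm
    refine ⟨x, z, hx, ?_⟩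
    have := congrArg Subtype.val hz
    exact (sub_eq_iff_eq_add'.1 this.symm)
  · intro h b
    obtain ⟨⟨y, hy⟩, rfl⟩ := Submodule.Quotient.mk_surjective _ b
    obtain ⟨x, z, hx, hz⟩ := h y hy
    refine ⟨Submodule.Quotient.mk ⟨x, hx⟩, ?_⟩
    refine ((Submodule.Quotient.eq (LinearMap.range (N.d.codRestrict (LinearMap.ker N.d) N.d_d))).2
      ⟨z, Subtype.ext ?_⟩).symm
    exact (sub_eq_iff_eq_add'.2 hz).symm

/-- The condition says that the cokernel of `f` is acyclic, phrased without quotients. -/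
theorem homologyMap_bijective_iff_of_injective (hf : Function.Injective f.toLin) :
    Function.Bijective (homologyMap f) ↔
      ∀ y x, N.d y = f.toLin x → ∃ x' z, y = f.toLin x' + N.d z := by
  have hf' : ∀ x, f.toLin x = 0 → x = 0 := (injective_iff_map_eq_zero _).1 hf
  rw [Function.Bijective, homologyMap_injective_iff, homologyMap_surjective_iff]
  constructor
  · rintro ⟨h1, h2⟩ y x hxy
    have hx : M.d x = 0 := hf' _ (by rw [f.map_d, ← hxy, N.d_d])
    obtain ⟨x', rfl⟩ := h1 x y hx hxy.symm
    obtain ⟨x'', z, -, hz⟩ := h2 (y - f.toLin x') (by rw [map_sub, hxy, f.map_d, sub_self])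
    exact ⟨x' + x'', z, by rw [map_add, add_assoc, ← hz]; abel⟩
  · refine fun h => ⟨fun x y hx hxy => ?_, fun y hy => ?_⟩
    · obtain ⟨x', z, rfl⟩ := h y x hxy.symm
      rw [map_add, N.d_d, add_zero, ← f.map_d] at hxy
      exact ⟨x', hf hxy⟩
    · obtain ⟨x, z, rfl⟩ := h y 0 (by rw [hy, map_zero])
      refine ⟨x, z, hf' _ ?_, rfl⟩
      rwa [map_add, N.d_d, add_zero, ← f.map_d] at hy

/-- The condition says that the kernel of `f` is acyclic. -/
theorem homologyMap_bijective_iff_of_surjective (hf : Function.Surjective f.toLin) :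
    Function.Bijective (homologyMap f) ↔
      ∀ x, f.toLin x = 0 → M.d x = 0 → ∃ w, f.toLin w = 0 ∧ M.d w = x := by
  rw [Function.Bijective, homologyMap_injective_iff, homologyMap_surjective_iff]
  constructor
  · rintro ⟨h1, h2⟩ x hfx hx
    obtain ⟨z, rfl⟩ := h1 x 0 hx (by rw [hfx, map_zero])
    obtain ⟨x', z', hx', hz⟩ := h2 (f.toLin z) (by rw [← f.map_d, hfx])
    obtain ⟨z'', rfl⟩ := hf z'
    refine ⟨z - x' - M.d z'', ?_, ?_⟩
    · rw [map_sub, map_sub, hz, f.map_d]; abel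
    · rw [map_sub, map_sub, hx', M.d_d, sub_zero, sub_zero]
  · refine fun h => ⟨fun x y hx hxy => ?_, fun y hy => ?_⟩
    · obtain ⟨y', rfl⟩ := hf y
      obtain ⟨w, -, hw⟩ := h (x - M.d y') (by rw [map_sub, hxy, f.map_d, sub_self])
        (by rw [map_sub, hx, M.d_d, sub_zero])
      exact ⟨w + y', by rw [map_add, hw]; abel⟩
    · obtain ⟨x, rfl⟩ := hf y
      obtain ⟨w, hw, hdw⟩ := h (M.d x) (by rw [f.map_d, hy]) (M.d_d x)
      exact ⟨x - w, 0, by rw [map_sub, hdw, sub_self], by rw [map_sub, hw, map_zero]; abel⟩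

theorem homologyMap_id (M : DGMod R) : homologyMap (𝟙 M) = LinearMap.id := by
  refine LinearMap.ext fun a => ?_
  obtain ⟨x, rfl⟩ := Submodule.Quotient.mk_surjective _ a
  rfl

theorem homologyMap_comp {P : DGMod R} (g : N ⟶ P) :
    homologyMap (f ≫ g) = (homologyMap g).comp (homologyMap f) := by
  refine LinearMap.ext fun a => ?_
  obtain ⟨x, rfl⟩ := Submodule.Quotient.mk_surjective _ a
  rfl

/-- Every cycle is a boundary. -/
def Acyclic (M : DGMod R) : Prop := ∀ x, M.d x = 0 → ∃ y, M.d y = x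

end DGMod

namespace DA

variable {A B : DA} (f : A ⟶ B)

/-- A relation `f v = d w` between vertices lifts to nubs after multiplication by Euler classes: `s`
and `t` clear denominators, `r` and `q` remove torsion. The conclusion returns to the vertex because
Euler classes act injectively on `L ⊗ V`. -/
theorem vertex_homology_injective (h : Function.Injective (DGMod.homologyMap f.nub)) :
    Function.Injective (DGMod.homologyMap f.vertex) := by
  rw [DGMod.homologyMap_injective_iff] at h ⊢
  intro v w hv hw
  obtain ⟨s, hs, x₀, hx₀⟩ := A.fraction v
  obtain ⟨t, ht, y, hy⟩ := B.fraction w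
  have h1 : A.β (A.nub.d x₀) = 0 := by
    rw [A.β_d, hx₀, extendL_smul_one, hv, TensorProduct.tmul_zero, smul_zero]
  obtain ⟨r, hr, h2⟩ := A.torsion h1
  have h3 : B.β (t • f.nub.toLin (r • x₀) - (r * s) • B.nub.d y) = 0 := by
    rw [map_sub, map_smul, map_smul, map_smul, map_smul, f.comm, hx₀, extendL_smul_one, hw, B.β_d,
      hy, extendL_smul_one, smul_smul, smul_smul, smul_smul, sub_eq_zero]
    congr 1
    ring
  obtain ⟨q, hq, h4⟩ := B.torsion h3
  obtain ⟨z, hz⟩ := h ((q * t * r) • x₀) ((q * r * s) • y)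
    (by rw [mul_assoc, mul_smul, mul_smul, map_smul, map_smul, map_smul, h2, smul_zero, smul_zero])
    (by
      rw [smul_sub, sub_eq_zero, map_smul] at h4
      rw [map_smul, map_smul, mul_smul, mul_smul, h4, smul_smul, mul_assoc])
  have h5 : (q * t * r * s) • (1 : L) ⊗ₜ[ℚ] (LinearMap.range A.vertex.d).mkQ v = 0 := by
    have h6 : extendL (LinearMap.range A.vertex.d).mkQ (A.β ((q * t * r) • x₀)) = 0 := by
      rw [hz, A.β_d, ← extendL_comp, LinearMap.range_mkQ_comp, extendL_zero]
    rwa [map_smul, hx₀, map_smul, extendL_smul_one, smul_smul] at h6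
  have h6 := one_tmul_injective
    (euler_smul_eq_zero (mul_mem (mul_mem (mul_mem hq ht) hr) hs) h5)
  obtain ⟨u, hu⟩ := (Submodule.Quotient.mk_eq_zero _).1 h6
  exact ⟨u, hu.symm⟩

theorem vertex_homology_surjective (h : Function.Surjective (DGMod.homologyMap f.nub)) :
    Function.Surjective (DGMod.homologyMap f.vertex) := by
  rw [DGMod.homologyMap_surjective_iff] at h ⊢
  intro w hw
  obtain ⟨s, hs, y₀, hy₀⟩ := B.fraction w
  have h1 : B.β (B.nub.d y₀) = 0 := by
    rw [B.β_d, hy₀, extendL_smul_one, hw, TensorProduct.tmul_zero, smul_zero]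
  obtain ⟨r, hr, h2⟩ := B.torsion h1
  obtain ⟨x, z, hx, hz⟩ := h (r • y₀) (by rw [map_smul, h2])
  -- The claim is that `w` lies in `T`, that is, vanishes modulo images of cycles and boundaries;
  -- this can be tested after tensoring with `L` and multiplying by Euler classes.
  let T := (LinearMap.ker A.vertex.d).map f.vertex.toLin ⊔ LinearMap.range B.vertex.d
  have hβ : A.β x ∈ Set.range (extendL (LinearMap.ker A.vertex.d).subtype) := by
    refine (extendL_exact (LinearMap.exact_subtype_ker_map A.vertex.d) _).1 ?_
    rw [← A.β_d, hx, map_zero]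
  obtain ⟨c, hc⟩ := hβ
  have h3 : extendL T.mkQ (B.β (r • y₀)) = 0 := by
    rw [hz, map_add, f.comm, ← hc, B.β_d, map_add, ← extendL_comp, ← extendL_comp, ← extendL_comp]
    have e1 : (T.mkQ.comp f.vertex.toLin).comp (LinearMap.ker A.vertex.d).subtype = 0 :=
      LinearMap.ext fun a => (Submodule.Quotient.mk_eq_zero _).2
        (Submodule.mem_sup_left ⟨a, a.2, rfl⟩)
    have e2 : T.mkQ.comp B.vertex.d = 0 :=
      LinearMap.ext fun a => (Submodule.Quotient.mk_eq_zero _).2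
        (Submodule.mem_sup_right ⟨a, rfl⟩)
    rw [e1, e2, extendL_zero, extendL_zero, add_zero]
  rw [map_smul, hy₀, map_smul, extendL_smul_one] at h3
  have h4 := one_tmul_injective (euler_smul_eq_zero hs (euler_smul_eq_zero hr h3))
  obtain ⟨_, ⟨a, ha, rfl⟩, _, ⟨b, rfl⟩, hab⟩ :=
    Submodule.mem_sup.1 ((Submodule.Quotient.mk_eq_zero _).1 h4)
  exact ⟨a, b, ha, hab.symm⟩

theorem homologyIso_iff : homologyIso f ↔ Function.Bijective (DGMod.homologyMap f.nub) :=
  ⟨fun h => h.1, fun h => ⟨h, vertex_homology_injective f h.1, vertex_homology_surjective f h.2⟩⟩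

/-- The homology of the nub. -/
noncomputable def nubHomology : DA ⥤ ModuleCat.{0} OF where
  obj A := ModuleCat.of OF A.nub.homology
  map f := ModuleCat.ofHom (DGMod.homologyMap f.nub)
  map_id A := congrArg ModuleCat.ofHom (DGMod.homologyMap_id A.nub)
  map_comp f g := congrArg ModuleCat.ofHom (DGMod.homologyMap_comp f.nub g.nub)

end DA

/-- This form lets two out of three and closure under retracts be inherited from isomorphisms of
modules. -/
theorem homologyIso_eq :
    homologyIso = (MorphismProperty.isomorphisms _).inverseImage DA.nubHomology := by
  ext A B f
  rw [DA.homologyIso_iff, MorphismProperty.inverseImage_iff, MorphismProperty.isomorphisms.iff,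
    ConcreteCategory.isIso_iff_bijective]
  rfl

instance : homologyIso.HasTwoOutOfThreeProperty := homologyIso_eq ▸ inferInstance

instance : homologyIso.IsStableUnderRetracts := homologyIso_eq ▸ inferInstance

instance : homologyIso.IsMultiplicative := homologyIso_eq ▸ inferInstance

instance : homologyIso.RespectsIso := homologyIso_eq ▸ inferInstance

variable {A B : DA} {f : A ⟶ B}

theorem homologyIso_iff_of_injective (hf : Function.Injective f.nub.toLin) :
    homologyIso f ↔
      ∀ y x, B.nub.d y = f.nub.toLin x → ∃ x' z, y = f.nub.toLin x' + B.nub.d z := by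
  rw [DA.homologyIso_iff, DGMod.homologyMap_bijective_iff_of_injective _ hf]

theorem homologyIso_iff_of_surjective (hf : Function.Surjective f.nub.toLin) :
    homologyIso f ↔
      ∀ x, f.nub.toLin x = 0 → A.nub.d x = 0 → ∃ w, f.nub.toLin w = 0 ∧ A.nub.d w = x := by
  rw [DA.homologyIso_iff, DGMod.homologyMap_bijective_iff_of_surjective _ hf]

/-- The subobject of cycles. -/
noncomputable def DA.Sub.cycles (A : DA) : DA.Sub A where
  nub := LinearMap.ker A.nub.d
  vertex := LinearMap.ker A.vertex.d
  isSub_nub := DGMod.isSub_cycles _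
  isSub_vertex := DGMod.isSub_cycles _
  β_mem x hx := by
    refine ((extendL_exact (LinearMap.exact_subtype_ker_map A.vertex.d)) _).1 ?_
    rw [← A.β_d, hx, map_zero]
  fraction v hv := by
    obtain ⟨s, hs, x, hx⟩ := A.fraction v
    have h1 : A.β (A.nub.d x) = 0 := by
      rw [A.β_d, hx, extendL_smul_one, hv, TensorProduct.tmul_zero, smul_zero]
    obtain ⟨t, ht, h2⟩ := A.torsion h1
    refine ⟨t * s, mul_mem ht hs, t • x, ?_, ?_⟩
    · rw [LinearMap.mem_ker, map_smul, h2]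
    · rw [map_smul, hx, smul_smul]

/-! ### The right lifting property implies being a homology isomorphism -/

section

variable {X Y : DA} {p : X ⟶ Y}

theorem exists_lift_of_rlp_mat (hp : ∀ (D : MatData) (n : ℤ),
    HasLiftingProperty (sphereInDisk n ▷ D.obj) p) (D : MatData) {m n : ℤ} (hmn : m = n - 1)
    (φ : GHom n D.obj Y) (ψ : GHom m D.obj X) (hψ : ∀ x, X.nub.d (ψ.nub x) = 0)
    (h : ∀ x, p.nub.toLin (ψ.nub x) = Y.nub.d (φ.nub x)) :
    ∃ χ : GHom n D.obj X, (∀ x, p.nub.toLin (χ.nub x) = φ.nub x) ∧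
      ∀ x, X.nub.d (χ.nub x) = ψ.nub x := by
  subst hmn
  have := hp D n
  exact exists_lift_of_hasLiftingProperty D.zeroDiff_obj n φ ψ hψ h

/-- Two lifts are needed. A map `φ` that covers `y` need not consist of cycles, so `d φ` is first
lifted to a map into the cycles of `X`; this is the problem one degree lower with zero boundary.
Then `φ` lifts with that boundary. -/
theorem surjective_of_rlp_mat (hp : ∀ (D : MatData) (n : ℤ),
    HasLiftingProperty (sphereInDisk n ▷ D.obj) p) : Function.Surjective p.nub.toLin := by
  intro y
  induction y using homogeneous_induction Y.nub.isInternal with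
  | zero => exact ⟨0, map_zero _⟩
  | add a b ha hb =>
    obtain ⟨a, rfl⟩ := ha
    obtain ⟨b, rfl⟩ := hb
    exact ⟨a + b, map_add _ _ _⟩
  | mem n y hy =>
    obtain ⟨D, φ, e, rfl⟩ := Y.exists_cover hy
    obtain ⟨ψ, h1, h2⟩ := exists_lift_of_rlp_mat hp D rfl φ.d (GHom.zero _ D.obj X)
      (fun x => map_zero _) (fun x => (map_zero p.nub.toLin).trans (Y.nub.d_d _).symm)
    obtain ⟨χ, h3, -⟩ := exists_lift_of_rlp_mat hp D rfl φ ψ h2 h1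
    exact ⟨χ.nub e, h3 e⟩

theorem homologyIso_of_rlp_mat (hp : ∀ (D : MatData) (n : ℤ),
    HasLiftingProperty (sphereInDisk n ▷ D.obj) p) : homologyIso p := by
  rw [homologyIso_iff_of_surjective (surjective_of_rlp_mat hp)]
  -- The cycles of the kernel form an object of their own, so they too are covered by matrix
  -- objects. Such a cover is a map into cycles over `0`, and lifting the zero map one degree higher
  -- exhibits it as a boundary in the kernel.
  let K := DA.Sub.cycles (DA.Sub.ker p).toDA
  let j : K.toDA ⟶ X := K.incl ≫ (DA.Sub.ker p).incl
  have hj : ∀ z : K.toDA.nub, ∃ w, p.nub.toLin w = 0 ∧ X.nub.d w = j.nub.toLin z := by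
    intro z
    induction z using homogeneous_induction K.toDA.nub.isInternal with
    | zero => exact ⟨0, map_zero _, (map_zero _).trans (map_zero j.nub.toLin).symm⟩
    | add a b ha hb =>
      obtain ⟨a', ha, ha'⟩ := ha
      obtain ⟨b', hb, hb'⟩ := hb
      exact ⟨a' + b', by rw [map_add, ha, hb, add_zero],
        by rw [map_add, ha', hb']; exact (map_add j.nub.toLin a b).symm⟩
    | mem n z hz =>
      obtain ⟨D, φ, e, rfl⟩ := DA.exists_cover K.toDA hz
      obtain ⟨χ, h1, h2⟩ := exists_lift_of_rlp_mat hp D (by norm_num) (GHom.zero 1 D.obj Y)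
        (φ.comp j) (fun x => congrArg Subtype.val (φ.nub x).2)
        (fun x => (φ.nub x).1.2.trans (map_zero Y.nub.d).symm)
      exact ⟨χ.nub e, h1 e, h2 e⟩
  intro x hx hdx
  exact hj ⟨⟨x, hx⟩, Subtype.ext hdx⟩

end

/-! ### A small separating family; pushouts and pullbacks in terms of elements -/

namespace DA

/-- A disk on an object with a free nub. -/
noncomputable abbrev gen (D : MatData) : DA := free.obj (disk 0) ⊗ D.obj

/-- Tensoring with the disk removes the condition on differentials: a degree 0 map out of `D.obj`
that need not commute with `d` is a map out of `gen D`. -/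
theorem exists_gen_hom (A : DA) {n : ℤ} {x : A.nub} (hx : x ∈ A.nub.gr n) :
    ∃ (D : MatData) (f : gen D ⟶ A) (z : (gen D).nub), f.nub.toLin z = x := by
  obtain ⟨D, φ, e, rfl⟩ := A.exists_cover hx
  exact ⟨D, (isDisk 0).desc D.zeroDiff_obj φ, (isDisk 0).nub.u ⊗ₜ[OF] e,
    (isDisk 0).desc_u D.zeroDiff_obj φ e⟩

theorem isSeparating_gen : ObjectProperty.IsSeparating (.ofObj gen) := by
  intro A B f g h
  refine hom_ext_nub (LinearMap.ext fun x => ?_)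
  induction x using homogeneous_induction A.nub.isInternal with
  | zero => rw [map_zero, map_zero]
  | add a b ha hb => rw [map_add, map_add, ha, hb]
  | mem n x hx =>
    obtain ⟨D, k, z, rfl⟩ := A.exists_gen_hom hx
    exact DFunLike.congr_fun (congrArg (fun f => f.nub.toLin) (h _ ⟨D⟩ k)) z

/-- `MatData` is a type in the lowest universe, so the coproduct of all the generators exists. -/
instance : HasSeparator DA := ⟨∐ gen, (isSeparator_sigma _).2 isSeparating_gen⟩

instance : IsGrothendieckAbelian.{0} DA where

theorem exact_elements {S : ShortComplex DA} (hS : S.Exact) {x : S.X₂.nub}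
    (hx : S.g.nub.toLin x = 0) : ∃ w, S.f.nub.toLin w = x :=
  (ShortComplex.moduleCat_exact_iff _).1 (hS.map nubMod) x hx

section Biprod

variable {X Y : DA}

/-- An element of a biproduct. -/
noncomputable def pair (x : X.nub) (y : Y.nub) : (X ⊞ Y).nub :=
  (biprod.inl : X ⟶ X ⊞ Y).nub.toLin x + (biprod.inr : Y ⟶ X ⊞ Y).nub.toLin y

theorem comp_apply {A B C : DA} (f : A ⟶ B) (g : B ⟶ C) (x : A.nub) :
    (f ≫ g).nub.toLin x = g.nub.toLin (f.nub.toLin x) := rfl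

theorem map_pair {Z : DA} (h : X ⊞ Y ⟶ Z) (x : X.nub) (y : Y.nub) :
    h.nub.toLin (pair x y) = (biprod.inl ≫ h).nub.toLin x + (biprod.inr ≫ h).nub.toLin y :=
  map_add _ _ _

theorem fst_pair (x : X.nub) (y : Y.nub) : (biprod.fst : X ⊞ Y ⟶ X).nub.toLin (pair x y) = x := by
  rw [map_pair, biprod.inl_fst, biprod.inr_fst]
  exact add_zero x

theorem snd_pair (x : X.nub) (y : Y.nub) : (biprod.snd : X ⊞ Y ⟶ Y).nub.toLin (pair x y) = y := by
  rw [map_pair, biprod.inl_snd, biprod.inr_snd]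
  exact zero_add y

theorem pair_fst_snd (t : (X ⊞ Y).nub) : pair ((biprod.fst : X ⊞ Y ⟶ X).nub.toLin t)
    ((biprod.snd : X ⊞ Y ⟶ Y).nub.toLin t) = t := by
  have := DFunLike.congr_fun (congrArg (fun f => f.nub.toLin) (biprod.total (X := X) (Y := Y))) t
  exact this

theorem desc_pair {Z : DA} (f : X ⟶ Z) (g : Y ⟶ Z) (x : X.nub) (y : Y.nub) :
    (biprod.desc f g).nub.toLin (pair x y) = f.nub.toLin x + g.nub.toLin y := by
  rw [map_pair, biprod.inl_desc, biprod.inr_desc]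

theorem lift_apply {W : DA} (f : W ⟶ X) (g : W ⟶ Y) (w : W.nub) :
    (biprod.lift f g).nub.toLin w = pair (f.nub.toLin w) (g.nub.toLin w) := by
  rw [← pair_fst_snd ((biprod.lift f g).nub.toLin w), ← comp_apply, ← comp_apply,
    biprod.lift_fst, biprod.lift_snd]

end Biprod

section Squares

variable {W X Y Z : DA} {f : W ⟶ X} {i : W ⟶ Y} {i' : X ⟶ Z} {f' : Y ⟶ Z}

theorem pushout_elements (h : IsPushout f i i' f') (z : Z.nub) :
    ∃ x y, z = i'.nub.toLin x + f'.nub.toLin y := by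
  have := h.epi_shortComplex_g
  obtain ⟨t, ht⟩ := (epi_iff _).1 this z
  refine ⟨(biprod.fst : X ⊞ Y ⟶ X).nub.toLin t, (biprod.snd : X ⊞ Y ⟶ Y).nub.toLin t, ?_⟩
  exact ht.symm.trans ((congrArg (biprod.desc i' f').nub.toLin (pair_fst_snd t).symm).trans
    (desc_pair _ _ _ _))

/-- A pushout square is a right exact sequence `W → X ⊞ Y → Z → 0`; the minus sign comes from the
second component of its first map. -/
theorem pushout_eq_zero (h : IsPushout f i i' f') {x : X.nub} {y : Y.nub}
    (hxy : i'.nub.toLin x + f'.nub.toLin y = 0) :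
    ∃ w, f.nub.toLin w = x ∧ i.nub.toLin w = -y := by
  obtain ⟨w, hw⟩ := exact_elements h.exact_shortComplex (x := pair x y)
    ((desc_pair i' f' x y).trans hxy)
  have h1 := (lift_apply f (-i) w).symm.trans hw
  have h2 := congrArg (biprod.fst : X ⊞ Y ⟶ X).nub.toLin h1
  have h3 := congrArg (biprod.snd : X ⊞ Y ⟶ Y).nub.toLin h1
  rw [fst_pair, fst_pair] at h2
  rw [snd_pair, snd_pair] at h3
  refine ⟨w, h2, ?_⟩
  rw [← h3]
  exact (neg_neg _).symm

theorem pullback_ext (h : IsPullback f i i' f') {a : W.nub} (h1 : f.nub.toLin a = 0)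
    (h2 : i.nub.toLin a = 0) : a = 0 := by
  have := h.mono_shortComplex'_f
  refine (injective_iff_map_eq_zero _).1 ((mono_iff _).1 this) a ?_
  have h3 : pair (f.nub.toLin a) (i.nub.toLin a) = (0 : (X ⊞ Y).nub) := by
    rw [h1, h2, pair, map_zero, map_zero, add_zero]
  exact (lift_apply f i a).trans h3

theorem pullback_exists (h : IsPullback f i i' f') {x : X.nub} {y : Y.nub}
    (hxy : i'.nub.toLin x = f'.nub.toLin y) : ∃ w, f.nub.toLin w = x ∧ i.nub.toLin w = y := by
  obtain ⟨w, hw⟩ := exact_elements h.exact_shortComplex' (x := pair x y)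
    ((desc_pair i' (-f') x y).trans ((congrArg (· + -f'.nub.toLin y) hxy).trans
      (add_neg_cancel _)))
  have h1 := (lift_apply f i w).symm.trans hw
  have h2 := congrArg (biprod.fst : X ⊞ Y ⟶ X).nub.toLin h1
  have h3 := congrArg (biprod.snd : X ⊞ Y ⟶ Y).nub.toLin h1
  rw [fst_pair, fst_pair] at h2
  rw [snd_pair, snd_pair] at h3
  exact ⟨w, h2, h3⟩

end Squares

end DA

/-! ### Properness by diagram chase -/

section Proper

variable {W X Y Z : DA} {f : W ⟶ X} {i : W ⟶ Y} {i' : X ⟶ Z} {f' : Y ⟶ Z}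

theorem sq_apply (h : f ≫ i' = i ≫ f') (w : W.nub) :
    i'.nub.toLin (f.nub.toLin w) = f'.nub.toLin (i.nub.toLin w) :=
  DFunLike.congr_fun (congrArg (fun f => f.nub.toLin) h) w

/-- Homology isomorphisms are stable under pushouts along monomorphisms. -/
theorem homologyIso_pushout (h : IsPushout f i i' f') (hi : Function.Injective i.nub.toLin)
    (hf : homologyIso f) : homologyIso f' := by
  have hi0 := (injective_iff_map_eq_zero _).1 hi
  rw [DA.homologyIso_iff, Function.Bijective, DGMod.homologyMap_injective_iff,
    DGMod.homologyMap_surjective_iff] at hf ⊢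
  refine ⟨fun y z hy hz => ?_, fun z hz => ?_⟩
  · obtain ⟨x, y', rfl⟩ := DA.pushout_elements h z
    rw [map_add, ← i'.nub.map_d, ← f'.nub.map_d] at hz
    -- The relation in the pushout comes from one element `w`, which is a cycle because `i` is
    -- injective. Its image under `f` is a boundary, so `w` is a boundary and corrects `y'`.
    obtain ⟨w, hw, hw'⟩ := DA.pushout_eq_zero h (x := X.nub.d x) (y := Y.nub.d y' - y) (by
      rw [map_sub, hz]; abel)
    obtain ⟨w', rfl⟩ := hf.1 w x (hi0 _ (by
      rw [i.nub.map_d, hw', map_neg, map_sub, Y.nub.d_d, hy, sub_zero, neg_zero])) hw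
    exact ⟨y' + i.nub.toLin w', by rw [map_add, ← i.nub.map_d, hw']; abel⟩
  · obtain ⟨x, y, rfl⟩ := DA.pushout_elements h z
    rw [map_add, ← i'.nub.map_d, ← f'.nub.map_d] at hz
    obtain ⟨w, hw, hw'⟩ := DA.pushout_eq_zero h hz
    obtain ⟨w', rfl⟩ := hf.1 w x (hi0 _ (by
      rw [i.nub.map_d, hw', map_neg, Y.nub.d_d, neg_zero])) hw
    obtain ⟨w'', x'', hw2, hx⟩ := hf.2 (x - f.nub.toLin w') (by
      rw [map_sub, ← hw, f.nub.map_d, sub_self])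
    refine ⟨i.nub.toLin (w'' + w') + y, i'.nub.toLin x'', ?_, ?_⟩
    · rw [map_add, map_add, map_add, ← i.nub.map_d, ← i.nub.map_d, hw2, hw', map_zero]; abel
    · rw [map_add, ← sq_apply h.w, map_add, ← i'.nub.map_d, sub_eq_iff_eq_add.1 hx, map_add,
        map_add, map_add]
      abel

/-- Homology isomorphisms are stable under pullbacks along epimorphisms. -/
theorem homologyIso_pullback (h : IsPullback f i i' f') (hp : Function.Surjective f'.nub.toLin)
    (hf : homologyIso i') : homologyIso i := by
  rw [DA.homologyIso_iff, Function.Bijective, DGMod.homologyMap_injective_iff,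
    DGMod.homologyMap_surjective_iff] at hf ⊢
  refine ⟨fun a y ha hy => ?_, fun y hy => ?_⟩
  · obtain ⟨x, hx⟩ := hf.1 (f.nub.toLin a) (f'.nub.toLin y) (by rw [← f.nub.map_d, ha, map_zero])
      (by rw [sq_apply h.w, hy, f'.nub.map_d])
    -- The elements `x` and `y` need not agree over `Z`. Their difference there is a cycle; it is
    -- removed by a cycle `x1` of `X` and a boundary, which lifts to `Y` because `f'` is surjective.
    obtain ⟨x1, z1, hx1, hz1⟩ := hf.2 (i'.nub.toLin x - f'.nub.toLin y) (by
      rw [map_sub, ← i'.nub.map_d, ← f'.nub.map_d, ← hx, ← hy, sq_apply h.w, sub_self])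
    obtain ⟨y1, rfl⟩ := hp z1
    obtain ⟨a1, h1, h2⟩ := DA.pullback_exists h (x := x - x1) (y := y + Y.nub.d y1) (by
      rw [map_sub, map_add, f'.nub.map_d, sub_eq_iff_eq_add.1 hz1]; abel)
    refine ⟨a1, sub_eq_zero.1 (DA.pullback_ext h ?_ ?_)⟩
    · rw [map_sub, f.nub.map_d, h1, map_sub, hx1, sub_zero, hx, sub_self]
    · rw [map_sub, i.nub.map_d, h2, map_add, Y.nub.d_d, add_zero, hy, sub_self]
  · obtain ⟨x, z, hx, hz⟩ := hf.2 (f'.nub.toLin y) (by rw [← f'.nub.map_d, hy, map_zero])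
    obtain ⟨y1, rfl⟩ := hp z
    obtain ⟨a, h1, h2⟩ := DA.pullback_exists h (x := x) (y := y - Y.nub.d y1) (by
      rw [map_sub, f'.nub.map_d, hz]; abel)
    refine ⟨a, y1, DA.pullback_ext h ?_ ?_, by rw [h2]; abel⟩
    · rw [f.nub.map_d, h1, hx]
    · rw [i.nub.map_d, h2, map_sub, hy, Y.nub.d_d, sub_zero]

end Proper

/-! ### Closure properties of trivial monomorphisms -/

/-- The monomorphisms that are homology isomorphisms. -/
def trivialMono : MorphismProperty DA := MorphismProperty.monomorphisms DA ⊓ homologyIso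

/-- A pushout of a monomorphism has the same cokernel, so acyclicity of the cokernel is preserved;
the proof chases this on elements. -/
instance : trivialMono.IsStableUnderCobaseChange where
  of_isPushout {A A' B B' f g f' g'} sq hf := by
    have hm : Mono f := hf.1
    have hf1 := (DA.mono_iff f).1 hm
    have hm' : MorphismProperty.monomorphisms DA f' :=
      MorphismProperty.of_isPushout (P := .monomorphisms DA) sq hf.1
    refine ⟨hm', ?_⟩
    rw [homologyIso_iff_of_injective ((DA.mono_iff f').1 hm')]
    have hf2 := (homologyIso_iff_of_injective hf1).1 hf.2
    intro z x hz
    obtain ⟨x0, y, rfl⟩ := DA.pushout_elements sq z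
    rw [map_add, ← f'.nub.map_d, ← g'.nub.map_d] at hz
    obtain ⟨w, h1, h2⟩ := DA.pushout_eq_zero sq (x := B.nub.d x0 - x) (y := A'.nub.d y) (by
      rw [map_sub, sub_add_eq_add_sub, hz, sub_self])
    obtain ⟨w', z', hw⟩ := hf2 (-y) w (by rw [map_neg, h2])
    refine ⟨x0 - g.nub.toLin w', -g'.nub.toLin z', ?_⟩
    rw [map_neg, map_sub, ← g'.nub.map_d, sq_apply sq.w, neg_eq_iff_eq_neg.1 hw, map_neg,
      map_add]
    abel

namespace DA

section Filtered

variable {J : Type} [SmallCategory J] [IsFiltered J] {F : J ⥤ DA} {c : Cocone F}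

theorem filtered_rep (hc : IsColimit c) (x : c.pt.nub) : ∃ j y, (c.ι.app j).nub.toLin y = x := by
  obtain ⟨j, y, h⟩ := Concrete.isColimit_exists_rep (F ⋙ nubMod)
    (isColimitOfPreserves nubMod hc) (show nubMod.obj c.pt from x)
  exact ⟨j, y, h⟩

theorem ι_map {j k : J} (g : j ⟶ k) (y : (F.obj j).nub) :
    (c.ι.app k).nub.toLin ((F.map g).nub.toLin y) = (c.ι.app j).nub.toLin y :=
  DFunLike.congr_fun (congrArg (fun f => f.nub.toLin) (c.w g)) y

theorem ι_d (j : J) (y : (F.obj j).nub) :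
    c.pt.nub.d ((c.ι.app j).nub.toLin y) = (c.ι.app j).nub.toLin ((F.obj j).nub.d y) :=
  ((c.ι.app j).nub.map_d y).symm

theorem map_map {j k l : J} (g : j ⟶ k) (h : k ⟶ l) (y : (F.obj j).nub) :
    (F.map h).nub.toLin ((F.map g).nub.toLin y) = (F.map (g ≫ h)).nub.toLin y := by
  rw [F.map_comp]
  rfl

theorem filtered_eq_zero (hc : IsColimit c) {j : J} {y : (F.obj j).nub}
    (hy : (c.ι.app j).nub.toLin y = 0) : ∃ (k : J) (g : j ⟶ k), (F.map g).nub.toLin y = 0 := by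
  obtain ⟨k, g, g', h⟩ := Concrete.isColimit_exists_of_rep_eq (F ⋙ nubMod)
    (isColimitOfPreserves nubMod hc) (show (F ⋙ nubMod).obj j from y)
    (show (F ⋙ nubMod).obj j from (0 : (F.obj j).nub))
    (hy.trans (map_zero (c.ι.app j).nub.toLin).symm)
  exact ⟨k, g, h.trans (map_zero (F.map g').nub.toLin)⟩

/-- Cycles of a filtered colimit are represented by cycles. -/
theorem filtered_cycle (hc : IsColimit c) {x : c.pt.nub} (hx : c.pt.nub.d x = 0) :
    ∃ j y, (F.obj j).nub.d y = 0 ∧ (c.ι.app j).nub.toLin y = x := by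
  obtain ⟨j, y, rfl⟩ := filtered_rep hc x
  rw [ι_d] at hx
  obtain ⟨k, g, h⟩ := filtered_eq_zero hc hx
  exact ⟨k, (F.map g).nub.toLin y, by rw [← (F.map g).nub.map_d, h], ι_map g y⟩

end Filtered

/-- A cycle of a filtered colimit, and an equation between homology classes, already exist at some
stage. -/
theorem homologyIso_filtered (J : Type) [SmallCategory J] [IsFiltered J] :
    homologyIso.IsStableUnderColimitsOfShape J where
  condition F G c c' hc hc' f hf φ hφ := by
    have hf' : ∀ j, homologyIso (f.app j) := hf
    have hφ' : ∀ j y, φ.nub.toLin ((c.ι.app j).nub.toLin y)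
        = (c'.ι.app j).nub.toLin ((f.app j).nub.toLin y) := fun j y =>
      DFunLike.congr_fun (congrArg (fun f => f.nub.toLin) (hφ j)) y
    have hnat : ∀ {j k} (g : j ⟶ k) y, (f.app k).nub.toLin ((F.map g).nub.toLin y)
        = (G.map g).nub.toLin ((f.app j).nub.toLin y) := fun g y =>
      DFunLike.congr_fun (congrArg (fun f => f.nub.toLin) (f.naturality g)) y
    simp only [homologyIso_iff, Function.Bijective, DGMod.homologyMap_injective_iff,
      DGMod.homologyMap_surjective_iff] at hf' ⊢
    refine ⟨fun x y hx hxy => ?_, fun y hy => ?_⟩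
    · obtain ⟨j, x, hx', rfl⟩ := filtered_cycle hc hx
      obtain ⟨k, y, rfl⟩ := filtered_rep hc' y
      let l := IsFiltered.max j k
      let g : j ⟶ l := IsFiltered.leftToMax j k
      let g' : k ⟶ l := IsFiltered.rightToMax j k
      obtain ⟨m, h, hm⟩ := filtered_eq_zero hc' (j := l)
        (y := (G.map g).nub.toLin ((f.app j).nub.toLin x)
          - (G.obj l).nub.d ((G.map g').nub.toLin y)) (by
            rw [map_sub, ← ι_d, ι_map, ι_map, ← hφ', hxy, sub_self])
      rw [map_sub, (G.map h).nub.map_d, map_map, sub_eq_zero, ← hnat] at hm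
      obtain ⟨z, hz⟩ := (hf' m).1 _ _ (by rw [← (F.map (g ≫ h)).nub.map_d, hx', map_zero]) hm
      exact ⟨(c.ι.app m).nub.toLin z, by rw [ι_d, ← hz, ι_map]⟩
    · obtain ⟨j, y, hy', rfl⟩ := filtered_cycle hc' hy
      obtain ⟨x, z, hx, rfl⟩ := (hf' j).2 y hy'
      exact ⟨(c.ι.app j).nub.toLin x, (c'.ι.app j).nub.toLin z,
        by rw [ι_d, hx, map_zero],
        by rw [map_add, hφ', ι_d]⟩

end DA

instance (J : Type) [SmallCategory J] [IsFiltered J] : trivialMono.IsStableUnderColimitsOfShape J where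
  condition F G c c' hc hc' f hf φ hφ :=
    ⟨(MorphismProperty.isStableUnderColimitsOfShape_monomorphisms (C := DA) (J := J)).condition F G c c' hc hc' f
      (fun j => (hf j).1) φ hφ,
    (DA.homologyIso_filtered J).condition F G c c' hc hc' f (fun j => (hf j).2) φ hφ⟩

instance : trivialMono.IsMultiplicative :=
  inferInstanceAs (MorphismProperty.monomorphisms DA ⊓ homologyIso).IsMultiplicative

instance : trivialMono.RespectsIso :=
  inferInstanceAs (MorphismProperty.monomorphisms DA ⊓ homologyIso).RespectsIso

instance : trivialMono.IsStableUnderRetracts :=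
  inferInstanceAs (MorphismProperty.monomorphisms DA ⊓ homologyIso).IsStableUnderRetracts

instance : trivialMono.IsStableUnderTransfiniteComposition.{0} where
  isStableUnderTransfiniteCompositionOfShape J _ _ _ _ :=
    .of_isStableUnderColimitsOfShape fun J _ _ _ _ => inferInstance

theorem homologyIso_dsum {ι : Type} {F G : ι → DA} (f : ∀ i, F i ⟶ G i)
    (hf : ∀ i, trivialMono (f i)) (hm : Mono (DA.dsumDesc F fun i => f i ≫ DA.dsumι G i)) :
    homologyIso (DA.dsumDesc F fun i => f i ≫ DA.dsumι G i) := by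
  let φ := DA.dsumDesc F fun i => f i ≫ DA.dsumι G i
  have hφ : ∀ i x, φ.nub.toLin ((DA.dsumι F i).nub.toLin x)
      = (DA.dsumι G i).nub.toLin ((f i).nub.toLin x) := fun i x =>
    DFunLike.congr_fun (congrArg (fun f => f.nub.toLin)
      (DA.dsumι_desc F (fun i => f i ≫ DA.dsumι G i) i)) x
  have hc : ∀ i x, DGMod.dsumComp (fun i => (G i).nub) i (φ.nub.toLin x)
      = (f i).nub.toLin (DGMod.dsumComp (fun i => (F i).nub) i x) := by
    classical
    intro i x
    induction x using DGMod.dsum_induction with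
    | zero => simp only [map_zero]
    | add a b ha hb => simp only [map_add, ha, hb]
    | mem j x =>
      refine (congrArg _ (hφ j x)).trans ?_
      by_cases h : j = i
      · subst h
        exact (DGMod.dsumComp_ι_self _ _ _).trans
          (congrArg (f j).nub.toLin (DGMod.dsumComp_ι_self (fun i => (F i).nub) j x).symm)
      · exact (DGMod.dsumComp_ι_ne _ h _).trans ((map_zero (f i).nub.toLin).symm.trans
          (congrArg (f i).nub.toLin (DGMod.dsumComp_ι_ne (fun i => (F i).nub) h x).symm))
  rw [homologyIso_iff_of_injective ((DA.mono_iff _).1 hm)]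
  intro z x hz
  have key : ∀ i, ∃ x' z', DGMod.dsumComp (fun i => (G i).nub) i z
      = (f i).nub.toLin x' + (G i).nub.d z' := fun i => by
    have hmi : Mono (f i) := (hf i).1
    refine (homologyIso_iff_of_injective ((DA.mono_iff (f i)).1 hmi)).1 (hf i).2 _
      (DGMod.dsumComp (fun i => (F i).nub) i x) ?_
    rw [← hc]
    exact (DGMod.dsumComp_d (fun i => (G i).nub) i z).symm.trans
      (congrArg (DGMod.dsumComp (fun i => (G i).nub) i) hz)
  choose x' z' h using key
  obtain ⟨s, hs⟩ := DGMod.dsum_sum (fun i => (G i).nub) z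
  refine ⟨∑ i ∈ s, (DA.dsumι F i).nub.toLin (x' i), ∑ i ∈ s, (DA.dsumι G i).nub.toLin (z' i), ?_⟩
  refine hs.trans ?_
  rw [map_sum, map_sum, ← Finset.sum_add_distrib]
  refine Finset.sum_congr rfl fun i _ => ?_
  rw [h i, map_add]
  refine congrArg₂ (· + ·) (hφ i _).symm ?_
  exact (DA.dsumι G i).nub.map_d _

instance : trivialMono.IsStableUnderCoproducts.{0} where
  isStableUnderCoproductsOfShape ι := by
    refine MorphismProperty.IsStableUnderCoproductsOfShape.mk (W := trivialMono) ι fun F G _ _ f hf => ?_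
    have hm : ∀ i, Mono (f i) := fun i => (hf i).1
    let e : Arrow.mk (Limits.Sigma.map f) ≅ Arrow.mk (DA.dsumDesc F fun i => f i ≫ DA.dsumι G i) :=
      Arrow.isoMk ((coproductIsCoproduct F).coconePointUniqueUpToIso (DA.dsumIsColimit F))
        ((coproductIsCoproduct G).coconePointUniqueUpToIso (DA.dsumIsColimit G)) (by
          refine Limits.Sigma.hom_ext _ _ fun i => ?_
          have h1 := IsColimit.comp_coconePointUniqueUpToIso_hom (coproductIsCoproduct F)
            (DA.dsumIsColimit F) ⟨i⟩
          have h2 := IsColimit.comp_coconePointUniqueUpToIso_hom (coproductIsCoproduct G)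
            (DA.dsumIsColimit G) ⟨i⟩
          dsimp at h1 h2 ⊢
          rw [reassoc_of% h1, Limits.Sigma.ι_map_assoc, h2]
          exact DA.dsumι_desc F _ i)
    refine (trivialMono.arrow_mk_iso_iff e).2 ⟨?_, ?_⟩
    · exact ((MorphismProperty.monomorphisms DA).arrow_mk_iso_iff e).1
        (inferInstanceAs (Mono (Limits.Sigma.map f)))
    · exact homologyIso_dsum f hf (((MorphismProperty.monomorphisms DA).arrow_mk_iso_iff e).1
        (inferInstanceAs (Mono (Limits.Sigma.map f))))

/-- The small object argument presents these maps as retracts of transfinite compositions of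
pushouts of coproducts of maps in `J`, and trivial monomorphisms are closed under all four
operations. -/
theorem llp_rlp_le_trivialMono {J : MorphismProperty DA}
    [MorphismProperty.HasSmallObjectArgument.{0} J] (hJ : J ≤ trivialMono) :
    J.rlp.llp ≤ trivialMono := by
  rw [MorphismProperty.llp_rlp_of_hasSmallObjectArgument.{0}]
  trans (MorphismProperty.transfiniteCompositions.{0}
    (MorphismProperty.coproducts.{0} trivialMono).pushouts).retracts
  · exact MorphismProperty.retracts_monotone (MorphismProperty.transfiniteCompositions_monotone
      (MorphismProperty.pushouts_monotone (MorphismProperty.coproducts_monotone hJ)))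
  · simp

/-- A small set of monomorphisms permits the small object argument. -/
theorem hasSmallObjectArgument_of_mono (I : MorphismProperty DA) [MorphismProperty.IsSmall.{0} I]
    (hI : I ≤ MorphismProperty.monomorphisms DA) :
    MorphismProperty.HasSmallObjectArgument.{0} I := by
  -- The regular cardinal `κ` must exceed the number of subobjects of every source; then maps out of
  -- the source commute with colimits of `κ`-indexed chains of monomorphisms.
  let T : Type 1 := Σ f : Shrink.{0} I.toSet, Subobject ((equivShrink _).symm f).1.left
  have : Small.{0} T := inferInstance
  obtain ⟨κ, hκ', hκ⟩ := HasCardinalLT.exists_regular_cardinal.{0} T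
  have : Fact κ.IsRegular := ⟨hκ'⟩
  have : Nonempty κ.ord.ToType := by simpa using hκ'.ne_zero
  have := WellFoundedLT.toOrderBot κ.ord.ToType
  exact ⟨κ, inferInstance, inferInstance,
    { preservesColimit {A B X Y} i hi f hf := by
        let hf' : (MorphismProperty.monomorphisms DA).TransfiniteCompositionOfShape κ.ord.ToType f :=
          { toTransfiniteCompositionOfShape := hf.toTransfiniteCompositionOfShape
            map_mem j hj := by
              have := (hf.attachCells j hj).pushouts_coproducts
              simp only [MorphismProperty.ofHoms_homFamily] at this
              refine (?_ : _ ≤ MorphismProperty.monomorphisms DA) _ this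
              simp only [MorphismProperty.pushouts_le_iff, MorphismProperty.coproducts_le_iff]
              exact hI }
        have (j j' : κ.ord.ToType) (φ : j ⟶ j') : Mono (hf'.F.map φ) := hf'.mem_map φ
        apply IsGrothendieckAbelian.preservesColimit_coyoneda_obj_of_mono (Y := hf'.F) (κ := κ)
        let a : I.toSet := ⟨Arrow.mk i, hi⟩
        let e : A ≅ ((equivShrink I.toSet).symm (equivShrink I.toSet a)).1.left :=
          eqToIso (by rw [Equiv.symm_apply_apply]; rfl)
        refine hκ.of_injective (fun s => (⟨equivShrink _ a,
          (Subobject.mapIsoToOrderIso e) s⟩ : T)) fun s t h => ?_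
        exact (Subobject.mapIsoToOrderIso e).injective (eq_of_heq (Sigma.mk.inj h).2) }⟩

/-! ### Cardinality bounds -/

namespace DA

open Cardinal

/-- A cardinal that bounds the sizes of `OF` and of the generators. -/
structure IsLarge (κ : Cardinal.{0}) : Prop where
  aleph0_le : ℵ₀ ≤ κ
  ring_le : #OF ≤ κ
  gen_le : ∀ D, #(gen D).nub ≤ κ

theorem exists_isLarge {ι : Type} (B : ι → DA) :
    ∃ κ : Cardinal.{0}, IsLarge κ ∧ ∀ i, #(B i).nub ≤ κ := by
  refine ⟨max (max ℵ₀ #OF) (max #(Σ D, (gen D).nub) #(Σ i, (B i).nub)),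
    ⟨(le_max_left _ _).trans (le_max_left _ _), (le_max_right _ _).trans (le_max_left _ _),
      fun D => ?_⟩, fun i => ?_⟩
  · exact (mk_le_of_injective (sigma_mk_injective (i := D))).trans
      ((le_max_left _ _).trans (le_max_right _ _))
  · exact (mk_le_of_injective (sigma_mk_injective (i := i))).trans
      ((le_max_right _ _).trans (le_max_right _ _))

instance : Nontrivial OF := ⟨0, 1, fun h => by
  have := congrArg (compAt ⟨⊥, inferInstance⟩) h
  simp at this⟩

variable {κ : Cardinal.{0}} {A X Y Z : DA}

theorem IsLarge.card_span (hκ : IsLarge κ) {M : Type} [AddCommGroup M] [Module OF M] {s : Set M}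
    (hs : #s ≤ κ) : #(Submodule.span OF s) ≤ κ := by
  have : Infinite κ.out := by rw [infinite_iff, mk_out]; exact hκ.aleph0_le
  have h1 : #(s →₀ OF) ≤ κ := by
    rw [← mk_out κ, le_def] at hs
    obtain ⟨e⟩ := hs
    calc #(s →₀ OF) ≤ #(κ.out →₀ OF) :=
          mk_le_of_injective (Finsupp.mapDomain_injective e.injective)
      _ = max #κ.out #OF := mk_finsupp_of_infinite _ _
      _ ≤ κ := by rw [mk_out]; exact max_le le_rfl hκ.ring_le
  have h2 : #(LinearMap.range (Finsupp.linearCombination OF ((↑) : s → M))) ≤ κ :=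
    mk_range_le.trans h1
  rwa [Finsupp.range_linearCombination, Subtype.range_coe] at h2

theorem IsLarge.card_iSup (hκ : IsLarge κ) {ι : Type} (hι : #ι ≤ κ) (T : ι → Sub A)
    (hT : ∀ i, #(T i).nub ≤ κ) : #(Sub.iSup T).nub ≤ κ := by
  change #(⨆ i, (T i).nub : Submodule OF A.nub) ≤ κ
  rw [Submodule.iSup_eq_span]
  refine hκ.card_span ?_
  calc _ ≤ #ι * ⨆ i, #(T i).nub := mk_iUnion_le _
    _ ≤ κ * κ := mul_le_mul' hι (ciSup_le' hT)
    _ = κ := mul_eq_self hκ.aleph0_le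

/-- A homogeneous element lies in the image of a single generator, which has at most `κ` elements;
sums are handled by suprema of two subobjects. -/
theorem IsLarge.exists_mem (hκ : IsLarge κ) (x : A.nub) : ∃ T : Sub A, x ∈ T.nub ∧ #T.nub ≤ κ := by
  induction x using homogeneous_induction A.nub.isInternal with
  | zero =>
    refine ⟨Sub.range (0 : A ⟶ A), zero_mem _, ?_⟩
    have : #(LinearMap.range (0 : A.nub →ₗ[OF] A.nub)) ≤ κ := by
      rw [LinearMap.range_zero, mk_eq_one]
      exact one_le_aleph0.trans hκ.aleph0_le
    exact this
  | add a b ha hb =>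
    obtain ⟨S, hS, hS'⟩ := ha
    obtain ⟨T, hT, hT'⟩ := hb
    let F : Bool → Sub A := fun b => if b then S else T
    refine ⟨Sub.iSup F, add_mem ?_ ?_, hκ.card_iSup ((mk_le_aleph0).trans hκ.aleph0_le) F ?_⟩
    · exact (le_iSup (fun i => (F i).nub) true) hS
    · exact (le_iSup (fun i => (F i).nub) false) hT
    · intro b
      cases b
      exacts [hT', hS']
  | mem n x hx =>
    obtain ⟨D, f, z, rfl⟩ := A.exists_gen_hom hx
    exact ⟨Sub.range f, ⟨z, rfl⟩, mk_range_le.trans (hκ.gen_le D)⟩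

theorem IsLarge.exists_superset (hκ : IsLarge κ) {s : Set A.nub} (hs : #s ≤ κ) :
    ∃ T : Sub A, s ⊆ T.nub ∧ #T.nub ≤ κ := by
  choose T hT hT' using fun x : s => hκ.exists_mem (A := A) x
  exact ⟨Sub.iSup T, fun x hx => (le_iSup (fun i => (T i).nub) ⟨x, hx⟩) (hT ⟨x, hx⟩),
    hκ.card_iSup hs T hT'⟩

theorem IsLarge.exists_step (hκ : IsLarge κ) {j : X ⟶ Z}
    (hj : ∀ z x, Z.nub.d z = j.nub.toLin x → ∃ x' w, z = j.nub.toLin x' + Z.nub.d w)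
    (T : Sub Z) (hT : #T.nub ≤ κ) : ∃ T' : Sub Z, #T'.nub ≤ κ ∧ T.nub ≤ T'.nub ∧
      ∀ z ∈ T.nub, ∀ x, Z.nub.d z = j.nub.toLin x →
        ∃ x', ∃ w ∈ T'.nub, z = j.nub.toLin x' + Z.nub.d w := by
  -- The required equation does not involve `x`, so one witness `w` for each `z` is enough and at
  -- most `κ` elements are added.
  have key : ∀ z : T.nub, ∃ w, ∀ x, Z.nub.d z = j.nub.toLin x →
      ∃ x', (z : Z.nub) = j.nub.toLin x' + Z.nub.d w := by
    intro z
    by_cases h : ∃ x, Z.nub.d z = j.nub.toLin x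
    · obtain ⟨x, hx⟩ := h
      obtain ⟨x', w, hw⟩ := hj z x hx
      exact ⟨w, fun _ _ => ⟨x', hw⟩⟩
    · exact ⟨0, fun x hx => absurd ⟨x, hx⟩ h⟩
  choose w hw using key
  obtain ⟨T', h1, h2⟩ := hκ.exists_superset (A := Z) (s := (T.nub : Set Z.nub) ∪ Set.range w) (by
    calc _ ≤ #T.nub + #(Set.range w) := mk_union_le _ _
      _ ≤ κ + κ := add_le_add hT (mk_range_le.trans hT)
      _ = κ := add_eq_self hκ.aleph0_le)
  refine ⟨T', h2, fun z hz => h1 (Or.inl hz), fun z hz x hx => ?_⟩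
  obtain ⟨x', hx'⟩ := hw ⟨z, hz⟩ x hx
  exact ⟨x', w ⟨z, hz⟩, h1 (Or.inr ⟨_, rfl⟩), hx'⟩

/-- The step is iterated over the natural numbers. Each element of the union lies in one stage, and
its witness lies in the next. -/
theorem IsLarge.exists_closed (hκ : IsLarge κ) {j : X ⟶ Z}
    (hj : ∀ z x, Z.nub.d z = j.nub.toLin x → ∃ x' w, z = j.nub.toLin x' + Z.nub.d w)
    {s : Set Z.nub} (hs : #s ≤ κ) : ∃ T : Sub Z, #T.nub ≤ κ ∧ s ⊆ T.nub ∧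
      ∀ z ∈ T.nub, ∀ x, Z.nub.d z = j.nub.toLin x →
        ∃ x', ∃ w ∈ T.nub, z = j.nub.toLin x' + Z.nub.d w := by
  choose g hg1 hg2 hg3 using hκ.exists_step hj
  obtain ⟨T₀, h0, h0'⟩ := hκ.exists_superset hs
  let t : ℕ → {T : Sub Z // #T.nub ≤ κ} := fun n =>
    Nat.rec ⟨T₀, h0'⟩ (fun _ T => ⟨g T.1 T.2, hg1 T.1 T.2⟩) n
  have hmono : Monotone fun n => (t n).1.nub := monotone_nat_of_le_succ fun n => hg2 _ _
  refine ⟨Sub.iSup fun n => (t n).1, hκ.card_iSup (mk_le_aleph0.trans hκ.aleph0_le) _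
    fun n => (t n).2, fun x hx => (le_iSup (fun n => (t n).1.nub) 0) (h0 hx), ?_⟩
  intro z hz x hx
  obtain ⟨n, hn⟩ := (Submodule.mem_iSup_of_directed _ hmono.directed_le).1 hz
  obtain ⟨x', w, hw, h⟩ := hg3 (t n).1 (t n).2 z hn x hx
  exact ⟨x', w, (le_iSup (fun n => (t n).1.nub) (n + 1)) hw, h⟩

variable (κ) in
/-- A coproduct of generators that maps onto all small objects. -/
noncomputable def cover : DA := dsum fun a : κ.out × MatData => gen a.2

/-- The factor `κ.out` names the elements of `Z`. The summand at `(a, D)` is mapped so as to hit the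
element named by `a`, if some map out of `gen D` does; this reaches all homogeneous elements, and
they span. -/
theorem exists_cover_hom (h : #Z.nub ≤ κ) :
    ∃ f : cover κ ⟶ Z, Function.Surjective f.nub.toLin := by
  classical
  have : Nonempty Z.nub := ⟨0⟩
  rw [← mk_out κ] at h
  obtain ⟨e⟩ := h
  let g : κ.out → Z.nub := Function.invFun e
  have hg : Function.Surjective g := Function.invFun_surjective e.injective
  let f : ∀ a : κ.out × MatData, gen a.2 ⟶ Z := fun a =>
    if h : ∃ k : gen a.2 ⟶ Z, g a.1 ∈ LinearMap.range k.nub.toLin then h.choose else 0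
  refine ⟨dsumDesc _ f, fun z => ?_⟩
  induction z using homogeneous_induction Z.nub.isInternal with
  | zero => exact ⟨0, map_zero _⟩
  | add a b ha hb =>
    obtain ⟨a, rfl⟩ := ha
    obtain ⟨b, rfl⟩ := hb
    exact ⟨a + b, map_add _ _ _⟩
  | mem n z hz =>
    obtain ⟨D, k, y, hy⟩ := Z.exists_gen_hom hz
    obtain ⟨a, rfl⟩ := hg z
    have h1 : ∃ k : gen (a, D).2 ⟶ Z, g (a, D).1 ∈ LinearMap.range k.nub.toLin := ⟨k, y, hy⟩
    obtain ⟨w, hw⟩ := h1.choose_spec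
    refine ⟨(dsumι (fun a : κ.out × MatData => gen a.2) (a, D)).nub.toLin w, ?_⟩
    have h2 := DFunLike.congr_fun (congrArg (fun f => f.nub.toLin)
      (dsumι_desc (fun a : κ.out × MatData => gen a.2) f (a, D))) w
    refine h2.trans (Eq.trans ?_ hw)
    exact congrArg (fun k : gen D ⟶ Z => k.nub.toLin w) (dif_pos h1)

theorem Sub.vertex_mem (T : Sub A) (f : X ⟶ A) (h : ∀ x, f.nub.toLin x ∈ T.nub) (v : X.vertex) :
    f.vertex.toLin v ∈ T.vertex := by
  obtain ⟨s, hs, x, hx⟩ := X.fraction v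
  have h1 := T.le_ker (h x)
  rw [LinearMap.mem_ker, LinearMap.comp_apply, f.comm, hx, extendL_smul_one, extendL_smul_one] at h1
  exact (Submodule.Quotient.mk_eq_zero _).1 (one_tmul_injective (euler_smul_eq_zero hs h1))

/-- The isomorphism of a quotient with the image. -/
theorem exists_iso_quot (f : A ⟶ Z) (hf : Function.Surjective f.nub.toLin) :
    Nonempty ((Sub.ker f).quot ≅ Z) := by
  let g : (Sub.ker f).quot ⟶ Z := (Sub.ker f).desc f le_rfl le_rfl
  have hg : ∀ x, g.nub.toLin ((Sub.ker f).proj.nub.toLin x) = f.nub.toLin x := fun x =>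
    DFunLike.congr_fun (congrArg (fun f => f.nub.toLin) ((Sub.ker f).proj_desc f le_rfl le_rfl)) x
  have := isIso_of_bijective g ⟨(injective_iff_map_eq_zero _).2 fun y hy => by
      obtain ⟨x, rfl⟩ := (Sub.ker f).proj_surjective y
      exact (Sub.ker f).proj_eq_zero.2 ((hg x).symm.trans hy),
    fun z => by
      obtain ⟨x, rfl⟩ := hf z
      exact ⟨_, hg x⟩⟩
  exact ⟨asIso g⟩

theorem exists_iso_range (f : A ⟶ Z) (hf : Function.Injective f.nub.toLin) :
    ∃ e : A ≅ (Sub.range f).toDA, e.hom ≫ (Sub.range f).incl = f := by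
  let g : A ⟶ (Sub.range f).toDA := (Sub.range f).lift f (fun x => ⟨x, rfl⟩) (fun x => ⟨x, rfl⟩)
  have := isIso_of_bijective g ⟨fun x y h => hf (congrArg Subtype.val h),
    fun ⟨_, x, hx⟩ => ⟨x, Subtype.ext hx⟩⟩
  exact ⟨asIso g, (Sub.range f).lift_incl f _ _⟩

end DA

/-! ### The solution set condition -/

/-- The trivial monomorphisms into the quotients of `F`. -/
def smallTrivialMono (F : DA) : MorphismProperty DA :=
  .ofHoms fun a : Σ K : DA.Sub F, {X : DA.Sub K.quot // homologyIso X.incl} => a.2.1.incl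

/-- Up to isomorphism `Z` is the quotient of `F` by the kernel of `f`, and `X` is a subobject of
that quotient. Both data range over a small set once `F` is fixed. -/
theorem exists_smallTrivialMono {F X Z : DA} (k : X ⟶ Z) (hk : trivialMono k) (f : F ⟶ Z)
    (hf : Function.Surjective f.nub.toLin) :
    ∃ (X' Z' : DA) (k' : X' ⟶ Z'), smallTrivialMono F k' ∧ Nonempty (Arrow.mk k ≅ Arrow.mk k') := by
  obtain ⟨e⟩ := DA.exists_iso_quot f hf
  have hm : Mono k := hk.1
  obtain ⟨e', he'⟩ := DA.exists_iso_range (k ≫ e.inv) ((DA.mono_iff _).1 inferInstance)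
  let E : Arrow.mk k ≅ Arrow.mk (DA.Sub.range (k ≫ e.inv)).incl := Arrow.isoMk e' e.symm he'
  have hW : homologyIso (DA.Sub.range (k ≫ e.inv)).incl :=
    (homologyIso.arrow_mk_iso_iff E).1 hk.2
  exact ⟨_, _, _, ⟨(⟨DA.Sub.ker f, ⟨_, hW⟩⟩ :
    Σ K : DA.Sub F, {X : DA.Sub K.quot // homologyIso X.incl})⟩, ⟨E⟩⟩

open Cardinal in
/-- Squares from monomorphisms with small target to homology isomorphisms factor through small
trivial monomorphisms. -/
theorem exists_factorization (hE : ∀ E : DA, Injective E → E.nub.Acyclic) {κ : Cardinal.{0}}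
    (hκ : DA.IsLarge κ) {A B X Y : DA} (i : A ⟶ B) [Mono i] (hB : #B.nub ≤ κ) (p : X ⟶ Y)
    (hp : homologyIso p) (u : A ⟶ X) (v : B ⟶ Y) (sq : u ≫ p = i ≫ v) :
    ∃ (X' Z' : DA) (k : X' ⟶ Z') (_ : smallTrivialMono (DA.cover κ) k) (u₁ : A ⟶ X') (v₁ : B ⟶ Z')
      (u₂ : X' ⟶ X) (v₂ : Z' ⟶ Y), u₁ ≫ u₂ = u ∧ v₁ ≫ v₂ = v ∧ u₁ ≫ k = i ≫ v₁ ∧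
        u₂ ≫ p = k ≫ v₂ := by
  -- Replacing `Y` by `Y ⊞ E` turns `p` into a monomorphism `j` without changing homology, as `E` is
  -- acyclic; the map from `B` extends to `Y ⊞ E` because `E` is injective.
  let E := Injective.under X
  have hfst : homologyIso (biprod.fst : Y ⊞ E ⟶ Y) := by
    rw [homologyIso_iff_of_surjective fun y => ⟨DA.pair y 0, DA.fst_pair _ _⟩]
    intro t ht hdt
    obtain ⟨e, he⟩ := hE E inferInstance ((biprod.snd : Y ⊞ E ⟶ E).nub.toLin t) (by
      rw [← (biprod.snd : Y ⊞ E ⟶ E).nub.map_d, hdt, map_zero])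
    refine ⟨DA.pair 0 e, DA.fst_pair _ _, ?_⟩
    rw [← DA.pair_fst_snd t, ht, ← he, DA.pair, map_zero, zero_add, DA.pair, map_zero, zero_add]
    exact ((biprod.inr : E ⟶ Y ⊞ E).nub.map_d e).symm
  let j : X ⟶ Y ⊞ E := biprod.lift p (Injective.ι X)
  have hjs : j ≫ biprod.snd = Injective.ι X := biprod.lift_snd _ _
  have hjf : j ≫ biprod.fst = p := biprod.lift_fst _ _
  have hjm : Mono j := by
    have : Mono (j ≫ biprod.snd) := by rw [hjs]; infer_instance
    exact mono_of_mono j biprod.snd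
  have hji := (DA.mono_iff j).1 hjm
  have hj : homologyIso j := homologyIso.of_postcomp j biprod.fst hfst (by rwa [hjf])
  have hj' := (homologyIso_iff_of_injective hji).1 hj
  let v' : B ⟶ Y ⊞ E := biprod.lift v (Injective.factorThru (u ≫ Injective.ι X) i)
  have hv' : i ≫ v' = u ≫ j := by
    apply biprod.hom_ext
    · rw [Category.assoc, Category.assoc, hjf, biprod.lift_fst, sq]
    · rw [Category.assoc, Category.assoc, hjs, biprod.lift_snd, Injective.comp_factorThru]
  -- The subobject `T` contains the image of `B` and the boundary witnesses which show that `j` is a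
  -- homology isomorphism, and it is still small.
  obtain ⟨T, hT, hs, hcl⟩ := hκ.exists_closed hj' (s := Set.range v'.nub.toLin)
    (mk_range_le.trans hB)
  have hvT : ∀ x, v'.nub.toLin x ∈ T.nub := fun x => hs ⟨x, rfl⟩
  let v₁ : B ⟶ T.toDA := T.lift v' hvT (T.vertex_mem v' hvT)
  have hv₁ : v₁ ≫ T.incl = v' := T.lift_incl _ _ _
  -- This is the intersection of `T` with the image of `X`. The closure property of `T` makes its
  -- inclusion in `T` a homology isomorphism.
  let K := DA.Sub.ker (T.incl ≫ (DA.Sub.range j).proj)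
  let k : K.toDA ⟶ T.toDA := K.incl
  have hkm : Mono k := (DA.mono_iff _).2 K.incl_injective
  have hTm : Mono T.incl := (DA.mono_iff _).2 T.incl_injective
  have hK : ∀ x : T.toDA.nub, x ∈ K.nub ↔ T.incl.nub.toLin x ∈ LinearMap.range j.nub.toLin :=
    fun x => (DA.Sub.range j).proj_eq_zero
  have huK : ∀ x, (i ≫ v₁).nub.toLin x ∈ K.nub := fun x => (hK _).2 (by
    refine ⟨u.nub.toLin x, ?_⟩
    have := DFunLike.congr_fun (congrArg (fun f => f.nub.toLin) hv') x
    exact this.symm)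
  let u₁ : A ⟶ K.toDA := K.lift (i ≫ v₁) huK (K.vertex_mem _ huK)
  have hu₁ : u₁ ≫ k = i ≫ v₁ := K.lift_incl _ _ _
  -- A monomorphism is the kernel of its cokernel, so `K` maps to `X`.
  let l := Abelian.monoIsKernelOfCokernel _ (DA.cokerIsColimit j)
  have hkl : (k ≫ T.incl) ≫ (DA.Sub.range j).proj = 0 := by
    rw [Category.assoc]
    exact DA.Sub.ker_incl_comp _
  obtain ⟨u₂, hu₂⟩ := KernelFork.IsLimit.lift' l (k ≫ T.incl) hkl
  replace hu₂ : u₂ ≫ j = k ≫ T.incl := hu₂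
  have hkW : trivialMono k := by
    refine ⟨hkm, (homologyIso_iff_of_injective K.incl_injective).2 fun z x hz => ?_⟩
    obtain ⟨x₀, hx₀⟩ := (hK _).1 x.2
    obtain ⟨x', w, hw, h⟩ := hcl _ z.2 x₀ ((congrArg Subtype.val hz).trans hx₀.symm)
    have hx' : j.nub.toLin x' ∈ T.nub := by
      rw [← sub_eq_iff_eq_add.2 h]
      exact sub_mem z.2 (T.isSub_nub.d w hw)
    exact ⟨⟨⟨j.nub.toLin x', hx'⟩, (hK _).2 ⟨x', rfl⟩⟩, ⟨w, hw⟩, Subtype.ext h⟩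
  obtain ⟨f, hf⟩ := DA.exists_cover_hom (κ := κ) (Z := T.toDA) hT
  obtain ⟨X', Z', k', hk', ⟨e⟩⟩ := exists_smallTrivialMono k hkW f hf
  refine ⟨X', Z', k', hk', u₁ ≫ e.hom.left, v₁ ≫ e.hom.right, e.inv.left ≫ u₂,
    e.inv.right ≫ T.incl ≫ biprod.fst, ?_, ?_, ?_, ?_⟩
  · rw [← cancel_mono j]
    have : e.hom.left ≫ e.inv.left = 𝟙 _ := congrArg (fun f => Arrow.leftFunc.map f) e.hom_inv_id
    simp only [Category.assoc]
    rw [reassoc_of% this, hu₂, reassoc_of% hu₁, hv₁, hv']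
  · have : e.hom.right ≫ e.inv.right = 𝟙 _ := congrArg (fun f => Arrow.rightFunc.map f) e.hom_inv_id
    simp only [Category.assoc]
    rw [reassoc_of% this, reassoc_of% hv₁]
    exact biprod.lift_fst _ _
  · have := Arrow.w e.hom
    dsimp at this
    rw [Category.assoc, this, reassoc_of% hu₁]
  · have := Arrow.w e.inv
    dsimp at this
    rw [Category.assoc, ← hjf, reassoc_of% hu₂, reassoc_of% this]

/-! ### Pushout products with the inclusions of spheres in disks -/

theorem exists_pushoutProduct {A B K M : DA} (f : A ⟶ B) (k : K ⟶ M) :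
    ∃ (T : DA) (a : B ⊗ K ⟶ T) (b : A ⊗ M ⟶ T) (h : T ⟶ B ⊗ M),
      IsPushout (f ▷ K) (A ◁ k) a b ∧ a ≫ h = B ◁ k ∧ b ≫ h = f ▷ M ∧
      ∀ W : MorphismProperty DA,
        W ((Arrow.pushoutProduct.obj (Arrow.mk f)).obj (Arrow.mk k)).hom ↔ W h := by
  refine ⟨_, pushout.inl (f ▷ K) (A ◁ k), pushout.inr (f ▷ K) (A ◁ k),
    ((Arrow.pushoutProduct.obj (Arrow.mk f)).obj (Arrow.mk k)).hom,
    IsPushout.of_hasPushout _ _, ?_, ?_, fun W => Iff.rfl⟩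
  · exact (Functor.PushoutObjObj.ofHasPushout (curriedTensor DA) f k).inl_ι
  · exact (Functor.PushoutObjObj.ofHasPushout (curriedTensor DA) f k).inr_ι

/-- The images of `B ⊗ K` and `A ⊗ M` in `B ⊗ M` meet only in `A ⊗ K`: the retraction `r` shows that
`y` comes from `A ⊗ K`, and flatness of `B` then identifies `x`. This is the injectivity of a
pushout product when one of the maps is split as a map of modules. -/
theorem exists_of_lTensor_add_rTensor_eq_zero {R A B K M : Type} [CommRing R] [AddCommGroup A]
    [AddCommGroup B] [AddCommGroup K] [AddCommGroup M] [Module R A] [Module R B] [Module R K]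
    [Module R M] {f : A →ₗ[R] B} {k : K →ₗ[R] M} {r : B →ₗ[R] A} (hr : r.comp f = LinearMap.id)
    [Module.Flat R B] (hk : Function.Injective k) {x : B ⊗[R] K} {y : A ⊗[R] M}
    (h : LinearMap.lTensor B k x + LinearMap.rTensor M f y = 0) :
    ∃ z, x = LinearMap.rTensor K f z ∧ y = -LinearMap.lTensor A k z := by
  have h2 : LinearMap.rTensor M r (LinearMap.rTensor M f y) = y := by
    rw [← LinearMap.comp_apply, ← LinearMap.rTensor_comp, hr, LinearMap.rTensor_id_apply]
  have h3 : LinearMap.rTensor M r (LinearMap.lTensor B k x)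
      = LinearMap.lTensor A k (LinearMap.rTensor K r x) := by
    rw [← LinearMap.comp_apply, ← LinearMap.comp_apply, LinearMap.rTensor_comp_lTensor,
      LinearMap.lTensor_comp_rTensor]
  have h4 : y = -LinearMap.lTensor A k (LinearMap.rTensor K r x) := by
    conv_lhs => rw [← h2]
    rw [← h3, eq_neg_iff_add_eq_zero, ← map_add, add_comm, h, map_zero]
  have h5 (w : A ⊗[R] K) : LinearMap.rTensor M f (LinearMap.lTensor A k w)
      = LinearMap.lTensor B k (LinearMap.rTensor K f w) := by
    rw [← LinearMap.comp_apply, ← LinearMap.comp_apply, LinearMap.rTensor_comp_lTensor,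
      LinearMap.lTensor_comp_rTensor]
  refine ⟨_, Module.Flat.lTensor_preserves_injective_linearMap (M := B) _ hk ?_, h4⟩
  rw [eq_neg_of_add_eq_zero_left h, h4, map_neg, neg_neg, h5]

namespace DA

section

variable {A B K M T : DA} {f : A ⟶ B} {k : K ⟶ M} {a : B ⊗ K ⟶ T} {b : A ⊗ M ⟶ T} {h : T ⟶ B ⊗ M}

theorem pushoutProduct_injective (sq : IsPushout (f ▷ K) (A ◁ k) a b) (ha : a ≫ h = B ◁ k)
    (hb : b ≫ h = f ▷ M) {r : B.nub →ₗ[OF] A.nub} (hr : r.comp f.nub.toLin = LinearMap.id)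
    [Module.Flat OF B.nub] (hk : Function.Injective k.nub.toLin) :
    Function.Injective h.nub.toLin := by
  refine (injective_iff_map_eq_zero _).2 fun t ht => ?_
  obtain ⟨x, y, rfl⟩ := pushout_elements sq t
  rw [map_add] at ht
  obtain ⟨z, hz, hz'⟩ := exists_of_lTensor_add_rTensor_eq_zero hr hk (x := x) (y := y)
    ((congrArg₂ (· + ·) (DFunLike.congr_fun (congrArg (fun g => g.nub.toLin) ha) x).symm
      (DFunLike.congr_fun (congrArg (fun g => g.nub.toLin) hb) y).symm).trans ht)
  have h1 : a.nub.toLin x = b.nub.toLin ((A ◁ k).nub.toLin z) :=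
    (congrArg a.nub.toLin hz).trans (sq_apply sq.w z)
  have h2 : b.nub.toLin y = -b.nub.toLin ((A ◁ k).nub.toLin z) :=
    (congrArg b.nub.toLin hz').trans (map_neg b.nub.toLin _)
  rw [h1, h2, add_neg_cancel]

end

/-- With zero differential on `A`, the differential of `A ⊗ Z` is `1 ⊗ d` followed by the sign
automorphism of `A`, and a flat module preserves the exactness of `d`. -/
theorem acyclic_tensor {A Z : DA} (hA : A.nub.d = 0) [Module.Flat OF A.nub] (hZ : Z.nub.Acyclic) :
    (A ⊗ Z).nub.Acyclic := by
  have key : ∀ t : A.nub ⊗[OF] Z.nub, DGMod.tensorD A.nub Z.nub t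
      = LinearMap.rTensor Z.nub A.nub.sign (LinearMap.lTensor A.nub Z.nub.d t) := fun t => by
    rw [← LinearMap.comp_apply, LinearMap.rTensor_comp_lTensor, DGMod.tensorD, hA]
    simp
  have hs : ∀ (N : Type) [AddCommGroup N] [Module OF N] (t : A.nub ⊗[OF] N),
      LinearMap.rTensor N A.nub.sign (LinearMap.rTensor N A.nub.sign t) = t := fun N _ _ t => by
    have : A.nub.sign.comp A.nub.sign = LinearMap.id := LinearMap.ext A.nub.sign_sign
    rw [← LinearMap.comp_apply, ← LinearMap.rTensor_comp, this, LinearMap.rTensor_id_apply]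
  have hex : Function.Exact Z.nub.d Z.nub.d := fun x => ⟨hZ x, by
    rintro ⟨y, rfl⟩
    exact Z.nub.d_d y⟩
  intro t ht
  have h1 : LinearMap.lTensor A.nub Z.nub.d t = 0 := by
    rw [← hs _ (LinearMap.lTensor A.nub Z.nub.d t)]
    exact (congrArg _ ((key t).symm.trans ht)).trans (map_zero _)
  obtain ⟨w, hw⟩ := (Module.Flat.lTensor_exact A.nub hex t).1 h1
  refine ⟨LinearMap.rTensor Z.nub A.nub.sign w, (key _).trans ?_⟩
  rw [← hw]
  conv_rhs => rw [← hs _ (LinearMap.lTensor A.nub Z.nub.d w)]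
  congr 1
  rw [← LinearMap.comp_apply, ← LinearMap.comp_apply, LinearMap.rTensor_comp_lTensor,
    LinearMap.lTensor_comp_rTensor]

theorem homologyIso_of_acyclic {A B : DA} (f : A ⟶ B) (hA : A.nub.Acyclic) (hB : B.nub.Acyclic) :
    homologyIso f := by
  rw [homologyIso_iff, Function.Bijective, DGMod.homologyMap_injective_iff,
    DGMod.homologyMap_surjective_iff]
  refine ⟨fun x _ hx _ => ?_, fun y hy => ?_⟩
  · obtain ⟨z, hz⟩ := hA x hx
    exact ⟨z, hz.symm⟩
  · obtain ⟨z, hz⟩ := hB y hy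
    exact ⟨0, z, map_zero _, by rw [map_zero, zero_add, hz]⟩

theorem acyclic_of_homologyIso {A B : DA} {f : A ⟶ B} (hf : homologyIso f) :
    A.nub.Acyclic ↔ B.nub.Acyclic := by
  rw [homologyIso_iff, Function.Bijective, DGMod.homologyMap_injective_iff,
    DGMod.homologyMap_surjective_iff] at hf
  refine ⟨fun h y hy => ?_, fun h x hx => ?_⟩
  · obtain ⟨x, z, hx, rfl⟩ := hf.2 y hy
    obtain ⟨w, rfl⟩ := h x hx
    exact ⟨f.nub.toLin w + z, by rw [map_add, f.nub.map_d]⟩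
  · obtain ⟨y, hy⟩ := h (f.nub.toLin x) (by rw [← f.nub.map_d, hx, map_zero])
    obtain ⟨z, hz⟩ := hf.1 x y hx hy.symm
    exact ⟨z, hz.symm⟩

/-- An injective map is a homology isomorphism if and only if its cokernel is acyclic. -/
theorem homologyIso_iff_of_exact {A B C : DA} {f : A ⟶ B} {g : B ⟶ C}
    (hf : Function.Injective f.nub.toLin) (hg : Function.Surjective g.nub.toLin)
    (h : Function.Exact f.nub.toLin g.nub.toLin) : homologyIso f ↔ C.nub.Acyclic := by
  rw [homologyIso_iff_of_injective hf]
  refine ⟨fun H c hc => ?_, fun H y x hy => ?_⟩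
  · obtain ⟨y, rfl⟩ := hg c
    obtain ⟨x, hx⟩ := (h (B.nub.d y)).1 (by rw [g.nub.map_d, hc])
    obtain ⟨x', z, rfl⟩ := H y x hx.symm
    exact ⟨g.nub.toLin z, by rw [map_add, h.apply_apply_eq_zero, zero_add, g.nub.map_d]⟩
  · obtain ⟨c, hc⟩ := H (g.nub.toLin y) (by rw [← g.nub.map_d, hy, h.apply_apply_eq_zero])
    obtain ⟨z, rfl⟩ := hg c
    obtain ⟨x', hx'⟩ := (h (y - B.nub.d z)).1 (by rw [map_sub, g.nub.map_d, hc, sub_self])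
    exact ⟨x', z, by rw [hx', sub_add_cancel]⟩

theorem exact_proj_range {A B : DA} (f : A ⟶ B) :
    Function.Exact f.nub.toLin (Sub.range f).proj.nub.toLin := fun _ => (Sub.range f).proj_eq_zero

/-- Tensoring with a flat object with zero differential preserves trivial monomorphisms. -/
theorem trivialMono_whiskerLeft {A K M : DA} (hA : A.nub.d = 0) [Module.Flat OF A.nub]
    {k : K ⟶ M} (hk : trivialMono k) : trivialMono (A ◁ k) := by
  have hki := (mono_iff k).1 hk.1
  have hi : Function.Injective (A ◁ k).nub.toLin :=
    Module.Flat.lTensor_preserves_injective_linearMap (M := A.nub) _ hki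
  refine ⟨(mono_iff _).2 hi, ?_⟩
  have hs := (Sub.range k).proj_surjective
  -- By right exactness the cokernel of `A ⊗ k` is `A` tensored with the cokernel of `k`.
  rw [homologyIso_iff_of_exact (g := A ◁ (Sub.range k).proj) hi
    (LinearMap.lTensor_surjective A.nub hs) (lTensor_exact A.nub (exact_proj_range k) hs)]
  exact acyclic_tensor hA ((homologyIso_iff_of_exact hki hs (exact_proj_range k)).1 hk.2)

end DA

/-- The underlying module of a dualisable object is finitely generated and projective. -/
theorem IsDualisable.exists_dualBasis {P : GrA} (hP : IsDualisable P) :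
    ∃ (ι : Type) (_ : Fintype ι) (x : ι → P.obj.nub) (c : ι → P.obj.nub →ₗ[OF] OF),
      ∀ p, ∑ i, c i p • x i = p := by
  obtain ⟨Q, ⟨_⟩⟩ := hP.exists_exactPairing
  let η : OF →ₗ[OF] Q.obj.nub ⊗[OF] P.obj.nub := (η_ Q P).hom.nub.toLin
  let ε : P.obj.nub ⊗[OF] Q.obj.nub →ₗ[OF] OF := (ε_ Q P).hom.nub.toLin
  have h (p : P.obj.nub) : LinearMap.rTensor P.obj.nub ε
      ((TensorProduct.assoc OF P.obj.nub Q.obj.nub P.obj.nub).symm (p ⊗ₜ[OF] η 1))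
      = (1 : OF) ⊗ₜ[OF] p := by
    have := DFunLike.congr_fun (congrArg (fun f => f.hom.nub.toLin)
      (ExactPairing.coevaluation_evaluation Q P)) (p ⊗ₜ[OF] (1 : OF))
    exact this.trans (congrArg (fun q : P.obj.nub => (1 : OF) ⊗ₜ[OF] q) (one_smul OF p))
  -- If `η 1 = ∑ q i ⊗ x i`, a triangle identity reads `p = ∑ ε (p ⊗ q i) • x i`, so the `x i` and
  -- the functionals `ε (- ⊗ q i)` form a dual basis.
  obtain ⟨s, hs⟩ := TensorProduct.exists_finset (η 1)
  refine ⟨s, inferInstance, fun i => i.1.2,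
    fun i => ε.comp ((TensorProduct.mk OF P.obj.nub Q.obj.nub).flip i.1.1), fun p => ?_⟩
  have := congrArg (TensorProduct.lid OF P.obj.nub) (h p)
  rw [hs, ← Finset.sum_coe_sort, TensorProduct.tmul_sum] at this
  simpa using this

theorem IsDualisable.flat {P : GrA} (hP : IsDualisable P) : Module.Flat OF P.obj.nub := by
  obtain ⟨ι, _, x, c, h⟩ := hP.exists_dualBasis
  refine Module.Flat.of_retract (R := OF) (M := ι → OF) (LinearMap.pi c)
    (Fintype.linearCombination OF x) (LinearMap.ext fun p => ?_)
  simpa [Fintype.linearCombination_apply] using h p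

theorem acyclic_disk_tensor (n : ℤ) (Z : DA) : (free.obj (disk n) ⊗ Z).nub.Acyclic :=
  fun t ht => (isDisk n).nub.exact Z.nub t ht

theorem acyclic_disk_tensor_tensor (n : ℤ) (P Z : DA) :
    ((free.obj (disk n) ⊗ P) ⊗ Z).nub.Acyclic :=
  (DA.acyclic_of_homologyIso (f := (α_ (free.obj (disk n)) P Z).hom)
    (MorphismProperty.of_isIso homologyIso _)).2 (acyclic_disk_tensor n (P ⊗ Z))

/-- A linear retraction of `S^(n-1) ⊗ P → D^n ⊗ P`. -/
noncomputable def diskRetraction (n : ℤ) (P : DA) :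
    (free.obj (disk n) ⊗ P).nub →ₗ[OF] (free.obj (sphere (n - 1)) ⊗ P).nub :=
  (isDisk n).nub.lin (N := P.nub) 0
    (TensorProduct.mk OF (free.obj (sphere (n - 1))).nub P.nub (isSphere (n - 1)).nub.w)

/-- The splitting is only linear, since it cannot commute with the differentials in general;
linearity is all that the injectivity of pushout products requires. -/
theorem diskRetraction_comp (n : ℤ) (P : DA) :
    (diskRetraction n P).comp (sphereInDisk n ▷ P).nub.toLin = LinearMap.id :=
  (isSphere (n - 1)).nub.ext (N := P.nub) fun x =>
    (isDisk n).nub.lin_v (N := P.nub) 0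
      (TensorProduct.mk OF (free.obj (sphere (n - 1))).nub P.nub (isSphere (n - 1)).nub.w) x

theorem sphereInDisk_whiskerRight_injective (n : ℤ) (P : DA) :
    Function.Injective (sphereInDisk n ▷ P).nub.toLin :=
  Function.LeftInverse.injective (g := diskRetraction n P)
    (DFunLike.congr_fun (diskRetraction_comp n P))

theorem zeroDiff_sphere_tensor (n : ℤ) {P : DA} (hP : zeroDiff P) :
    zeroDiff (free.obj (sphere n) ⊗ P) :=
  ⟨tensorD_zero (isSphere n).zeroDiff_obj.1 hP.1, tensorD_zero (isSphere n).zeroDiff_obj.2 hP.2⟩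

theorem flat_sphere_tensor (n : ℤ) (P : DA) [Module.Flat OF P.nub] :
    Module.Flat OF (free.obj (sphere n) ⊗ P).nub := by
  have := (isSphere n).nub.flat
  exact inferInstanceAs (Module.Flat OF ((free.obj (sphere n)).nub ⊗[OF] P.nub))

theorem flat_disk_tensor (n : ℤ) (P : DA) [Module.Flat OF P.nub] :
    Module.Flat OF (free.obj (disk n) ⊗ P).nub := by
  have := (isDisk n).nub.flat
  exact inferInstanceAs (Module.Flat OF ((free.obj (disk n)).nub ⊗[OF] P.nub))

section

variable {K M : DA} {k : K ⟶ M} (n : ℤ) {P : DA}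

theorem mono_sphereInDisk_pushoutProduct [Module.Flat OF P.nub]
    (hk : MorphismProperty.monomorphisms DA k) : MorphismProperty.monomorphisms DA
      ((Arrow.pushoutProduct.obj (Arrow.mk (sphereInDisk n ▷ P))).obj (Arrow.mk k)).hom := by
  obtain ⟨T, a, b, h, sq, ha, hb, H⟩ := exists_pushoutProduct (sphereInDisk n ▷ P) k
  have := flat_disk_tensor n P
  exact (H _).2 ((DA.mono_iff h).2
    (DA.pushoutProduct_injective sq ha hb (diskRetraction_comp n P) ((DA.mono_iff k).1 hk)))

/-- The leg `a` is a pushout of a flat object tensored with `k`, hence a trivial monomorphism. Its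
composite with the corner map goes between acyclic objects, so two out of three applies. -/
theorem trivialMono_sphereInDisk_pushoutProduct (hP : zeroDiff P) [Module.Flat OF P.nub]
    (hk : trivialMono k) : trivialMono
      ((Arrow.pushoutProduct.obj (Arrow.mk (sphereInDisk n ▷ P))).obj (Arrow.mk k)).hom := by
  refine ⟨mono_sphereInDisk_pushoutProduct n hk.1, ?_⟩
  obtain ⟨T, a, b, h, sq, ha, hb, H⟩ := exists_pushoutProduct (sphereInDisk n ▷ P) k
  have := flat_sphere_tensor (n - 1) P
  have h1 : trivialMono a := trivialMono.of_isPushout sq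
    (DA.trivialMono_whiskerLeft (zeroDiff_sphere_tensor (n - 1) hP).1 hk)
  refine (H _).2 (homologyIso.of_precomp a h h1.2 ?_)
  rw [ha]
  exact DA.homologyIso_of_acyclic _ (acyclic_disk_tensor_tensor _ _ _)
    (acyclic_disk_tensor_tensor _ _ _)

end

/-- The inclusions of spheres in disks on matrix objects are among the monomorphisms, so lifting
against all monomorphisms is more than enough. -/
theorem homologyIso_of_mono_rlp {X Y : DA} {p : X ⟶ Y}
    (hp : (MorphismProperty.monomorphisms DA).rlp p) : homologyIso p :=
  homologyIso_of_rlp_mat fun D n =>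
    hp _ ((DA.mono_iff _).2 (sphereInDisk_whiskerRight_injective n D.obj))

theorem DA.acyclic_of_isZero {Z : DA} (h : IsZero Z) : Z.nub.Acyclic := fun x _ => by
  have := DFunLike.congr_fun (congrArg (fun f => f.nub.toLin) (h.eq_of_src (𝟙 Z) 0)) x
  exact ⟨0, (map_zero _).trans this.symm⟩

/-- Injectivity says that the map from `E` to the zero object lifts against all monomorphisms, so
this map is a homology isomorphism. -/
theorem DA.acyclic_of_injective (E : DA) [Injective E] : E.nub.Acyclic := by
  have hz := isZero_zero DA
  refine (DA.acyclic_of_homologyIso (f := hz.from_ E) ?_).2 (DA.acyclic_of_isZero hz)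
  refine homologyIso_of_mono_rlp fun A B i hi => ⟨fun {u v} sq => ?_⟩
  have : Mono i := hi
  exact ⟨⟨⟨Injective.factorThru u i, Injective.comp_factorThru u i, hz.eq_of_tgt _ _⟩⟩⟩

/-- The coefficient at the generator of degree `n` of the disk. -/
noncomputable def diskCoord (n : ℤ) (P : DA) : (free.obj (disk n) ⊗ P).nub →ₗ[OF] P.nub :=
  (isDisk n).nub.lin (N := P.nub) LinearMap.id 0

/-- The inclusion `x ↦ u ⊗ x`, for `u` the generator of degree `n` of the disk. -/
noncomputable def diskIncl (n : ℤ) (P : DA) : GHom n P (free.obj (disk n) ⊗ P) :=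
  (isDisk n).restr (𝟙 _)

theorem diskCoord_incl (n : ℤ) (P : DA) (x : P.nub) : diskCoord n P ((diskIncl n P).nub x) = x :=
  (isDisk n).nub.lin_u (N := P.nub) LinearMap.id 0 x

theorem diskCoord_comp (n : ℤ) (P : DA) :
    (diskCoord n P).comp (sphereInDisk n ▷ P).nub.toLin = 0 :=
  (isSphere (n - 1)).nub.ext (N := P.nub) fun x =>
    (isDisk n).nub.lin_v (N := P.nub) LinearMap.id 0 x

theorem d_diskIncl (n : ℤ) {P : DA} (hP : zeroDiff P) (x : P.nub) :
    ∃ t, (free.obj (disk n) ⊗ P).nub.d ((diskIncl n P).nub x)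
      = (sphereInDisk n ▷ P).nub.toLin t :=
  ⟨(isSphere (n - 1)).nub.w ⊗ₜ[OF] x, (isDisk n).restr_d hP (𝟙 _) x⟩

theorem sphereInDisk_rep (n : ℤ) (P : DA) (s : (free.obj (disk n) ⊗ P).nub) :
    ∃ t, s = (diskIncl n P).nub (diskCoord n P s) + (sphereInDisk n ▷ P).nub.toLin t :=
  ⟨(isSphere (n - 1)).nub.w ⊗ₜ[OF] _, (isDisk n).nub.tensor_rep (N := P.nub) s⟩

/-- If the range of `f : X ⟶ Y` has a complement in `Y` that is the image of a dualisable object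
under a map of degree `n` whose boundary lies in the range of `f`, then `f` is a pushout of the
inclusion of a sphere in a disk. -/
theorem llp_rlp_of_semisplit {I : MorphismProperty DA} {X Y R : DA} (hR : zeroDiff R) {n : ℤ}
    (hI : I.rlp.llp (sphereInDisk n ▷ R)) (f : X ⟶ Y) (hf : Function.Injective f.nub.toLin)
    (σ : GHom n R Y) (π : Y.nub →ₗ[OF] R.nub) (hπσ : ∀ x, π (σ.nub x) = x)
    (hπf : ∀ x, π (f.nub.toLin x) = 0)
    (hσ : ∀ y, ∃ x, f.nub.toLin x = y - σ.nub (π y))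
    (hd : ∀ x, ∃ y, f.nub.toLin y = Y.nub.d (σ.nub x)) : I.rlp.llp f := by
  have : Mono f := (DA.mono_iff f).2 hf
  -- This is the attaching map of the cell, the boundary of `σ`; by `hd` it factors through `f`.
  let g := (isSphere (n - 1)).desc hR σ.d fun x => Y.nub.d_d _
  have hg : g ≫ (DA.Sub.range f).proj = 0 := (isSphere (n - 1)).hom_ext fun x => by
    refine (congrArg (DA.Sub.range f).proj.nub.toLin
      ((isSphere (n - 1)).desc_w hR σ.d (fun x => Y.nub.d_d _) x)).trans ?_
    exact (DA.Sub.range f).proj_eq_zero.2 (hd x)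
  obtain ⟨(g' : _ ⟶ X), hg'⟩ := KernelFork.IsLimit.lift'
    (Abelian.monoIsKernelOfCokernel _ (DA.cokerIsColimit f)) g hg
  replace hg' : g' ≫ f = g := hg'
  have hw : (sphereInDisk n ▷ R) ≫ (isDisk n).desc hR σ = g' ≫ f := by
    rw [hg']
    refine (isSphere (n - 1)).hom_ext fun x => ?_
    exact ((isDisk n).desc_v hR σ x).trans
      ((isSphere (n - 1)).desc_w hR σ.d (fun x => Y.nub.d_d _) x).symm
  have sq := IsPushout.of_hasPushout (sphereInDisk n ▷ R) g'
  let Φ := sq.desc ((isDisk n).desc hR σ) f hw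
  have h1 (t) : Φ.nub.toLin ((pushout.inl (sphereInDisk n ▷ R) g').nub.toLin t)
      = ((isDisk n).desc hR σ).nub.toLin t :=
    DFunLike.congr_fun (congrArg (fun f => f.nub.toLin) (sq.inl_desc _ _ hw)) t
  have h2 (x) : Φ.nub.toLin ((pushout.inr (sphereInDisk n ▷ R) g').nub.toLin x)
      = f.nub.toLin x :=
    DFunLike.congr_fun (congrArg (fun f => f.nub.toLin) (sq.inr_desc _ _ hw)) x
  have h3 (p) : ((isDisk n).desc hR σ).nub.toLin
      ((diskIncl n R).nub p) = σ.nub p :=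
    (isDisk n).desc_u hR σ p
  have hΦ : IsIso Φ := by
    -- As modules, both the pushout and `Y` consist of `X` and a copy of `R`: applying `π` isolates
    -- the copy of `R`, and `hσ` provides the remaining part.
    refine DA.isIso_of_bijective _ ⟨(injective_iff_map_eq_zero _).2 fun t ht => ?_, fun y => ?_⟩
    · obtain ⟨s, x, rfl⟩ := DA.pushout_elements sq t
      obtain ⟨p, t, rfl⟩ : ∃ p t, s = (diskIncl n R).nub p + (sphereInDisk n ▷ R).nub.toLin t :=
        ⟨_, sphereInDisk_rep n R s⟩
      rw [map_add, h1, h2, map_add, ← h1 ((sphereInDisk n ▷ R).nub.toLin t), sq_apply sq.w t, h2,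
        h3, add_assoc, ← map_add] at ht
      have hp : p = 0 := by
        have := congrArg π ht
        rwa [map_add, hπσ, hπf, add_zero, map_zero] at this
      rw [hp, map_zero, zero_add] at ht
      have hx : g'.nub.toLin t + x = 0 := hf (ht.trans (map_zero _).symm)
      rw [hp, map_zero, zero_add, sq_apply sq.w t, ← map_add, hx, map_zero]
    · obtain ⟨x, hx⟩ := hσ y
      refine ⟨(pushout.inl (sphereInDisk n ▷ R) g').nub.toLin
        ((diskIncl n R).nub (π y))
        + (pushout.inr (sphereInDisk n ▷ R) g').nub.toLin x, ?_⟩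
      rw [map_add, h1, h2, h3, hx, add_sub_cancel]
  rw [← sq.inr_desc _ _ hw]
  exact MorphismProperty.comp_mem _ _ _ (MorphismProperty.of_isPushout sq.flip hI)
    (MorphismProperty.of_isIso _ _)

/-- The tensor product of two maps. -/
noncomputable def GHom.tensor {m n : ℤ} {P Q A B : DA} (φ : GHom m P A) (ψ : GHom n Q B) :
    GHom (m + n) (P ⊗ Q) (A ⊗ B) where
  nub := TensorProduct.map φ.nub ψ.nub
  vertex := TensorProduct.map φ.vertex ψ.vertex
  nub_mem k _ ht := map_mem_of_tmul (TensorProduct.map φ.nub ψ.nub).toAddMonoidHom _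
    (fun _ _ hij x hx y hy => tmul_mem_tensorGr (by lia) (φ.nub_mem _ x hx) (ψ.nub_mem _ y hy)) ht
  vertex_mem k _ ht := map_mem_of_tmul (TensorProduct.map φ.vertex ψ.vertex).toAddMonoidHom _
    (fun _ _ hij x hx y hy =>
      tmul_mem_tensorGr (by lia) (φ.vertex_mem _ x hx) (ψ.vertex_mem _ y hy)) ht
  comm := by
    have : (DA.tensorβ A B).comp (TensorProduct.map φ.nub ψ.nub)
        = (extendL (TensorProduct.map φ.vertex ψ.vertex)).comp (DA.tensorβ P Q) :=
      TensorProduct.ext' fun x y => by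
        simp only [LinearMap.comp_apply, TensorProduct.map_tmul, DA.tensorβ_tmul, φ.comm, ψ.comm,
          DA.combine_map]
    exact DFunLike.congr_fun this

section

variable {I : MorphismProperty DA} {P Q : DA}

/-- Modulo the source of the pushout product, `(D^m ⊗ P) ⊗ (D^n ⊗ Q)` is a copy of `P ⊗ Q` in degree
`m + n`, spanned by the products of the top generators, and its boundary lies in the source. So the
pushout product attaches a single cell on `P ⊗ Q`. -/
theorem llp_rlp_sphereInDisk_pushoutProduct (hP : zeroDiff P) (hQ : zeroDiff Q)
    [Module.Flat OF P.nub] (m n : ℤ) (hI : I.rlp.llp (sphereInDisk (m + n) ▷ (P ⊗ Q))) :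
    I.rlp.llp ((Arrow.pushoutProduct.obj (Arrow.mk (sphereInDisk m ▷ P))).obj
      (Arrow.mk (sphereInDisk n ▷ Q))).hom := by
  obtain ⟨T, a, b, h, sq, ha, hb, H⟩ := exists_pushoutProduct (sphereInDisk m ▷ P)
    (sphereInDisk n ▷ Q)
  refine (H _).2 ?_
  have := flat_disk_tensor m P
  have hh := DA.pushoutProduct_injective sq ha hb (diskRetraction_comp m P)
    (sphereInDisk_whiskerRight_injective n Q)
  let A := free.obj (disk m) ⊗ P
  let B := free.obj (disk n) ⊗ Q
  let p : A.nub →ₗ[OF] P.nub := diskCoord m P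
  let q : B.nub →ₗ[OF] Q.nub := diskCoord n Q
  let φ : GHom m P A := diskIncl m P
  let ψ : GHom n Q B := diskIncl n Q
  have ha' (x) : h.nub.toLin (a.nub.toLin x)
      = LinearMap.lTensor A.nub (sphereInDisk n ▷ Q).nub.toLin x :=
    DFunLike.congr_fun (congrArg (fun f => f.nub.toLin) ha) x
  have hb' (x) : h.nub.toLin (b.nub.toLin x)
      = LinearMap.rTensor B.nub (sphereInDisk m ▷ P).nub.toLin x :=
    DFunLike.congr_fun (congrArg (fun f => f.nub.toLin) hb) x
  -- Membership in the range of `h` is expressed as vanishing in the quotient, because linear maps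
  -- can then be compared on pure tensors.
  let ρ : A.nub ⊗[OF] B.nub →ₗ[OF] (A ⊗ B).nub ⧸ LinearMap.range h.nub.toLin :=
    (LinearMap.range h.nub.toLin).mkQ
  have hρ (t : A.nub ⊗[OF] B.nub) (ht : ρ t = 0) : ∃ x, h.nub.toLin x = t :=
    (Submodule.Quotient.mk_eq_zero _).1 ht
  have hρ1 (s t) : ρ ((sphereInDisk m ▷ P).nub.toLin s ⊗ₜ[OF] t) = 0 :=
    (Submodule.Quotient.mk_eq_zero _).2 ⟨_, hb' (s ⊗ₜ[OF] t)⟩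
  have hρ2 (s t) : ρ (s ⊗ₜ[OF] (sphereInDisk n ▷ Q).nub.toLin t) = 0 :=
    (Submodule.Quotient.mk_eq_zero _).2 ⟨_, ha' (s ⊗ₜ[OF] t)⟩
  refine llp_rlp_of_semisplit (R := P ⊗ Q) ⟨tensorD_zero hP.1 hQ.1, tensorD_zero hP.2 hQ.2⟩ hI h
    hh (φ.tensor ψ) (TensorProduct.map p q) ?_ ?_ ?_ ?_
  · have : (TensorProduct.map p q).comp (TensorProduct.map φ.nub ψ.nub) = LinearMap.id := by
      rw [← TensorProduct.map_comp, LinearMap.ext (f := p.comp φ.nub) (g := LinearMap.id)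
        (diskCoord_incl m P), LinearMap.ext (f := q.comp ψ.nub) (g := LinearMap.id)
        (diskCoord_incl n Q), TensorProduct.map_id]
    exact DFunLike.congr_fun this
  · intro t
    obtain ⟨x, y, rfl⟩ := DA.pushout_elements sq t
    have h1 : (TensorProduct.map p q).comp
        (LinearMap.lTensor A.nub (sphereInDisk n ▷ Q).nub.toLin) = 0 := by
      rw [LinearMap.map_comp_lTensor]
      exact (congrArg _ (diskCoord_comp n Q)).trans (TensorProduct.map_zero_right _)
    have h2 : (TensorProduct.map p q).comp
        (LinearMap.rTensor B.nub (sphereInDisk m ▷ P).nub.toLin) = 0 := by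
      rw [LinearMap.map_comp_rTensor]
      exact (congrArg (TensorProduct.map · q) (diskCoord_comp m P)).trans
        (TensorProduct.map_zero_left _)
    rw [map_add, ha', hb']
    refine (map_add (TensorProduct.map p q) _ _).trans ?_
    exact (congrArg₂ (· + ·) (DFunLike.congr_fun h1 x) (DFunLike.congr_fun h2 y)).trans
      (add_zero _)
  · intro t
    refine hρ _ ?_
    have : ρ.comp (LinearMap.id - (TensorProduct.map φ.nub ψ.nub).comp (TensorProduct.map p q))
        = 0 := TensorProduct.ext' fun x y => by
      obtain ⟨x', hx⟩ := sphereInDisk_rep m P x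
      obtain ⟨y', hy⟩ := sphereInDisk_rep n Q y
      have : x ⊗ₜ[OF] y - φ.nub (p x) ⊗ₜ[OF] ψ.nub (q y)
          = (sphereInDisk m ▷ P).nub.toLin x' ⊗ₜ[OF] y
            + φ.nub (p x) ⊗ₜ[OF] (sphereInDisk n ▷ Q).nub.toLin y' := by
        rw [← sub_eq_of_eq_add' hx, ← sub_eq_of_eq_add' hy, TensorProduct.sub_tmul,
          TensorProduct.tmul_sub]
        exact (sub_add_sub_cancel _ _ _).symm
      refine (congrArg ρ this).trans ?_
      rw [map_add, hρ1, hρ2, add_zero, LinearMap.zero_apply]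
    exact DFunLike.congr_fun this t
  · intro t
    refine hρ _ ?_
    have : (ρ.comp (DGMod.tensorD A.nub B.nub)).comp (TensorProduct.map φ.nub ψ.nub) = 0 :=
      TensorProduct.ext' fun x y => by
        obtain ⟨x', hx⟩ := d_diskIncl m hP x
        obtain ⟨y', hy⟩ := d_diskIncl n hQ y
        change ρ (DGMod.tensorD A.nub B.nub (φ.nub x ⊗ₜ[OF] ψ.nub y)) = 0
        rw [DGMod.tensorD_tmul, map_add, hx, hy, hρ1, hρ2, add_zero]
    exact DFunLike.congr_fun this t

end

/-! ### The closed structure; extending pushout products from generators -/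

/-- The nub of a tensor product. -/
noncomputable def tensorLeftNubMod (A : DA) :
    tensorLeft A ⋙ DA.nubMod ≅ DA.nubMod ⋙ tensorLeft (DA.nubMod.obj A) :=
  NatIso.ofComponents (fun _ => Iso.refl _) (fun _ => rfl)

noncomputable instance (A : DA) : PreservesColimitsOfSize.{0, 0} (tensorLeft A) := by
  have : PreservesColimitsOfSize.{0, 0} (tensorLeft A ⋙ DA.nubMod) :=
    preservesColimits_of_natIso (tensorLeftNubMod A).symm
  have : ReflectsColimitsOfSize.{0, 0} DA.nubMod := reflectsColimits_of_reflectsIsomorphisms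
  exact preservesColimits_of_reflects_of_preserves _ DA.nubMod

/-- Tensoring with `A` preserves colimits because it does so on nubs and `nubMod` reflects colimits.
With a small separating family the adjoint functor theorem provides the function objects. -/
noncomputable instance : MonoidalClosed DA where
  closed A :=
    have : (tensorLeft A).IsLeftAdjoint :=
      isLeftAdjoint_of_preservesColimits_of_isSeparating DA.isSeparating_gen _
    ⟨_, Adjunction.ofIsLeftAdjoint (tensorLeft A)⟩

section

variable {C : Type*} [Category C] [MonoidalCategory C] [BraidedCategory C] [MonoidalClosed C]
  [HasPushouts C] [HasPullbacks C]

/-- Pushout products of saturated classes can be checked on generators of the first class. -/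
theorem pushoutProduct_mem_of_left {I K T : MorphismProperty C}
    (h : ∀ ⦃A B X Y : C⦄ (i : A ⟶ B) (k : X ⟶ Y), I i → K k →
      T.rlp.llp ((Arrow.pushoutProduct.obj (Arrow.mk i)).obj (Arrow.mk k)).hom)
    ⦃A B X Y : C⦄ (i : A ⟶ B) (k : X ⟶ Y) (hi : I.rlp.llp i) (hk : K k) :
    T.rlp.llp ((Arrow.pushoutProduct.obj (Arrow.mk i)).obj (Arrow.mk k)).hom :=
  -- By adjunction, `p` lifts against the pushout product exactly when `i` lifts against a map built
  -- from `k` and `p`; that map lies in `I.rlp` by the case of generators.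
  fun E F p hp => Arrow.PushoutProduct.hasLiftingProperty_mk_iff'.2
    (hi _ fun A' B' i' hi' => Arrow.PushoutProduct.hasLiftingProperty_mk_iff'.1 (h i' k hi' hk p hp))

/-- Pushout products of saturated classes can be checked on generators of the second class. -/
theorem pushoutProduct_mem_of_right {I K T : MorphismProperty C}
    (h : ∀ ⦃A B X Y : C⦄ (i : A ⟶ B) (k : X ⟶ Y), I i → K k →
      T.rlp.llp ((Arrow.pushoutProduct.obj (Arrow.mk i)).obj (Arrow.mk k)).hom)
    ⦃A B X Y : C⦄ (i : A ⟶ B) (k : X ⟶ Y) (hi : I i) (hk : K.rlp.llp k) :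
    T.rlp.llp ((Arrow.pushoutProduct.obj (Arrow.mk i)).obj (Arrow.mk k)).hom :=
  fun E F p hp => Arrow.PushoutProduct.hasLiftingProperty_mk_iff.2
    (hk _ fun A' B' k' hk' => Arrow.PushoutProduct.hasLiftingProperty_mk_iff.1 (h i k' hi hk' p hp))

end

/-! ### Recognition of model structures -/

section

universe v u

variable {C : Type u} [Category.{v} C] [HasFiniteLimits C] [HasFiniteColimits C]

/-- Smith's recognition theorem, for given sets of generating cofibrations and of generating
trivial cofibrations. -/
theorem exists_modelCategory (W I J : MorphismProperty C) [W.HasTwoOutOfThreeProperty]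
    [W.IsStableUnderRetracts] [I.rlp.llp.HasFactorization I.rlp] [J.rlp.llp.HasFactorization J.rlp]
    (hIW : I.rlp ≤ W) (hJ : J ≤ I.rlp.llp) (hJW : J.rlp.llp ≤ W) (hJI : J.rlp ⊓ W ≤ I.rlp) :
    ∃ M : ModelCategory C, weakEquivalences C = W ∧ cofibrations C = I.rlp.llp ∧
      fibrations C = J.rlp ∧ trivialFibrations C = I.rlp := by
  have hIJ : I.rlp ≤ J.rlp := fun X Y p hp A B j hj => hJ j hj p hp
  have hJI' : J.rlp.llp ≤ I.rlp.llp := MorphismProperty.antitone_llp hIJ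
  have heq : J.rlp ⊓ W = I.rlp := le_antisymm hJI fun _ _ _ hp => ⟨hIJ _ hp, hIW _ hp⟩
  refine ⟨{ categoryWithFibrations := ⟨J.rlp⟩
            categoryWithCofibrations := ⟨I.rlp.llp⟩
            categoryWithWeakEquivalences := ⟨W⟩
            cm2 := inferInstanceAs W.HasTwoOutOfThreeProperty
            cm3a := inferInstanceAs W.IsStableUnderRetracts
            cm3b := inferInstanceAs J.rlp.IsStableUnderRetracts
            cm3c := inferInstanceAs I.rlp.llp.IsStableUnderRetracts
            cm4a := ?_
            cm4b := ?_
            cm5a := ?_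
            cm5b := ?_ }, rfl, rfl, rfl, heq⟩
  · intro A B X Y i p hi hi' hp
    letI : CategoryWithFibrations C := ⟨J.rlp⟩
    letI : CategoryWithCofibrations C := ⟨I.rlp.llp⟩
    letI : CategoryWithWeakEquivalences C := ⟨W⟩
    replace hi : I.rlp.llp i := hi.mem
    replace hi' : W i := hi'.mem
    replace hp : J.rlp p := hp.mem
    let φ := MorphismProperty.factorizationData J.rlp.llp J.rlp i
    -- Retract argument: the second factor of `i` is a weak equivalence with the right lifting
    -- property against `J`, so the cofibration `i` lifts against it and inherits the lifting
    -- property of the first factor.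
    have hq : I.rlp φ.p := hJI _ ⟨φ.hp, W.of_precomp _ _ (hJW _ φ.hi) (by rw [φ.fac]; exact hi')⟩
    have := hi _ hq
    have := φ.hi _ hp
    refine ⟨fun {u v} sq => ?_⟩
    have sq₁ : CommSq φ.i i φ.p (𝟙 B) := ⟨by simp⟩
    have sq₂ : CommSq u φ.i p (φ.p ≫ v) := ⟨by simp [sq.w]⟩
    exact ⟨⟨⟨sq₁.lift ≫ sq₂.lift, by simp [reassoc_of% sq₁.fac_left],
      by simp [reassoc_of% sq₁.fac_right]⟩⟩⟩
  · intro A B X Y i p hi hp hp'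
    letI : CategoryWithFibrations C := ⟨J.rlp⟩
    letI : CategoryWithCofibrations C := ⟨I.rlp.llp⟩
    letI : CategoryWithWeakEquivalences C := ⟨W⟩
    exact (show I.rlp.llp i from hi.mem) p (hJI _ ⟨hp.mem, hp'.mem⟩)
  · refine ⟨fun f => ?_⟩
    let φ := MorphismProperty.factorizationData J.rlp.llp J.rlp f
    exact ⟨{ φ with hi := ⟨hJI' _ φ.hi, hJW _ φ.hi⟩ }⟩
  · change (I.rlp.llp).HasFactorization (J.rlp ⊓ W)
    rw [heq]
    infer_instance

end

open Cardinal in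
/-- A small set `I` of monomorphisms such that the maps with the right lifting property with respect
to `I` are homology isomorphisms generates a model structure. -/
theorem DA.exists_modelCategory (I : MorphismProperty DA) [MorphismProperty.IsSmall.{0} I]
    (hI : I ≤ MorphismProperty.monomorphisms DA) (hIW : I.rlp ≤ homologyIso) :
    ∃ M : ModelCategory DA, weakEquivalences DA = homologyIso ∧ cofibrations DA = I.rlp.llp ∧
      trivialFibrations DA = I.rlp ∧ MorphismProperty.HasSmallObjectArgument.{0} I ∧
      ∃ J : MorphismProperty DA, MorphismProperty.HasSmallObjectArgument.{0} J ∧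
        fibrations DA = J.rlp := by
  have := hasSmallObjectArgument_of_mono I hI
  obtain ⟨κ, hκ, hκI⟩ := DA.exists_isLarge fun a : Shrink.{0} I.toSet => ((equivShrink _).symm a).1.right
  replace hκI : ∀ ⦃A B : DA⦄ (i : A ⟶ B), I i → #B.nub ≤ κ := fun A B i hi => by
    have := hκI (equivShrink I.toSet ⟨Arrow.mk i, hi⟩)
    rwa [Equiv.symm_apply_apply] at this
  let ι := Σ K : DA.Sub (DA.cover κ), {X : DA.Sub K.quot // homologyIso X.incl}
  let k (a : ι) := a.2.1.incl
  -- The small trivial monomorphisms need not be cofibrations. Their cofibration factors are, and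
  -- these are weak equivalences by two out of three; they serve as generating trivial cofibrations.
  let φ (a : ι) := MorphismProperty.factorizationData I.rlp.llp I.rlp (k a)
  let J : MorphismProperty DA := .ofHoms fun a => (φ a).i
  have hIm : I.rlp.llp ≤ MorphismProperty.monomorphisms DA := by
    rw [← IsGrothendieckAbelian.llp_rlp_monomorphisms (isSeparator_separator DA)]
    exact MorphismProperty.antitone_llp (MorphismProperty.antitone_rlp hI)
  have hJ : J ≤ trivialMono := by
    rintro _ _ _ ⟨a⟩
    refine ⟨hIm _ (φ a).hi, homologyIso.of_postcomp _ (φ a).p (hIW _ (φ a).hp) ?_⟩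
    rw [(φ a).fac]
    exact a.2.2
  have hJs : MorphismProperty.HasSmallObjectArgument.{0} J :=
    hasSmallObjectArgument_of_mono J (hJ.trans inf_le_left)
  have hJI : J.rlp ⊓ homologyIso ≤ I.rlp := by
    rintro X Y p ⟨hp, hpW⟩ A B i hi
    refine ⟨fun {u v} sq => ?_⟩
    have : Mono i := hI _ hi
    -- The square factors through some `k a`. A lift is composed of one against the `I.rlp` factor
    -- of `k a` and one of `p` against its cofibration factor.
    obtain ⟨_, _, _, ⟨a⟩, u₁, v₁, u₂, v₂, hu, hv, h₁, h₂⟩ :=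
      exists_factorization (fun E _ => DA.acyclic_of_injective E) hκ i (hκI i hi) p hpW u v sq.w
    have := (φ a).hp i hi
    have := hp _ (MorphismProperty.ofHoms.mk a : J (φ a).i)
    have sq₁ : CommSq (u₁ ≫ (φ a).i) i (φ a).p v₁ := ⟨by rw [Category.assoc, (φ a).fac]; exact h₁⟩
    have sq₂ : CommSq u₂ (φ a).i p ((φ a).p ≫ v₂) :=
      ⟨by rw [← Category.assoc, (φ a).fac]; exact h₂⟩
    refine ⟨⟨⟨sq₁.lift ≫ sq₂.lift, ?_, ?_⟩⟩⟩
    · rw [← Category.assoc, sq₁.fac_left, Category.assoc, sq₂.fac_left, hu]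
    · rw [Category.assoc, sq₂.fac_right, ← Category.assoc, sq₁.fac_right, hv]
  obtain ⟨M, h₁, h₂, h₃, h₄⟩ := AlgModel.exists_modelCategory homologyIso I J hIW
    (by rintro _ _ _ ⟨a⟩; exact (φ a).hi) ((llp_rlp_le_trivialMono hJ).trans inf_le_right) hJI
  exact ⟨M, h₁, h₂, h₄, inferInstance, J, hJs, h₃⟩

/-- In a Grothendieck category all monomorphisms are generated by the inclusions of subobjects of a
separator, which form a set. -/
theorem DA.exists_injective_modelCategory :
    ∃ M : ModelCategory DA, weakEquivalences DA = homologyIso ∧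
      cofibrations DA = MorphismProperty.monomorphisms DA := by
  have hG := isSeparator_separator DA
  have hr := IsGrothendieckAbelian.generatingMonomorphisms_rlp hG
  have : MorphismProperty.IsSmall.{0}
      (IsGrothendieckAbelian.generatingMonomorphisms (separator DA)) :=
    inferInstanceAs (MorphismProperty.IsSmall.{0} (.ofHoms _))
  obtain ⟨M, h₁, h₂, -⟩ := DA.exists_modelCategory
    (IsGrothendieckAbelian.generatingMonomorphisms (separator DA))
    (IsGrothendieckAbelian.generatingMonomorphisms_le_monomorphisms _)
    (hr.le.trans fun _ _ _ hp => homologyIso_of_mono_rlp hp)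
  exact ⟨M, h₁, h₂.trans (by rw [hr, IsGrothendieckAbelian.llp_rlp_monomorphisms hG])⟩

/-! ### Dualisable objects up to isomorphism form a set -/

open Cardinal in
theorem IsDualisable.card_nub_le {κ : Cardinal.{0}} (hκ : DA.IsLarge κ) {P : GrA}
    (hP : IsDualisable P) : #P.obj.nub ≤ κ := by
  obtain ⟨ι, _, x, c, h⟩ := hP.exists_dualBasis
  have ht : Submodule.span OF (Set.range x) = ⊤ := eq_top_iff.2 fun p _ => by
    rw [← h p]
    exact Submodule.sum_mem _ fun i _ => Submodule.smul_mem _ _ (Submodule.subset_span ⟨i, rfl⟩)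
  have := hκ.card_span ((mk_le_aleph0 (α := Set.range x)).trans hκ.aleph0_le)
  rw [ht] at this
  exact (mk_congr (Submodule.topEquiv (R := OF) (M := P.obj.nub)).toEquiv).ge.trans this

section

variable {S : Set GrA}

/-- There are, up to isomorphism, only a set of dualisable objects. -/
theorem small_dualisable (hS : ∀ P ∈ S, IsDualisable P)
    (hS' : ∀ P : GrA, IsDualisable P → ∃! Q, Q ∈ S ∧ Nonempty (P ≅ Q)) : Small.{0} S := by
  obtain ⟨κ, hκ, -⟩ := DA.exists_isLarge fun a : Empty => a.elim
  have (P : S) : ∃ K : DA.Sub (DA.cover κ), Nonempty (K.quot ≅ P.1.obj) := by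
    obtain ⟨f, hf⟩ := DA.exists_cover_hom ((hS P.1 P.2).card_nub_le hκ)
    exact ⟨_, DA.exists_iso_quot f hf⟩
  choose K e using this
  -- An object is recovered up to isomorphism from the subobject of the fixed cover, and `S`
  -- contains only one object of each isomorphism class.
  refine small_of_injective (f := K) fun P Q h => Subtype.ext ?_
  obtain ⟨eP⟩ := e P
  obtain ⟨eQ⟩ := e Q
  rw [h] at eP
  exact (hS' P.1 (hS P.1 P.2)).unique ⟨P.2, ⟨Iso.refl _⟩⟩
    ⟨Q.2, ⟨zeroDiff.fullyFaithfulι.preimageIso (eP.symm ≪≫ eQ)⟩⟩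

theorem isSmall_generatingCofibrations [Small.{0} S] :
    MorphismProperty.IsSmall.{0} (generatingCofibrations S) := by
  have : generatingCofibrations S
      = .ofHoms fun a : S × ℤ => sphereInDisk a.2 ▷ a.1.1.obj := by
    refine le_antisymm ?_ ?_
    · rintro _ _ _ ⟨P, hP, n⟩
      exact ⟨((⟨P, hP⟩, n) : S × ℤ)⟩
    · rintro _ _ _ ⟨a⟩
      exact ⟨_, a.1.2, _⟩
  rw [this]
  infer_instance

theorem generatingCofibrations_le (S : Set GrA) :
    generatingCofibrations S ≤ MorphismProperty.monomorphisms DA := by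
  rintro _ _ _ ⟨P, hP, n⟩
  exact (DA.mono_iff _).2 (sphereInDisk_whiskerRight_injective n P.obj)

/-- Matrix objects are dualisable, hence isomorphic to members of `S`, so the lifting property
against matrix objects is available. -/
theorem homologyIso_of_generatingCofibrations_rlp
    (hS' : ∀ P : GrA, IsDualisable P → ∃! Q, Q ∈ S ∧ Nonempty (P ≅ Q)) :
    (generatingCofibrations S).rlp ≤ homologyIso := fun _ _ _ hp =>
  homologyIso_of_rlp_mat fun D n => hasLiftingProperty_of_rlp hS' hp D.isDualisable n

end

/-! ### Tensoring with cofibrations and cofibrant objects -/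

theorem monomorphisms_rlp_llp :
    (MorphismProperty.monomorphisms DA).rlp.llp = MorphismProperty.monomorphisms DA :=
  IsGrothendieckAbelian.llp_rlp_monomorphisms (isSeparator_separator DA)

/-- These are the trivial cofibrations of the injective model structure, so they are determined by a
lifting property. This allows pushout products with them to be checked on generators. -/
theorem trivialMono_rlp_llp : trivialMono.rlp.llp = trivialMono := by
  obtain ⟨M, h₁, h₂⟩ := DA.exists_injective_modelCategory
  have h : trivialMono = trivialCofibrations DA := by
    rw [trivialMono, ← h₁, ← h₂]
    rfl
  rw [h, MorphismProperty.rlp_eq_of_wfs (trivialCofibrations DA) (fibrations DA),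
    MorphismProperty.llp_eq_of_wfs (trivialCofibrations DA) (fibrations DA)]

/-- `A ⊗ ⊥` is initial. -/
noncomputable def tensorInitial (A : DA) : IsInitial (A ⊗ ⊥_ DA) :=
  initialIsInitial.isInitialObj (tensorLeft A) _

/-- `⊥ ⊗ A` is initial. -/
noncomputable def initialTensor (A : DA) : IsInitial ((⊥_ DA) ⊗ A) :=
  (tensorInitial A).ofIso (β_ A (⊥_ DA))

theorem DA.acyclic_of_isInitial {Z : DA} (h : IsInitial Z) : Z.nub.Acyclic :=
  DA.acyclic_of_isZero ((isZero_zero DA).of_iso (h.uniqueUpToIso (isZero_zero DA).isInitial))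

/-- The class of dualisable objects is represented by a set of dualisable objects. -/
structure IsRepresentative (S : Set GrA) : Prop where
  isDualisable : ∀ P ∈ S, IsDualisable P
  existsUnique : ∀ P : GrA, IsDualisable P → ∃! Q, Q ∈ S ∧ Nonempty (P ≅ Q)

section

variable {S : Set GrA}

/-- The cofibrations generated by `S`. -/
abbrev qdCofibrations (S : Set GrA) : MorphismProperty DA := (generatingCofibrations S).rlp.llp

variable {A B K M : DA}

theorem qdCofibrations_le : qdCofibrations S ≤ MorphismProperty.monomorphisms DA := by
  rw [← monomorphisms_rlp_llp]
  exact MorphismProperty.antitone_llp (MorphismProperty.antitone_rlp (generatingCofibrations_le S))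

/-- Cofibrancy of the cokernel follows from a lift of the zero map along `f`: such a lift vanishes
on `A` and so factors through the cokernel. -/
theorem initial_to_cokernel_mem {f : A ⟶ B} (hf : qdCofibrations S f) :
    qdCofibrations S (initial.to (DA.Sub.range f).quot) := by
  intro X Y p hp
  refine ⟨fun {u v} sq => ?_⟩
  have := hf p hp
  have hπ : Epi (DA.Sub.range f).proj := (DA.epi_iff _).2 (DA.Sub.range f).proj_surjective
  have sq' : CommSq (0 : A ⟶ X) f p ((DA.Sub.range f).proj ≫ v) :=
    ⟨by rw [← Category.assoc, DA.Sub.comp_range_proj, Limits.zero_comp, Limits.zero_comp]⟩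
  obtain ⟨(l : (DA.Sub.range f).quot ⟶ X), hl⟩ :=
    CokernelCofork.IsColimit.desc' (DA.cokerIsColimit f) sq'.lift sq'.fac_left
  replace hl : (DA.Sub.range f).proj ≫ l = sq'.lift := hl
  refine ⟨⟨⟨l, Subsingleton.elim _ _, ?_⟩⟩⟩
  rw [← cancel_epi (DA.Sub.range f).proj, ← Category.assoc, hl, sq'.fac_right]

namespace IsRepresentative

theorem sphereInDisk_mem (hS : IsRepresentative S) {P : GrA} (hP : IsDualisable P) (n : ℤ) :
    qdCofibrations S (sphereInDisk n ▷ P.obj) :=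
  fun _ _ _ hp => hasLiftingProperty_of_rlp hS.existsUnique hp hP n

theorem pushoutProduct_mem (hS : IsRepresentative S) {f : A ⟶ B} {g : K ⟶ M} (hf : qdCofibrations S f)
    (hg : qdCofibrations S g) :
    qdCofibrations S ((Arrow.pushoutProduct.obj (Arrow.mk f)).obj (Arrow.mk g)).hom := by
  refine pushoutProduct_mem_of_left (K := qdCofibrations S) (fun _ _ _ _ i k hi hk => ?_) f g hf hg
  refine pushoutProduct_mem_of_right (fun _ _ _ _ i k hi hk => ?_) i k hi hk
  obtain ⟨P, hP, m⟩ := hi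
  obtain ⟨Q, hQ, n⟩ := hk
  have := (hS.isDualisable P hP).flat
  exact llp_rlp_sphereInDisk_pushoutProduct P.2 Q.2 m n
    (hS.sphereInDisk_mem ((hS.isDualisable P hP).tensor (hS.isDualisable Q hQ)) _)

theorem mono_pushoutProduct (hS : IsRepresentative S) {f : A ⟶ B} {g : K ⟶ M} (hf : qdCofibrations S f)
    (hg : MorphismProperty.monomorphisms DA g) : MorphismProperty.monomorphisms DA
      ((Arrow.pushoutProduct.obj (Arrow.mk f)).obj (Arrow.mk g)).hom := by
  rw [← monomorphisms_rlp_llp]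
  refine pushoutProduct_mem_of_left (fun _ _ _ _ i k hi hk => ?_) f g hf hg
  obtain ⟨P, hP, m⟩ := hi
  have := (hS.isDualisable P hP).flat
  rw [monomorphisms_rlp_llp]
  exact mono_sphereInDisk_pushoutProduct m hk

theorem trivialMono_pushoutProduct (hS : IsRepresentative S) {f : A ⟶ B} {g : K ⟶ M} (hf : qdCofibrations S f)
    (hg : trivialMono g) : trivialMono
      ((Arrow.pushoutProduct.obj (Arrow.mk f)).obj (Arrow.mk g)).hom := by
  rw [← trivialMono_rlp_llp]
  refine pushoutProduct_mem_of_left (fun _ _ _ _ i k hi hk => ?_) f g hf hg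
  obtain ⟨P, hP, m⟩ := hi
  have := (hS.isDualisable P hP).flat
  rw [trivialMono_rlp_llp]
  exact trivialMono_sphereInDisk_pushoutProduct m P.2 hk

/-- The map `C ⊗ k` is a pushout of an isomorphism of initial objects followed by the pushout
product of `k` with the map from the initial object to `C`. -/
theorem trivialMono_whiskerLeft (hS : IsRepresentative S) {C : DA} (hC : qdCofibrations S (initial.to C)) {k : K ⟶ M}
    (hk : trivialMono k) : trivialMono (C ◁ k) := by
  obtain ⟨T, a, b, h, sq, ha, hb, H⟩ := exists_pushoutProduct (initial.to C) k
  rw [← ha]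
  have := isIso_of_isInitial (initialTensor K) (initialTensor M) ((⊥_ DA) ◁ k)
  exact trivialMono.comp_mem _ _ (trivialMono.of_isPushout sq (trivialMono.of_isIso _))
    ((H _).1 (hS.trivialMono_pushoutProduct hC hk))

/-- Factor `f` as a monomorphism followed by a map `p` that lifts against all monomorphisms. Both
the first factor and a section of `p` are trivial monomorphisms, a case already treated, and two out
of three handles `p`. -/
theorem homologyIso_whiskerLeft (hS : IsRepresentative S) {C : DA} (hC : qdCofibrations S (initial.to C)) {f : A ⟶ B}
    (hf : homologyIso f) : homologyIso (C ◁ f) := by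
  let φ := MorphismProperty.factorizationData (MorphismProperty.monomorphisms DA)
    (MorphismProperty.monomorphisms DA).rlp f
  have hp : homologyIso φ.p := homologyIso_of_mono_rlp φ.hp
  have hi : homologyIso φ.i := homologyIso.of_postcomp _ _ hp (by rwa [φ.fac])
  have := φ.hp (initial.to B) (inferInstanceAs (Mono _))
  have sq : CommSq (initial.to φ.Z) (initial.to B) φ.p (𝟙 B) := ⟨by simp⟩
  have hs : trivialMono sq.lift :=
    ⟨mono_of_mono_fac sq.fac_right, homologyIso.of_postcomp _ _ hp (by
      rw [sq.fac_right]; exact homologyIso.of_isIso _)⟩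
  have hCp : homologyIso (C ◁ φ.p) := by
    refine homologyIso.of_precomp (C ◁ sq.lift) _ (hS.trivialMono_whiskerLeft hC hs).2 ?_
    rw [← whiskerLeft_comp, sq.fac_right]
    exact homologyIso.of_isIso _
  rw [← φ.fac, whiskerLeft_comp]
  exact homologyIso.comp_mem _ _ (hS.trivialMono_whiskerLeft hC ⟨φ.hi, hi⟩).2 hCp

theorem mono_whiskerRight (hS : IsRepresentative S) {f : A ⟶ B} (hf : qdCofibrations S f) (Z : DA) : Mono (f ▷ Z) := by
  obtain ⟨T, a, b, h, sq, ha, hb, H⟩ := exists_pushoutProduct f (initial.to Z)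
  have h1 : Mono h := (H _).1 (hS.mono_pushoutProduct hf (inferInstanceAs (Mono (initial.to Z))))
  have := isIso_of_isInitial (tensorInitial A) (tensorInitial B) (f ▷ ⊥_ DA)
  have : IsIso b := sq.isIso_inr_of_isIso
  rw [← hb]
  infer_instance

/-- Attaching the cell `D^n ⊗ P` to the initial object collapses its boundary and leaves `S^n ⊗ P`.
-/
theorem initial_to_sphere_mem (hS : IsRepresentative S) {P : GrA} (hP : IsDualisable P) (n : ℤ) :
    qdCofibrations S (initial.to (free.obj (sphere n) ⊗ P.obj)) := by
  have h0 : ∀ x : (⊥_ DA).nub, x = 0 := fun x =>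
    DFunLike.congr_fun (congrArg (fun f => f.nub.toLin)
      (initialIsInitial.hom_ext (𝟙 (⊥_ DA)) 0)) x
  have hw : (LinearMap.id : (free.obj (sphere n)).nub ⊗[OF] P.obj.nub →ₗ[OF] _)
      = ((isSphere n).restr (𝟙 (free.obj (sphere n) ⊗ P.obj))).nub.comp
        ((isSphere n).nub.lin (N := P.obj.nub) LinearMap.id) :=
    (isSphere n).nub.ext (N := P.obj.nub) fun x => (congrArg
      ((isSphere n).restr (𝟙 (free.obj (sphere n) ⊗ P.obj))).nub
      ((isSphere n).nub.lin_w (N := P.obj.nub) LinearMap.id x)).symm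
  refine llp_rlp_of_semisplit P.2 (hS.sphereInDisk_mem hP n) _
    (fun x y _ => (h0 x).trans (h0 y).symm) ((isSphere n).restr (𝟙 _))
    ((isSphere n).nub.lin (N := P.obj.nub) LinearMap.id)
    (fun x => (isSphere n).nub.lin_w (N := P.obj.nub) LinearMap.id x) (fun x => ?_)
    (fun y => ⟨0, ?_⟩) (fun x => ⟨0, ?_⟩)
  · rw [h0 x, map_zero]
    exact map_zero ((isSphere n).nub.lin (N := P.obj.nub) LinearMap.id)
  · rw [map_zero]
    exact (sub_eq_zero.2 (DFunLike.congr_fun hw y)).symm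
  · rw [map_zero, (isSphere n).restr_d P.2]

/-- The disk is built in two cells, first the sphere of degree `-1` and then the disk itself. -/
theorem initial_to_gen_mem (hS : IsRepresentative S) (D : MatData) :
    qdCofibrations S (initial.to (DA.gen D)) := by
  rw [← initial.to_comp (sphereInDisk 0 ▷ D.obj)]
  exact MorphismProperty.comp_mem _ _ _ (hS.initial_to_sphere_mem D.isDualisable (0 - 1))
    (hS.sphereInDisk_mem D.isDualisable 0)

/-- Maps with the right lifting property with respect to trivial cofibrations are surjective. -/
theorem surjective_of_rlp (hS : IsRepresentative S) {X Y : DA} {p : X ⟶ Y}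
    (hp : (qdCofibrations S ⊓ homologyIso).rlp p) : Function.Surjective p.nub.toLin := by
  intro y
  induction y using homogeneous_induction Y.nub.isInternal with
  | zero => exact ⟨0, map_zero _⟩
  | add a b ha hb =>
    obtain ⟨a, rfl⟩ := ha
    obtain ⟨b, rfl⟩ := hb
    exact ⟨a + b, map_add _ _ _⟩
  | mem n y hy =>
    obtain ⟨D, f, z, rfl⟩ := Y.exists_gen_hom hy
    -- The disks on matrix objects are cofibrant and acyclic, so maps out of them lift along `p`,
    -- and their images contain all homogeneous elements.
    have := hp (initial.to (DA.gen D)) ⟨hS.initial_to_gen_mem D, DA.homologyIso_of_acyclic _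
      (DA.acyclic_of_isInitial initialIsInitial) (acyclic_disk_tensor 0 D.obj)⟩
    have sq : CommSq (initial.to X) (initial.to (DA.gen D)) p f := ⟨Subsingleton.elim _ _⟩
    exact ⟨sq.lift.nub.toLin z,
      DFunLike.congr_fun (congrArg (fun f => f.nub.toLin) sq.fac_right) z⟩

variable [Small.{0} S]

theorem exists_cofibrant (hS : IsRepresentative S) (Z : DA) : ∃ (Q : DA) (q : Q ⟶ Z), qdCofibrations S (initial.to Q) ∧
    homologyIso q := by
  have := isSmall_generatingCofibrations (S := S)
  have := hasSmallObjectArgument_of_mono _ (generatingCofibrations_le S)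
  let φ := MorphismProperty.factorizationData (generatingCofibrations S).rlp.llp
    (generatingCofibrations S).rlp (initial.to Z)
  refine ⟨φ.Z, φ.p, ?_, homologyIso_of_generatingCofibrations_rlp hS.existsUnique _ φ.hp⟩
  rw [Subsingleton.elim (initial.to φ.Z) φ.i]
  exact φ.hi

/-- Replace `Z` by a cofibrant `Q`, which is harmless since `C` is cofibrant. Then exchange the
roles: `Q` is cofibrant, so `Q ⊗ C` is acyclic along with `C`. -/
theorem acyclic_tensor (hS : IsRepresentative S) {C : DA} (hC : qdCofibrations S (initial.to C)) (hC' : C.nub.Acyclic)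
    (Z : DA) : (C ⊗ Z).nub.Acyclic := by
  obtain ⟨Q, q, hQ, hq⟩ := hS.exists_cofibrant Z
  rw [← DA.acyclic_of_homologyIso (hS.homologyIso_whiskerLeft hC hq),
    DA.acyclic_of_homologyIso (homologyIso.of_isIso (β_ C Q).hom),
    ← DA.acyclic_of_homologyIso (hS.homologyIso_whiskerLeft hQ (f := initial.to C)
      (DA.homologyIso_of_acyclic _ (DA.acyclic_of_isInitial initialIsInitial) hC'))]
  exact DA.acyclic_of_isInitial (tensorInitial Q)

/-- The cokernel of `f ⊗ Z` is `C ⊗ Z`, for `C` the cokernel of `f`, which is cofibrant and acyclic.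
Nothing is required of `Z`; this is the content of the monoid axiom. -/
theorem trivialMono_whiskerRight (hS : IsRepresentative S) {f : A ⟶ B} (hf : qdCofibrations S f) (hf' : homologyIso f)
    (Z : DA) : trivialMono (f ▷ Z) := by
  have hm := hS.mono_whiskerRight hf Z
  have hs := (DA.Sub.range f).proj_surjective
  have hex := DA.exact_proj_range f
  refine ⟨hm, ?_⟩
  rw [DA.homologyIso_iff_of_exact (g := (DA.Sub.range f).proj ▷ Z) ((DA.mono_iff _).1 hm)
    (LinearMap.rTensor_surjective Z.nub hs) (rTensor_exact Z.nub hex hs)]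
  exact hS.acyclic_tensor (initial_to_cokernel_mem hf)
    ((DA.homologyIso_iff_of_exact ((DA.mono_iff f).1 (qdCofibrations_le _ hf)) hs hex).1 hf') Z

end IsRepresentative

end

/-! ### The axioms for `∂A_qd` and the comparison with the injective structure -/

section

variable {S : Set GrA} [Small.{0} S] {M : ModelCategory DA}

theorem isProper_of_qdCofibrations (hS : IsRepresentative S)
    (hW : weakEquivalences DA = homologyIso) (hC : cofibrations DA = qdCofibrations S) :
    IsProper M where
  left _ _ _ _ f i i' f' sq hi hf := by
    rw [hW] at hf ⊢
    rw [hC] at hi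
    exact homologyIso_pushout sq ((DA.mono_iff i).1 (qdCofibrations_le _ hi)) hf
  right _ _ _ _ p' f' f p sq hp hf := by
    rw [hW] at hf ⊢
    -- Fibrations are used only through lifting against trivial cofibrations, which makes them
    -- surjective on nubs.
    rw [← MorphismProperty.rlp_eq_of_wfs (trivialCofibrations DA) (fibrations DA),
      trivialCofibrations, hW, hC] at hp
    exact homologyIso_pullback sq (hS.surjective_of_rlp hp) hf

theorem isMonoidalModelCategory_of_qdCofibrations (hS : IsRepresentative S)
    (hW : weakEquivalences DA = homologyIso) (hC : cofibrations DA = qdCofibrations S) :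
    IsMonoidalModelCategory M where
  closed := ⟨inferInstance⟩
  pushoutProduct _ _ _ _ f g hf hg := by
    rw [hC] at hf hg ⊢
    rw [hW]
    refine ⟨hS.pushoutProduct_mem hf hg, ?_⟩
    rintro (h | h)
    -- The symmetry exchanges the factors, so that the trivial one comes second.
    · have := (hS.trivialMono_pushoutProduct hg ⟨qdCofibrations_le _ hf, h⟩).2
      exact (homologyIso.arrow_mk_iso_iff
        (Arrow.PushoutProduct.braiding (Arrow.mk g) (Arrow.mk f))).1 this
    · exact (hS.trivialMono_pushoutProduct hf ⟨qdCofibrations_le _ hg, h⟩).2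
  unit Q q _ hq X hX := by
    rw [hW] at hq ⊢
    have hX' : qdCofibrations S (initial.to X) := hC ▸ hX.mem
    have e : Arrow.mk (X ◁ q) ≅ Arrow.mk (q ▷ X) :=
      Arrow.isoMk (β_ X Q) (β_ X (𝟙_ DA)) (BraidedCategory.braiding_naturality_right X q).symm
    exact (homologyIso.arrow_mk_iso_iff e).1 (hS.homologyIso_whiskerLeft hX' hq)

theorem monoidAxiom_of_qdCofibrations (hS : IsRepresentative S)
    (hW : weakEquivalences DA = homologyIso) (hC : cofibrations DA = qdCofibrations S) :
    MonoidAxiom M := by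
  have h : trivialCofibrationTensor M ≤ trivialMono := by
    rintro _ _ _ ⟨j, hj, Z⟩
    rw [trivialCofibrations, hW, hC] at hj
    exact hS.trivialMono_whiskerRight hj.1 hj.2 Z
  rw [MonoidAxiom, hW]
  have h' : MorphismProperty.transfiniteCompositions.{0} trivialMono.pushouts ≤ trivialMono := by
    simp
  exact ((MorphismProperty.transfiniteCompositions_monotone
    (MorphismProperty.pushouts_monotone h)).trans h').trans inf_le_right

end

/-- The identity adjunction leaves maps unchanged and the weak equivalences coincide, so the only
genuine condition is the inclusion of cofibrations. -/
theorem isQuillenEquivalence_id {M N : ModelCategory DA}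
    (hM : @weakEquivalences DA _ M.categoryWithWeakEquivalences = homologyIso)
    (hN : @weakEquivalences DA _ N.categoryWithWeakEquivalences = homologyIso)
    (hC : @cofibrations DA _ M.categoryWithCofibrations
      ≤ @cofibrations DA _ N.categoryWithCofibrations) :
    IsQuillenEquivalence M N (Adjunction.id (C := DA)) where
  map_cofibrations _ _ _ hf := hC _ hf
  map_trivialCofibrations _ _ f hf := by
    refine ⟨hC _ hf.1, ?_⟩
    rw [hN, ← hM]
    exact hf.2
  equivalence X Y f _ _ := by
    rw [hM, hN]
    have : Adjunction.id.homEquiv X Y f = f := Category.id_comp f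
    rw [this]

end AlgModel

theorem mainTheorem7 (S : Set AlgModel.GrA) (hS : ∀ P ∈ S, AlgModel.IsDualisable P)
    (hS' : ∀ P : AlgModel.GrA, AlgModel.IsDualisable P → ∃! Q, Q ∈ S ∧ Nonempty (P ≅ Q)) :
    Small.{0} S ∧ HasLimits AlgModel.DA ∧ HasColimits AlgModel.DA ∧
    ∃ Mqd : ModelCategory AlgModel.DA,
      weakEquivalences AlgModel.DA = AlgModel.homologyIso ∧
      AlgModel.IsCofibrantlyGeneratedBy Mqd (AlgModel.generatingCofibrations S) ∧
      AlgModel.IsMonoidalModelCategory Mqd ∧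
      AlgModel.IsProper Mqd ∧
      AlgModel.MonoidAxiom Mqd ∧
      ∃ Minj : ModelCategory AlgModel.DA,
        @weakEquivalences AlgModel.DA _ Minj.categoryWithWeakEquivalences =
          AlgModel.homologyIso ∧
        @cofibrations AlgModel.DA _ Minj.categoryWithCofibrations =
          MorphismProperty.monomorphisms AlgModel.DA ∧
        AlgModel.IsQuillenEquivalence Mqd Minj (Adjunction.id (C := AlgModel.DA)) := by
  have hs := AlgModel.small_dualisable hS hS'
  have := AlgModel.isSmall_generatingCofibrations (S := S)
  obtain ⟨Mqd, hW, hC, hF, hI, hJ⟩ := AlgModel.DA.exists_modelCategory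
    (AlgModel.generatingCofibrations S) (AlgModel.generatingCofibrations_le S)
    (AlgModel.homologyIso_of_generatingCofibrations_rlp hS')
  obtain ⟨Minj, hW', hC'⟩ := AlgModel.DA.exists_injective_modelCategory
  have hR : AlgModel.IsRepresentative S := ⟨hS, hS'⟩
  refine ⟨hs, inferInstance, inferInstance, Mqd, hW, ⟨hI, hF, hJ⟩,
    AlgModel.isMonoidalModelCategory_of_qdCofibrations hR hW hC,
    AlgModel.isProper_of_qdCofibrations hR hW hC,
    AlgModel.monoidAxiom_of_qdCofibrations hR hW hC, Minj, hW', hC',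
    AlgModel.isQuillenEquivalence_id hW hW' ?_⟩
  rw [hC, hC']
  exact AlgModel.qdCofibrations_le
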